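/- **Hypernets.** Vertex labels are $\star$ (terms), $\diamond$ (atoms) and $T^n(\star)$, $n\in\mathbb N$ (thunks). A monoidal hypergraph has finitely many vertices and edges, each edge having a list of distinct sources and a list of distinct targets, and each vertex being a source of at most one edge and a target of at most one edge; it is interfaced if the vertices that are no target (inputs) and those that are no source (outputs) are linearly ordered, and no vertex is both. It has type $d\Rightarrow c$ if $d$, $c$ are the lists of labels of its inputs and outputs. The operation set $\mathbb O^{ex}$ consists of the passive operations: natural numbers $p$, $\lambda$ (one thunk $T^1(\star)$, no eager argument), $\mathsf{tt}$, $\mathsf{ff}$ and the empty tuple $()$; and of the active operations, with eager arguments only: $\vec@$, $=$, $:=$, $+$, $-$ (binary) and $\mathsf{ref}$, $!$, $-_1$ (unary). Edges are: operations $\phi:\star\Rightarrow\star^m\otimes\bigotimes_i T^{n_i}(\star)$; instances $I:\star\Rightarrow\diamond$; atoms $\circ:\diamond\Rightarrow\star$; contractions $C^\ell:\ell\otimes\ell\Rightarrow\ell$ and weakenings $W^\ell:\varepsilon\Rightarrow\ell$ for $\ell\in\{\star,\diamond\}$; tokens $?,\checkmark,↯:\star\Rightarrow\star$; holes $\chi:d\Rightarrow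 c$ (infinitely many for each type); and box edges $T^n(\star)\Rightarrow\star^k\otimes\diamond^h$, labelled with a hypernet $\star\Rightarrow\star^{n+k}\otimes\diamond^h$, their content. A hypernet is an interfaced monoidal hypergraph with such edges, boxes being nested finitely deep; hypernets are identified up to renaming of vertices and edges at any depth. An edge is shallow if it is not inside a box, and deep otherwise. A path from a vertex $v$ to a vertex $v'$ is a non-empty sequence of shallow edges, $v$ being a source of the first and $v'$ a target of the last, in which each edge has a target that is a source of the next; it is an operation path if all its edges are operation edges. A hypernet is focus-free if it has no token at any depth. It is focussed, written $\dot N$, if it has exactly one token edge, which is shallow, whose source and target differ, and which does not have both its source an input and its target an output; $|\dot N|$ is obtained by removing the token and identifying its source and target. A context is a hypernet with holes in which no hole label appears twice (at any depth); $\mathcal C[\vec G]$ results from replacing each hole with the component of $\vec G$ for it, of the same type. A simple context has a single hole, which is shallow. A state is a hole-free focussed hypernet of type $\star\Rightarrow\varepsilon$. The interaction rules are as follows. A token $?$ on a source of $C^\star$ becomes $↯$; $?$ on the source of $I$ becomes $\checkmark$; $?$ on the source of an operation moves to its first eager argument, $\checkmark$ on an eager argument becomes $?$ on the next one; $\checkmark$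 on the last eager argument, or $?$ on the source of an operation without eager arguments, becomes $\checkmark$ (if the operation is passive) or $↯$ (if active) on the source of the operation. A search transition relates states $\mathcal C[G]$, $\mathcal C[G']$ for an interaction rule $G\mapsto G'$ and a focus-free simple context $\mathcal C:\star\Rightarrow\varepsilon$. A state $\dot G$ is rooted if search transitions lead from $?;|\dot G|$ (token $?$ attached to the input) to $\dot G$. **Special hypernets.** A contraction tree is a hypernet $\ell^k\Rightarrow\ell$ ($\ell\in\{\star,\diamond\}$) all whose vertices have label $\ell$ and reach the output, and whose edges are contractions and weakenings. A stable hypernet $\star\Rightarrow z$ consists of instances and passive operations, has every vertex reachable from its input, and has no output of type $\star$. A copyable hypernet has type $\star\Rightarrow\star^p\otimes\diamond^h$ and is an instance edge, or an operation edge together with a box edge on each of its thunk targets. A shared atom with $k$ inputs is a contraction tree $\diamond^k\Rightarrow\diamond$ followed by an atom edge; for $k=1$ the tree may be absent. The distributor $D^\ell_{1,m}:\ell^m\Rightarrow\ell$ is the right-nested contraction tree ending in one weakening ($D^\ell_{1,0}$ is a weakening, and $D^\ell_{1,m+1}$ contracts the first input with the output of $D^\ell_{1,m}$); $D^\ell_{k,m}:\ell^{km}\Rightarrow\ell^k$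 has as $j$-th output the result of $D^\ell_{1,m}$ on the $j$-th inputs of the $m$ successive bunches of $k$ inputs. **Rules.** Each rule relates hypernets of the same type. * *Contraction rule*: on the left, $↯$ is on an input of a contraction tree $C$ on $\star$ whose output is the input of a copyable $H:\star\Rightarrow\star^p\otimes\diamond^h$. On the right, $?$ is on a copy of $H$; a weakening takes the token's place at the input of $C$; $C$ still leads to $H$; and the outputs of the two copies of $H$ are joined by $D^\star_{p,2}$ and $D^\diamond_{h,2}$. * *Local rewrite rules*: $↯$ on an active operation becomes $?$ as follows. * $\vec@$, with a $\lambda$ followed by a box as first argument and a stable $A$ as second one: the token is put on the box content, whose bound output is connected to $A$. * $\mathsf{ref}$, with a stable argument $A$: $?;I;\circ;A$. * $=$, with two instances as arguments: the result is $\mathsf{tt}$ if they are connected to the same shared atom and $\mathsf{ff}$ if to two different ones; weakenings of type $\diamond$ replace the instances. * $:=$, with an instance of a shared atom and a stable $A$: the result is $()$, the atom gets connected to $A$, a weakening replaces the instance, and another one is put on the previous target of the atom. * $!$, with an instance of a shared atom: a weakening replaces the instance, and the token and the target of the atom are joined by a contraction leading to the previous target of the atom. * $+$, $-$, $-_1$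 on natural numbers compute the result, if it is a natural number. **Notions about relations.** A pre-template $\vartriangleleft$ is a relation between focus-free hole-free hypernets of the same type. A hypernet is one-way if no path from an input of type $\star$ to an output of type $\star$ is an operation path; $\vartriangleleft$ is output-closed if $G\vartriangleleft H$ implies that $G$ or $H$ is one-way. For a set $\mathbb C$ of contexts, a $\mathbb C$-specimen of $\vartriangleleft$ is a triple $(\dot{\mathcal C};\vec G;\vec H)$ with $\dot{\mathcal C}$ a focussed context, $|\dot{\mathcal C}|\in\mathbb C$, $G_i\vartriangleleft H_i$ of the types of the holes, and $\dot{\mathcal C}[\vec G]$, $\dot{\mathcal C}[\vec H]$ states. A context is binding-free if, at any depth, there is no path from a source of a contraction, atom, box or hole edge to a source of a hole edge. **Lemma.** Let $\vartriangleleft$ be an output-closed pre-template, and let $(\mathcal C_1[\vec{\chi'},\dot{\mathcal C}_2[\vec{\chi''}]];\vec{G'},\vec{G''};\vec{H'},\vec{H''})$ be a $\mathbb C$-specimen of $\vartriangleleft$, where $\mathcal C_1[\vec{\chi'},\chi]$ is a focus-free context and $\dot{\mathcal C}_2[\vec{\chi''}]$ is a focussed context of the type of $\chi$. Let $\dot N$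 be a focussed hypernet such that $\dot{\mathcal C}_2[\vec{G''}]\mapsto\dot N$ is a contraction rule or a local rewrite rule of an operation in $\{\vec@,\mathsf{ref},=,:=,!,+,-,-_1\}$. Consider the following property $(*)$ of a focussed context $\dot{\mathcal C}_2'[\vec{\chi'''}]$ and sequences $\vec{G'''}$, $\vec{H'''}$ of focus-free hypernets: $\dot{\mathcal C}_2'$ has the type of $\chi$ and $\mathcal C_1[\vec{\chi'},\dot{\mathcal C}_2'[\vec{\chi'''}]]$ is a context; $$\dot{\mathcal C}_2[\vec{G''}]\mapsto\dot{\mathcal C}_2'[\vec{G'''}]=\dot N,\qquad \dot{\mathcal C}_2[\vec{H''}]\mapsto\dot{\mathcal C}_2'[\vec{H'''}]$$ are contraction rules or local rewrite rules; and $G'''_i\vartriangleleft H'''_i$ for each $i$. 1. If all holes of $\dot{\mathcal C}_2$ are deep, then there exist $\dot{\mathcal C}_2',\vec{G'''},\vec{H'''}$ satisfying $(*)$. 2. If all holes of $\dot{\mathcal C}_2$ are deep, the states $\mathcal C_1[\vec{G'},\dot{\mathcal C}_2[\vec{G''}]]$ and $\mathcal C_1[\vec{H'},\dot{\mathcal C}_2[\vec{H''}]]$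 are rooted, $|\mathcal C_1[\vec{\chi'},\dot{\mathcal C}_2[\vec{\chi''}]]|$ is binding-free, and all sources of the holes $\vec{\chi'}$ have type $\star$, then $\dot{\mathcal C}_2',\vec{G'''},\vec{H'''}$ satisfying $(*)$ can be taken so that $|\mathcal C_1[\vec{\chi'},\dot{\mathcal C}_2'[\vec{\chi'''}]]|$ is also binding-free. 3. If $\vartriangleleft$ relates contraction trees only, then there exist $\dot{\mathcal C}_2',\vec{G'''},\vec{H'''}$ satisfying $(*)$. -/

import Mathlib

namespace Spartan

/-! ## Labels -/

/-- Vertex labels: the type `⋆` of terms, the type `⋄` of atoms, and the types `T^n(⋆)` of thunks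
with `n` bound variables. -/
inductive VLabel : Type
  | star
  | dia
  | thunk (n : ℕ)

/-- The two vertex labels at which contraction is available. -/
inductive Link : Type
  | star
  | dia

/-- The vertex label of a link. -/
def Link.label : Link → VLabel
  | .star => .star
  | .dia => .dia

/-- The three states of the token: search `?`, value `✓` and rewrite `↯`. -/
inductive Token : Type
  | search
  | value
  | rewrite

/-- The operation set `𝕆^ex`.  The passive operations are the natural numbers, `λ`, the truth values
and the empty tuple (the result of an assignment); the active ones are left-to-right call-by-value
application, reference creation, equality of references, assignment, dereferencing, addition,
subtraction and negation. -/
inductive Op : Type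
  | num (n : ℕ)
  | lam
  | tt
  | ff
  | unit
  | app
  | ref
  | eq
  | assign
  | deref
  | add
  | sub
  | neg

/-- The active operations `𝕆^ex_↯`. -/
def Op.IsActive : Op → Prop
  | .app | .ref | .eq | .assign | .deref | .add | .sub | .neg => True
  | _ => False

/-- The number of eager arguments of an operation. -/
def Op.eager : Op → ℕ
  | .app | .eq | .assign | .add | .sub => 2
  | .ref | .deref | .neg => 1
  | _ => 0

/-- The numbers of variables bound in the deferred arguments (thunks) of an operation. -/
def Op.thunks : Op → List ℕ
  | .lam => [1]
  | _ => []

/-- The output type `⋆^m ⊗ T^{n₁}(⋆) ⊗ ⋯` of an operation edge. -/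
def Op.cod (φ : Op) : List VLabel :=
  List.replicate φ.eager .star ++ φ.thunks.map .thunk

/-- Typed hole labels.  There are infinitely many of each type. -/
structure Hole : Type where
  name : ℕ
  dom : List VLabel
  cod : List VLabel

/-- Edge labels other than hypernets: the label set `M_𝕆` extended by hole labels. -/
inductive BLabel : Type
  | inst
  | token (t : Token)
  | op (φ : Op)
  | atom
  | weak (ℓ : Link)
  | contr (ℓ : Link)
  | hole (χ : Hole)

/-- Source type of an edge label. -/
def BLabel.dom : BLabel → List VLabel
  | .inst => [.star]
  | .token _ => [.star]
  | .op _ => [.star]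
  | .atom => [.dia]
  | .weak _ => []
  | .contr ℓ => [ℓ.label, ℓ.label]
  | .hole χ => χ.dom

/-- Target type of an edge label. -/
def BLabel.cod : BLabel → List VLabel
  | .inst => [.dia]
  | .token _ => [.star]
  | .op φ => φ.cod
  | .atom => [.star]
  | .weak ℓ => [ℓ.label]
  | .contr ℓ => [ℓ.label]
  | .hole χ => χ.cod

/-! ## Hypergraphs -/

/-- The data of an interfaced labelled monoidal hypergraph with edge labels in `Λ`. -/
structure Graph (Λ : Type 1) : Type 1 where
  V : Type
  E : Type
  vlab : V → VLabel
  ins : List V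
  outs : List V
  src : E → List V
  tgt : E → List V
  lab : E → Λ

/-- The conditions on an interfaced monoidal hypergraph: finitely many vertices and edges; source and
target lists consist of distinct vertices; a vertex is a source (target) of at most one edge; `ins`
(`outs`) enumerates, without repetition, the vertices that are a target (source) of no edge; and no
vertex is both an input and an output. -/
structure Graph.IsInterfaced {Λ : Type 1} (G : Graph Λ) : Prop where
  finV : Finite G.V
  finE : Finite G.E
  src_nodup : ∀ e, (G.src e).Nodup
  tgt_nodup : ∀ e, (G.tgt e).Nodup
  src_unique : ∀ v e e', v ∈ G.src e → v ∈ G.src e' → e = e'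
  tgt_unique : ∀ v e e', v ∈ G.tgt e → v ∈ G.tgt e' → e = e'
  ins_nodup : G.ins.Nodup
  outs_nodup : G.outs.Nodup
  mem_ins : ∀ v, v ∈ G.ins ↔ ∀ e, v ∉ G.tgt e
  mem_outs : ∀ v, v ∈ G.outs ↔ ∀ e, v ∉ G.src e
  disjoint : ∀ v, v ∈ G.ins → v ∉ G.outs

/-- `e` is an incoming edge of `e'`. -/
def Graph.Incoming {Λ : Type 1} (G : Graph Λ) (e e' : G.E) : Prop :=
  ∃ v, v ∈ G.tgt e ∧ v ∈ G.src e'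

/-- `p` is a path, i.e. a non-empty sequence of edges each of which is incoming to the next one,
from the vertex `v` (a source of the first edge) to the vertex `v'` (a target of the last edge). -/
def Graph.IsPath {Λ : Type 1} (G : Graph Λ) (p : List G.E) (v v' : G.V) : Prop :=
  p.IsChain G.Incoming ∧ (∃ e ∈ p.head?, v ∈ G.src e) ∧ (∃ e ∈ p.getLast?, v' ∈ G.tgt e)

/-- Reachability of `v'` from `v`. -/
def Graph.Reachable {Λ : Type 1} (G : Graph Λ) (v v' : G.V) : Prop :=
  v = v' ∨ ∃ p, G.IsPath p v v'

/-! ## Hypernets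

An edge is labelled either by a basic label or by a hypernet (its content); in the latter case it is
a box edge.  A box edge also records the number `n` of variables bound by the box, so that it has
source type `T^n(⋆)`. -/

/-- Edge labels of hypernets. -/
inductive Label : Type 1
  | base (b : BLabel)
  | box (n : ℕ) (G : Graph Label)

/-- Hypernets (possibly with holes and tokens), before imposing typing. -/
abbrev Net : Type 1 := Graph Label

/-- Induction over the nesting of hypernets. -/
theorem Label.induction {P : Label → Prop} (base : ∀ b, P (.base b))
    (box : ∀ n (G : Net), (∀ e, P (G.lab e)) → P (.box n G)) : ∀ l, P l
  | .base b => base b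
  | .box n ⟨_, _, _, _, _, _, _, lab⟩ => box n _ (fun e => Label.induction base box (lab e))

/-- `l.HasType d c`: an edge labelled `l` may have source type `d` and target type `c`.  A box edge
has type `T^n(⋆) ⇒ ⋆^k ⊗ ⋄^h` where its content is a hypernet of type `⋆ ⇒ ⋆^(n+k) ⊗ ⋄^h` whose
first `n` outputs are the bound ones. -/
def Label.HasType : Label → List VLabel → List VLabel → Prop
  | .base b, d, c => d = b.dom ∧ c = b.cod
  | .box n ⟨V, E, vlab, ins, outs, src, tgt, lab⟩, d, c => ∃ k h : ℕ,
      d = [.thunk n] ∧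
      c = List.replicate k .star ++ List.replicate h .dia ∧
      Graph.IsInterfaced ⟨V, E, vlab, ins, outs, src, tgt, lab⟩ ∧
      ins.map vlab = [.star] ∧
      outs.map vlab = List.replicate (n + k) .star ++ List.replicate h .dia ∧
      ∀ e, (lab e).HasType ((src e).map vlab) ((tgt e).map vlab)

/-- `N` is a (well-formed, well-typed) hypernet of type `d ⇒ c`. -/
structure Net.IsHypernet (N : Net) (d c : List VLabel) : Prop where
  interfaced : N.IsInterfaced
  typed : ∀ e, (N.lab e).HasType ((N.src e).map N.vlab) ((N.tgt e).map N.vlab)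
  ins_type : N.ins.map N.vlab = d
  outs_type : N.outs.map N.vlab = c

theorem Label.hasType_box (n : ℕ) (G : Net) (d c : List VLabel) :
    (Label.box n G).HasType d c ↔ ∃ k h : ℕ, d = [.thunk n] ∧
      c = List.replicate k .star ++ List.replicate h .dia ∧
      G.IsHypernet [.star] (List.replicate (n + k) .star ++ List.replicate h .dia) := by
  constructor
  · rintro ⟨k, h, h1, h2, h3, h4, h5, h6⟩
    exact ⟨k, h, h1, h2, h3, h6, h4, h5⟩
  · rintro ⟨k, h, h1, h2, h3, h6, h4, h5⟩
    exact ⟨k, h, h1, h2, h3, h4, h5, h6⟩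

/-- Equality of edge labels up to renaming of vertices and edges, at any depth. -/
inductive Label.Iso : Label → Label → Prop
  | base (b : BLabel) : Label.Iso (.base b) (.base b)
  | box (n : ℕ) (G G' : Net) (f : G.V ≃ G'.V) (g : G.E ≃ G'.E)
      (vlab : ∀ v, G'.vlab (f v) = G.vlab v)
      (ins : G'.ins = G.ins.map f) (outs : G'.outs = G.outs.map f)
      (src : ∀ e, G'.src (g e) = (G.src e).map f) (tgt : ∀ e, G'.tgt (g e) = (G.tgt e).map f)
      (lab : ∀ e, Label.Iso (G.lab e) (G'.lab (g e))) : Label.Iso (.box n G) (.box n G')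

/-- Equality of hypernets, i.e. equality up to renaming of vertices and edges, at any depth. -/
def Net.Iso (G G' : Net) : Prop :=
  ∃ (f : G.V ≃ G'.V) (g : G.E ≃ G'.E),
    (∀ v, G'.vlab (f v) = G.vlab v) ∧ G'.ins = G.ins.map f ∧ G'.outs = G.outs.map f ∧
    (∀ e, G'.src (g e) = (G.src e).map f) ∧ (∀ e, G'.tgt (g e) = (G.tgt e).map f) ∧
    ∀ e, Label.Iso (G.lab e) (G'.lab (g e))

/-- The occurrences of the basic label `b`, at any depth, in an edge with the given label. -/
def Label.Occ (b : BLabel) : Label → Type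
  | .base b' => PLift (b' = b)
  | .box _ ⟨_, E, _, _, _, _, _, lab⟩ => Σ e : E, (lab e).Occ b

/-- The edges of `N`, at any depth, labelled by the basic label `b`; the first component is the shallow
edge of `N` that is, or whose label contains, this edge. -/
def Net.Occ (N : Net) (b : BLabel) : Type := Σ e : N.E, (N.lab e).Occ b

/-- The hole label `χ` appears in `N` (at any depth). -/
def Net.HasHole (N : Net) (χ : Hole) : Prop := Nonempty (N.Occ (.hole χ))

/-- No hole appears in `N` (at any depth). -/
def Net.HoleFree (N : Net) : Prop := ∀ χ, ¬ N.HasHole χ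

/-- All holes of `N` are deep. -/
def Net.AllHolesDeep (N : Net) : Prop := ∀ e χ, N.lab e ≠ .base (.hole χ)

/-- There is no token edge in `N` (at any depth). -/
def Net.FocusFree (N : Net) : Prop := ∀ t, IsEmpty (N.Occ (.token t))

/-- `N` is focussed: it has exactly one token edge (at any depth), and this edge is shallow,
self-acyclic and not exposed. -/
def Net.Focussed (N : Net) : Prop :=
  ∃ e t, N.lab e = .base (.token t) ∧
    (∀ t' (o : N.Occ (.token t')), o.1 = e) ∧
    (∀ v ∈ N.src e, v ∉ N.tgt e) ∧
    ¬ ((∀ v ∈ N.src e, v ∈ N.ins) ∧ (∀ v ∈ N.tgt e, v ∈ N.outs))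

/-- `N` is a context: a holed hypernet in which each hole label appears at most once. -/
def Net.IsContext (N : Net) : Prop :=
  (∃ d c, N.IsHypernet d c) ∧ ∀ χ, Subsingleton (N.Occ (.hole χ))

/-- `N` is a context whose only hole, which is shallow, is labelled by `χ`. -/
def Net.IsSimpleContext (N : Net) (χ : Hole) : Prop :=
  N.IsContext ∧ ∃ e, N.lab e = .base (.hole χ) ∧ ∀ χ' (o : N.Occ (.hole χ')), o.1 = e

/-- A state: a focussed hypernet without holes, of type `⋆ ⇒ ε`. -/
def Net.IsState (N : Net) : Prop := N.IsHypernet [.star] [] ∧ N.Focussed ∧ N.HoleFree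

/-! ## Gluing and plugging -/

/-- The hypernet that consists of one edge with label `l` and its endpoints. -/
def Net.single (l : Label) (d c : List VLabel) : Net where
  V := Fin d.length ⊕ Fin c.length
  E := Unit
  vlab := Sum.elim d.get c.get
  ins := (List.finRange d.length).map Sum.inl
  outs := (List.finRange c.length).map Sum.inr
  src := fun _ => (List.finRange d.length).map Sum.inl
  tgt := fun _ => (List.finRange c.length).map Sum.inr
  lab := fun _ => l

/-- The one-edge hypernet of a basic label. -/
def Net.base (b : BLabel) : Net := Net.single (.base b) b.dom b.cod

/-- In a hypergraph `D` whose edges are labelled by hypernets, the vertex of `D` with which a vertex `v`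
of the label of the edge `e` is identified: the `i`-th input (output) of the label is identified with
the `i`-th source (target) of `e`, and other vertices are not identified with any. -/
noncomputable def Graph.glue (D : Graph Net) (e : D.E) (v : (D.lab e).V) : Option D.V :=
  open Classical in
  if v ∈ (D.lab e).ins then (D.src e)[(D.lab e).ins.idxOf v]?
  else if v ∈ (D.lab e).outs then (D.tgt e)[(D.lab e).outs.idxOf v]?
  else none

/-- The vertices of the hypernet obtained by replacing each edge of `D` with the hypernet labelling
it. -/
def Graph.FlatV (D : Graph Net) : Type :=
  D.V ⊕ {x : Σ e : D.E, (D.lab e).V // D.glue x.1 x.2 = none}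

/-- The vertex that a vertex of a replacing hypernet becomes. -/
noncomputable def Graph.embed (D : Graph Net) (e : D.E) (v : (D.lab e).V) : D.FlatV :=
  match h : D.glue e v with
  | some u => Sum.inl u
  | none => Sum.inr ⟨⟨e, v⟩, h⟩

/-- The hypernet obtained from `D` by replacing each edge with the hypernet labelling it, identifying
inputs (outputs) of the latter with the corresponding sources (targets) of the edge. -/
noncomputable def Graph.flatten (D : Graph Net) : Net where
  V := D.FlatV
  E := Σ e : D.E, (D.lab e).E
  vlab := Sum.elim D.vlab (fun x => (D.lab x.1.1).vlab x.1.2)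
  ins := D.ins.map Sum.inl
  outs := D.outs.map Sum.inl
  src := fun x => ((D.lab x.1).src x.2).map (D.embed x.1)
  tgt := fun x => ((D.lab x.1).tgt x.2).map (D.embed x.1)
  lab := fun x => (D.lab x.1).lab x.2

/-- What an edge with label `l` and type `d ⇒ c` is replaced with in plugging `σ`: a hole `χ` is replaced
with `σ χ`, and any other edge is kept, with its label updated to `l'`. -/
def plugEdge (σ : Hole → Net) (l l' : Label) (d c : List VLabel) : Net :=
  match l with
  | .base (.hole χ) => σ χ
  | _ => Net.single l' d c

/-- Plugging in (the content of) a label. -/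
noncomputable def Label.plug (σ : Hole → Net) : Label → Label
  | .base b => .base b
  | .box n ⟨V, E, vlab, ins, outs, src, tgt, lab⟩ =>
      .box n (Graph.flatten ⟨V, E, vlab, ins, outs, src, tgt, fun e =>
        plugEdge σ (lab e) ((lab e).plug σ) ((src e).map vlab) ((tgt e).map vlab)⟩)

/-- Plugging: every hole edge of `C`, at any depth, with label `χ` is replaced with the hypernet
`σ χ`.  A sequence of hypernets `G⃗` plugged into `C[χ⃗]` is presented as a function on hole labels, of
which only the values at the hole labels of `C` matter. -/
noncomputable def Net.plug (C : Net) (σ : Hole → Net) : Net :=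
  Graph.flatten ⟨C.V, C.E, C.vlab, C.ins, C.outs, C.src, C.tgt, fun e =>
    plugEdge σ (C.lab e) ((C.lab e).plug σ) ((C.src e).map C.vlab) ((C.tgt e).map C.vlab)⟩

theorem Label.plug_box (σ : Hole → Net) (n : ℕ) (G : Net) :
    (Label.box n G).plug σ = .box n (G.plug σ) := rfl

/-- Plugging `C'` into the hole `χ` of `C` only, keeping the other holes. -/
noncomputable def Net.plugAt (C : Net) (χ : Hole) (C' : Net) : Net :=
  open Classical in C.plug (fun ψ => if ψ = χ then C' else Net.base (.hole ψ))

/-! ## Tokens -/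

/-- The hypernet obtained by removing the edge `e` and identifying its source and its target. -/
noncomputable def Net.eraseEdge (N : Net) (e : N.E) : Net where
  V := Quot (fun u v => u ∈ N.src e ∧ v ∈ N.tgt e)
  E := {e' : N.E // e' ≠ e}
  vlab := fun q => N.vlab q.out
  ins := N.ins.map (Quot.mk _)
  outs := N.outs.map (Quot.mk _)
  src := fun e' => (N.src e'.1).map (Quot.mk _)
  tgt := fun e' => (N.tgt e'.1).map (Quot.mk _)
  lab := fun e' => N.lab e'.1

/-- The underlying focus-free hypernet `|N|` of a focussed hypernet `N`. -/
noncomputable def Net.underlying (N : Net) : Net :=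
  open Classical in
  if h : ∃ e t, N.lab e = .base (.token t) then N.eraseEdge h.choose else N

/-- The hypernet `t ; N`: a token `t` is connected to the first input of `N`. -/
def Net.withToken (t : Token) (N : Net) : Net where
  V := Option N.V
  E := Option N.E
  vlab := fun v => v.elim .star N.vlab
  ins := match N.ins with
    | [] => []
    | _ :: vs => none :: vs.map some
  outs := N.outs.map some
  src := fun e => e.elim [none] (fun e => (N.src e).map some)
  tgt := fun e => e.elim (N.ins.head?.toList.map some) (fun e => (N.tgt e).map some)
  lab := fun e => e.elim (.base (.token t)) N.lab

/-! ## Diagrams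

Rewrite rules are presented by wiring hypernets together along bundles of vertices. -/

/-- The hypernet obtained by wiring.  There are `r` bundles of vertices, the `i`-th one having labels
`w i`; the interface is given by lists of bundles, and each component is a hypernet together with the
bundles its inputs and its outputs are connected to. -/
noncomputable def diagram {r : ℕ} (w : Fin r → List VLabel) (ins outs : List (Fin r))
    (es : List (Net × List (Fin r) × List (Fin r))) : Net :=
  let bundles : List (Fin r) → List (Σ i : Fin r, Fin (w i).length) :=
    fun l => l.flatMap (fun i => (List.finRange (w i).length).map (fun j => ⟨i, j⟩))
  Graph.flatten
    { V := Σ i : Fin r, Fin (w i).length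
      E := Fin es.length
      vlab := fun v => (w v.1).get v.2
      ins := bundles ins
      outs := bundles outs
      src := fun e => bundles (es.get e).2.1
      tgt := fun e => bundles (es.get e).2.2
      lab := fun e => (es.get e).1 }

/-- The list `⋆^k`. -/
abbrev stars (k : ℕ) : List VLabel := List.replicate k .star

/-- The list `⋄^k`. -/
abbrev dias (k : ℕ) : List VLabel := List.replicate k .dia

/-! ## Classes of hypernets -/

/-- `N` is a contraction tree `ℓ^k ⇒ ℓ`. -/
structure Net.IsContractionTree (N : Net) (ℓ : Link) (k : ℕ) : Prop where
  hypernet : N.IsHypernet (List.replicate k ℓ.label) [ℓ.label]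
  vlab : ∀ v, N.vlab v = ℓ.label
  lab : ∀ e, N.lab e = .base (.weak ℓ) ∨ N.lab e = .base (.contr ℓ)
  reach : ∀ v, ∃ o ∈ N.outs, N.Reachable v o

/-- `N` is a stable hypernet `⋆ ⇒ c`: its edges are instances and passive operations, its outputs
have type `⋄` or `T^n(⋆)`, and each vertex is reachable from the unique input. -/
structure Net.IsStable (N : Net) (c : List VLabel) : Prop where
  hypernet : N.IsHypernet [.star] c
  outs_ne : VLabel.star ∉ c
  lab : ∀ e, N.lab e = .base .inst ∨ ∃ φ : Op, ¬ φ.IsActive ∧ N.lab e = .base (.op φ)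
  reach : ∀ v, ∃ i ∈ N.ins, N.Reachable i v

/-- `N` is a copyable hypernet `⋆ ⇒ ⋆^k ⊗ ⋄^h`: either a single instance edge, or an operation edge
all whose thunk-typed targets are sources of box edges (by the type of the outputs of `N`, a thunk-typed
target cannot be an output). -/
structure Net.IsCopyable (N : Net) (k h : ℕ) : Prop where
  hypernet : N.IsHypernet [.star] (stars k ++ dias h)
  shape : ∃ e₀, N.src e₀ = N.ins ∧
    ((N.lab e₀ = .base .inst ∧ ∀ e, e = e₀) ∨
      ∃ φ, N.lab e₀ = .base (.op φ) ∧
        ∀ e, e ≠ e₀ → (∃ n G, N.lab e = .box n G) ∧ ∃ v ∈ N.tgt e₀, v ∈ N.src e)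

/-- `N` is one-way: no path from an input to an output, both of type `⋆`, is an operation path. -/
def Net.OneWay (N : Net) : Prop :=
  ∀ i ∈ N.ins, ∀ o ∈ N.outs, N.vlab i = .star → N.vlab o = .star →
    ∀ p, N.IsPath p i o → ¬ ∀ e ∈ p, ∃ φ, N.lab e = .base (.op φ)

/-- `l` labels a contraction (or weakening), atom, box or hole edge. -/
def Label.IsBinding : Label → Prop
  | .base .atom | .base (.weak _) | .base (.contr _) | .base (.hole _) | .box _ _ => True
  | _ => False

/-- There is no (shallow) path in `N` from a source of a contraction, atom, box or hole edge to a
source of a hole edge. -/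
def Net.ShallowBindingFree (N : Net) : Prop :=
  ∀ e e' χ v v', (N.lab e).IsBinding → v ∈ N.src e → N.lab e' = .base (.hole χ) → v' ∈ N.src e' →
    ∀ p, ¬ N.IsPath p v v'

/-- The content of a box label, if any, is binding-free (at any depth). -/
def Label.BindingFree : Label → Prop
  | .base _ => True
  | .box _ ⟨V, E, vlab, ins, outs, src, tgt, lab⟩ =>
      Net.ShallowBindingFree ⟨V, E, vlab, ins, outs, src, tgt, lab⟩ ∧ ∀ e, (lab e).BindingFree

/-- `N` is binding-free: there is no path, at any depth, from a source of a contraction, atom, box or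
hole edge to a source of a hole edge. -/
def Net.BindingFree (N : Net) : Prop :=
  N.ShallowBindingFree ∧ ∀ e, (N.lab e).BindingFree

/-- The distributor `D_{1,m} : ℓ^m ⇒ ℓ`: a right-nested contraction tree ending in one weakening. -/
noncomputable def distributorOne (ℓ : Link) : ℕ → Net
  | 0 => Net.base (.weak ℓ)
  | m + 1 => diagram ![[ℓ.label], List.replicate m ℓ.label, [ℓ.label], [ℓ.label]] [0, 1] [3]
      [(distributorOne ℓ m, [1], [2]), (Net.base (.contr ℓ), [0, 2], [3])]

/-- The distributor `D_{k,m} : ℓ^(km) ⇒ ℓ^k`: its inputs are `m` successive bunches of `k` vertices,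
and its `j`-th output is obtained by applying `D_{1,m}` to the `j`-th inputs of the bunches. -/
noncomputable def distributor (ℓ : Link) (k m : ℕ) : Net :=
  Graph.flatten
    { V := (Fin m × Fin k) ⊕ Fin k
      E := Fin k
      vlab := fun _ => ℓ.label
      ins := (List.finRange m).flatMap (fun i => (List.finRange k).map (fun j => Sum.inl (i, j)))
      outs := (List.finRange k).map Sum.inr
      src := fun j => (List.finRange m).map (fun i => Sum.inl (i, j))
      tgt := fun j => [Sum.inr j]
      lab := fun _ => distributorOne ℓ m }

/-- `A` is an atom edge preceded by a contraction tree with `k` inputs; if `k = 1` the contraction tree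
may be absent. -/
def IsSharedAtom (A : Net) (k : ℕ) : Prop :=
  (k = 1 ∧ A = Net.base .atom) ∨
  ∃ C : Net, C.IsContractionTree .dia k ∧
    A = diagram ![dias k, [.dia], [.star]] [0] [2] [(C, [0], [1]), (Net.base .atom, [1], [2])]

/-! ## Search transitions and rooted states -/

/-- A token `t` on the source of an operation `φ`. -/
noncomputable def tokenBefore (t : Token) (φ : Op) : Net :=
  diagram ![[.star], [.star], φ.cod] [0] [2]
    [(Net.base (.token t), [0], [1]), (Net.base (.op φ), [1], [2])]

/-- A token `t` on the target of index `i` (counted from `0`) of an operation `φ`. -/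
noncomputable def tokenAfter (t : Token) (φ : Op) (i : ℕ) : Net :=
  diagram ![[.star], φ.cod.take i, [.star], [.star], φ.cod.drop (i + 1)] [0] [1, 3, 4]
    [(Net.base (.op φ), [0], [1, 2, 4]), (Net.base (.token t), [2], [3])]

/-- The interaction rules. -/
inductive InteractionRule : Net → Net → Prop
  | contrLeft : InteractionRule
      (diagram ![[.star], [.star], [.star], [.star]] [0, 2] [3]
        [(Net.base (.token .search), [0], [1]), (Net.base (.contr .star), [1, 2], [3])])
      (diagram ![[.star], [.star], [.star], [.star]] [0, 2] [3]
        [(Net.base (.token .rewrite), [0], [1]), (Net.base (.contr .star), [1, 2], [3])])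
  | contrRight : InteractionRule
      (diagram ![[.star], [.star], [.star], [.star]] [2, 0] [3]
        [(Net.base (.token .search), [0], [1]), (Net.base (.contr .star), [2, 1], [3])])
      (diagram ![[.star], [.star], [.star], [.star]] [2, 0] [3]
        [(Net.base (.token .rewrite), [0], [1]), (Net.base (.contr .star), [2, 1], [3])])
  | inst : InteractionRule
      (diagram ![[.star], [.star], [.dia]] [0] [2]
        [(Net.base (.token .search), [0], [1]), (Net.base .inst, [1], [2])])
      (diagram ![[.star], [.star], [.dia]] [0] [2]
        [(Net.base (.token .value), [0], [1]), (Net.base .inst, [1], [2])])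
  | enter (φ : Op) (h : 0 < φ.eager) :
      InteractionRule (tokenBefore .search φ) (tokenAfter .search φ 0)
  | next (φ : Op) (i : ℕ) (h : i + 1 < φ.eager) :
      InteractionRule (tokenAfter .value φ i) (tokenAfter .search φ (i + 1))
  | leavePassive (φ : Op) (i : ℕ) (h : i + 1 = φ.eager) (hφ : ¬ φ.IsActive) :
      InteractionRule (tokenAfter .value φ i) (tokenBefore .value φ)
  | leaveActive (φ : Op) (i : ℕ) (h : i + 1 = φ.eager) (hφ : φ.IsActive) :
      InteractionRule (tokenAfter .value φ i) (tokenBefore .rewrite φ)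
  | nullaryPassive (φ : Op) (h : φ.eager = 0) (hφ : ¬ φ.IsActive) :
      InteractionRule (tokenBefore .search φ) (tokenBefore .value φ)
  | nullaryActive (φ : Op) (h : φ.eager = 0) (hφ : φ.IsActive) :
      InteractionRule (tokenBefore .search φ) (tokenBefore .rewrite φ)

/-- Search transitions: an interaction rule is applied inside a focus-free simple context. -/
def SearchTransition (S S' : Net) : Prop :=
  S.IsState ∧ S'.IsState ∧
  ∃ (C : Net) (χ : Hole) (G G' : Net), InteractionRule G G' ∧
    C.IsSimpleContext χ ∧ C.FocusFree ∧ C.IsHypernet [.star] [] ∧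
    G.IsHypernet χ.dom χ.cod ∧ G'.IsHypernet χ.dom χ.cod ∧
    S.Iso (C.plugAt χ G) ∧ S'.Iso (C.plugAt χ G')

/-- A state `S` is rooted if there is a sequence of search transitions from `? ; |S|` to `S`. -/
def Rooted (S : Net) : Prop :=
  S.IsState ∧ ∃ S', Relation.ReflTransGen SearchTransition (S.underlying.withToken .search) S' ∧
    S'.Iso S

/-! ## Contraction rules and local rewrite rules of operations -/

/-- The contraction rules and the local rewrite rules of the active operations, up to renaming of
vertices and edges.  In each rule the first bundle is the token source. -/
inductive RuleShape : Net → Net → Prop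
  /-- Contraction: the token is on an input of a contraction tree `C` above a copyable `H`; a copy of
  `H` is made for the token, and a weakening takes the place of the token at the input of `C`. -/
  | contraction (C H : Net) (k₁ k₂ p h : ℕ) (hC : C.IsContractionTree .star (k₁ + 1 + k₂))
      (hH : H.IsCopyable p h) : RuleShape
      (diagram ![[.star], [.star], stars k₁, stars k₂, [.star], stars p, dias h] [2, 0, 3] [5, 6]
        [(Net.base (.token .rewrite), [0], [1]), (C, [2, 1, 3], [4]), (H, [4], [5, 6])])
      (diagram ![[.star], [.star], stars k₁, stars k₂, [.star], stars p, dias h, [.star],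
          stars p, dias h, stars p, dias h] [2, 0, 3] [5, 6]
        [(Net.base (.token .search), [0], [1]), (H, [1], [8, 9]),
          (Net.base (.weak .star), [], [7]), (C, [2, 7, 3], [4]), (H, [4], [10, 11]),
          (distributor .star p 2, [8, 10], [5]), (distributor .dia h 2, [9, 11], [6])])
  /-- Application of an abstraction, with content `G` of its box, to a stable hypernet `A`. -/
  | beta (G A : Net) (k h : ℕ) (z : List VLabel)
      (hG : G.IsHypernet [.star] (stars (1 + k) ++ dias h)) (hA : A.IsStable z) : RuleShape
      (diagram ![[.star], [.star], [.star], [.star], [.thunk 1], stars k ++ dias h, z] [0] [5, 6]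
        [(Net.base (.token .rewrite), [0], [1]), (Net.base (.op .app), [1], [2, 3]),
          (Net.base (.op .lam), [2], [4]),
          (Net.single (.box 1 G) [.thunk 1] (stars k ++ dias h), [4], [5]), (A, [3], [6])])
      (diagram ![[.star], [.star], [.star], stars k ++ dias h, z] [0] [3, 4]
        [(Net.base (.token .search), [0], [1]), (G, [1], [2, 3]), (A, [2], [4])])
  /-- Reference creation. -/
  | ref (A : Net) (z : List VLabel) (hA : A.IsStable z) : RuleShape
      (diagram ![[.star], [.star], [.star], z] [0] [3]
        [(Net.base (.token .rewrite), [0], [1]), (Net.base (.op .ref), [1], [2]), (A, [2], [3])])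
      (diagram ![[.star], [.star], [.dia], [.star], z] [0] [4]
        [(Net.base (.token .search), [0], [1]), (Net.base .inst, [1], [2]),
          (Net.base .atom, [2], [3]), (A, [3], [4])])
  /-- Equality of references: two instances of the same atom. -/
  | eqTrue (A : Net) (k : ℕ) (hA : IsSharedAtom A (2 + k)) : RuleShape
      (diagram ![[.star], [.star], [.star], [.star], [.dia], [.dia], dias k, [.star]] [0, 6] [7]
        [(Net.base (.token .rewrite), [0], [1]), (Net.base (.op .eq), [1], [2, 3]),
          (Net.base .inst, [2], [4]), (Net.base .inst, [3], [5]), (A, [4, 5, 6], [7])])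
      (diagram ![[.star], [.star], [.dia], [.dia], dias k, [.star]] [0, 4] [5]
        [(Net.base (.token .search), [0], [1]), (Net.base (.op .tt), [1], []),
          (Net.base (.weak .dia), [], [2]), (Net.base (.weak .dia), [], [3]),
          (A, [2, 3, 4], [5])])
  /-- Equality of references: instances of two different atoms. -/
  | eqFalse (A A' : Net) (k k' : ℕ) (hA : IsSharedAtom A (1 + k)) (hA' : IsSharedAtom A' (1 + k')) :
      RuleShape
      (diagram ![[.star], [.star], [.star], [.star], [.dia], [.dia], dias k, dias k', [.star],
          [.star]] [0, 6, 7] [8, 9]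
        [(Net.base (.token .rewrite), [0], [1]), (Net.base (.op .eq), [1], [2, 3]),
          (Net.base .inst, [2], [4]), (Net.base .inst, [3], [5]), (A, [4, 6], [8]),
          (A', [5, 7], [9])])
      (diagram ![[.star], [.star], [.dia], [.dia], dias k, dias k', [.star], [.star]]
          [0, 4, 5] [6, 7]
        [(Net.base (.token .search), [0], [1]), (Net.base (.op .ff), [1], []),
          (Net.base (.weak .dia), [], [2]), (Net.base (.weak .dia), [], [3]), (A, [2, 4], [6]),
          (A', [3, 5], [7])])
  /-- Assignment: the atom gets connected to the new value `G`, and the old value is weakened. -/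
  | assign (A G : Net) (k : ℕ) (z : List VLabel) (hA : IsSharedAtom A (1 + k)) (hG : G.IsStable z) :
      RuleShape
      (diagram ![[.star], [.star], [.star], [.star], [.dia], dias k, [.star], z] [0, 5] [6, 7]
        [(Net.base (.token .rewrite), [0], [1]), (Net.base (.op .assign), [1], [2, 3]),
          (Net.base .inst, [2], [4]), (A, [4, 5], [6]), (G, [3], [7])])
      (diagram ![[.star], [.star], [.star], [.dia], dias k, [.star], z] [0, 4] [5, 6]
        [(Net.base (.token .search), [0], [1]), (Net.base (.op .unit), [1], []),
          (Net.base (.weak .dia), [], [3]), (A, [3, 4], [2]), (G, [2], [6]),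
          (Net.base (.weak .star), [], [5])])
  /-- Dereferencing: the stored value gets shared with the token. -/
  | deref (A : Net) (k : ℕ) (hA : IsSharedAtom A (1 + k)) : RuleShape
      (diagram ![[.star], [.star], [.star], [.dia], dias k, [.star]] [0, 4] [5]
        [(Net.base (.token .rewrite), [0], [1]), (Net.base (.op .deref), [1], [2]),
          (Net.base .inst, [2], [3]), (A, [3, 4], [5])])
      (diagram ![[.star], [.star], [.star], [.dia], dias k, [.star]] [0, 4] [5]
        [(Net.base (.token .search), [0], [1]), (Net.base (.weak .dia), [], [3]),
          (A, [3, 4], [2]), (Net.base (.contr .star), [1, 2], [5])])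
  /-- Addition of natural numbers. -/
  | add (m n p : ℕ) (hp : p = m + n) : RuleShape
      (diagram ![[.star], [.star], [.star], [.star]] [0] []
        [(Net.base (.token .rewrite), [0], [1]), (Net.base (.op .add), [1], [2, 3]),
          (Net.base (.op (.num m)), [2], []), (Net.base (.op (.num n)), [3], [])])
      (diagram ![[.star], [.star]] [0] []
        [(Net.base (.token .search), [0], [1]), (Net.base (.op (.num p)), [1], [])])
  /-- Subtraction of natural numbers. -/
  | sub (m n p : ℕ) (hp : (p : ℤ) = (m : ℤ) - (n : ℤ)) : RuleShape
      (diagram ![[.star], [.star], [.star], [.star]] [0] []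
        [(Net.base (.token .rewrite), [0], [1]), (Net.base (.op .sub), [1], [2, 3]),
          (Net.base (.op (.num m)), [2], []), (Net.base (.op (.num n)), [3], [])])
      (diagram ![[.star], [.star]] [0] []
        [(Net.base (.token .search), [0], [1]), (Net.base (.op (.num p)), [1], [])])
  /-- Negation of natural numbers. -/
  | neg (m p : ℕ) (hp : (p : ℤ) = -(m : ℤ)) : RuleShape
      (diagram ![[.star], [.star], [.star]] [0] []
        [(Net.base (.token .rewrite), [0], [1]), (Net.base (.op .neg), [1], [2]),
          (Net.base (.op (.num m)), [2], [])])
      (diagram ![[.star], [.star]] [0] []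
        [(Net.base (.token .search), [0], [1]), (Net.base (.op (.num p)), [1], [])])

/-- `G ↦ N` is a contraction rule or a local rewrite rule of an active operation. -/
def LocalRule (G N : Net) : Prop := ∃ G₀ N₀, RuleShape G₀ N₀ ∧ G.Iso G₀ ∧ N.Iso N₀

/-! ## Pre-templates and specimens -/

/-- A pre-template: a relation between focus-free hypernets of the same type. -/
def IsPreTemplate (R : Net → Net → Prop) : Prop :=
  ∀ G H, R G H → G.FocusFree ∧ H.FocusFree ∧ G.HoleFree ∧ H.HoleFree ∧
    ∃ d c, G.IsHypernet d c ∧ H.IsHypernet d c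

/-- Output-closure: of any two related hypernets at least one is one-way. -/
def OutputClosed (R : Net → Net → Prop) : Prop := ∀ G H, R G H → G.OneWay ∨ H.OneWay

/-- The pre-template relates contraction trees only. -/
def OnContractionTrees (R : Net → Net → Prop) : Prop :=
  ∀ G H, R G H → (∃ ℓ k, G.IsContractionTree ℓ k) ∧ ∃ ℓ k, H.IsContractionTree ℓ k

/-- The sequences `G⃗` and `H⃗` to be plugged in `C` have the types of the holes of `C` and are related,
componentwise, by `R`. -/
def RelatedOn (R : Net → Net → Prop) (C : Net) (G H : Hole → Net) : Prop :=
  ∀ χ, C.HasHole χ → R (G χ) (H χ) ∧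
    (G χ).IsHypernet χ.dom χ.cod ∧ (H χ).IsHypernet χ.dom χ.cod

/-- `(C; G⃗; H⃗)` is a `𝒞`-specimen of `R`. -/
structure IsSpecimen (𝒞 : Set Net) (R : Net → Net → Prop) (C : Net) (G H : Hole → Net) : Prop where
  context : C.IsContext
  focussed : C.Focussed
  underlying_mem : C.underlying ∈ 𝒞
  related : RelatedOn R C G H
  left_state : (C.plug G).IsState
  right_state : (C.plug H).IsState

/-- The local rule `C₂[G⃗''] ↦ N` preserves or duplicates the parts contributed by `R`, as witnessed by
`C₂'`, `G⃗'''` and `H⃗'''`: `C₂'` is a focussed context that can be plugged into the hole `χ` of `C₁` in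
place of `C₂`, `C₂[G⃗''] ↦ C₂'[G⃗'''] = N` and `C₂[H⃗''] ↦ C₂'[H⃗''']`, and `G⃗'''`, `H⃗'''` are related
by `R`. -/
structure Preserves (R : Net → Net → Prop) (C₁ : Net) (χ : Hole) (C₂ : Net) (G H : Hole → Net)
    (N C₂' : Net) (G' H' : Hole → Net) : Prop where
  context : C₂'.IsContext
  focussed : C₂'.Focussed
  type : C₂'.IsHypernet χ.dom χ.cod
  context_plug : (C₁.plugAt χ C₂').IsContext
  related : RelatedOn R C₂' G' H'
  left_rule : LocalRule (C₂.plug G) (C₂'.plug G')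
  left_eq : (C₂'.plug G').Iso N
  right_rule : LocalRule (C₂.plug H) (C₂'.plug H')

end Spartan

open Spartan

namespace Spartan

/-! ## Isomorphisms -/

/-! A redex `C₂[G]` is, up to isomorphism, the left-hand side of a rule, hence a wiring of a fixed
finite shape whose components are single edges, contraction trees, copyable hypernets, shared atoms,
stable hypernets or a box. The main point is that this wiring can be pulled back through plugging.
If the edges that replace each edge of `C₂` all lie in one component, the components of `C₂` itself
are the subhypergraphs on the edges of each colour, and plugging `G` in them gives back the
components of the redex (`decompose`). An edge that is not a hole is replaced by a single edge, so
only shallow holes need care. For claims 1 and 2 there are none. For claim 3 a shallow hole is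
filled with a contraction tree: all its edges are contractions or weakenings and all of them lead to
its output, while in no left-hand side does a component with such shallow edges feed another one, so
the tree cannot straddle two components (`exists_colouring`).

It remains to exchange `G` for `H` in each component. Components made of basic labels other than
contractions and weakenings contain no hole and do not change (`Net.IsHypernet.rigid`). Contraction
trees, copyable hypernets, shared atoms and boxes stay in their class
(`Net.IsContractionTree.transfer`, `Net.IsCopyable.transfer`, `IsSharedAtom.transfer`,
`Net.IsHypernet.exists_box`). Hence `C₂[H]` is a redex of the same rule. The right-hand side is a
wiring of constants and of at most two copies of some components of the left-hand side, or of the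
content of a box of it. Wiring the corresponding pieces of `C₂` in the same way gives `C₂'`. Each
copy has its holes renamed apart, to names not used by `C₁`, so that the result is again a context.
All this is collected in `Residual`, constructed rule by rule, and `Residual.preserves` derives the
required property.

For binding-freeness, the token edge can be kept or erased at will, since it is neither binding nor
a hole. When all holes of `C₂` are deep, new shallow holes arise only in the application rule, which
opens a box. The content of the box is binding-free already, so what matters is what lies above the
token. Rootedness gives an operation path from the input of the state to the token, because every
interaction rule moves the token along such paths (`Rooted.tokenReach`). This path exists both for
`G` and for `H`. Tracing the two back in parallel, they cannot leave through the same hole when one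
of its two fillings is one-way, so the path lies in the context itself
(`Net.IsHypernet.opReach_of_plug`). As an operation has a single source, everything above the token
is an operation, hence not binding.

The holes of `C₁` could be endangered only by paths through the replaced part. But every output of
type `⋆` of a redex lies below a source of a contraction, an atom or a box
(`RuleShape.guardedOutputs`). As the old context is binding-free and the sources of these holes have
type `⋆`, nothing above them passes through `C₂`, and the region above them is unchanged by the step
(`Graph.Replaces.shallowBindingFree`). -/

theorem Label.Iso.of_net {G G' : Net} (n : ℕ) (h : G.Iso G') :
    Label.Iso (.box n G) (.box n G') := by
  obtain ⟨f, g, h1, h2, h3, h4, h5, h6⟩ := h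
  exact .box n G G' f g h1 h2 h3 h4 h5 h6

theorem Label.Iso.box_left {n : ℕ} {G : Net} {l : Label} (h : Label.Iso (.box n G) l) :
    ∃ G' : Net, l = .box n G' ∧ G.Iso G' := by
  cases h with
  | box n G G' f g h1 h2 h3 h4 h5 h6 => exact ⟨G', rfl, f, g, h1, h2, h3, h4, h5, h6⟩

theorem Label.Iso.box_right {n : ℕ} {G : Net} {l : Label} (h : Label.Iso l (.box n G)) :
    ∃ G' : Net, l = .box n G' ∧ G'.Iso G := by
  cases h with
  | box n G G' f g h1 h2 h3 h4 h5 h6 => exact ⟨_, rfl, f, g, h1, h2, h3, h4, h5, h6⟩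

theorem Label.Iso.base_left {b : BLabel} {l : Label} (h : Label.Iso (.base b) l) :
    l = .base b := by
  cases h; rfl

theorem Label.Iso.base_right {b : BLabel} {l : Label} (h : Label.Iso l (.base b)) :
    l = .base b := by
  cases h; rfl

theorem Label.Iso.refl (l : Label) : Label.Iso l l := by
  induction l using Label.induction with
  | base b => exact .base b
  | box n G ih =>
    exact .box n G G (Equiv.refl _) (Equiv.refl _) (by simp) (by simp) (by simp) (by simp)
      (by simp) (by simpa using ih)

theorem Label.Iso.symm {l l' : Label} (h : Label.Iso l l') : Label.Iso l' l := by
  induction h with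
  | base b => exact .base b
  | box n G G' f g h1 h2 h3 h4 h5 _ ih =>
    refine .box n G' G f.symm g.symm (fun v => ?_) ?_ ?_ (fun e => ?_) (fun e => ?_) (fun e => ?_)
    · rw [← h1, Equiv.apply_symm_apply]
    · simp [h2]
    · simp [h3]
    · have := h4 (g.symm e)
      simp only [Equiv.apply_symm_apply] at this
      simp [this]
    · have := h5 (g.symm e)
      simp only [Equiv.apply_symm_apply] at this
      simp [this]
    · simpa using ih (g.symm e)

theorem Label.Iso.trans {l l' l'' : Label} (h : Label.Iso l l') (h' : Label.Iso l' l'') :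
    Label.Iso l l'' := by
  induction h generalizing l'' with
  | base b => exact h'
  | box n G G' f g h1 h2 h3 h4 h5 _ ih =>
    obtain ⟨G'', rfl, f', g', k1, k2, k3, k4, k5, k6⟩ := h'.box_left
    refine .box n G G'' (f.trans f') (g.trans g') (fun v => ?_) ?_ ?_ (fun e => ?_) (fun e => ?_)
      (fun e => ?_)
    · simp [k1, h1]
    · simp [k2, h2]
    · simp [k3, h3]
    · simp [k4, h4]
    · simp [k5, h5]
    · exact ih e (k6 (g e))

theorem Net.Iso.refl (N : Net) : N.Iso N :=
  ⟨Equiv.refl _, Equiv.refl _, by simp, by simp, by simp, by simp, by simp,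
    fun e => Label.Iso.refl _⟩

theorem Net.Iso.of_label {n n' : ℕ} {G G' : Net} (h : Label.Iso (.box n G) (.box n' G')) :
    G.Iso G' := by
  obtain ⟨G'', h1, h2⟩ := h.box_left
  cases h1
  exact h2

theorem Net.Iso.symm {N N' : Net} (h : N.Iso N') : N'.Iso N :=
  .of_label (Label.Iso.of_net 0 h).symm

theorem Net.Iso.trans {N N' N'' : Net} (h : N.Iso N') (h' : N'.Iso N'') : N.Iso N'' :=
  .of_label ((Label.Iso.of_net 0 h).trans (Label.Iso.of_net 0 h'))

theorem Net.Iso.of_eq {N N' : Net} (h : N = N') : N.Iso N' := h ▸ .refl N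

/-- Between interfaced hypergraphs, a homomorphism that is bijective on edges is an isomorphism: a
vertex is determined by its being an input or a target of an edge. -/
theorem Net.Iso.of_hom {X Y : Net} (hX : X.IsInterfaced) (hY : Y.IsInterfaced)
    (f : X.V → Y.V) (g : X.E → Y.E) (hg : Function.Bijective g)
    (vlab : ∀ v, Y.vlab (f v) = X.vlab v)
    (ins : Y.ins = X.ins.map f) (outs : Y.outs = X.outs.map f)
    (src : ∀ e, Y.src (g e) = (X.src e).map f) (tgt : ∀ e, Y.tgt (g e) = (X.tgt e).map f)
    (lab : ∀ e, Label.Iso (X.lab e) (Y.lab (g e))) : X.Iso Y := by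
  have hf : Function.Bijective f := by
    constructor
    · intro x x' hxx
      -- If `x'` were a target, its image would be a target; but this image is also that of `x`, an
      -- input.
      have aux : ∀ x x', f x = f x' → x ∈ X.ins → x' ∈ X.ins := by
        intro x x' h hx
        rw [hX.mem_ins]
        intro e he
        have h1 : f x ∈ Y.ins := by rw [ins]; exact List.mem_map_of_mem hx
        rw [hY.mem_ins] at h1
        apply h1 (g e)
        rw [h, tgt]
        exact List.mem_map_of_mem he
      by_cases hx : x ∈ X.ins
      · have hn := hY.ins_nodup
        rw [ins] at hn
        exact List.inj_on_of_nodup_map hn hx (aux x x' hxx hx) hxx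
      · have hx' : x' ∉ X.ins := fun h => hx (aux x' x hxx.symm h)
        rw [hX.mem_ins] at hx hx'
        push Not at hx hx'
        obtain ⟨e, he⟩ := hx
        obtain ⟨e', he'⟩ := hx'
        have h1 : f x ∈ Y.tgt (g e) := by rw [tgt]; exact List.mem_map_of_mem he
        have h2 : f x ∈ Y.tgt (g e') := by rw [tgt, hxx]; exact List.mem_map_of_mem he'
        obtain rfl := hg.1 (hY.tgt_unique _ _ _ h1 h2)
        have hn := hY.tgt_nodup (g e)
        rw [tgt] at hn
        exact List.inj_on_of_nodup_map hn he he' hxx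
    · intro y
      by_cases hy : y ∈ Y.ins
      · rw [ins, List.mem_map] at hy
        exact ⟨_, hy.choose_spec.2⟩
      · rw [hY.mem_ins] at hy
        push Not at hy
        obtain ⟨e, he⟩ := hy
        obtain ⟨e, rfl⟩ := hg.2 e
        rw [tgt, List.mem_map] at he
        exact ⟨_, he.choose_spec.2⟩
  exact ⟨Equiv.ofBijective f hf, Equiv.ofBijective g hg, vlab, ins, outs, src, tgt, lab⟩

theorem map_vlab_of_comp {α β γ : Type*} {f : α → β} {p : α → γ} {q : β → γ}
    (h : ∀ v, q (f v) = p v) (l : List α) : (l.map f).map q = l.map p := by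
  rw [List.map_map]; exact List.map_congr_left fun v _ => h v

theorem Graph.IsInterfaced.of_equiv {Λ : Type 1} {X Y : Graph Λ} (hX : X.IsInterfaced)
    (f : X.V ≃ Y.V) (g : X.E ≃ Y.E)
    (ins : Y.ins = X.ins.map f) (outs : Y.outs = X.outs.map f)
    (src : ∀ e, Y.src (g e) = (X.src e).map f) (tgt : ∀ e, Y.tgt (g e) = (X.tgt e).map f) :
    Y.IsInterfaced := by
  have src' : ∀ e, Y.src e = (X.src (g.symm e)).map f := fun e => by
    rw [← src, Equiv.apply_symm_apply]
  have tgt' : ∀ e, Y.tgt e = (X.tgt (g.symm e)).map f := fun e => by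
    rw [← tgt, Equiv.apply_symm_apply]
  have mem : ∀ (v : Y.V) (l : List X.V), v ∈ l.map f ↔ f.symm v ∈ l := by
    intro v l
    conv_lhs => rw [← f.apply_symm_apply v]
    exact List.mem_map_of_injective f.injective
  constructor
  · have := hX.finV; exact Finite.of_equiv _ f
  · have := hX.finE; exact Finite.of_equiv _ g
  · intro e; rw [src']; exact (hX.src_nodup _).map f.injective
  · intro e; rw [tgt']; exact (hX.tgt_nodup _).map f.injective
  · intro v e e' h h'
    rw [src', mem] at h h'
    exact g.symm.injective (hX.src_unique _ _ _ h h')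
  · intro v e e' h h'
    rw [tgt', mem] at h h'
    exact g.symm.injective (hX.tgt_unique _ _ _ h h')
  · rw [ins]; exact hX.ins_nodup.map f.injective
  · rw [outs]; exact hX.outs_nodup.map f.injective
  · intro v
    rw [ins, mem, hX.mem_ins, ← g.symm.forall_congr_right]
    simp only [tgt', mem]
  · intro v
    rw [outs, mem, hX.mem_outs, ← g.symm.forall_congr_right]
    simp only [src', mem]
  · intro v
    rw [ins, outs, mem, mem]
    exact hX.disjoint _

theorem Label.HasType.iso {l l' : Label} (h : l.Iso l') {d c : List VLabel}
    (ht : l.HasType d c) : l'.HasType d c := by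
  induction h generalizing d c with
  | base b => exact ht
  | box n G G' f g h1 h2 h3 h4 h5 _ ih =>
    rw [Label.hasType_box] at ht ⊢
    obtain ⟨k, h, hd, hc, hG⟩ := ht
    refine ⟨k, h, hd, hc, hG.interfaced.of_equiv f g h2 h3 h4 h5, fun e => ?_, ?_, ?_⟩
    · obtain ⟨e, rfl⟩ := g.surjective e
      rw [h4, h5, map_vlab_of_comp h1, map_vlab_of_comp h1]
      exact ih e (hG.typed e)
    · rw [h2, map_vlab_of_comp h1]; exact hG.ins_type
    · rw [h3, map_vlab_of_comp h1]; exact hG.outs_type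

theorem Net.IsHypernet.iso {N N' : Net} {d c : List VLabel} (hN : N.IsHypernet d c)
    (h : N.Iso N') : N'.IsHypernet d c := by
  obtain ⟨f, g, h1, h2, h3, h4, h5, h6⟩ := h
  refine ⟨hN.interfaced.of_equiv f g h2 h3 h4 h5, fun e => ?_, ?_, ?_⟩
  · obtain ⟨e, rfl⟩ := g.surjective e
    rw [h4, h5, map_vlab_of_comp h1, map_vlab_of_comp h1]
    exact (hN.typed e).iso (h6 e)
  · rw [h2, map_vlab_of_comp h1]; exact hN.ins_type
  · rw [h3, map_vlab_of_comp h1]; exact hN.outs_type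

/-- The type of a hypernet is unique. -/
theorem Net.IsHypernet.type_unique {N : Net} {d c d' c' : List VLabel} (h : N.IsHypernet d c)
    (h' : N.IsHypernet d' c') : d = d' ∧ c = c' :=
  ⟨h.ins_type.symm.trans h'.ins_type, h.outs_type.symm.trans h'.outs_type⟩

theorem Label.occ_box (b : BLabel) (n : ℕ) (G : Net) : (Label.box n G).Occ b = G.Occ b := rfl

theorem Label.Iso.occ_equiv {l l' : Label} (h : l.Iso l') (b : BLabel) :
    Nonempty (l.Occ b ≃ l'.Occ b) := by
  induction h with
  | base b => exact ⟨Equiv.refl _⟩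
  | box n G G' f g _ _ _ _ _ _ ih =>
    exact ⟨Equiv.sigmaCongr g fun e => (ih e).some⟩

theorem Net.Iso.occ_equiv {N N' : Net} (h : N.Iso N') (b : BLabel) :
    Nonempty (N.Occ b ≃ N'.Occ b) := (Label.Iso.of_net 0 h).occ_equiv b

theorem Net.hasHole_of_lab {N : Net} {e : N.E} {χ : Hole} (h : N.lab e = .base (.hole χ)) :
    N.HasHole χ := by
  refine ⟨⟨e, ?_⟩⟩
  rw [h]
  exact ⟨rfl⟩

/-! ## Flattening -/

/-- A hypergraph whose edges are labelled by hypernets of the right types. -/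
structure Graph.WF (D : Graph Net) : Prop where
  interfaced : D.IsInterfaced
  typed : ∀ e, (D.lab e).IsHypernet ((D.src e).map D.vlab) ((D.tgt e).map D.vlab)

namespace Graph

variable {D : Graph Net}

/-- The vertices of `D`, as vertices of the flattening. -/
def vtx (D : Graph Net) (u : D.V) : D.FlatV := Sum.inl u

theorem vtx_injective (D : Graph Net) : Function.Injective D.vtx := Sum.inl_injective

theorem vtx_ne_inr {u : D.V} {x} (h : D.vtx u = (Sum.inr x : D.FlatV)) : False :=
  nomatch (show (Sum.inl u : D.FlatV) = Sum.inr x from h)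

theorem embed_of_some {e : D.E} {v : (D.lab e).V} {u : D.V} (h : D.glue e v = some u) :
    D.embed e v = D.vtx u := by
  unfold embed
  split
  · rename_i u' h'
    rw [h] at h'
    cases h'
    rfl
  · rename_i h'
    rw [h] at h'
    cases h'

theorem embed_of_none {e : D.E} {v : (D.lab e).V} (h : D.glue e v = none) :
    D.embed e v = Sum.inr ⟨⟨e, v⟩, h⟩ := by
  unfold embed
  split
  · rename_i h'
    rw [h] at h'
    cases h'
  · rfl

theorem WF.length_ins (hD : D.WF) (e : D.E) : (D.lab e).ins.length = (D.src e).length := by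
  have := congrArg List.length (hD.typed e).ins_type
  simpa using this

theorem WF.length_outs (hD : D.WF) (e : D.E) : (D.lab e).outs.length = (D.tgt e).length := by
  have := congrArg List.length (hD.typed e).outs_type
  simpa using this

theorem WF.embed_ins_get (hD : D.WF) (e : D.E) (k : ℕ) (h : k < (D.lab e).ins.length) :
    D.embed e (D.lab e).ins[k] = D.vtx ((D.src e)[k]'(hD.length_ins e ▸ h)) := by
  classical
  apply embed_of_some
  have h1 : (D.lab e).ins.idxOf (D.lab e).ins[k] = k :=
    (hD.typed e).interfaced.ins_nodup.idxOf_getElem k h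
  unfold glue
  rw [if_pos (List.getElem_mem h)]
  convert List.getElem?_eq_getElem (hD.length_ins e ▸ h) using 2

theorem WF.embed_outs_get (hD : D.WF) (e : D.E) (k : ℕ) (h : k < (D.lab e).outs.length) :
    D.embed e (D.lab e).outs[k] = D.vtx ((D.tgt e)[k]'(hD.length_outs e ▸ h)) := by
  classical
  apply embed_of_some
  have h1 : (D.lab e).outs.idxOf (D.lab e).outs[k] = k :=
    (hD.typed e).interfaced.outs_nodup.idxOf_getElem k h
  unfold glue
  -- `glue` tests inputs first; an output reaches the second branch because no vertex is both an
  -- input and an output.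
  rw [if_neg fun h' => (hD.typed e).interfaced.disjoint _ h' (List.getElem_mem h),
    if_pos (List.getElem_mem h)]
  convert List.getElem?_eq_getElem (hD.length_outs e ▸ h) using 2

theorem WF.map_embed_ins (hD : D.WF) (e : D.E) :
    (D.lab e).ins.map (D.embed e) = (D.src e).map D.vtx := by
  apply List.ext_getElem
  · simpa using hD.length_ins e
  · intro k h1 h2
    rw [List.getElem_map, List.getElem_map, hD.embed_ins_get]

theorem WF.map_embed_outs (hD : D.WF) (e : D.E) :
    (D.lab e).outs.map (D.embed e) = (D.tgt e).map D.vtx := by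
  apply List.ext_getElem
  · simpa using hD.length_outs e
  · intro k h1 h2
    rw [List.getElem_map, List.getElem_map, hD.embed_outs_get]

theorem embed_inner {e : D.E} {v : (D.lab e).V} (h1 : v ∉ (D.lab e).ins)
    (h2 : v ∉ (D.lab e).outs) : ∃ h, D.embed e v = Sum.inr ⟨⟨e, v⟩, h⟩ := by
  have : D.glue e v = none := by
    unfold glue
    rw [if_neg h1, if_neg h2]
  exact ⟨this, embed_of_none this⟩

theorem WF.glue_eq_none (hD : D.WF) {e : D.E} {v : (D.lab e).V} :
    D.glue e v = none ↔ v ∉ (D.lab e).ins ∧ v ∉ (D.lab e).outs := by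
  constructor
  · intro h
    refine ⟨fun h' => ?_, fun h' => ?_⟩
    · obtain ⟨k, hk, rfl⟩ := List.getElem_of_mem h'
      have h1 := embed_of_none h
      rw [hD.embed_ins_get] at h1
      exact vtx_ne_inr h1
    · obtain ⟨k, hk, rfl⟩ := List.getElem_of_mem h'
      have h1 := embed_of_none h
      rw [hD.embed_outs_get] at h1
      exact vtx_ne_inr h1
  · rintro ⟨h1, h2⟩
    unfold glue
    rw [if_neg h1, if_neg h2]

theorem WF.embed_cases (hD : D.WF) (e : D.E) (v : (D.lab e).V) :
    (v ∈ (D.lab e).ins ∧ ∃ u ∈ D.src e, D.embed e v = D.vtx u) ∨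
    (v ∈ (D.lab e).outs ∧ ∃ u ∈ D.tgt e, D.embed e v = D.vtx u) ∨
    (v ∉ (D.lab e).ins ∧ v ∉ (D.lab e).outs ∧ ∃ h, D.embed e v = Sum.inr ⟨⟨e, v⟩, h⟩) := by
  by_cases h1 : v ∈ (D.lab e).ins
  · obtain ⟨k, hk, rfl⟩ := List.getElem_of_mem h1
    exact .inl ⟨h1, _, List.getElem_mem _, hD.embed_ins_get e k hk⟩
  by_cases h2 : v ∈ (D.lab e).outs
  · obtain ⟨k, hk, rfl⟩ := List.getElem_of_mem h2
    exact .inr (.inl ⟨h2, _, List.getElem_mem _, hD.embed_outs_get e k hk⟩)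
  · exact .inr (.inr ⟨h1, h2, embed_inner h1 h2⟩)

theorem WF.mem_src_of_embed (hD : D.WF) {e : D.E} {v : (D.lab e).V} {u : D.V}
    (h1 : v ∉ (D.lab e).outs) (h : D.embed e v = D.vtx u) :
    v ∈ (D.lab e).ins ∧ u ∈ D.src e := by
  rcases hD.embed_cases e v with ⟨h2, u', hu, h3⟩ | ⟨h2, _⟩ | ⟨_, _, _, h3⟩
  · rw [h] at h3; obtain rfl := D.vtx_injective h3; exact ⟨h2, hu⟩
  · exact absurd h2 h1
  · rw [h] at h3; exact (vtx_ne_inr h3).elim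

theorem WF.mem_tgt_of_embed (hD : D.WF) {e : D.E} {v : (D.lab e).V} {u : D.V}
    (h1 : v ∉ (D.lab e).ins) (h : D.embed e v = D.vtx u) :
    v ∈ (D.lab e).outs ∧ u ∈ D.tgt e := by
  rcases hD.embed_cases e v with ⟨h2, _⟩ | ⟨h2, u', hu, h3⟩ | ⟨_, _, _, h3⟩
  · exact absurd h2 h1
  · rw [h] at h3; obtain rfl := D.vtx_injective h3; exact ⟨h2, hu⟩
  · rw [h] at h3; exact (vtx_ne_inr h3).elim

/-- Gluing never merges two vertices that are not inputs: outputs go to targets of their edge, which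
are distinct and belong to one edge only, and inner vertices are kept apart. Targets of edges inside
the labels are of this kind. -/
theorem WF.embed_inj_outs (hD : D.WF) {e e' : D.E} {v : (D.lab e).V} {v' : (D.lab e').V}
    (h1 : v ∉ (D.lab e).ins) (h1' : v' ∉ (D.lab e').ins)
    (h : D.embed e v = D.embed e' v') : (⟨e, v⟩ : Σ e, (D.lab e).V) = ⟨e', v'⟩ := by
  rcases hD.embed_cases e v with ⟨h2, _⟩ | ⟨h2, u, hu, h3⟩ | ⟨_, h2, h3, h4⟩
  · exact absurd h2 h1
  · rw [h] at h3
    have h4 := hD.mem_tgt_of_embed h1' h3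
    obtain rfl := hD.interfaced.tgt_unique _ _ _ hu h4.2
    have hn : ((D.lab e).outs.map (D.embed e)).Nodup := by
      rw [hD.map_embed_outs]
      exact (hD.interfaced.tgt_nodup e).map D.vtx_injective
    rw [List.inj_on_of_nodup_map hn h2 h4.1 h]
  · rw [h] at h4
    rcases hD.embed_cases e' v' with ⟨h2, _⟩ | ⟨h2, u, hu, h3⟩ | ⟨_, h2, h3, h5⟩
    · exact absurd h2 h1'
    · rw [h3] at h4; exact (vtx_ne_inr h4).elim
    · rw [h5] at h4; cases h4; rfl

/-- The dual fact, for vertices that are not outputs; it applies to the sources of edges inside the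
labels. -/
theorem WF.embed_inj_ins (hD : D.WF) {e e' : D.E} {v : (D.lab e).V} {v' : (D.lab e').V}
    (h1 : v ∉ (D.lab e).outs) (h1' : v' ∉ (D.lab e').outs)
    (h : D.embed e v = D.embed e' v') : (⟨e, v⟩ : Σ e, (D.lab e).V) = ⟨e', v'⟩ := by
  rcases hD.embed_cases e v with ⟨h2, u, hu, h3⟩ | ⟨h2, _⟩ | ⟨h2, _, h3, h4⟩
  · rw [h] at h3
    have h4 := hD.mem_src_of_embed h1' h3
    obtain rfl := hD.interfaced.src_unique _ _ _ hu h4.2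
    have hn : ((D.lab e).ins.map (D.embed e)).Nodup := by
      rw [hD.map_embed_ins]
      exact (hD.interfaced.src_nodup e).map D.vtx_injective
    rw [List.inj_on_of_nodup_map hn h2 h4.1 h]
  · exact absurd h2 h1
  · rw [h] at h4
    rcases hD.embed_cases e' v' with ⟨h2, u, hu, h3⟩ | ⟨h2, _⟩ | ⟨h2, _, h3, h5⟩
    · rw [h3] at h4; exact (vtx_ne_inr h4).elim
    · exact absurd h2 h1'
    · rw [h5] at h4; cases h4; rfl

/-- If the sources of an edge differ from its targets, the label of the edge is embedded. -/
theorem WF.embed_injective (hD : D.WF) {e : D.E} (he : ∀ u ∈ D.src e, u ∉ D.tgt e) :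
    Function.Injective (D.embed e) := by
  intro v v' h
  by_cases h1 : v ∈ (D.lab e).ins
  · have h2 := (hD.typed e).interfaced.disjoint _ h1
    by_cases h3 : v' ∈ (D.lab e).outs
    · rcases hD.embed_cases e v with ⟨_, u, hu, h4⟩ | ⟨h4, _⟩ | ⟨h4, _⟩
      · rw [h] at h4
        exact absurd (hD.mem_tgt_of_embed
          (fun h5 => (hD.typed e).interfaced.disjoint _ h5 h3) h4).2 (he u hu)
      · exact absurd h4 h2
      · exact absurd h1 h4
    · exact eq_of_heq (Sigma.mk.inj (hD.embed_inj_ins h2 h3 h)).2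
  · by_cases h3 : v' ∈ (D.lab e).ins
    · have h3' := (hD.typed e).interfaced.disjoint _ h3
      by_cases h2 : v ∈ (D.lab e).outs
      · rcases hD.embed_cases e v' with ⟨_, u, hu, h4⟩ | ⟨h4, _⟩ | ⟨h4, _⟩
        · rw [← h] at h4
          exact absurd (hD.mem_tgt_of_embed h1 h4).2 (he u hu)
        · exact absurd h4 h3'
        · exact absurd h3 h4
      · exact eq_of_heq (Sigma.mk.inj (hD.embed_inj_ins h2 h3' h)).2
    · exact eq_of_heq (Sigma.mk.inj (hD.embed_inj_outs h1 h3 h)).2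

theorem WF.src_notMem_outs (hD : D.WF) {e : D.E} {x : (D.lab e).E} {v : (D.lab e).V}
    (h : v ∈ (D.lab e).src x) : v ∉ (D.lab e).outs :=
  fun h' => ((hD.typed e).interfaced.mem_outs v).1 h' x h

theorem WF.tgt_notMem_ins (hD : D.WF) {e : D.E} {x : (D.lab e).E} {v : (D.lab e).V}
    (h : v ∈ (D.lab e).tgt x) : v ∉ (D.lab e).ins :=
  fun h' => ((hD.typed e).interfaced.mem_ins v).1 h' x h

theorem mem_flatten_src {y : D.flatten.V} {e : D.E} {x : (D.lab e).E} :
    y ∈ D.flatten.src ⟨e, x⟩ ↔ ∃ v ∈ (D.lab e).src x, D.embed e v = y := List.mem_map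

theorem mem_flatten_tgt {y : D.flatten.V} {e : D.E} {x : (D.lab e).E} :
    y ∈ D.flatten.tgt ⟨e, x⟩ ↔ ∃ v ∈ (D.lab e).tgt x, D.embed e v = y := List.mem_map

theorem WF.inl_mem_src (hD : D.WF) {u : D.V} {e : D.E} {x : (D.lab e).E}
    (h : D.vtx u ∈ D.flatten.src ⟨e, x⟩) : u ∈ D.src e := by
  obtain ⟨v, hv, h⟩ := mem_flatten_src.1 h
  exact (hD.mem_src_of_embed (hD.src_notMem_outs hv) h).2

theorem WF.inl_mem_tgt (hD : D.WF) {u : D.V} {e : D.E} {x : (D.lab e).E}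
    (h : D.vtx u ∈ D.flatten.tgt ⟨e, x⟩) : u ∈ D.tgt e := by
  obtain ⟨v, hv, h⟩ := mem_flatten_tgt.1 h
  exact (hD.mem_tgt_of_embed (hD.tgt_notMem_ins hv) h).2

/-- A source of an edge is a source of some edge of its label. -/
theorem WF.exists_src (hD : D.WF) {u : D.V} {e : D.E} (h : u ∈ D.src e) :
    ∃ x, D.vtx u ∈ D.flatten.src ⟨e, x⟩ := by
  have h1 : D.vtx u ∈ (D.lab e).ins.map (D.embed e) := by
    rw [hD.map_embed_ins]; exact List.mem_map_of_mem h
  obtain ⟨v, hv, h2⟩ := List.mem_map.1 h1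
  have h3 := (hD.typed e).interfaced.disjoint v hv
  rw [(hD.typed e).interfaced.mem_outs] at h3
  push Not at h3
  obtain ⟨x, hx⟩ := h3
  exact ⟨x, mem_flatten_src.2 ⟨v, hx, h2⟩⟩

theorem WF.exists_tgt (hD : D.WF) {u : D.V} {e : D.E} (h : u ∈ D.tgt e) :
    ∃ x, D.vtx u ∈ D.flatten.tgt ⟨e, x⟩ := by
  have h1 : D.vtx u ∈ (D.lab e).outs.map (D.embed e) := by
    rw [hD.map_embed_outs]; exact List.mem_map_of_mem h
  obtain ⟨v, hv, h2⟩ := List.mem_map.1 h1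
  have h3 : v ∉ (D.lab e).ins := fun h => (hD.typed e).interfaced.disjoint v h hv
  rw [(hD.typed e).interfaced.mem_ins] at h3
  push Not at h3
  obtain ⟨x, hx⟩ := h3
  exact ⟨x, mem_flatten_tgt.2 ⟨v, hx, h2⟩⟩

theorem WF.vlab_embed (hD : D.WF) (e : D.E) (v : (D.lab e).V) :
    D.flatten.vlab (D.embed e v) = (D.lab e).vlab v := by
  by_cases h1 : v ∈ (D.lab e).ins
  · obtain ⟨k, hk, rfl⟩ := List.getElem_of_mem h1
    rw [hD.embed_ins_get]
    have := congrArg (fun l => l[k]?) (hD.typed e).ins_type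
    simp only [List.getElem?_map, List.getElem?_eq_getElem hk,
      List.getElem?_eq_getElem (hD.length_ins e ▸ hk), Option.map_some, Option.some.injEq] at this
    exact this.symm
  by_cases h2 : v ∈ (D.lab e).outs
  · obtain ⟨k, hk, rfl⟩ := List.getElem_of_mem h2
    rw [hD.embed_outs_get]
    have := congrArg (fun l => l[k]?) (hD.typed e).outs_type
    simp only [List.getElem?_map, List.getElem?_eq_getElem hk,
      List.getElem?_eq_getElem (hD.length_outs e ▸ hk), Option.map_some, Option.some.injEq] at this
    exact this.symm
  · obtain ⟨h3, h4⟩ := embed_inner h1 h2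
    rw [h4]
    rfl

/-- Uniqueness of sources and targets reduces to the injectivity of `embed` away from outputs and
inputs respectively. For the interface, a vertex of `D` is consumed (produced) by an edge of the
flattening exactly when it is a source (target) of an edge of `D`, and an inner vertex is both
produced and consumed inside its label. -/
theorem WF.flatten_interfaced (hD : D.WF) : D.flatten.IsInterfaced := by
  have hi := fun e => (hD.typed e).interfaced
  constructor
  · have := hD.interfaced.finV
    have := hD.interfaced.finE
    have := fun e => (hi e).finV
    exact inferInstanceAs (Finite (D.V ⊕ {x : Σ e : D.E, (D.lab e).V // D.glue x.1 x.2 = none}))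
  · have := hD.interfaced.finE
    have := fun e => (hi e).finE
    exact inferInstanceAs (Finite (Σ e : D.E, (D.lab e).E))
  · rintro ⟨e, x⟩
    refine List.Nodup.map_on (fun v hv v' hv' h => ?_) ((hi e).src_nodup x)
    exact eq_of_heq (Sigma.mk.inj
      (hD.embed_inj_ins (hD.src_notMem_outs hv) (hD.src_notMem_outs hv') h)).2
  · rintro ⟨e, x⟩
    refine List.Nodup.map_on (fun v hv v' hv' h => ?_) ((hi e).tgt_nodup x)
    exact eq_of_heq (Sigma.mk.inj
      (hD.embed_inj_outs (hD.tgt_notMem_ins hv) (hD.tgt_notMem_ins hv') h)).2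
  · rintro y ⟨e, x⟩ ⟨e', x'⟩ h h'
    obtain ⟨v, hv, rfl⟩ := mem_flatten_src.1 h
    obtain ⟨v', hv', h1⟩ := mem_flatten_src.1 h'
    cases hD.embed_inj_ins (hD.src_notMem_outs hv) (hD.src_notMem_outs hv') h1.symm
    rw [(hi e).src_unique _ _ _ hv hv']
  · rintro y ⟨e, x⟩ ⟨e', x'⟩ h h'
    obtain ⟨v, hv, rfl⟩ := mem_flatten_tgt.1 h
    obtain ⟨v', hv', h1⟩ := mem_flatten_tgt.1 h'
    cases hD.embed_inj_outs (hD.tgt_notMem_ins hv) (hD.tgt_notMem_ins hv') h1.symm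
    rw [(hi e).tgt_unique _ _ _ hv hv']
  · exact hD.interfaced.ins_nodup.map D.vtx_injective
  · exact hD.interfaced.outs_nodup.map D.vtx_injective
  · intro y
    constructor
    · rintro h ⟨e, x⟩ hx
      obtain ⟨u, hu, rfl⟩ := List.mem_map.1 h
      exact (hD.interfaced.mem_ins u).1 hu e (hD.inl_mem_tgt hx)
    · intro h
      rcases y with u | ⟨⟨e, v⟩, hv⟩
      · refine List.mem_map_of_mem ((hD.interfaced.mem_ins u).2 fun e he => ?_)
        obtain ⟨x, hx⟩ := hD.exists_tgt he
        exact h _ hx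
      · have h1 := (hD.glue_eq_none.1 hv).1
        rw [(hi e).mem_ins] at h1
        push Not at h1
        obtain ⟨x, hx⟩ := h1
        exact absurd (mem_flatten_tgt.2 ⟨v, hx, embed_of_none hv⟩) (h ⟨e, x⟩)
  · intro y
    constructor
    · rintro h ⟨e, x⟩ hx
      obtain ⟨u, hu, rfl⟩ := List.mem_map.1 h
      exact (hD.interfaced.mem_outs u).1 hu e (hD.inl_mem_src hx)
    · intro h
      rcases y with u | ⟨⟨e, v⟩, hv⟩
      · refine List.mem_map_of_mem ((hD.interfaced.mem_outs u).2 fun e he => ?_)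
        obtain ⟨x, hx⟩ := hD.exists_src he
        exact h _ hx
      · have h1 := (hD.glue_eq_none.1 hv).2
        rw [(hi e).mem_outs] at h1
        push Not at h1
        obtain ⟨x, hx⟩ := h1
        exact absurd (mem_flatten_src.2 ⟨v, hx, embed_of_none hv⟩) (h ⟨e, x⟩)
  · intro y h h'
    obtain ⟨u, hu, rfl⟩ := List.mem_map.1 h
    obtain ⟨u', hu', h1⟩ := List.mem_map.1 h'
    obtain rfl := D.vtx_injective h1
    exact hD.interfaced.disjoint _ hu hu'

theorem WF.flatten_isHypernet (hD : D.WF) :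
    D.flatten.IsHypernet (D.ins.map D.vlab) (D.outs.map D.vlab) := by
  refine ⟨hD.flatten_interfaced, ?_, ?_, ?_⟩
  · rintro ⟨e, x⟩
    have h := (hD.typed e).typed x
    have h1 := map_vlab_of_comp (hD.vlab_embed e)
    rw [← h1, ← h1] at h
    exact h
  · exact map_vlab_of_comp (fun _ => rfl) _
  · exact map_vlab_of_comp (fun _ => rfl) _

/-- The map out of the vertices of a flattening defined by maps out of the vertices of the hypergraph and
of the labels. -/
def lift {W : Type*} (D : Graph Net) (a : D.V → W) (b : ∀ e, (D.lab e).V → W) : D.FlatV → W :=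
  Sum.elim a fun x => b x.1.1 x.1.2

/-- Only the interface needs checking, since on inner vertices `lift` is given by `b`. -/
theorem WF.lift_embed {W : Type*} (hD : D.WF) {a : D.V → W} {b : ∀ e, (D.lab e).V → W} {e : D.E}
    (h1 : (D.lab e).ins.map (b e) = (D.src e).map a)
    (h2 : (D.lab e).outs.map (b e) = (D.tgt e).map a) (v : (D.lab e).V) :
    D.lift a b (D.embed e v) = b e v := by
  by_cases h3 : v ∈ (D.lab e).ins
  · obtain ⟨k, hk, rfl⟩ := List.getElem_of_mem h3
    rw [hD.embed_ins_get]
    have := congrArg (fun l => l[k]?) h1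
    simp only [List.getElem?_map, List.getElem?_eq_getElem hk,
      List.getElem?_eq_getElem (hD.length_ins e ▸ hk), Option.map_some, Option.some.injEq] at this
    exact this.symm
  by_cases h4 : v ∈ (D.lab e).outs
  · obtain ⟨k, hk, rfl⟩ := List.getElem_of_mem h4
    rw [hD.embed_outs_get]
    have := congrArg (fun l => l[k]?) h2
    simp only [List.getElem?_map, List.getElem?_eq_getElem hk,
      List.getElem?_eq_getElem (hD.length_outs e ▸ hk), Option.map_some, Option.some.injEq] at this
    exact this.symm
  · obtain ⟨h5, h6⟩ := embed_inner h3 h4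
    rw [h6]
    rfl

/-- The universal property of flattening together with `Net.Iso.of_hom`: a compatible family of maps
out of the pieces is an isomorphism as soon as it is bijective on edges, so nothing has to be shown
about injectivity on vertices. -/
theorem WF.flatten_iso (hD : D.WF) {X : Net} (hX : X.IsInterfaced) (a : D.V → X.V)
    (b : ∀ e, (D.lab e).V → X.V) (c : (Σ e, (D.lab e).E) → X.E) (hc : Function.Bijective c)
    (vlab_a : ∀ u, X.vlab (a u) = D.vlab u)
    (vlab_b : ∀ e v, X.vlab (b e v) = (D.lab e).vlab v)
    (ins : X.ins = D.ins.map a) (outs : X.outs = D.outs.map a)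
    (ins_b : ∀ e, (D.lab e).ins.map (b e) = (D.src e).map a)
    (outs_b : ∀ e, (D.lab e).outs.map (b e) = (D.tgt e).map a)
    (src : ∀ e x, X.src (c ⟨e, x⟩) = ((D.lab e).src x).map (b e))
    (tgt : ∀ e x, X.tgt (c ⟨e, x⟩) = ((D.lab e).tgt x).map (b e))
    (lab : ∀ e x, Label.Iso ((D.lab e).lab x) (X.lab (c ⟨e, x⟩))) : D.flatten.Iso X := by
  have hl := fun e v => hD.lift_embed (ins_b e) (outs_b e) v
  refine .of_hom hD.flatten_interfaced hX (D.lift a b) c hc ?_ ?_ ?_ ?_ ?_ ?_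
  · rintro (u | ⟨⟨e, v⟩, hv⟩)
    · exact vlab_a u
    · exact vlab_b e v
  · rw [ins]; symm; exact map_vlab_of_comp (fun _ => rfl) _
  · rw [outs]; symm; exact map_vlab_of_comp (fun _ => rfl) _
  · rintro ⟨e, x⟩
    rw [src]; symm; exact map_vlab_of_comp (hl e) _
  · rintro ⟨e, x⟩
    rw [tgt]; symm; exact map_vlab_of_comp (hl e) _
  · rintro ⟨e, x⟩
    exact lab e x

theorem WF.flatten_congr {D D' : Graph Net} (hD : D.WF) (hD' : D'.WF) (f : D.V → D'.V)
    (g : D.E → D'.E) (hg : Function.Bijective g)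
    (vlab : ∀ v, D'.vlab (f v) = D.vlab v)
    (ins : D'.ins = D.ins.map f) (outs : D'.outs = D.outs.map f)
    (src : ∀ e, D'.src (g e) = (D.src e).map f) (tgt : ∀ e, D'.tgt (g e) = (D.tgt e).map f)
    (lab : ∀ e, (D.lab e).Iso (D'.lab (g e))) : D.flatten.Iso D'.flatten := by
  choose F G h1 h2 h3 h4 h5 h6 using lab
  refine hD.flatten_iso hD'.flatten_interfaced (fun u => D'.vtx (f u))
    (fun e v => D'.embed (g e) (F e v)) (fun x => ⟨g x.1, G x.1 x.2⟩) ?_ vlab ?_ ?_ ?_ ?_ ?_ ?_ ?_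
    (fun e x => h6 e x)
  · have h7 := Function.Injective.sigma_map (β₂ := fun e => (D'.lab e).E) (f₁ := g)
      (f₂ := fun e => G e) hg.1 fun e => (G e).injective
    have h8 := Function.Surjective.sigma_map (β₂ := fun e => (D'.lab e).E) (f₁ := g)
      (f₂ := fun e => G e) hg.2 fun e => (G e).surjective
    exact ⟨h7, h8⟩
  · intro e v
    rw [hD'.vlab_embed, h1]
  · change D'.ins.map D'.vtx = _
    rw [ins, List.map_map]; rfl
  · change D'.outs.map D'.vtx = _
    rw [outs, List.map_map]; rfl
  · intro e
    have := hD'.map_embed_ins (g e)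
    rw [h2, src, List.map_map, List.map_map] at this
    exact this
  · intro e
    have := hD'.map_embed_outs (g e)
    rw [h3, tgt, List.map_map, List.map_map] at this
    exact this
  · intro e x
    change List.map _ _ = _
    rw [h4, List.map_map]; rfl
  · intro e x
    change List.map _ _ = _
    rw [h5, List.map_map]; rfl

theorem flatten_interfaced_single_aux {d c : List VLabel} :
    ∀ v : Fin d.length ⊕ Fin c.length,
      v ∈ (List.finRange d.length).map Sum.inl ∨ v ∈ (List.finRange c.length).map Sum.inr := by
  rintro (v | v)
  · exact .inl (List.mem_map_of_mem (List.mem_finRange v))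
  · exact .inr (List.mem_map_of_mem (List.mem_finRange v))

end Graph

/-! ### One-edge hypernets -/

theorem Net.single_isHypernet {l : Label} {d c : List VLabel} (h : l.HasType d c) :
    (Net.single l d c).IsHypernet d c := by
  have hd : ((List.finRange d.length).map Sum.inl).map (Sum.elim d.get c.get) = d := by
    rw [map_vlab_of_comp (fun _ => rfl)]; exact List.map_get_finRange d
  have hc : ((List.finRange c.length).map Sum.inr).map (Sum.elim d.get c.get) = c := by
    rw [map_vlab_of_comp (fun _ => rfl)]; exact List.map_get_finRange c
  have nd : ∀ n m, ((List.finRange n).map (Sum.inl : _ → Fin n ⊕ Fin m)).Nodup :=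
    fun n m => (List.nodup_finRange _).map Sum.inl_injective
  have nc : ∀ n m, ((List.finRange n).map (Sum.inr : _ → Fin m ⊕ Fin n)).Nodup :=
    fun n m => (List.nodup_finRange _).map Sum.inr_injective
  have hx : ∀ v : Fin d.length ⊕ Fin c.length, v ∈ (List.finRange d.length).map Sum.inl ↔
      v ∉ (List.finRange c.length).map Sum.inr := by
    rintro (v | v) <;> simp
  refine ⟨⟨?_, ?_, fun _ => nd _ _, fun _ => nc _ _, fun _ _ _ _ _ => rfl, fun _ _ _ _ _ => rfl,
    nd _ _, nc _ _, fun v => ⟨fun h _ => (hx v).1 h, fun h => (hx v).2 (h ())⟩,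
    fun v => ⟨fun h _ h' => (hx v).1 h' h, fun h => ?_⟩, fun v => (hx v).1⟩, fun _ => ?_, hd, hc⟩
  · exact inferInstanceAs (Finite (Fin d.length ⊕ Fin c.length))
  · exact inferInstanceAs (Finite Unit)
  · by_contra h'
    exact h () ((hx v).2 h')
  · have h' : ∀ d' c', d' = d → c' = c → l.HasType d' c' := by rintro _ _ rfl rfl; exact h
    exact h' _ _ hd hc

theorem Net.base_isHypernet (b : BLabel) : (Net.base b).IsHypernet b.dom b.cod :=
  Net.single_isHypernet ⟨rfl, rfl⟩

/-- `N` consists of a single edge, with label `l`, and its endpoints. -/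
structure Net.IsSingle (N : Net) (l : Label) : Prop where
  edge : ∃ x : N.E, ∀ y, y = x
  src : ∀ y, N.src y = N.ins
  tgt : ∀ y, N.tgt y = N.outs
  lab : ∀ y, N.lab y = l
  vertex : ∀ v, v ∈ N.ins ∨ v ∈ N.outs

theorem Net.single_isSingle (l : Label) (d c : List VLabel) : (Net.single l d c).IsSingle l :=
  ⟨⟨(), fun _ => rfl⟩, fun _ => rfl, fun _ => rfl, fun _ => rfl,
    Graph.flatten_interfaced_single_aux⟩

theorem Net.single_iso {l l' : Label} (h : l.Iso l') (d c : List VLabel) :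
    (Net.single l d c).Iso (Net.single l' d c) :=
  ⟨Equiv.refl _, Equiv.refl _, fun _ => rfl, (List.map_id _).symm, (List.map_id _).symm,
    fun _ => (List.map_id _).symm, fun _ => (List.map_id _).symm, fun _ => h⟩

/-- The hypergraph `N` with edge labels replaced. -/
def Net.relabel (N : Net) (l : N.E → Label) : Net :=
  ⟨N.V, N.E, N.vlab, N.ins, N.outs, N.src, N.tgt, l⟩

theorem Net.relabel_isHypernet {N : Net} {d c : List VLabel} (hN : N.IsHypernet d c)
    {l : N.E → Label}
    (hl : ∀ e, (l e).HasType ((N.src e).map N.vlab) ((N.tgt e).map N.vlab)) :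
    (N.relabel l).IsHypernet d c := by
  obtain ⟨⟨h1, h2, h3, h4, h5, h6, h7, h8, h9, h10, h11⟩, ht, hi, ho⟩ := hN
  exact ⟨⟨h1, h2, h3, h4, h5, h6, h7, h8, h9, h10, h11⟩, hl, hi, ho⟩

/-- Flattening a hypergraph whose labels are single edges. -/
theorem Graph.WF.flatten_of_single {D : Graph Net} (hD : D.WF) {X : Net} (l : D.E → Label)
    (h : ∀ e, (D.lab e).IsSingle (l e)) (hX : X = ⟨D.V, D.E, D.vlab, D.ins, D.outs, D.src, D.tgt, l⟩) :
    X.Iso D.flatten := by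
  subst hX
  choose x hx using fun e => (h e).edge
  obtain ⟨h1, h2, h3, h4, h5, h6, h7, h8, h9, h10, h11⟩ := hD.interfaced
  refine .of_hom ⟨h1, h2, h3, h4, h5, h6, h7, h8, h9, h10, h11⟩ hD.flatten_interfaced D.vtx
    (fun e => ⟨e, x e⟩) ⟨fun e e' he => congrArg Sigma.fst he, ?_⟩ (fun _ => rfl) rfl rfl ?_ ?_ ?_
  · rintro ⟨e, y⟩
    exact ⟨e, by rw [hx e y]⟩
  · intro e
    change List.map _ _ = _
    rw [(h e).src, hD.map_embed_ins]
    rfl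
  · intro e
    change List.map _ _ = _
    rw [(h e).tgt, hD.map_embed_outs]
    rfl
  · intro e
    change Label.Iso (l e) ((D.lab e).lab (x e))
    rw [(h e).lab]
    exact .refl _

/-! ## Plugging -/

/-- All values of a substitution have the type of the hole. -/
def WellTyped (σ : Hole → Net) : Prop := ∀ ψ, (σ ψ).IsHypernet ψ.dom ψ.cod

theorem wellTyped_base : WellTyped fun ψ => Net.base (.hole ψ) := fun _ => Net.base_isHypernet _

/-- The hypergraph whose flattening is `C.plug σ`. -/
noncomputable def Net.plugGraph (C : Net) (σ : Hole → Net) : Graph Net :=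
  ⟨C.V, C.E, C.vlab, C.ins, C.outs, C.src, C.tgt, fun e =>
    plugEdge σ (C.lab e) ((C.lab e).plug σ) ((C.src e).map C.vlab) ((C.tgt e).map C.vlab)⟩

theorem Net.flatten_plugGraph (C : Net) (σ : Hole → Net) : (C.plugGraph σ).flatten = C.plug σ := rfl

theorem plugEdge_of_ne {l : Label} (h : ∀ χ, l ≠ .base (.hole χ)) (σ : Hole → Net) (l' : Label)
    (d c : List VLabel) : plugEdge σ l l' d c = Net.single l' d c := by
  unfold plugEdge
  split
  · exact absurd rfl (h _)
  · rfl

theorem plugEdge_isHypernet {σ : Hole → Net} (hσ : WellTyped σ) {l l' : Label} {d c : List VLabel}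
    (h : l.HasType d c) (h' : l'.HasType d c) : (plugEdge σ l l' d c).IsHypernet d c := by
  by_cases hl : ∃ χ, l = .base (.hole χ)
  · obtain ⟨χ, rfl⟩ := hl
    obtain ⟨rfl, rfl⟩ := h
    exact hσ χ
  · rw [plugEdge_of_ne (not_exists.1 hl)]
    exact Net.single_isHypernet h'

/-- The typing of the plugged labels is an assumption here so that the induction over nesting in
`Label.HasType.plug` can supply it from its induction hypothesis. -/
theorem Net.plugGraph_wf_aux {σ : Hole → Net} (hσ : WellTyped σ) {C : Net} {d c : List VLabel}
    (hC : C.IsHypernet d c)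
    (h : ∀ e, ((C.lab e).plug σ).HasType ((C.src e).map C.vlab) ((C.tgt e).map C.vlab)) :
    (C.plugGraph σ).WF := by
  obtain ⟨⟨h1, h2, h3, h4, h5, h6, h7, h8, h9, h10, h11⟩, ht, hi, ho⟩ := hC
  exact ⟨⟨h1, h2, h3, h4, h5, h6, h7, h8, h9, h10, h11⟩, fun e =>
    plugEdge_isHypernet hσ (ht e) (h e)⟩

theorem Label.HasType.plug {σ : Hole → Net} (hσ : WellTyped σ) {l : Label} {d c : List VLabel}
    (h : l.HasType d c) : (l.plug σ).HasType d c := by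
  induction l using Label.induction generalizing d c with
  | base b => exact h
  | box n G ih =>
    rw [Label.hasType_box] at h
    rw [Label.plug_box, Label.hasType_box]
    obtain ⟨k, h, hd, hc, hG⟩ := h
    refine ⟨k, h, hd, hc, ?_⟩
    have := (Net.plugGraph_wf_aux hσ hG fun e => ih e (hG.typed e)).flatten_isHypernet
    have h1 := hG.ins_type
    have h2 := hG.outs_type
    rw [← h1, ← h2]
    exact this

theorem Net.IsHypernet.plugGraph_wf {σ : Hole → Net} (hσ : WellTyped σ) {C : Net}
    {d c : List VLabel} (hC : C.IsHypernet d c) : (C.plugGraph σ).WF :=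
  Net.plugGraph_wf_aux hσ hC fun e => (hC.typed e).plug hσ

theorem Net.IsHypernet.plug {σ : Hole → Net} (hσ : WellTyped σ) {C : Net} {d c : List VLabel}
    (hC : C.IsHypernet d c) : (C.plug σ).IsHypernet d c := by
  have := (hC.plugGraph_wf hσ).flatten_isHypernet
  have h1 := hC.ins_type
  have h2 := hC.outs_type
  rw [← h1, ← h2]
  exact this

/-- The types recorded in plugging may be replaced with equal ones. -/
theorem Net.plug_eq (C : Net) (σ : Hole → Net) {d c : C.E → List VLabel}
    (hd : ∀ e, (C.src e).map C.vlab = d e) (hc : ∀ e, (C.tgt e).map C.vlab = c e) :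
    C.plug σ = Graph.flatten ⟨C.V, C.E, C.vlab, C.ins, C.outs, C.src, C.tgt, fun e =>
      plugEdge σ (C.lab e) ((C.lab e).plug σ) (d e) (c e)⟩ := by
  obtain rfl := funext hd
  obtain rfl := funext hc
  rfl

theorem Net.plugGraph_isSingle {C : Net} {σ : Hole → Net} {e : C.E}
    (h : ∀ χ, C.lab e ≠ .base (.hole χ)) :
    ((C.plugGraph σ).lab e).IsSingle ((C.lab e).plug σ) := by
  change (plugEdge _ _ _ _ _).IsSingle _
  rw [plugEdge_of_ne h]
  exact Net.single_isSingle _ _ _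

/-- The induction has to be about `plugEdge` rather than `Label.plug`: the latter leaves a hole
label alone, and the value of the substitution shows only where the edge is replaced. -/
theorem plugEdge_congr {σ τ : Hole → Net} (l : Label)
    (h : ∀ ψ, Nonempty (l.Occ (.hole ψ)) → σ ψ = τ ψ) (d c : List VLabel) :
    plugEdge σ l (l.plug σ) d c = plugEdge τ l (l.plug τ) d c := by
  induction l using Label.induction generalizing d c with
  | base b =>
    cases b with
    | hole χ => exact h χ ⟨⟨rfl⟩⟩
    | _ => rfl
  | box n G ih =>
    change Net.single (Label.plug σ (.box n G)) d c = Net.single (Label.plug τ (.box n G)) d c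
    rw [Label.plug_box, Label.plug_box]
    have : G.plugGraph σ = G.plugGraph τ := by
      unfold Net.plugGraph
      congr 1
      funext e
      exact ih e (fun ψ hψ => h ψ (hψ.map fun o => ⟨e, o⟩)) _ _
    rw [← Net.flatten_plugGraph, this, Net.flatten_plugGraph]

theorem Net.plugGraph_congr {C : Net} {σ τ : Hole → Net} (h : ∀ ψ, C.HasHole ψ → σ ψ = τ ψ) :
    C.plugGraph σ = C.plugGraph τ := by
  unfold Net.plugGraph
  congr 1
  funext e
  exact plugEdge_congr _ (fun ψ hψ => h ψ (hψ.map fun o => ⟨e, o⟩)) _ _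

theorem Net.plug_congr {C : Net} {σ τ : Hole → Net} (h : ∀ ψ, C.HasHole ψ → σ ψ = τ ψ) :
    C.plug σ = C.plug τ := congrArg Graph.flatten (Net.plugGraph_congr h)

theorem plugEdge_iso {σ : Hole → Net} {l l' : Label} (h : l.Iso l')
    (h' : (l.plug σ).Iso (l'.plug σ)) (d c : List VLabel) :
    (plugEdge σ l (l.plug σ) d c).Iso (plugEdge σ l' (l'.plug σ) d c) := by
  cases h with
  | base b => exact .refl _
  | box n G G' f g h1 h2 h3 h4 h5 h6 => exact Net.single_iso h' d c

/-- As with typing, the isomorphisms of the plugged labels are assumed, to be provided by induction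
over nesting. -/
theorem Net.plugGraph_iso_aux {σ : Hole → Net} (hσ : WellTyped σ) {C C' : Net} {d c : List VLabel}
    (hC : C.IsHypernet d c) (f : C.V ≃ C'.V) (g : C.E ≃ C'.E)
    (vlab : ∀ v, C'.vlab (f v) = C.vlab v)
    (ins : C'.ins = C.ins.map f) (outs : C'.outs = C.outs.map f)
    (src : ∀ e, C'.src (g e) = (C.src e).map f) (tgt : ∀ e, C'.tgt (g e) = (C.tgt e).map f)
    (lab : ∀ e, Label.Iso (C.lab e) (C'.lab (g e)))
    (lab' : ∀ e, Label.Iso ((C.lab e).plug σ) ((C'.lab (g e)).plug σ)) :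
    (C.plug σ).Iso (C'.plug σ) := by
  have hC' : C'.IsHypernet d c := hC.iso ⟨f, g, vlab, ins, outs, src, tgt, lab⟩
  refine (hC.plugGraph_wf hσ).flatten_congr (hC'.plugGraph_wf hσ) f g g.bijective vlab ins outs src
    tgt fun (e : C.E) => ?_
  change (plugEdge _ _ _ _ _).Iso (plugEdge _ _ _ _ _)
  rw [src, tgt, map_vlab_of_comp vlab, map_vlab_of_comp vlab]
  exact plugEdge_iso (lab e) (lab' e) _ _

theorem Label.Iso.plug {σ : Hole → Net} (hσ : WellTyped σ) {l l' : Label} (h : l.Iso l')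
    {d c : List VLabel} (ht : l.HasType d c) : (l.plug σ).Iso (l'.plug σ) := by
  induction h generalizing d c with
  | base b => exact .base b
  | box n G G' f g h1 h2 h3 h4 h5 h6 ih =>
    rw [Label.hasType_box] at ht
    obtain ⟨k, h, hd, hc, hG⟩ := ht
    rw [Label.plug_box, Label.plug_box]
    exact .of_net n (Net.plugGraph_iso_aux hσ hG f g h1 h2 h3 h4 h5 h6 fun e => ih e (hG.typed e))

theorem Net.Iso.plug {σ : Hole → Net} (hσ : WellTyped σ) {C C' : Net} (h : C.Iso C')
    {d c : List VLabel} (hC : C.IsHypernet d c) : (C.plug σ).Iso (C'.plug σ) := by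
  obtain ⟨f, g, h1, h2, h3, h4, h5, h6⟩ := h
  exact Net.plugGraph_iso_aux hσ hC f g h1 h2 h3 h4 h5 h6 fun e => (h6 e).plug hσ (hC.typed e)

/-! ### Plugging commutes with flattening -/

/-- Replacing the labels of `D` with hypernets of the same types. -/
def Graph.relabel (D : Graph Net) (l : D.E → Net) : Graph Net :=
  ⟨D.V, D.E, D.vlab, D.ins, D.outs, D.src, D.tgt, l⟩

theorem Graph.WF.relabel {D : Graph Net} (hD : D.WF) {l : D.E → Net}
    (h : ∀ e, (l e).IsHypernet ((D.src e).map D.vlab) ((D.tgt e).map D.vlab)) :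
    (D.relabel l).WF := by
  obtain ⟨h1, h2, h3, h4, h5, h6, h7, h8, h9, h10, h11⟩ := hD.interfaced
  exact ⟨⟨h1, h2, h3, h4, h5, h6, h7, h8, h9, h10, h11⟩, h⟩

theorem Graph.WF.relabel_iso {D : Graph Net} (hD : D.WF) {l : D.E → Net}
    (h : ∀ e, (D.lab e).Iso (l e)) : D.flatten.Iso (D.relabel l).flatten :=
  hD.flatten_congr (hD.relabel fun e => (hD.typed e).iso (h e)) id id Function.bijective_id
    (fun _ => rfl) (List.map_id _).symm (List.map_id _).symm (fun _ => (List.map_id _).symm)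
    (fun _ => (List.map_id _).symm) h

theorem map_map_congr {α β β' γ : Type*} {f : α → β} {g : β → γ} {f' : α → β'} {g' : β' → γ}
    (h : ∀ v, g (f v) = g' (f' v)) (l : List α) : (l.map f).map g = (l.map f').map g' := by
  rw [List.map_map, List.map_map]; exact List.map_congr_left fun v _ => h v

/-- Plugging in a flattening. -/
theorem Graph.WF.plug_flatten {D : Graph Net} (hD : D.WF) {σ : Hole → Net} (hσ : WellTyped σ) :
    (D.relabel fun e => (D.lab e).plug σ).flatten.Iso (D.flatten.plug σ) := by
  have hD' : (D.relabel fun e => (D.lab e).plug σ).WF :=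
    hD.relabel fun e => (hD.typed e).plug hσ
  have hq := D.flatten.plug_eq σ (d := fun x => ((D.lab x.1).src x.2).map (D.lab x.1).vlab)
    (c := fun x => ((D.lab x.1).tgt x.2).map (D.lab x.1).vlab)
    (fun x => map_vlab_of_comp (hD.vlab_embed x.1) _)
    (fun x => map_vlab_of_comp (hD.vlab_embed x.1) _)
  -- `Q` flattens to the plugged flattening, but records the type of each edge as read in its own
  -- label; its components thus agree with those of the separately plugged labels.
  set Q : Graph Net := ⟨D.flatten.V, D.flatten.E, D.flatten.vlab, D.flatten.ins, D.flatten.outs,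
    D.flatten.src, D.flatten.tgt, fun x =>
      plugEdge σ ((D.lab x.1).lab x.2) (((D.lab x.1).lab x.2).plug σ)
        (((D.lab x.1).src x.2).map (D.lab x.1).vlab)
        (((D.lab x.1).tgt x.2).map (D.lab x.1).vlab)⟩ with hQ
  have hQwf : Q.WF := by
    have hf := hD.flatten_isHypernet
    obtain ⟨h1, h2, h3, h4, h5, h6, h7, h8, h9, h10, h11⟩ := hf.interfaced
    refine ⟨⟨h1, h2, h3, h4, h5, h6, h7, h8, h9, h10, h11⟩, ?_⟩
    rintro ⟨e, x⟩
    have := plugEdge_isHypernet hσ ((hD.typed e).typed x) (((hD.typed e).typed x).plug hσ)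
    change (plugEdge _ _ _ _ _).IsHypernet (List.map _ (List.map _ _)) (List.map _ (List.map _ _))
    convert this using 1
    · exact map_vlab_of_comp (hD.vlab_embed e) _
    · exact map_vlab_of_comp (hD.vlab_embed e) _
  rw [show D.flatten.plug σ = Q.flatten from hq]
  have hP := fun e => (hD.typed e).plugGraph_wf hσ
  -- A vertex of a plugged label is either an old vertex of that label, sent through both
  -- embeddings, or an inner vertex of something that replaces one of its edges.
  let B : ∀ e, ((D.lab e).plug σ).V → Q.FlatV := fun e =>
    ((D.lab e).plugGraph σ).lift (fun v => Q.vtx (D.embed e v)) (fun x w => Q.embed ⟨e, x⟩ w)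
  have B_embed : ∀ e x w, B e (((D.lab e).plugGraph σ).embed x w) = Q.embed ⟨e, x⟩ w := by
    intro e x w
    refine (hP e).lift_embed ?_ ?_ w
    · refine (hQwf.map_embed_ins ⟨e, x⟩).trans ?_
      exact map_vlab_of_comp (fun _ => rfl) _
    · refine (hQwf.map_embed_outs ⟨e, x⟩).trans ?_
      exact map_vlab_of_comp (fun _ => rfl) _
  refine hD'.flatten_iso hQwf.flatten_interfaced (fun u => Q.vtx (D.vtx u)) B
    -- On edges the isomorphism is the reassociation of nested pairs.
    (fun y => ⟨⟨y.1, y.2.1⟩, y.2.2⟩) ⟨?_, ?_⟩ (fun _ => rfl) ?_ ?_ ?_ ?_ ?_ ?_ ?_ ?_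
  · rintro ⟨e, ⟨x, y⟩⟩ ⟨e', ⟨x', y'⟩⟩ h
    cases h
    rfl
  · rintro ⟨⟨e, x⟩, y⟩
    exact ⟨⟨e, ⟨x, y⟩⟩, rfl⟩
  · intro e w
    rcases w with v | ⟨⟨x, v⟩, hv⟩
    · exact hD.vlab_embed e v
    · exact hQwf.vlab_embed ⟨e, x⟩ v
  · exact List.map_map (f := D.vtx) (g := Q.vtx) (l := D.ins)
  · exact List.map_map (f := D.vtx) (g := Q.vtx) (l := D.outs)
  · intro (e : D.E)
    have h1 : (((D.lab e).ins.map ((D.lab e).plugGraph σ).vtx).map (B e)) =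
        ((D.lab e).ins.map (D.embed e)).map Q.vtx :=
      map_map_congr (f := ((D.lab e).plugGraph σ).vtx) (g := B e) (f' := D.embed e) (g' := Q.vtx)
        (fun _ => rfl) (D.lab e).ins
    rw [hD.map_embed_ins] at h1
    exact h1.trans List.map_map
  · intro (e : D.E)
    have h1 : (((D.lab e).outs.map ((D.lab e).plugGraph σ).vtx).map (B e)) =
        ((D.lab e).outs.map (D.embed e)).map Q.vtx :=
      map_map_congr (f := ((D.lab e).plugGraph σ).vtx) (g := B e) (f' := D.embed e) (g' := Q.vtx)
        (fun _ => rfl) (D.lab e).outs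
    rw [hD.map_embed_outs] at h1
    exact h1.trans List.map_map
  · rintro e ⟨x, y⟩
    symm; exact map_vlab_of_comp (B_embed e x) _
  · rintro e ⟨x, y⟩
    symm; exact map_vlab_of_comp (B_embed e x) _
  · rintro e ⟨x, y⟩
    exact .refl _

/-- Plugging in a hypernet without shallow holes. -/
theorem Net.AllHolesDeep.plug_iso {C : Net} (h : C.AllHolesDeep) {d c : List VLabel}
    (hC : C.IsHypernet d c) {σ : Hole → Net} (hσ : WellTyped σ) :
    (C.relabel fun e => (C.lab e).plug σ).Iso (C.plug σ) :=
  (hC.plugGraph_wf hσ).flatten_of_single (fun e => (C.lab e).plug σ)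
    (fun e => Net.plugGraph_isSingle (h e)) rfl

theorem Net.plug_base_iso_aux {C : Net} {d c : List VLabel} (hC : C.IsHypernet d c)
    (h : ∀ e, ((C.lab e).plug fun ψ => Net.base (.hole ψ)).Iso (C.lab e)) :
    (C.plug fun ψ => Net.base (.hole ψ)).Iso C := by
  have h1 : (C.relabel fun e => (C.lab e).plug fun ψ => Net.base (.hole ψ)).Iso
      (C.plug fun ψ => Net.base (.hole ψ)) := by
    refine (hC.plugGraph_wf wellTyped_base).flatten_of_single _ (fun e => ?_) rfl
    by_cases h : ∃ χ, C.lab e = .base (.hole χ)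
    · obtain ⟨χ, h⟩ := h
      change (plugEdge _ _ _ _ _).IsSingle _
      rw [h]
      exact Net.single_isSingle _ _ _
    · exact Net.plugGraph_isSingle (not_exists.1 h)
  refine h1.symm.trans ⟨Equiv.refl _, Equiv.refl _, fun _ => rfl, (List.map_id _).symm,
    (List.map_id _).symm, fun _ => (List.map_id _).symm, fun _ => (List.map_id _).symm, h⟩

theorem Label.plug_base_iso {l : Label} {d c : List VLabel} (h : l.HasType d c) :
    (l.plug fun ψ => Net.base (.hole ψ)).Iso l := by
  induction l using Label.induction generalizing d c with
  | base b => exact .base b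
  | box n G ih =>
    rw [Label.hasType_box] at h
    obtain ⟨k, h, hd, hc, hG⟩ := h
    rw [Label.plug_box]
    exact .of_net n (Net.plug_base_iso_aux hG fun e => ih e (hG.typed e))

/-- Plugging each hole with itself. -/
theorem Net.IsHypernet.plug_base_iso {C : Net} {d c : List VLabel} (hC : C.IsHypernet d c) :
    (C.plug fun ψ => Net.base (.hole ψ)).Iso C :=
  Net.plug_base_iso_aux hC fun e => Label.plug_base_iso (hC.typed e)

/-! ## Renaming holes -/

/-- Renaming of a hole label. -/
def Hole.rename (ρ : ℕ → ℕ) (χ : Hole) : Hole := ⟨ρ χ.name, χ.dom, χ.cod⟩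

/-- Renaming of the hole labels in a basic label. -/
def BLabel.rename (ρ : ℕ → ℕ) : BLabel → BLabel
  | .hole χ => .hole (χ.rename ρ)
  | b => b

/-- Renaming of the hole labels in a label, at any depth. -/
def Label.rename (ρ : ℕ → ℕ) : Label → Label
  | .base b => .base (b.rename ρ)
  | .box n ⟨V, E, vlab, ins, outs, src, tgt, lab⟩ =>
      .box n ⟨V, E, vlab, ins, outs, src, tgt, fun e => (lab e).rename ρ⟩

/-- Renaming of the hole labels in a hypernet, at any depth. -/
def Net.rename (ρ : ℕ → ℕ) (N : Net) : Net := N.relabel fun e => (N.lab e).rename ρ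

theorem Label.rename_box (ρ : ℕ → ℕ) (n : ℕ) (G : Net) :
    (Label.box n G).rename ρ = .box n (Net.rename ρ G) := rfl

theorem BLabel.rename_dom (ρ : ℕ → ℕ) (b : BLabel) : (b.rename ρ).dom = b.dom := by cases b <;> rfl

theorem BLabel.rename_cod (ρ : ℕ → ℕ) (b : BLabel) : (b.rename ρ).cod = b.cod := by cases b <;> rfl

theorem Label.HasType.rename {l : Label} {d c : List VLabel} (h : l.HasType d c) (ρ : ℕ → ℕ) :
    (l.rename ρ).HasType d c := by
  induction l using Label.induction generalizing d c with
  | base b =>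
    obtain ⟨rfl, rfl⟩ := h
    exact ⟨(b.rename_dom ρ).symm, (b.rename_cod ρ).symm⟩
  | box n G ih =>
    rw [Label.hasType_box] at h
    rw [Label.rename_box, Label.hasType_box]
    obtain ⟨k, h, hd, hc, hG⟩ := h
    exact ⟨k, h, hd, hc, Net.relabel_isHypernet hG fun e => ih e (hG.typed e)⟩

theorem Net.IsHypernet.rename {N : Net} {d c : List VLabel} (h : N.IsHypernet d c) (ρ : ℕ → ℕ) :
    (N.rename ρ).IsHypernet d c :=
  Net.relabel_isHypernet h fun e => (h.typed e).rename ρ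

/-- Renaming changes nothing but labels, so the two sides are equal and not just isomorphic. -/
theorem plugEdge_rename (σ : Hole → Net) (ρ : ℕ → ℕ) (l : Label) (d c : List VLabel) :
    plugEdge σ (l.rename ρ) ((l.rename ρ).plug σ) d c =
      plugEdge (fun ψ => σ (ψ.rename ρ)) l (l.plug fun ψ => σ (ψ.rename ρ)) d c := by
  induction l using Label.induction generalizing d c with
  | base b => cases b <;> rfl
  | box n G ih =>
    change Net.single (.box n ((Net.rename ρ G).plug σ)) d c = Net.single (.box n (G.plug _)) d c
    have : (Net.rename ρ G).plugGraph σ = G.plugGraph fun ψ => σ (ψ.rename ρ) := by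
      unfold Net.plugGraph
      congr 1
      funext e
      exact ih e _ _
    rw [← Net.flatten_plugGraph, this, Net.flatten_plugGraph]

theorem Net.plug_rename (σ : Hole → Net) (ρ : ℕ → ℕ) (N : Net) :
    (N.rename ρ).plug σ = N.plug fun ψ => σ (ψ.rename ρ) := by
  have : (N.rename ρ).plugGraph σ = N.plugGraph fun ψ => σ (ψ.rename ρ) := by
    unfold Net.plugGraph
    congr 1
    funext e
    exact plugEdge_rename σ ρ _ _ _
  exact congrArg Graph.flatten this

theorem BLabel.rename_injective {ρ : ℕ → ℕ} (hρ : Function.Injective ρ) :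
    Function.Injective (BLabel.rename ρ) := by
  intro b b' h
  cases b <;> cases b' <;> simp_all [BLabel.rename, Hole.rename]
  rename_i χ χ'
  obtain ⟨n, d, c⟩ := χ
  obtain ⟨n', d', c'⟩ := χ'
  simp_all [hρ.eq_iff]

theorem Label.occ_rename_equiv {ρ : ℕ → ℕ} (hρ : Function.Injective ρ) (b : BLabel) (l : Label) :
    Nonempty ((l.rename ρ).Occ (b.rename ρ) ≃ l.Occ b) := by
  induction l using Label.induction with
  | base b' =>
    exact ⟨⟨fun h => ⟨BLabel.rename_injective hρ h.down⟩, fun h => ⟨congrArg _ h.down⟩,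
      fun _ => rfl, fun _ => rfl⟩⟩
  | box n G ih => exact ⟨Equiv.sigmaCongrRight fun e => (ih e).some⟩

theorem Net.occ_rename_equiv {ρ : ℕ → ℕ} (hρ : Function.Injective ρ) (b : BLabel) (N : Net) :
    Nonempty ((N.rename ρ).Occ (b.rename ρ) ≃ N.Occ b) :=
  Label.occ_rename_equiv hρ b (.box 0 N)

theorem Label.occ_rename_hole {ρ : ℕ → ℕ} {l : Label} {χ : Hole}
    (h : Nonempty ((l.rename ρ).Occ (.hole χ))) :
    ∃ ψ, χ = ψ.rename ρ ∧ Nonempty (l.Occ (.hole ψ)) := by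
  induction l using Label.induction with
  | base b =>
    obtain ⟨⟨h⟩⟩ := h
    cases b <;> simp [BLabel.rename] at h
    exact ⟨_, h.symm, ⟨⟨rfl⟩⟩⟩
  | box n G ih =>
    obtain ⟨⟨e, o⟩⟩ := h
    obtain ⟨ψ, h1, ⟨o'⟩⟩ := ih e ⟨o⟩
    exact ⟨ψ, h1, ⟨⟨e, o'⟩⟩⟩

theorem Net.hasHole_rename {ρ : ℕ → ℕ} {N : Net} {χ : Hole} (h : (N.rename ρ).HasHole χ) :
    ∃ ψ, χ = ψ.rename ρ ∧ N.HasHole ψ :=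
  Label.occ_rename_hole (l := .box 0 N) h

theorem Net.FocusFree.rename {ρ : ℕ → ℕ} (hρ : Function.Injective ρ) {N : Net} (h : N.FocusFree) :
    (N.rename ρ).FocusFree := fun t =>
  have := h t
  (Net.occ_rename_equiv hρ (.token t) N).some.isEmpty

/-! ## Occurrences of holes -/

/-- Occurrences in a flattening. -/
def Graph.occFlatten (D : Graph Net) (b : BLabel) : D.flatten.Occ b ≃ Σ e, (D.lab e).Occ b :=
  Equiv.sigmaAssoc fun (e : D.E) (x : (D.lab e).E) => ((D.lab e).lab x).Occ b

/-- A hole occurrence after plugging is located by the occurrence of the hole that was filled and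
the place inside its filling. An injection is enough for the intended use, which is to bound the
number of occurrences by one. -/
theorem occ_plugEdge {τ : Hole → Net} {ψ₀ : Hole} (l : Label) (d c : List VLabel) :
    ∃ F : (plugEdge τ l (l.plug τ) d c).Occ (.hole ψ₀) →
      Σ ψ : Hole, l.Occ (.hole ψ) × (τ ψ).Occ (.hole ψ₀), Function.Injective F := by
  induction l using Label.induction generalizing d c with
  | base b =>
    by_cases h : ∃ χ, b = .hole χ
    · obtain ⟨χ, rfl⟩ := h
      refine ⟨fun o => ⟨χ, ⟨rfl⟩, o⟩, fun o o' h => ?_⟩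
      exact (Prod.mk.inj (eq_of_heq (Sigma.mk.inj h).2)).2
    · have : IsEmpty ((plugEdge τ (.base b) ((Label.base b).plug τ) d c).Occ (.hole ψ₀)) := by
        rw [plugEdge_of_ne (fun χ h' => h ⟨χ, by injection h'⟩)]
        exact ⟨fun o => h ⟨_, o.2.down⟩⟩
      exact ⟨fun o => this.elim o, fun o => this.elim o⟩
  | box n G ih =>
    choose F hF using fun e => ih e ((G.src e).map G.vlab) ((G.tgt e).map G.vlab)
    -- The first coordinate of the located occurrence in `G` is the shallow edge; it tells different
    -- edges apart, and the induction hypothesis handles a fixed edge.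
    let A : (Σ e, ((G.plugGraph τ).lab e).Occ (.hole ψ₀)) →
        Σ ψ : Hole, (Label.box n G).Occ (.hole ψ) × (τ ψ).Occ (.hole ψ₀) :=
      fun o => ⟨(F o.1 o.2).1, ⟨o.1, (F o.1 o.2).2.1⟩, (F o.1 o.2).2.2⟩
    have hA : Function.Injective A := by
      rintro ⟨e, o⟩ ⟨e', o'⟩ h
      obtain rfl : e = e' := congrArg (fun z => z.2.1.1) h
      refine congrArg _ (hF e ?_)
      change (⟨(F e o).1, ⟨e, (F e o).2.1⟩, (F e o).2.2⟩ :
        Σ ψ : Hole, (Σ e, (G.lab e).Occ (.hole ψ)) × (τ ψ).Occ (.hole ψ₀)) =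
        ⟨(F e o').1, ⟨e, (F e o').2.1⟩, (F e o').2.2⟩ at h
      revert h
      generalize F e o = z
      generalize F e o' = z'
      obtain ⟨ψ, p, q⟩ := z
      obtain ⟨ψ', p', q'⟩ := z'
      intro h
      simp only [Sigma.mk.injEq] at h
      obtain ⟨rfl, h⟩ := h
      simp only [heq_eq_eq, Prod.mk.injEq] at h
      obtain ⟨h, rfl⟩ := h
      obtain rfl := eq_of_heq (Sigma.mk.inj h).2
      rfl
    refine ⟨fun o => A ((G.plugGraph τ).occFlatten _ o.2), fun o o' h => ?_⟩
    have h1 := ((G.plugGraph τ).occFlatten _).injective (hA h)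
    obtain ⟨x, o⟩ := o
    obtain ⟨x', o'⟩ := o'
    cases x
    cases x'
    exact congrArg _ h1

theorem Net.occ_plug (C : Net) (τ : Hole → Net) (ψ₀ : Hole) :
    ∃ F : (C.plug τ).Occ (.hole ψ₀) → Σ ψ : Hole, C.Occ (.hole ψ) × (τ ψ).Occ (.hole ψ₀),
      Function.Injective F := by
  obtain ⟨F, hF⟩ := occ_plugEdge (τ := τ) (ψ₀ := ψ₀) (.box 0 C) [] []
  refine ⟨fun o => F ⟨(), o⟩, fun o o' h => ?_⟩
  exact eq_of_heq (Sigma.mk.inj (hF h)).2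

theorem occ_plugEdge_of_hole {τ : Hole → Net} {χ : Hole} {b : BLabel} {l : Label}
    (h : Nonempty (l.Occ (.hole χ))) (h' : Nonempty ((τ χ).Occ b)) (d c : List VLabel) :
    Nonempty ((plugEdge τ l (l.plug τ) d c).Occ b) := by
  induction l using Label.induction generalizing d c with
  | base b =>
    obtain ⟨⟨rfl⟩⟩ := h
    exact h'
  | box n G ih =>
    obtain ⟨⟨e, o⟩⟩ := h
    obtain ⟨o'⟩ := ih e ⟨o⟩ ((G.src e).map G.vlab) ((G.tgt e).map G.vlab)
    exact ⟨⟨(), ((G.plugGraph τ).occFlatten b).symm ⟨e, o'⟩⟩⟩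

theorem Net.occ_plug_of_hole {C : Net} {τ : Hole → Net} {χ : Hole} {b : BLabel}
    (h : C.HasHole χ) (h' : Nonempty ((τ χ).Occ b)) : Nonempty ((C.plug τ).Occ b) := by
  obtain ⟨⟨e, o⟩⟩ := h
  obtain ⟨o'⟩ := occ_plugEdge_of_hole ⟨o⟩ h' ((C.src e).map C.vlab) ((C.tgt e).map C.vlab)
  exact ⟨((C.plugGraph τ).occFlatten b).symm ⟨e, o'⟩⟩

/-- The names of the holes of a hypernet are bounded. -/
theorem Label.HasType.exists_name_lt {l : Label} {d c : List VLabel} (h : l.HasType d c) :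
    ∃ K, ∀ χ, Nonempty (l.Occ (.hole χ)) → χ.name < K := by
  induction l using Label.induction generalizing d c with
  | base b =>
    cases b with
    | hole χ =>
      refine ⟨χ.name + 1, ?_⟩
      rintro ψ ⟨⟨h⟩⟩
      cases h
      exact Nat.lt_succ_self _
    | _ => exact ⟨0, fun ψ ⟨⟨h⟩⟩ => nomatch h⟩
  | box n G ih =>
    rw [Label.hasType_box] at h
    obtain ⟨k, h, hd, hc, hG⟩ := h
    choose K hK using fun e => ih e (hG.typed e)
    have := hG.interfaced.finE
    obtain ⟨M, hM⟩ := (Set.finite_range K).bddAbove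
    refine ⟨M, ?_⟩
    rintro χ ⟨⟨e, o⟩⟩
    exact (hK e χ ⟨o⟩).trans_le (hM ⟨e, rfl⟩)

theorem Net.IsHypernet.exists_name_lt {N : Net} {d c : List VLabel} (h : N.IsHypernet d c) :
    ∃ K, ∀ χ, N.HasHole χ → χ.name < K := by
  choose K hK using fun e => (h.typed e).exists_name_lt
  have := h.interfaced.finE
  obtain ⟨M, hM⟩ := (Set.finite_range K).bddAbove
  refine ⟨M, ?_⟩
  rintro χ ⟨⟨e, o⟩⟩
  exact (hK e χ ⟨o⟩).trans_le (hM ⟨e, rfl⟩)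

/-! ## Decomposition along a flattening -/

/-- `v` is an endpoint of an edge satisfying `P`. -/
def Graph.Touched {Λ : Type 1} (X : Graph Λ) (P : X.E → Prop) (v : X.V) : Prop :=
  ∃ e, P e ∧ (v ∈ X.src e ∨ v ∈ X.tgt e)

/-- The sub-hypergraph on the edges satisfying `P`, with given inputs and outputs. -/
def Graph.sub {Λ : Type 1} (X : Graph Λ) (P : X.E → Prop) (ins outs : List X.V)
    (hi : ∀ v ∈ ins, X.Touched P v) (ho : ∀ v ∈ outs, X.Touched P v) : Graph Λ where
  V := {v // X.Touched P v}
  E := {e // P e}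
  vlab := fun v => X.vlab v.1
  ins := ins.attachWith _ hi
  outs := outs.attachWith _ ho
  src := fun e => (X.src e.1).attachWith _ fun _ hv => ⟨e.1, e.2, .inl hv⟩
  tgt := fun e => (X.tgt e.1).attachWith _ fun _ hv => ⟨e.1, e.2, .inr hv⟩
  lab := fun e => X.lab e.1

theorem mem_attachWith_iff {α : Type*} {p : α → Prop} {l : List α} (h : ∀ a ∈ l, p a)
    (v : {a // p a}) : v ∈ l.attachWith p h ↔ v.1 ∈ l := by
  simp [List.mem_attachWith]

theorem nodup_attachWith {α : Type*} {p : α → Prop} {l : List α} (h : ∀ a ∈ l, p a)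
    (hl : l.Nodup) : (l.attachWith p h).Nodup :=
  List.Nodup.of_map Subtype.val (by rwa [List.attachWith_map_subtype_val])

/-- The interface of a subhypergraph carries an order which the edges do not determine; hence it is
given, and only its set of elements is constrained by `mi` and `mo`. -/
theorem Graph.sub_isInterfaced {Λ : Type 1} {X : Graph Λ} (hX : X.IsInterfaced) {P : X.E → Prop}
    {ins outs : List X.V} {hi : ∀ v ∈ ins, X.Touched P v} {ho : ∀ v ∈ outs, X.Touched P v}
    (ni : ins.Nodup) (no : outs.Nodup)
    (mi : ∀ v, X.Touched P v → (v ∈ ins ↔ ∀ e, P e → v ∉ X.tgt e))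
    (mo : ∀ v, X.Touched P v → (v ∈ outs ↔ ∀ e, P e → v ∉ X.src e))
    (hd : ∀ v ∈ ins, v ∉ outs) : (X.sub P ins outs hi ho).IsInterfaced := by
  constructor
  · have := hX.finV
    exact inferInstanceAs (Finite {v // X.Touched P v})
  · have := hX.finE
    exact inferInstanceAs (Finite {e // P e})
  · exact fun e => nodup_attachWith _ (hX.src_nodup _)
  · exact fun e => nodup_attachWith _ (hX.tgt_nodup _)
  · intro v e e' h h'
    exact Subtype.ext (hX.src_unique _ _ _ ((mem_attachWith_iff _ v).1 h)
      ((mem_attachWith_iff _ v).1 h'))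
  · intro v e e' h h'
    exact Subtype.ext (hX.tgt_unique _ _ _ ((mem_attachWith_iff _ v).1 h)
      ((mem_attachWith_iff _ v).1 h'))
  · exact nodup_attachWith _ ni
  · exact nodup_attachWith _ no
  · intro v
    refine (mem_attachWith_iff _ v).trans ((mi v.1 v.2).trans ⟨fun h e he => ?_, fun h e he he' => ?_⟩)
    · exact h e.1 e.2 ((mem_attachWith_iff _ v).1 he)
    · exact h ⟨e, he⟩ ((mem_attachWith_iff _ v).2 he')
  · intro v
    refine (mem_attachWith_iff _ v).trans ((mo v.1 v.2).trans ⟨fun h e he => ?_, fun h e he he' => ?_⟩)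
    · exact h e.1 e.2 ((mem_attachWith_iff _ v).1 he)
    · exact h ⟨e, he⟩ ((mem_attachWith_iff _ v).2 he')
  · intro v h h'
    exact hd _ ((mem_attachWith_iff _ v).1 h) ((mem_attachWith_iff _ v).1 h')

theorem attachWith_map_map {α β : Type*} {p : α → Prop} {l : List α} (h : ∀ a ∈ l, p a)
    (f : α → β) : (l.attachWith p h).map (fun v => f v.1) = l.map f := by
  rw [← map_vlab_of_comp (f := Subtype.val) (q := f) (fun _ => rfl),
    List.attachWith_map_subtype_val]

theorem Net.sub_isHypernet {X : Net} {d c : List VLabel} (hX : X.IsHypernet d c)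
    {P : X.E → Prop} {ins outs : List X.V} {hi : ∀ v ∈ ins, X.Touched P v}
    {ho : ∀ v ∈ outs, X.Touched P v} (h : (Graph.sub X P ins outs hi ho).IsInterfaced) :
    Net.IsHypernet (Graph.sub X P ins outs hi ho) (ins.map X.vlab) (outs.map X.vlab) := by
  refine ⟨h, fun e => ?_, attachWith_map_map _ _, attachWith_map_map _ _⟩
  change (X.lab e.1).HasType _ _
  convert hX.typed e.1 using 1
  · exact attachWith_map_map _ _
  · exact attachWith_map_map _ _

/-- No edge has a vertex both as a source and as a target. -/
def Graph.NoLoop {Λ : Type 1} (D : Graph Λ) : Prop := ∀ e, ∀ u ∈ D.src e, u ∉ D.tgt e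

theorem map_cancel {α β : Type*} {f : α → β} (hf : Function.Injective f) {l l' : List α}
    (h : l.map f = l'.map f) : l = l' := List.map_injective_iff.2 hf h

/-- If plugging `σ` in `X` yields the flattening of `D`, and if the edges replacing each edge of `X`
belong to the label of a single edge of `D`, then `X` itself is the flattening of a hypergraph of the
shape of `D` that yields `D` when `σ` is plugged in. -/
theorem decompose {X : Net} {d c : List VLabel} (hX : X.IsHypernet d c) {σ : Hole → Net}
    (hσ : WellTyped σ) {D : Graph Net} (hD : D.WF) (hl : D.NoLoop)
    (f : (X.plugGraph σ).flatten.V ≃ D.flatten.V) (g : (X.plugGraph σ).flatten.E ≃ D.flatten.E)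
    (f_vlab : ∀ v, D.flatten.vlab (f v) = (X.plugGraph σ).flatten.vlab v)
    (f_ins : D.flatten.ins = (X.plugGraph σ).flatten.ins.map f)
    (f_outs : D.flatten.outs = (X.plugGraph σ).flatten.outs.map f)
    (f_src : ∀ e, D.flatten.src (g e) = ((X.plugGraph σ).flatten.src e).map f)
    (f_tgt : ∀ e, D.flatten.tgt (g e) = ((X.plugGraph σ).flatten.tgt e).map f)
    (f_lab : ∀ e, Label.Iso ((X.plugGraph σ).flatten.lab e) (D.flatten.lab (g e)))
    (κ : X.E → D.E) (hκ : ∀ e (x : ((X.plugGraph σ).lab e).E), (g ⟨e, x⟩).1 = κ e) :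
    ∃ n : D.E → Net,
      (∀ i, (n i).IsHypernet ((D.src i).map D.vlab) ((D.tgt i).map D.vlab)) ∧
      X.Iso (D.relabel n).flatten ∧ (∀ i, ((n i).plug σ).Iso (D.lab i)) ∧
      ∀ i x, ∃ e, (n i).lab x = X.lab e := by
  have hQ : (X.plugGraph σ).WF := hX.plugGraph_wf hσ
  -- A vertex of `X` is identified with its image in the flattening of `D`; most equations below are
  -- checked there.
  have finj : Function.Injective fun v : X.V => f ((X.plugGraph σ).vtx v) :=
    f.injective.comp (X.plugGraph σ).vtx_injective
  have hg : ∀ e (x : ((X.plugGraph σ).lab e).E) i, κ e = i → ∃ x', g ⟨e, x⟩ = ⟨i, x'⟩ := by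
    rintro e x i rfl
    have := hκ e x
    generalize g ⟨e, x⟩ = y at this
    obtain ⟨i, x'⟩ := y
    change i = κ e at this
    subst this
    exact ⟨x', rfl⟩
  have msrc : ∀ (y : (X.plugGraph σ).flatten.V) e, y ∈ (X.plugGraph σ).flatten.src e ↔ f y ∈ D.flatten.src (g e) := by
    intro y e; rw [f_src, List.mem_map_of_injective f.injective]
  have mtgt : ∀ (y : (X.plugGraph σ).flatten.V) e, y ∈ (X.plugGraph σ).flatten.tgt e ↔ f y ∈ D.flatten.tgt (g e) := by
    intro y e; rw [f_tgt, List.mem_map_of_injective f.injective]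
  have src1 : ∀ e, ∀ v ∈ X.src e, ∃ x', f ((X.plugGraph σ).vtx v) ∈ D.flatten.src ⟨κ e, x'⟩ := by
    intro e v hv
    obtain ⟨x, hx⟩ := hQ.exists_src (e := e) hv
    obtain ⟨x', hx'⟩ := hg e x _ rfl
    have := (msrc _ _).1 hx
    rw [hx'] at this
    exact ⟨x', this⟩
  have tgt1 : ∀ e, ∀ v ∈ X.tgt e, ∃ x', f ((X.plugGraph σ).vtx v) ∈ D.flatten.tgt ⟨κ e, x'⟩ := by
    intro e v hv
    obtain ⟨x, hx⟩ := hQ.exists_tgt (e := e) hv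
    obtain ⟨x', hx'⟩ := hg e x _ rfl
    have := (mtgt _ _).1 hx
    rw [hx'] at this
    exact ⟨x', this⟩
  have src2 : ∀ i x' v, f ((X.plugGraph σ).vtx v) ∈ D.flatten.src ⟨i, x'⟩ → ∃ e, κ e = i ∧ v ∈ X.src e := by
    intro i x' v h
    obtain ⟨⟨e, x⟩, he⟩ := g.surjective ⟨i, x'⟩
    rw [← he] at h
    refine ⟨e, ?_, hQ.inl_mem_src ((msrc _ _).2 h)⟩
    rw [← hκ e x, he]
  have tgt2 : ∀ i x' v, f ((X.plugGraph σ).vtx v) ∈ D.flatten.tgt ⟨i, x'⟩ → ∃ e, κ e = i ∧ v ∈ X.tgt e := by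
    intro i x' v h
    obtain ⟨⟨e, x⟩, he⟩ := g.surjective ⟨i, x'⟩
    rw [← he] at h
    refine ⟨e, ?_, hQ.inl_mem_tgt ((mtgt _ _).2 h)⟩
    rw [← hκ e x, he]
  -- The wiring vertices are vertices of `X`. An inner vertex of what replaces an edge `e` is both a
  -- target and a source of edges in component `κ e`; as a wiring vertex it would be a loop at that
  -- component.
  have ha : ∀ u : D.V, ∃ v : X.V, f ((X.plugGraph σ).vtx v) = D.vtx u := by
    intro u
    obtain ⟨y, hy⟩ := f.surjective (D.vtx u)
    rcases y with v | ⟨⟨e, w⟩, hw⟩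
    · exact ⟨v, hy⟩
    · obtain ⟨h1, h2⟩ := hQ.glue_eq_none.1 hw
      rw [(hQ.typed e).interfaced.mem_ins] at h1
      rw [(hQ.typed e).interfaced.mem_outs] at h2
      push Not at h1 h2
      obtain ⟨x, hx⟩ := h1
      obtain ⟨x', hx'⟩ := h2
      have h3 := (mtgt _ ⟨e, x⟩).1 (Graph.mem_flatten_tgt.2 ⟨w, hx, Graph.embed_of_none hw⟩)
      have h4 := (msrc _ ⟨e, x'⟩).1 (Graph.mem_flatten_src.2 ⟨w, hx', Graph.embed_of_none hw⟩)
      obtain ⟨z, hz⟩ := hg e x _ rfl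
      obtain ⟨z', hz'⟩ := hg e x' _ rfl
      rw [hz, hy] at h3
      rw [hz', hy] at h4
      exact absurd (hD.inl_mem_tgt h3) (hl _ _ (hD.inl_mem_src h4))
  choose a ha using ha
  have hax : ∀ l : List D.V, (l.map a).map (fun v => f ((X.plugGraph σ).vtx v)) = l.map D.vtx :=
    fun l => map_vlab_of_comp (f := a) (q := fun v => f ((X.plugGraph σ).vtx v)) ha l
  have ainj : Function.Injective a := fun u u' h => D.vtx_injective (by rw [← ha, h, ha])
  have src4 : ∀ u i, u ∈ D.src i → ∃ e, κ e = i ∧ a u ∈ X.src e := by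
    intro u i hu
    obtain ⟨x, hx⟩ := hD.exists_src hu
    rw [← ha] at hx
    exact src2 _ _ _ hx
  have tgt4 : ∀ u i, u ∈ D.tgt i → ∃ e, κ e = i ∧ a u ∈ X.tgt e := by
    intro u i hu
    obtain ⟨x, hx⟩ := hD.exists_tgt hu
    rw [← ha] at hx
    exact tgt2 _ _ _ hx
  have src5 : ∀ u e, a u ∈ X.src e → u ∈ D.src (κ e) := by
    intro u e h
    obtain ⟨x, hx⟩ := src1 e _ h
    rw [ha] at hx
    exact hD.inl_mem_src hx
  have tgt5 : ∀ u e, a u ∈ X.tgt e → u ∈ D.tgt (κ e) := by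
    intro u e h
    obtain ⟨x, hx⟩ := tgt1 e _ h
    rw [ha] at hx
    exact hD.inl_mem_tgt hx
  have touch : ∀ i v, X.Touched (fun e => κ e = i) v → ∃ z, D.embed i z = f ((X.plugGraph σ).vtx v) := by
    rintro i v ⟨e, rfl, h | h⟩
    · obtain ⟨x, hx⟩ := src1 e v h
      obtain ⟨z, _, hz⟩ := Graph.mem_flatten_src.1 hx
      exact ⟨z, hz⟩
    · obtain ⟨x, hx⟩ := tgt1 e v h
      obtain ⟨z, _, hz⟩ := Graph.mem_flatten_tgt.1 hx
      exact ⟨z, hz⟩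
  have hi : ∀ i, ∀ v ∈ (D.src i).map a, X.Touched (fun e => κ e = i) v := by
    intro i v hv
    obtain ⟨u, hu, rfl⟩ := List.mem_map.1 hv
    obtain ⟨e, h1, h2⟩ := src4 u i hu
    exact ⟨e, h1, .inl h2⟩
  have ho : ∀ i, ∀ v ∈ (D.tgt i).map a, X.Touched (fun e => κ e = i) v := by
    intro i v hv
    obtain ⟨u, hu, rfl⟩ := List.mem_map.1 hv
    obtain ⟨e, h1, h2⟩ := tgt4 u i hu
    exact ⟨e, h1, .inr h2⟩
  -- Component `i` consists of the edges of `X` of colour `i`, with the interface in the order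
  -- prescribed by `D`.
  let n : D.E → Net := fun i => Graph.sub X (fun e => κ e = i) _ _ (hi i) (ho i)
  have avlab : ∀ u, X.vlab (a u) = D.vlab u := by
    intro u
    have := f_vlab ((X.plugGraph σ).vtx (a u))
    rw [ha] at this
    exact this.symm
  have ni : ∀ i, (n i).IsInterfaced := by
    intro i
    refine Graph.sub_isInterfaced hX.interfaced ((hD.interfaced.src_nodup i).map ainj)
      ((hD.interfaced.tgt_nodup i).map ainj) (fun v hv => ⟨fun h e he he' => ?_, fun h => ?_⟩)
      (fun v hv => ⟨fun h e he he' => ?_, fun h => ?_⟩) fun v h h' => ?_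
    · obtain ⟨u, hu, rfl⟩ := List.mem_map.1 h
      have := tgt5 u e he'
      rw [he] at this
      exact hl i u hu this
    · obtain ⟨z, hz⟩ := touch i v hv
      rcases hD.embed_cases i z with ⟨h2, u, hu, h4⟩ | ⟨h2, _⟩ | ⟨h2, _⟩
      · rw [hz, ← ha] at h4
        obtain rfl := finj h4
        exact List.mem_map_of_mem hu
      -- In both remaining cases the vertex is not an input of the label, so an edge of the label
      -- produces it, and an edge of `X` of colour `i` lies behind that one.
      all_goals
        have h2' : z ∉ (D.lab i).ins := fun h3 => by
          first
          | exact h2 h3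
          | exact (hD.typed i).interfaced.disjoint _ h3 h2
        rw [(hD.typed i).interfaced.mem_ins] at h2'
        push Not at h2'
        obtain ⟨x, hx⟩ := h2'
        obtain ⟨e, he, he'⟩ := tgt2 i x v (Graph.mem_flatten_tgt.2 ⟨z, hx, hz⟩)
        exact absurd he' (h e he)
    · obtain ⟨u, hu, rfl⟩ := List.mem_map.1 h
      have := src5 u e he'
      rw [he] at this
      exact hl i u this hu
    · obtain ⟨z, hz⟩ := touch i v hv
      by_cases h2' : z ∈ (D.lab i).outs
      · rcases hD.embed_cases i z with ⟨h2, _⟩ | ⟨h2, u, hu, h4⟩ | ⟨_, h2, _⟩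
        · exact absurd h2' ((hD.typed i).interfaced.disjoint _ h2)
        · rw [hz, ← ha] at h4
          obtain rfl := finj h4
          exact List.mem_map_of_mem hu
        · exact absurd h2' h2
      · rw [(hD.typed i).interfaced.mem_outs] at h2'
        push Not at h2'
        obtain ⟨x, hx⟩ := h2'
        obtain ⟨e, he, he'⟩ := src2 i x v (Graph.mem_flatten_src.2 ⟨z, hx, hz⟩)
        exact absurd he' (h e he)
    · obtain ⟨u, hu, rfl⟩ := List.mem_map.1 h
      obtain ⟨u', hu', h1⟩ := List.mem_map.1 h'
      obtain rfl := ainj h1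
      exact hl i _ hu hu'
  have nh : ∀ i, (n i).IsHypernet ((D.src i).map D.vlab) ((D.tgt i).map D.vlab) := by
    intro i
    have := Net.sub_isHypernet hX (ni i)
    rwa [map_vlab_of_comp avlab, map_vlab_of_comp avlab] at this
  refine ⟨n, nh, ?_, fun i => ?_, fun i x => ⟨x.1, rfl⟩⟩
  · have hDn : (D.relabel n).WF := hD.relabel nh
    refine (hDn.flatten_iso hX.interfaced a (fun i v => v.1) (fun x => x.2.1) ⟨?_, ?_⟩ avlab
      (fun _ _ => rfl) ?_ ?_ (fun i => List.attachWith_map_subtype_val _)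
      (fun i => List.attachWith_map_subtype_val _)
      (fun i x => (List.attachWith_map_subtype_val _).symm)
      (fun i x => (List.attachWith_map_subtype_val _).symm) fun i x => .refl _).symm
    · rintro ⟨i, ⟨e, he⟩⟩ ⟨i', ⟨e', he'⟩⟩ h
      change e = e' at h
      subst h
      change κ e = i at he
      subst he
      change κ e = i' at he'
      subst he'
      rfl
    · intro e
      exact ⟨⟨κ e, ⟨e, rfl⟩⟩, rfl⟩
    · apply map_cancel finj
      have h1 : D.ins.map D.vtx = (X.ins.map (X.plugGraph σ).vtx).map f := f_ins
      refine (map_vlab_of_comp (fun _ => rfl) _).symm.trans (h1.symm.trans ?_)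
      exact (hax _).symm
    · apply map_cancel finj
      have h1 : D.outs.map D.vtx = (X.outs.map (X.plugGraph σ).vtx).map f := f_outs
      refine (map_vlab_of_comp (fun _ => rfl) _).symm.trans (h1.symm.trans ?_)
      exact (hax _).symm
  -- Without loops the label of `i` is embedded in the flattening, so equalities of lists of its
  -- vertices may be tested after embedding.
  · have einj := hD.embed_injective (hl i)
    have hq : (n i).plugGraph σ = ⟨(n i).V, (n i).E, (n i).vlab, (n i).ins, (n i).outs, (n i).src,
        (n i).tgt, fun e => (X.plugGraph σ).lab e.1⟩ := by
      unfold Net.plugGraph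
      congr 1
      funext e
      change plugEdge _ _ _ _ _ = plugEdge _ _ _ _ _
      congr 1
      · exact attachWith_map_map _ _
      · exact attachWith_map_map _ _
    have hqw := (nh i).plugGraph_wf hσ
    rw [← Net.flatten_plugGraph]
    rw [hq] at hqw ⊢
    -- Every vertex of what replaces an edge of colour `i` is an endpoint of one of the replacing
    -- edges, which all lie in component `i`.
    have hb : ∀ (e : (n i).E) (w : ((X.plugGraph σ).lab e.1).V), ∃ z, D.embed i z = f ((X.plugGraph σ).embed e.1 w) := by
      rintro ⟨e, he⟩ w
      change κ e = i at he
      by_cases hw : w ∈ ((X.plugGraph σ).lab e).outs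
      · have hw' : w ∉ ((X.plugGraph σ).lab e).ins := fun h => (hQ.typed e).interfaced.disjoint _ h hw
        rw [(hQ.typed e).interfaced.mem_ins] at hw'
        push Not at hw'
        obtain ⟨x, hx⟩ := hw'
        have h3 := (mtgt _ ⟨e, x⟩).1 (Graph.mem_flatten_tgt.2 ⟨w, hx, rfl⟩)
        obtain ⟨x', hx'⟩ := hg e x i he
        rw [hx'] at h3
        obtain ⟨z, _, hz⟩ := Graph.mem_flatten_tgt.1 h3
        exact ⟨z, hz⟩
      · rw [(hQ.typed e).interfaced.mem_outs] at hw
        push Not at hw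
        obtain ⟨x, hx⟩ := hw
        have h3 := (msrc _ ⟨e, x⟩).1 (Graph.mem_flatten_src.2 ⟨w, hx, rfl⟩)
        obtain ⟨x', hx'⟩ := hg e x i he
        rw [hx'] at h3
        obtain ⟨z, _, hz⟩ := Graph.mem_flatten_src.1 h3
        exact ⟨z, hz⟩
    choose b hb using hb
    choose a' ha' using fun v : (n i).V => touch i v.1 v.2
    choose k hk using fun (e : (n i).E) (x : ((X.plugGraph σ).lab e.1).E) => hg e.1 x i e.2
    refine hqw.flatten_iso (hD.typed i).interfaced a' b (fun y => k y.1 y.2) ⟨?_, ?_⟩ ?_ ?_ ?_ ?_ ?_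
      ?_ ?_ ?_ ?_
    · rintro ⟨e, x⟩ ⟨e', x'⟩ h
      have h1 := hk e x
      change k e x = k e' x' at h
      rw [h, ← hk e' x'] at h1
      have h2 := g.injective h1
      obtain ⟨e, he⟩ := e
      obtain ⟨e', he'⟩ := e'
      obtain rfl : e = e' := congrArg Sigma.fst h2
      obtain rfl := eq_of_heq (Sigma.mk.inj h2).2
      rfl
    · intro z
      obtain ⟨⟨e, x⟩, he⟩ := g.surjective ⟨i, z⟩
      have he' : κ e = i := by rw [← hκ e x, he]
      refine ⟨⟨⟨e, he'⟩, x⟩, ?_⟩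
      have h1 := hk ⟨e, he'⟩ x
      rw [he] at h1
      exact (eq_of_heq (Sigma.mk.inj h1).2).symm
    · intro v
      rw [← hD.vlab_embed, ha']
      exact f_vlab _
    · intro e w
      rw [← hD.vlab_embed, hb]
      exact (f_vlab _).trans (hQ.vlab_embed _ _)
    · apply map_cancel einj
      rw [hD.map_embed_ins, map_vlab_of_comp ha']
      refine Eq.trans ?_ (attachWith_map_map (hi i) (fun v => f ((X.plugGraph σ).vtx v))).symm
      exact (hax _).symm
    · apply map_cancel einj
      rw [hD.map_embed_outs, map_vlab_of_comp ha']
      refine Eq.trans ?_ (attachWith_map_map (ho i) (fun v => f ((X.plugGraph σ).vtx v))).symm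
      exact (hax _).symm
    · intro e
      apply map_cancel einj
      refine (map_vlab_of_comp (hb e) _).trans (Eq.trans ?_ (map_vlab_of_comp ha' _).symm)
      refine Eq.trans ?_ (attachWith_map_map _ (fun v => f ((X.plugGraph σ).vtx v))).symm
      exact (map_vlab_of_comp (f := (X.plugGraph σ).embed e.1) (q := f) (fun _ => rfl) _).symm.trans
        ((congrArg (List.map f) (hQ.map_embed_ins e.1)).trans
          (map_vlab_of_comp (f := (X.plugGraph σ).vtx) (q := f) (fun _ => rfl) _))
    · intro e
      apply map_cancel einj
      refine (map_vlab_of_comp (hb e) _).trans (Eq.trans ?_ (map_vlab_of_comp ha' _).symm)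
      refine Eq.trans ?_ (attachWith_map_map _ (fun v => f ((X.plugGraph σ).vtx v))).symm
      exact (map_vlab_of_comp (f := (X.plugGraph σ).embed e.1) (q := f) (fun _ => rfl) _).symm.trans
        ((congrArg (List.map f) (hQ.map_embed_outs e.1)).trans
          (map_vlab_of_comp (f := (X.plugGraph σ).vtx) (q := f) (fun _ => rfl) _))
    · intro e x
      apply map_cancel einj
      refine Eq.trans ?_ (map_vlab_of_comp (hb e) _).symm
      have := f_src ⟨e.1, x⟩
      rw [hk e x] at this
      exact this.trans
        (map_vlab_of_comp (f := (X.plugGraph σ).embed e.1) (q := f) (fun _ => rfl) _)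
    · intro e x
      apply map_cancel einj
      refine Eq.trans ?_ (map_vlab_of_comp (hb e) _).symm
      have := f_tgt ⟨e.1, x⟩
      rw [hk e x] at this
      exact this.trans
        (map_vlab_of_comp (f := (X.plugGraph σ).embed e.1) (q := f) (fun _ => rfl) _)
    · intro e x
      have := f_lab ⟨e.1, x⟩
      rw [hk e x] at this
      exact this

open Relation

/-! ## Paths -/

/-- There is an edge from the vertex `v` to the vertex `v'`. -/
def Graph.Step {Λ : Type 1} (G : Graph Λ) (v v' : G.V) : Prop := ∃ e, v ∈ G.src e ∧ v' ∈ G.tgt e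

theorem Graph.exists_isPath_iff {Λ : Type 1} {G : Graph Λ} {P : G.E → Prop} {v v' : G.V} :
    (∃ p, G.IsPath p v v' ∧ ∀ e ∈ p, P e) ↔
      ∃ e e', v ∈ G.src e ∧ v' ∈ G.tgt e' ∧ P e ∧
        ReflTransGen (fun a b => G.Incoming a b ∧ P b) e e' := by
  constructor
  · rintro ⟨p, ⟨hp, ⟨e, he, hv⟩, ⟨e', he', hv'⟩⟩, hP⟩
    refine ⟨e, e', hv, hv', hP e (List.mem_of_mem_head? he), ?_⟩
    obtain ⟨l, rfl⟩ : ∃ l, p = e :: l := by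
      cases p with
      | nil => cases he
      | cons a l => cases he; exact ⟨l, rfl⟩
    clear he hv hv'
    induction l generalizing e with
    | nil => cases he'; exact .refl
    | cons a l ih =>
      rw [List.isChain_cons_cons] at hp
      refine .head ⟨hp.1, hP a (by simp)⟩ (ih a (fun b hb => hP b (List.mem_cons_of_mem _ hb))
        hp.2 ?_)
      simpa using he'
  · rintro ⟨e, e', hv, hv', hP, h⟩
    obtain ⟨l, hl, hl'⟩ := List.exists_isChain_cons_of_relationReflTransGen h
    refine ⟨e :: l, ⟨hl.imp fun _ _ h => h.1, ⟨e, rfl, hv⟩, ⟨e', ?_, hv'⟩⟩, ?_⟩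
    · rw [List.getLast?_eq_some_getLast (List.cons_ne_nil _ _), hl']
      rfl
    · intro a ha
      rcases List.mem_cons.1 ha with rfl | ha
      · exact hP
      · exact hl.cons_induction P l (fun x y h _ => h.2) hP a ha

theorem Graph.reachable_iff {Λ : Type 1} {G : Graph Λ} {v v' : G.V} :
    G.Reachable v v' ↔ ReflTransGen G.Step v v' := by
  constructor
  · rintro (rfl | ⟨p, hp⟩)
    · exact .refl
    · obtain ⟨e, e', h1, h2, _, h3⟩ :=
        Graph.exists_isPath_iff.1 ⟨p, hp, fun _ _ => (trivial : True)⟩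
      clear hp p
      induction h3 using ReflTransGen.head_induction_on generalizing v with
      | refl => exact .single ⟨_, h1, h2⟩
      | head h _ ih =>
        obtain ⟨⟨w, hw, hw'⟩, _⟩ := h
        exact .head ⟨_, h1, hw⟩ (ih hw')
  · intro h
    induction h using ReflTransGen.head_induction_on with
    | refl => exact .inl rfl
    | head h _ ih =>
      obtain ⟨e, he, he'⟩ := h
      right
      rcases ih with rfl | ⟨p, hp⟩
      · exact ⟨[e], .singleton _, ⟨e, rfl, he⟩, ⟨e, rfl, he'⟩⟩
      · obtain ⟨a, a', h1, h2, h3, h4⟩ :=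
          Graph.exists_isPath_iff.1 ⟨p, hp, fun _ _ => (trivial : True)⟩
        obtain ⟨q, hq, _⟩ := Graph.exists_isPath_iff.2
          ⟨e, a', he, h2, trivial, .head ⟨⟨_, he', h1⟩, trivial⟩ h4⟩
        exact ⟨q, hq⟩

/-! ## Contraction trees -/

/-- `l` labels a contraction or a weakening. -/
def Label.IsTree (l : Label) : Prop := ∃ ℓ, l = .base (.weak ℓ) ∨ l = .base (.contr ℓ)

theorem Label.IsTree.iso {l l' : Label} (h : l.IsTree) (h' : l.Iso l') : l'.IsTree := by
  obtain ⟨ℓ, rfl | rfl⟩ := h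
  · exact ⟨ℓ, .inl h'.base_left⟩
  · exact ⟨ℓ, .inr h'.base_left⟩

theorem Net.IsContractionTree.isTree {T : Net} {ℓ : Link} {k : ℕ} (h : T.IsContractionTree ℓ k)
    (e : T.E) : (T.lab e).IsTree := ⟨ℓ, h.lab e⟩

theorem exists_eq_singleton_of_map {α β : Type*} {f : α → β} {l : List α} {b : β}
    (h : l.map f = [b]) : ∃ a, l = [a] ∧ f a = b := by
  rcases l with _ | ⟨a, _ | ⟨a', l⟩⟩ <;> simp_all

theorem Net.IsContractionTree.tgt_eq {T : Net} {ℓ : Link} {k : ℕ} (h : T.IsContractionTree ℓ k)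
    (e : T.E) : ∃ v, T.tgt e = [v] := by
  have := h.hypernet.typed e
  rcases h.lab e with h1 | h1 <;> rw [h1] at this
  · obtain ⟨a, ha, _⟩ := exists_eq_singleton_of_map this.2
    exact ⟨a, ha⟩
  · obtain ⟨a, ha, _⟩ := exists_eq_singleton_of_map this.2
    exact ⟨a, ha⟩

/-- A contraction tree has an output, which is the target of some edge. -/
theorem Net.IsContractionTree.exists_output {T : Net} {ℓ : Link} {k : ℕ}
    (h : T.IsContractionTree ℓ k) : ∃ o x, T.outs = [o] ∧ o ∈ T.tgt x := by
  obtain ⟨o, ho, _⟩ := exists_eq_singleton_of_map h.hypernet.outs_type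
  have h1 : o ∉ T.ins := fun h1 => h.hypernet.interfaced.disjoint _ h1 (by rw [ho]; simp)
  rw [h.hypernet.interfaced.mem_ins] at h1
  push Not at h1
  obtain ⟨x, hx⟩ := h1
  exact ⟨o, x, ho, hx⟩

theorem Net.IsContractionTree.reach_output {T : Net} {ℓ : Link} {k : ℕ}
    (h : T.IsContractionTree ℓ k) {o : T.V} (ho : T.outs = [o]) (v : T.V) :
    ReflTransGen T.Step v o := by
  obtain ⟨o', ho', h1⟩ := h.reach v
  rw [ho] at ho'
  obtain rfl := List.mem_singleton.1 ho'
  exact Graph.reachable_iff.1 h1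

/-- The shallow holes of `X` are plugged with contraction trees. -/
def TreeHoles (X : Net) (σ : Hole → Net) : Prop :=
  ∀ e ψ, X.lab e = .base (.hole ψ) → ∃ ℓ k, (σ ψ).IsContractionTree ℓ k

theorem Net.AllHolesDeep.treeHoles {X : Net} (h : X.AllHolesDeep) (σ : Hole → Net) :
    TreeHoles X σ := fun e ψ he => absurd he (h e ψ)

/-- The edges of a contraction tree plugged in a hole belong to the same component of the result. -/
theorem exists_colouring {X : Net} {σ : Hole → Net}
    (ht : TreeHoles X σ) {D : Graph Net} (hD : D.WF)
    (sep : ∀ i i', (∃ x, ((D.lab i).lab x).IsTree) → (∃ x, ((D.lab i').lab x).IsTree) →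
      ∀ u ∈ D.tgt i, u ∉ D.src i')
    (f : (X.plugGraph σ).flatten.V ≃ D.flatten.V) (g : (X.plugGraph σ).flatten.E ≃ D.flatten.E)
    (f_src : ∀ e, D.flatten.src (g e) = ((X.plugGraph σ).flatten.src e).map f)
    (f_tgt : ∀ e, D.flatten.tgt (g e) = ((X.plugGraph σ).flatten.tgt e).map f)
    (f_lab : ∀ e, Label.Iso ((X.plugGraph σ).flatten.lab e) (D.flatten.lab (g e))) :
    ∃ κ : X.E → D.E, ∀ e (x : ((X.plugGraph σ).lab e).E), (g ⟨e, x⟩).1 = κ e := by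
  have key : ∀ e : X.E, ∃ i : D.E, ∀ x : ((X.plugGraph σ).lab e).E, (g ⟨e, x⟩).1 = i := by
    intro e
    by_cases he : ∃ ψ, X.lab e = .base (.hole ψ)
    · obtain ⟨ψ, he⟩ := he
      have hT : ∃ ℓ k, ((X.plugGraph σ).lab e).IsContractionTree ℓ k := by
        change ∃ ℓ k, (plugEdge σ (X.lab e) _ _ _).IsContractionTree ℓ k
        rw [he]
        exact ht e ψ he
      obtain ⟨ℓ, k, hT⟩ := hT
      -- Consecutive edges of the plugged tree share a component. Otherwise the vertex between them
      -- would be a wiring vertex leading from one component with tree edges to another, against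
      -- `sep`.
      have adj : ∀ (x y : ((X.plugGraph σ).lab e).E) v, v ∈ ((X.plugGraph σ).lab e).tgt x →
          v ∈ ((X.plugGraph σ).lab e).src y → (g ⟨e, x⟩).1 = (g ⟨e, y⟩).1 := by
        intro x y v hx hy
        have h1 : f ((X.plugGraph σ).embed e v) ∈ D.flatten.tgt (g ⟨e, x⟩) := by
          have h0 := List.mem_map_of_mem (f := f)
            ((Graph.mem_flatten_tgt (D := X.plugGraph σ) (e := e) (x := x)).2 ⟨v, hx, rfl⟩)
          exact Eq.mpr (congrArg (_ ∈ ·) (f_tgt ⟨e, x⟩)) h0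
        have h2 : f ((X.plugGraph σ).embed e v) ∈ D.flatten.src (g ⟨e, y⟩) := by
          have h0 := List.mem_map_of_mem (f := f)
            ((Graph.mem_flatten_src (D := X.plugGraph σ) (e := e) (x := y)).2 ⟨v, hy, rfl⟩)
          exact Eq.mpr (congrArg (_ ∈ ·) (f_src ⟨e, y⟩)) h0
        have t1 := (hT.isTree x).iso (f_lab ⟨e, x⟩)
        have t2 := (hT.isTree y).iso (f_lab ⟨e, y⟩)
        revert h1 h2 t1 t2
        generalize g ⟨e, x⟩ = ix
        generalize g ⟨e, y⟩ = iy
        generalize f ((X.plugGraph σ).embed e v) = w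
        obtain ⟨i, x'⟩ := ix
        obtain ⟨i', y'⟩ := iy
        intro h1 h2 t1 t2
        obtain ⟨z, hz, rfl⟩ := Graph.mem_flatten_tgt.1 h1
        obtain ⟨z', hz', h3⟩ := Graph.mem_flatten_src.1 h2
        rcases hD.embed_cases i z with ⟨h4, _⟩ | ⟨_, u, hu, h4⟩ | ⟨_, _, _, h4⟩
        · exact absurd h4 (hD.tgt_notMem_ins hz)
        · rw [h4] at h3
          exact absurd (hD.mem_src_of_embed (hD.src_notMem_outs hz') h3).2
            (sep i i' ⟨_, t1⟩ ⟨_, t2⟩ u hu)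
        · rw [h4] at h3
          rcases hD.embed_cases i' z' with ⟨_, u, _, h5⟩ | ⟨_, u, _, h5⟩ | ⟨_, _, _, h5⟩
          · rw [h5] at h3; exact (Graph.vtx_ne_inr h3).elim
          · rw [h5] at h3; exact (Graph.vtx_ne_inr h3).elim
          · rw [h5] at h3
            have := congrArg (fun q => q.1.1) (Sum.inr.inj h3)
            exact this.symm
      -- The edge producing the output serves as reference: every edge has a target, from which the
      -- tree leads down to that output through consecutive edges.
      obtain ⟨o, x₀, ho, hx₀⟩ := hT.exists_output
      refine ⟨(g ⟨e, x₀⟩).1, fun x => ?_⟩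
      have claim : ∀ v, ReflTransGen ((X.plugGraph σ).lab e).Step v o →
          ∀ x, v ∈ ((X.plugGraph σ).lab e).tgt x → (g ⟨e, x⟩).1 = (g ⟨e, x₀⟩).1 := by
        intro v hv
        induction hv using ReflTransGen.head_induction_on with
        | refl =>
          intro x hx
          rw [hT.hypernet.interfaced.tgt_unique _ _ _ hx hx₀]
        | head h _ ih =>
          obtain ⟨y, h1, h2⟩ := h
          intro x hx
          exact (adj x y _ hx h1).trans (ih y h2)
      obtain ⟨v, hv⟩ := hT.tgt_eq x
      exact claim v (hT.reach_output ho v) x (by rw [hv]; simp)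
    -- An edge that is not a hole is replaced by one edge, whose component is its colour.
    · obtain ⟨x, hx⟩ := (Net.plugGraph_isSingle (σ := σ) (not_exists.1 he)).edge
      exact ⟨(g ⟨e, x⟩).1, fun y => by rw [hx y]⟩
  choose κ hκ using key
  exact ⟨κ, hκ⟩

/-! ## Diagrams -/

/-- The vertices of a list of bundles. -/
def bundles {r : ℕ} (w : Fin r → List VLabel) (l : List (Fin r)) :
    List (Σ i : Fin r, Fin (w i).length) :=
  l.flatMap fun i => (List.finRange (w i).length).map fun j => ⟨i, j⟩

theorem mem_bundles {r : ℕ} {w : Fin r → List VLabel} {l : List (Fin r)}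
    {v : Σ i : Fin r, Fin (w i).length} : v ∈ bundles w l ↔ v.1 ∈ l := by
  obtain ⟨i, j⟩ := v
  unfold bundles
  rw [List.mem_flatMap]
  constructor
  · rintro ⟨i', hi', h⟩
    obtain ⟨j', _, h⟩ := List.mem_map.1 h
    cases h
    exact hi'
  · intro h
    exact ⟨i, h, List.mem_map_of_mem (List.mem_finRange j)⟩

theorem nodup_bundles {r : ℕ} {w : Fin r → List VLabel} {l : List (Fin r)} (h : l.Nodup) :
    (bundles w l).Nodup := by
  unfold bundles
  rw [List.nodup_flatMap]
  refine ⟨fun i _ => (List.nodup_finRange _).map fun j j' h => by cases h; rfl, ?_⟩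
  refine List.Pairwise.imp ?_ h
  intro i i' hne v hv hv'
  obtain ⟨j, _, rfl⟩ := List.mem_map.1 hv
  obtain ⟨j', _, h⟩ := List.mem_map.1 hv'
  cases h
  exact hne rfl

theorem map_bundles {r : ℕ} (w : Fin r → List VLabel) (l : List (Fin r)) :
    (bundles w l).map (fun v => (w v.1).get v.2) = l.flatMap w := by
  unfold bundles
  rw [List.map_flatMap]
  congr 1
  funext i
  rw [List.map_map]
  exact List.map_get_finRange (w i)

/-- The hypergraph whose flattening is a diagram, with components indexed by `Fin k`. -/
def wiring {r k : ℕ} (w : Fin r → List VLabel) (ins outs : List (Fin r)) (F : Fin k → Net)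
    (S : Fin k → List (Fin r) × List (Fin r)) : Graph Net where
  V := Σ i : Fin r, Fin (w i).length
  E := Fin k
  vlab := fun v => (w v.1).get v.2
  ins := bundles w ins
  outs := bundles w outs
  src := fun e => bundles w (S e).1
  tgt := fun e => bundles w (S e).2
  lab := F

/-- Separating hypernets `F` from connections `S` lets the wiring stay fixed while the components
vary, and lets its linearity be decided without looking at the components. -/
theorem diagram_eq {r : ℕ} (w : Fin r → List VLabel) (ins outs : List (Fin r))
    (es : List (Net × List (Fin r) × List (Fin r))) (F : Fin es.length → Net)
    (S : Fin es.length → List (Fin r) × List (Fin r)) (h : ∀ j, es.get j = (F j, S j)) :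
    diagram w ins outs es = (wiring w ins outs F S).flatten := by
  obtain rfl : (fun j => (es.get j).1) = F := funext fun j => by rw [h]
  obtain rfl : (fun j => (es.get j).2) = S := funext fun j => by rw [h]
  rfl

/-- The wiring of bundles is linear, without loops. -/
structure Linear {r k : ℕ} (ins outs : List (Fin r)) (S : Fin k → List (Fin r) × List (Fin r)) :
    Prop where
  ins_nodup : ins.Nodup
  outs_nodup : outs.Nodup
  src_nodup : ∀ j, (S j).1.Nodup
  tgt_nodup : ∀ j, (S j).2.Nodup
  noLoop : ∀ j, ∀ i ∈ (S j).1, i ∉ (S j).2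
  src_unique : ∀ j j', j ≠ j' → ∀ i ∈ (S j).1, i ∉ (S j').1
  tgt_unique : ∀ j j', j ≠ j' → ∀ i ∈ (S j).2, i ∉ (S j').2
  mem_ins : ∀ i, i ∈ ins ↔ ∀ j, i ∉ (S j).2
  mem_outs : ∀ i, i ∈ outs ↔ ∀ j, i ∉ (S j).1
  disjoint : ∀ i ∈ ins, i ∉ outs

theorem wiring_wf {r k : ℕ} {w : Fin r → List VLabel} {ins outs : List (Fin r)} {F : Fin k → Net}
    {S : Fin k → List (Fin r) × List (Fin r)} (h : Linear ins outs S)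
    (hF : ∀ j, (F j).IsHypernet ((S j).1.flatMap w) ((S j).2.flatMap w)) :
    (wiring w ins outs F S).WF := by
  refine ⟨⟨?_, ?_, fun e => nodup_bundles (h.src_nodup e), fun e => nodup_bundles (h.tgt_nodup e),
    fun v e e' h1 h2 => ?_, fun v e e' h1 h2 => ?_, nodup_bundles h.ins_nodup,
    nodup_bundles h.outs_nodup, fun v => ?_, fun v => ?_, fun v h1 h2 => ?_⟩, fun e => ?_⟩
  · exact inferInstanceAs (Finite (Σ i : Fin r, Fin (w i).length))
  · exact inferInstanceAs (Finite (Fin k))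
  · by_contra hne
    exact h.src_unique _ _ hne _ (mem_bundles.1 h1) (mem_bundles.1 h2)
  · by_contra hne
    exact h.tgt_unique _ _ hne _ (mem_bundles.1 h1) (mem_bundles.1 h2)
  · exact mem_bundles.trans ((h.mem_ins _).trans (forall_congr' fun e => not_congr mem_bundles.symm))
  · exact mem_bundles.trans
      ((h.mem_outs _).trans (forall_congr' fun e => not_congr mem_bundles.symm))
  · exact h.disjoint _ (mem_bundles.1 h1) (mem_bundles.1 h2)
  · change (F e).IsHypernet ((bundles w (S e).1).map _) ((bundles w (S e).2).map _)
    have := hF e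
    rw [← map_bundles, ← map_bundles] at this
    exact this

theorem wiring_noLoop {r k : ℕ} {w : Fin r → List VLabel} {ins outs : List (Fin r)}
    {F : Fin k → Net} {S : Fin k → List (Fin r) × List (Fin r)} (h : Linear ins outs S) :
    (wiring w ins outs F S).NoLoop :=
  fun e _ h1 h2 => h.noLoop e _ (mem_bundles.1 h1) (mem_bundles.1 h2)

theorem wiring_isHypernet {r k : ℕ} {w : Fin r → List VLabel} {ins outs : List (Fin r)}
    {F : Fin k → Net} {S : Fin k → List (Fin r) × List (Fin r)} (h : Linear ins outs S)
    (hF : ∀ j, (F j).IsHypernet ((S j).1.flatMap w) ((S j).2.flatMap w)) :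
    (wiring w ins outs F S).flatten.IsHypernet (ins.flatMap w) (outs.flatMap w) := by
  have := (wiring_wf h hF).flatten_isHypernet
  rw [← map_bundles, ← map_bundles]
  exact this

/-- Decomposition of a hypernet along a diagram. -/
theorem exists_wiring {X : Net} {d c : List VLabel} (hX : X.IsHypernet d c) {σ : Hole → Net}
    (hσ : WellTyped σ) (ht : TreeHoles X σ) {r k : ℕ} {w : Fin r → List VLabel}
    {ins outs : List (Fin r)} {F : Fin k → Net} {S : Fin k → List (Fin r) × List (Fin r)}
    (h : Linear ins outs S) (hF : ∀ j, (F j).IsHypernet ((S j).1.flatMap w) ((S j).2.flatMap w))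
    (sep : ∀ j j', (∃ x, ((F j).lab x).IsTree) → (∃ x, ((F j').lab x).IsTree) →
      ∀ i ∈ (S j).2, i ∉ (S j').1)
    (hi : (X.plug σ).Iso (wiring w ins outs F S).flatten) :
    ∃ F' : Fin k → Net,
      (∀ j, (F' j).IsHypernet ((S j).1.flatMap w) ((S j).2.flatMap w)) ∧
      X.Iso (wiring w ins outs F' S).flatten ∧ (∀ j, ((F' j).plug σ).Iso (F j)) ∧
      ∀ j x, ∃ e, (F' j).lab x = X.lab e := by
  have hD := wiring_wf h hF
  obtain ⟨f, g, h1, h2, h3, h4, h5, h6⟩ :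
      (X.plugGraph σ).flatten.Iso (wiring w ins outs F S).flatten := hi
  obtain ⟨κ, hκ⟩ := exists_colouring ht hD (fun i i' ti ti' u hu hu' =>
    sep i i' ti ti' _ (mem_bundles.1 hu) (mem_bundles.1 hu')) f g h4 h5 h6
  obtain ⟨n, k1, k2, k3, k4⟩ := decompose hX hσ hD (wiring_noLoop h) f g h1 h2 h3 h4 h5 h6 κ hκ
  refine ⟨n, fun j => ?_, k2, k3, k4⟩
  rw [← map_bundles, ← map_bundles]
  exact k1 j

theorem wiring_congr {r k : ℕ} {w : Fin r → List VLabel} {ins outs : List (Fin r)}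
    {F F' : Fin k → Net} {S : Fin k → List (Fin r) × List (Fin r)} (h : Linear ins outs S)
    (hF : ∀ j, (F j).IsHypernet ((S j).1.flatMap w) ((S j).2.flatMap w))
    (hi : ∀ j, (F j).Iso (F' j)) :
    (wiring w ins outs F S).flatten.Iso (wiring w ins outs F' S).flatten :=
  (wiring_wf h hF).relabel_iso (l := F') hi

theorem plug_wiring {r k : ℕ} {w : Fin r → List VLabel} {ins outs : List (Fin r)}
    {F : Fin k → Net} {S : Fin k → List (Fin r) × List (Fin r)} (h : Linear ins outs S)
    (hF : ∀ j, (F j).IsHypernet ((S j).1.flatMap w) ((S j).2.flatMap w)) {σ : Hole → Net}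
    (hσ : WellTyped σ) :
    (wiring w ins outs (fun j => (F j).plug σ) S).flatten.Iso
      ((wiring w ins outs F S).flatten.plug σ) :=
  (wiring_wf h hF).plug_flatten hσ

/-! ## Transfer of contraction trees -/

theorem Graph.Step.map {Λ Λ' : Type 1} {G : Graph Λ} {G' : Graph Λ'} (f : G.V → G'.V)
    (g : G.E → G'.E) (src : ∀ e, G'.src (g e) = (G.src e).map f)
    (tgt : ∀ e, G'.tgt (g e) = (G.tgt e).map f) {v v' : G.V} (h : G.Step v v') :
    G'.Step (f v) (f v') := by
  obtain ⟨e, h1, h2⟩ := h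
  exact ⟨g e, by rw [src]; exact List.mem_map_of_mem h1, by rw [tgt]; exact List.mem_map_of_mem h2⟩

theorem Net.IsContractionTree.iso {T T' : Net} {ℓ : Link} {k : ℕ} (h : T.IsContractionTree ℓ k)
    (hi : T.Iso T') : T'.IsContractionTree ℓ k := by
  have hh := h.hypernet.iso hi
  obtain ⟨f, g, h1, h2, h3, h4, h5, h6⟩ := hi
  refine ⟨hh, f.surjective.forall.2 fun v => (h1 v).trans (h.vlab v),
    g.surjective.forall.2 fun e => ?_, f.surjective.forall.2 fun v => ?_⟩
  · have := h6 e
    rcases h.lab e with h | h <;> rw [h] at this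
    · exact .inl this.base_left
    · exact .inr this.base_left
  · obtain ⟨o, ho, hr⟩ := h.reach v
    refine ⟨f o, h3 ▸ List.mem_map_of_mem ho, Graph.reachable_iff.2 ?_⟩
    exact (Graph.reachable_iff.1 hr).lift f fun a b hab => hab.map f g h4 h5

/-- A contraction tree leads each of its vertices to its only output, so a step of `D` becomes a
path of the flattening, and reachability of the output in `D` lifts. -/
theorem Graph.WF.flatten_isContractionTree {D : Graph Net} (hD : D.WF) {ℓ : Link} {k : ℕ}
    (hins : D.ins.map D.vlab = List.replicate k ℓ.label) (houts : D.outs.map D.vlab = [ℓ.label])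
    (hv : ∀ u, D.vlab u = ℓ.label) (hT : ∀ e, ∃ k, (D.lab e).IsContractionTree ℓ k)
    (hr : ∀ u, ∃ o ∈ D.outs, ReflTransGen D.Step u o) : D.flatten.IsContractionTree ℓ k := by
  have key : ∀ e (v : (D.lab e).V), ∃ t, D.tgt e = [t] ∧
      ReflTransGen D.flatten.Step (D.embed e v) (D.vtx t) := by
    intro e v
    obtain ⟨k, hT⟩ := hT e
    obtain ⟨o, _, ho, _⟩ := hT.exists_output
    have h1 := hD.map_embed_outs e
    rw [ho] at h1
    obtain ⟨t, h2, h3⟩ := exists_eq_singleton_of_map h1.symm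
    refine ⟨t, h2, ?_⟩
    rw [h3]
    exact (hT.reach_output ho v).lift (D.embed e) fun a b ⟨x, ha, hb⟩ =>
      ⟨⟨e, x⟩, Graph.mem_flatten_src.2 ⟨a, ha, rfl⟩, Graph.mem_flatten_tgt.2 ⟨b, hb, rfl⟩⟩
  have step : ∀ u u', D.Step u u' → ReflTransGen D.flatten.Step (D.vtx u) (D.vtx u') := by
    rintro u u' ⟨e, h1, h2⟩
    have h3 : D.vtx u ∈ (D.lab e).ins.map (D.embed e) := by
      rw [hD.map_embed_ins]; exact List.mem_map_of_mem h1
    obtain ⟨a, _, ha⟩ := List.mem_map.1 h3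
    obtain ⟨t, ht, h4⟩ := key e a
    rw [ht] at h2
    rw [List.mem_singleton.1 h2, ← ha]
    exact h4
  have lift : ∀ u u', ReflTransGen D.Step u u' → ReflTransGen D.flatten.Step (D.vtx u) (D.vtx u') := by
    intro u u' h
    induction h with
    | refl => exact .refl
    | tail _ h ih => exact ih.trans (step _ _ h)
  refine ⟨?_, ?_, ?_, ?_⟩
  · rw [← hins, ← houts]; exact hD.flatten_isHypernet
  · rintro (u | ⟨⟨e, v⟩, h⟩)
    · exact hv u
    · exact (hT e).choose_spec.vlab v
  · rintro ⟨e, x⟩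
    exact (hT e).choose_spec.lab x
  · rintro (u | ⟨⟨e, v⟩, h⟩)
    · obtain ⟨o, ho, h⟩ := hr u
      exact ⟨D.vtx o, List.mem_map_of_mem ho, Graph.reachable_iff.2 (lift _ _ h)⟩
    · obtain ⟨t, _, h1⟩ := key e v
      rw [Graph.embed_of_none h] at h1
      obtain ⟨o, ho, h2⟩ := hr t
      exact ⟨D.vtx o, List.mem_map_of_mem ho, Graph.reachable_iff.2 (h1.trans (lift _ _ h2))⟩

/-- The converse direction. Collapsing the inner vertices of a label to the only target of its edge
turns each step of the flattening into at most one step of `D`. -/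
theorem Graph.WF.reach_of_flatten {D : Graph Net} (hD : D.WF) (htgt : ∀ e, ∃ t, D.tgt e = [t])
    (hr : ∀ y, ∃ o ∈ D.flatten.outs, ReflTransGen D.flatten.Step y o) (u : D.V) :
    ∃ o ∈ D.outs, ReflTransGen D.Step u o := by
  choose t ht using htgt
  let π : D.FlatV → D.V := Sum.elim id fun x => t x.1.1
  have step : ∀ y y', D.flatten.Step y y' → ReflTransGen D.Step (π y) (π y') := by
    rintro y y' ⟨⟨e, x⟩, h1, h2⟩
    obtain ⟨a, ha, rfl⟩ := Graph.mem_flatten_src.1 h1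
    obtain ⟨b, hb, rfl⟩ := Graph.mem_flatten_tgt.1 h2
    have hb' : π (D.embed e b) = t e := by
      rcases hD.embed_cases e b with ⟨h4, _⟩ | ⟨_, u, hu, h4⟩ | ⟨_, _, _, h4⟩
      · exact absurd h4 (hD.tgt_notMem_ins hb)
      · rw [ht] at hu
        rw [h4]
        exact List.mem_singleton.1 hu
      · rw [h4]; rfl
    rw [hb']
    rcases hD.embed_cases e a with ⟨_, u, hu, h4⟩ | ⟨h4, _⟩ | ⟨_, _, _, h4⟩
    · rw [h4]
      exact .single ⟨e, hu, by rw [ht]; exact List.mem_singleton.2 rfl⟩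
    · exact absurd h4 (hD.src_notMem_outs ha)
    · rw [h4]
      exact .refl
  obtain ⟨y, hy, h⟩ := hr (D.vtx u)
  obtain ⟨o, ho, rfl⟩ := List.mem_map.1 hy
  refine ⟨o, ho, ?_⟩
  have : ∀ y y', ReflTransGen D.flatten.Step y y' → ReflTransGen D.Step (π y) (π y') := by
    intro y y' h
    induction h with
    | refl => exact .refl
    | tail _ h ih => exact ih.trans (step _ _ h)
  exact this _ _ h

theorem Link.label_injective : Function.Injective Link.label := by
  rintro (_ | _) (_ | _) h <;> first | rfl | cases h

theorem Net.IsSingle.isContractionTree {N : Net} {ℓ : Link} {b : BLabel}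
    (hb : b = .weak ℓ ∨ b = .contr ℓ) (h : N.IsSingle (.base b)) (hN : N.IsHypernet b.dom b.cod) :
    ∃ k, N.IsContractionTree ℓ k := by
  obtain ⟨k, hd, hc⟩ : ∃ k, b.dom = List.replicate k ℓ.label ∧ b.cod = [ℓ.label] := by
    rcases hb with rfl | rfl
    · exact ⟨0, rfl, rfl⟩
    · exact ⟨2, rfl, rfl⟩
  rw [hd, hc] at hN
  obtain ⟨o, ho, hol⟩ := exists_eq_singleton_of_map hN.outs_type
  obtain ⟨x, hx⟩ := h.edge
  refine ⟨k, hN, fun v => ?_, fun e => ?_, fun v => ⟨o, by rw [ho]; exact List.mem_singleton.2 rfl, ?_⟩⟩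
  · rcases h.vertex v with hv | hv
    · have h1 : N.vlab v ∈ N.ins.map N.vlab := List.mem_map_of_mem hv
      rw [hN.ins_type] at h1
      exact List.eq_of_mem_replicate h1
    · rw [ho] at hv
      rw [List.mem_singleton.1 hv, hol]
  · rw [h.lab]
    rcases hb with rfl | rfl
    · exact .inl rfl
    · exact .inr rfl
  · rcases h.vertex v with hv | hv
    · refine Graph.reachable_iff.2 (.single ⟨x, ?_, ?_⟩)
      · rw [h.src]; exact hv
      · rw [h.tgt, ho]; exact List.mem_singleton.2 rfl
    · rw [ho] at hv
      exact .inl (List.mem_singleton.1 hv)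

theorem Label.plug_eq_base {σ : Hole → Net} {l : Label} {b : BLabel} (h : l.plug σ = .base b) :
    l = .base b := by
  cases l with
  | base b' => exact h
  | box n G => cases h

/-- Being a contraction tree after plugging is a property of the coarse hypergraph `Q`, provided
that each edge is replaced by a contraction tree: reachability descends from the first plugging to
`Q` and lifts to the second one. -/
theorem Net.IsContractionTree.transfer {Q : Net} {d c : List VLabel} (hQ : Q.IsHypernet d c)
    {σ σ' : Hole → Net} (hσ : WellTyped σ) (hσ' : WellTyped σ') (ht : TreeHoles Q σ)
    (ht' : TreeHoles Q σ') {ℓ : Link} {k : ℕ} (h : (Q.plug σ).IsContractionTree ℓ k) :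
    (Q.plug σ').IsContractionTree ℓ k := by
  have hv : ∀ u : Q.V, Q.vlab u = ℓ.label := fun u => h.vlab ((Q.plugGraph σ).vtx u)
  have comp : ∀ τ, WellTyped τ → TreeHoles Q τ → ∀ e : Q.E,
      ∃ k, ((Q.plugGraph τ).lab e).IsContractionTree ℓ k := by
    intro τ hτ htτ e
    have hD := hQ.plugGraph_wf hτ
    by_cases he : ∃ ψ, Q.lab e = .base (.hole ψ)
    · obtain ⟨ψ, he⟩ := he
      obtain ⟨ℓ', k', h1⟩ := htτ e ψ he
      have h2 : (Q.plugGraph τ).lab e = τ ψ := by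
        change plugEdge τ (Q.lab e) _ _ _ = _
        rw [he]; rfl
      have h3 := (hD.typed e).outs_type
      rw [h2, h1.hypernet.outs_type] at h3
      obtain ⟨t, _, h4⟩ := exists_eq_singleton_of_map h3.symm
      -- The filling is a contraction tree of some link; its output is glued to a vertex of `Q`,
      -- which forces the link.
      obtain rfl : ℓ = ℓ' := Link.label_injective ((hv t).symm.trans h4)
      exact ⟨k', h2 ▸ h1⟩
    · have h1 := Net.plugGraph_isSingle (σ := σ) (not_exists.1 he)
      have h2 := Net.plugGraph_isSingle (σ := τ) (not_exists.1 he)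
      obtain ⟨x, hx⟩ := h1.edge
      obtain ⟨b, hb, h3⟩ : ∃ b : BLabel, (b = .weak ℓ ∨ b = .contr ℓ) ∧ Q.lab e = .base b := by
        have h4 : ((Q.plugGraph σ).lab e).lab x = _ ∨ ((Q.plugGraph σ).lab e).lab x = _ := h.lab ⟨e, x⟩
        rw [h1.lab] at h4
        rcases h4 with h4 | h4
        · exact ⟨_, .inl rfl, Label.plug_eq_base h4⟩
        · exact ⟨_, .inr rfl, Label.plug_eq_base h4⟩
      rw [h3] at h2
      have h5 := hD.typed e
      have h6 := hQ.typed e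
      rw [h3] at h6
      obtain ⟨h7, h8⟩ := h6
      have h5 : ((Q.plugGraph τ).lab e).IsHypernet ((Q.src e).map Q.vlab) ((Q.tgt e).map Q.vlab) := h5
      rw [h7, h8] at h5
      exact h2.isContractionTree hb h5
  have hty := h.hypernet.type_unique (hQ.plug hσ)
  refine (hQ.plugGraph_wf hσ').flatten_isContractionTree ?_ ?_ hv (comp σ' hσ' ht') ?_
  · exact hQ.ins_type.trans hty.1.symm
  · exact hQ.outs_type.trans hty.2.symm
  · intro u
    refine (hQ.plugGraph_wf hσ).reach_of_flatten (fun e => ?_) (fun y => ?_) u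
    · obtain ⟨k, h1⟩ := comp σ hσ ht e
      have h3 := ((hQ.plugGraph_wf hσ).typed e).outs_type
      rw [h1.hypernet.outs_type] at h3
      obtain ⟨t, h4, _⟩ := exists_eq_singleton_of_map h3.symm
      exact ⟨t, h4⟩
    · obtain ⟨o, ho, hr⟩ := h.reach y
      exact ⟨o, ho, Graph.reachable_iff.1 hr⟩

/-! ## Transfer of other classes of hypernets -/

/-- A shallow hole filled with a contraction tree would leave a contraction or weakening edge in the
result. -/
theorem Net.allHolesDeep_of_plug {Q : Net} {σ : Hole → Net} (ht : TreeHoles Q σ) {B : Net}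
    (hi : (Q.plug σ).Iso B) (hB : ∀ x, ¬ (B.lab x).IsTree) : Q.AllHolesDeep := by
  intro e ψ he
  obtain ⟨ℓ, k, hT⟩ := ht e ψ he
  have h2 : (Q.plugGraph σ).lab e = σ ψ := by
    change plugEdge σ (Q.lab e) _ _ _ = _
    rw [he]; rfl
  rw [← h2] at hT
  obtain ⟨_, x, _⟩ := hT.exists_output
  obtain ⟨f, g, h1, h2, h3, h4, h5, h6⟩ := hi
  exact hB (g ⟨e, x⟩) ((hT.isTree x).iso (h6 ⟨e, x⟩))

/-- Such a component has no shallow hole, because of its labels, and no deep hole, because it has no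
boxes. The substitution therefore has nothing to act on. -/
theorem Net.IsHypernet.rigid {Q : Net} {d c : List VLabel} (hQ : Q.IsHypernet d c)
    {σ σ' : Hole → Net} (hσ : WellTyped σ) (hσ' : WellTyped σ') (ht : TreeHoles Q σ) {B : Net}
    (hi : (Q.plug σ).Iso B) (hB : ∀ x, ∃ b, B.lab x = .base b ∧ ¬ (Label.base b).IsTree) :
    (Q.plug σ').Iso B := by
  have hd := Net.allHolesDeep_of_plug ht hi fun x => by
    obtain ⟨b, h1, h2⟩ := hB x
    rwa [h1]
  have h1 := hd.plug_iso hQ hσ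
  have h2 := hd.plug_iso hQ hσ'
  have h3 : ∀ e, (Q.lab e).plug σ = (Q.lab e).plug σ' := by
    obtain ⟨f, g, _, _, _, _, _, h6⟩ := h1.trans hi
    intro e
    have h7 : Label.Iso ((Q.lab e).plug σ) (B.lab (g e)) := h6 e
    obtain ⟨b, h8, _⟩ := hB (g e)
    rw [h8] at h7
    rw [Label.plug_eq_base h7.base_right]
    rfl
  rw [funext h3] at h1
  exact h2.symm.trans (h1.trans hi)

theorem Net.IsCopyable.not_isTree {H : Net} {p h : ℕ} (hH : H.IsCopyable p h) (x : H.E) :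
    ¬ (H.lab x).IsTree := by
  obtain ⟨e₀, _, ⟨h1, h2⟩ | ⟨φ, h1, h2⟩⟩ := hH.shape
  · rw [h2 x, h1]
    rintro ⟨ℓ, h | h⟩ <;> cases h
  · by_cases hx : x = e₀
    · rw [hx, h1]
      rintro ⟨ℓ, h | h⟩ <;> cases h
    · obtain ⟨⟨n, G, h3⟩, _⟩ := h2 x hx
      rw [h3]
      rintro ⟨ℓ, h | h⟩ <;> cases h

/-- Copyability sees the shallow hypergraph, basic labels, and which edges are boxes, but not what
the boxes contain. So the contents may change freely. -/
theorem Net.IsCopyable.of_equiv {H X : Net} {p h : ℕ} (hH : H.IsCopyable p h)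
    (hX : X.IsHypernet (stars 1) (stars p ++ dias h)) (f : X.V ≃ H.V) (g : X.E ≃ H.E)
    (ins : H.ins = X.ins.map f) (src : ∀ e, H.src (g e) = (X.src e).map f)
    (tgt : ∀ e, H.tgt (g e) = (X.tgt e).map f)
    (hbase : ∀ e b, H.lab (g e) = .base b → X.lab e = .base b)
    (hbox : ∀ e n G, H.lab (g e) = .box n G → ∃ G', X.lab e = .box n G') : X.IsCopyable p h := by
  refine ⟨hX, ?_⟩
  obtain ⟨e₀, h0, h1⟩ := hH.shape
  obtain ⟨e₀, rfl⟩ := g.surjective e₀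
  refine ⟨e₀, ?_, ?_⟩
  · rw [src, ins] at h0
    exact List.map_injective_iff.2 f.injective h0
  · rcases h1 with ⟨h1, h2⟩ | ⟨φ, h1, h2⟩
    · exact .inl ⟨hbase _ _ h1, fun e => g.injective (h2 _)⟩
    · refine .inr ⟨φ, hbase _ _ h1, fun e he => ?_⟩
      obtain ⟨⟨n, G, h3⟩, v, hv, hv'⟩ := h2 (g e) (g.injective.ne he)
      obtain ⟨G', h4⟩ := hbox _ _ _ h3
      rw [tgt] at hv
      rw [src] at hv'
      obtain ⟨w, hw, rfl⟩ := List.mem_map.1 hv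
      exact ⟨⟨n, G', h4⟩, w, hw, (List.mem_map_of_injective f.injective).1 hv'⟩

theorem Net.IsCopyable.of_iso {H X : Net} {p h : ℕ} (hH : H.IsCopyable p h) (hi : X.Iso H) :
    X.IsCopyable p h := by
  have hX := hH.hypernet.iso hi.symm
  obtain ⟨f, g, h1, h2, h3, h4, h5, h6⟩ := hi
  refine hH.of_equiv hX f g h2 h4 h5 (fun e b hb => ?_) (fun e n G hG => ?_)
  · have := h6 e
    rw [hb] at this
    exact this.base_right
  · have := h6 e
    rw [hG] at this
    obtain ⟨G', h, _⟩ := this.box_right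
    exact ⟨G', h⟩

theorem Label.plug_eq_box {σ : Hole → Net} {l : Label} {n : ℕ} {G : Net}
    (h : l.plug σ = .box n G) : ∃ G' : Net, l = .box n G' ∧ G = G'.plug σ := by
  cases l with
  | base b => cases h
  | box m G' =>
    rw [Label.plug_box] at h
    cases h
    exact ⟨G', rfl, rfl⟩

/-- A copyable hypernet has no shallow contraction or weakening, so all holes behind it are deep,
and the two pluggings differ in the contents of boxes only. -/
theorem Net.IsCopyable.transfer {Q : Net} {d c : List VLabel} (hQ : Q.IsHypernet d c)
    {σ σ' : Hole → Net} (hσ : WellTyped σ) (hσ' : WellTyped σ') (ht : TreeHoles Q σ) {H : Net}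
    {p h : ℕ} (hH : H.IsCopyable p h) (hi : (Q.plug σ).Iso H) : (Q.plug σ').IsCopyable p h := by
  have hd := Net.allHolesDeep_of_plug ht hi hH.not_isTree
  have h1 := (hH.of_iso hi).of_iso (hd.plug_iso hQ hσ)
  have h2 := hd.plug_iso hQ hσ'
  have hX := h1.hypernet
  obtain ⟨rfl, rfl⟩ := hX.type_unique ((hQ.plug hσ).iso (hd.plug_iso hQ hσ).symm)
  refine (h1.of_equiv ((hQ.plug hσ').iso h2.symm) (Equiv.refl _) (Equiv.refl _) ?_ ?_ ?_ ?_ ?_).of_iso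
    h2.symm
  · exact (List.map_id _).symm
  · exact fun e => (List.map_id _).symm
  · exact fun e => (List.map_id _).symm
  · intro e b hb
    have hb : (Q.lab e).plug σ = .base b := hb
    change (Q.lab e).plug σ' = _
    rw [Label.plug_eq_base hb]
    rfl
  · intro e n G hG
    have hG : (Q.lab e).plug σ = .box n G := hG
    obtain ⟨G', h3, _⟩ := Label.plug_eq_box hG
    change ∃ G', (Q.lab e).plug σ' = _
    rw [h3, Label.plug_box]
    exact ⟨_, rfl⟩

/-- A hypernet that becomes a box edge by plugging trees in its shallow holes is a box edge. -/
theorem Net.IsHypernet.exists_box {Q : Net} {d c d' c' : List VLabel} (hQ : Q.IsHypernet d c)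
    {σ : Hole → Net} (hσ : WellTyped σ) (ht : TreeHoles Q σ) {n : ℕ} {G : Net}
    (hi : (Q.plug σ).Iso (Net.single (.box n G) d' c')) :
    ∃ (e : Q.E) (G' : Net), Q.lab e = .box n G' ∧ (G'.plug σ).Iso G ∧
      ∀ σ', WellTyped σ' → (Q.plug σ').Iso (Net.single (.box n (G'.plug σ')) d' c') := by
  have hd := Net.allHolesDeep_of_plug ht hi fun x => by
    rintro ⟨ℓ, h | h⟩ <;> cases h
  obtain ⟨f, g, h1, h2, h3, h4, h5, h6⟩ := (hd.plug_iso hQ hσ).trans hi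
  obtain ⟨e, he⟩ := g.surjective ()
  have h7 : Label.Iso ((Q.lab e).plug σ) (.box n G) := h6 e
  obtain ⟨G₁, h8, h9⟩ := h7.box_right
  obtain ⟨G', h10, rfl⟩ := Label.plug_eq_box h8
  refine ⟨e, G', h10, h9, fun σ' hσ' => (hd.plug_iso hQ hσ').symm.trans ?_⟩
  refine ⟨f, g, h1, h2, h3, h4, h5, fun e' => ?_⟩
  obtain rfl : e' = e := g.injective rfl
  change Label.Iso ((Q.lab e').plug σ') (.box n (Net.plug G' σ'))
  rw [h10]
  exact .refl _

/-! ## Explicit wirings -/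

-- The wirings of all the rules have numeral sizes, whatever the lengths of their bundles, so
-- `decide` settles their linearity.
set_option synthInstance.maxSize 1000 in
set_option synthInstance.maxHeartbeats 200000 in
instance {r k : ℕ} (ins outs : List (Fin r)) (S : Fin k → List (Fin r) × List (Fin r)) :
    Decidable (Linear ins outs S) :=
  decidable_of_iff
    ((ins.Nodup ∧ outs.Nodup ∧ (∀ j, (S j).1.Nodup) ∧ (∀ j, (S j).2.Nodup) ∧
      ∀ j, ∀ i ∈ (S j).1, i ∉ (S j).2) ∧
      (∀ j j', j ≠ j' → ∀ i ∈ (S j).1, i ∉ (S j').1) ∧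
      (∀ j j', j ≠ j' → ∀ i ∈ (S j).2, i ∉ (S j').2) ∧
      (∀ i, i ∈ ins ↔ ∀ j, i ∉ (S j).2) ∧ (∀ i, i ∈ outs ↔ ∀ j, i ∉ (S j).1) ∧
      ∀ i ∈ ins, i ∉ outs)
    ⟨fun ⟨⟨h1, h2, h3, h4, h5⟩, h6, h7, h8, h9, h10⟩ => ⟨h1, h2, h3, h4, h5, h6, h7, h8, h9, h10⟩,
      fun ⟨h1, h2, h3, h4, h5, h6, h7, h8, h9, h10⟩ => ⟨⟨h1, h2, h3, h4, h5⟩, h6, h7, h8, h9, h10⟩⟩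

/-- Decomposition of a hypernet along a diagram in which only the components selected by `tr` may
have contractions or weakenings. -/
theorem exists_wiring_of_select {X : Net} {d c : List VLabel} (hX : X.IsHypernet d c)
    {σ : Hole → Net} (hσ : WellTyped σ) (ht : TreeHoles X σ) {r k : ℕ} {w : Fin r → List VLabel}
    {ins outs : List (Fin r)} {F : Fin k → Net} {S : Fin k → List (Fin r) × List (Fin r)}
    (tr : Fin k → Bool) (h : Linear ins outs S)
    (hF : ∀ j, (F j).IsHypernet ((S j).1.flatMap w) ((S j).2.flatMap w))
    (sep : ∀ j j', tr j = true → tr j' = true → ∀ i ∈ (S j).2, i ∉ (S j').1)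
    (htr : ∀ j, tr j = false → ∀ x, ¬ ((F j).lab x).IsTree)
    (hi : (X.plug σ).Iso (wiring w ins outs F S).flatten) :
    ∃ F' : Fin k → Net,
      (∀ j, (F' j).IsHypernet ((S j).1.flatMap w) ((S j).2.flatMap w)) ∧
      X.Iso (wiring w ins outs F' S).flatten ∧ (∀ j, ((F' j).plug σ).Iso (F j)) ∧
      ∀ j x, ∃ e, (F' j).lab x = X.lab e := by
  have : ∀ j, (∃ x, ((F j).lab x).IsTree) → tr j = true := fun j ⟨x, hx⟩ => by
    cases hj : tr j with
    | true => rfl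
    | false => exact absurd hx (htr j hj x)
  exact exists_wiring hX hσ ht h hF (fun j j' h1 h2 => sep j j' (this _ h1) (this _ h2)) hi

theorem Net.single_not_isTree {l : Label} {d c : List VLabel} (h : ¬ l.IsTree)
    (x : (Net.single l d c).E) : ¬ ((Net.single l d c).lab x).IsTree := h

theorem Net.base_labels {b : BLabel} (h : ¬ (Label.base b).IsTree) (x : (Net.base b).E) :
    ∃ b', (Net.base b).lab x = .base b' ∧ ¬ (Label.base b').IsTree := ⟨b, rfl, h⟩

theorem Label.not_isTree_atom : ¬ (Label.base .atom).IsTree := by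
  rintro ⟨ℓ, h | h⟩ <;> cases h

/-- A bare atom is rigid. Otherwise the hypernet is cut between its contraction tree and its atom:
the tree transfers, the atom is rigid. -/
theorem IsSharedAtom.transfer {Q : Net} {d c : List VLabel} (hQ : Q.IsHypernet d c)
    {σ σ' : Hole → Net} (hσ : WellTyped σ) (hσ' : WellTyped σ') (ht : TreeHoles Q σ)
    (ht' : TreeHoles Q σ') {A : Net} {k : ℕ} (hA : IsSharedAtom A k) (hi : (Q.plug σ).Iso A) :
    ∃ A', IsSharedAtom A' k ∧ (Q.plug σ').Iso A' := by
  rcases hA with ⟨rfl, rfl⟩ | ⟨C, hC, rfl⟩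
  · exact ⟨_, .inl ⟨rfl, rfl⟩, hQ.rigid hσ hσ' ht hi (Net.base_labels Label.not_isTree_atom)⟩
  · have hL : Linear (r := 3) (k := 2) [0] [2] ![([0], [1]), ([1], [2])] := by decide
    have hty : ∀ C : Net, C.IsContractionTree .dia k → ∀ j : Fin 2, (![C, Net.base .atom] j).IsHypernet
        ((![([0], [1]), ([1], [2])] j : List (Fin 3) × List (Fin 3)).1.flatMap
          ![dias k, [.dia], [.star]])
        ((![([0], [1]), ([1], [2])] j : List (Fin 3) × List (Fin 3)).2.flatMap
          ![dias k, [.dia], [.star]]) := by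
      intro C hC j
      fin_cases j
      · change C.IsHypernet (dias k ++ []) [.dia]
        rw [List.append_nil]
        exact hC.hypernet
      · exact Net.base_isHypernet _
    have heq : ∀ C, diagram ![dias k, [.dia], [.star]] [0] [2]
        [(C, [0], [1]), (Net.base .atom, [1], [2])] =
        (wiring ![dias k, [.dia], [.star]] [0] [2] ![C, Net.base .atom]
          ![([0], [1]), ([1], [2])]).flatten := fun C =>
      diagram_eq _ _ _ _ _ _ fun j => by fin_cases j <;> rfl
    rw [heq] at hi
    -- Only the tree, component `0`, may contain contractions or weakenings, and it does not feed
    -- itself.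
    obtain ⟨F', h1, h2, h3, h4⟩ := exists_wiring_of_select hQ hσ ht ![true, false] hL (hty C hC)
      (by decide) (by
        intro j hj
        fin_cases j
        · cases hj
        · exact Net.single_not_isTree Label.not_isTree_atom) hi
    have t1 : ∀ τ, TreeHoles Q τ → ∀ j, TreeHoles (F' j) τ := fun τ hτ j x ψ hx => by
      obtain ⟨e, he⟩ := h4 j x
      exact hτ e ψ (he ▸ hx)
    have hC' := (hC.iso (h3 0).symm).transfer (h1 0) hσ hσ' (t1 σ ht 0) (t1 σ' ht' 0)
    refine ⟨_, .inr ⟨_, hC', rfl⟩, ?_⟩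
    rw [heq]
    refine (h2.plug hσ' hQ).trans ((plug_wiring hL h1 hσ').symm.trans
      (wiring_congr hL (fun j => (h1 j).plug hσ') fun j => ?_))
    fin_cases j
    · exact .refl _
    · exact (h1 1).rigid hσ hσ' (t1 σ ht 1) (h3 1) (Net.base_labels Label.not_isTree_atom)

/-! ## Residuals -/

/-- The component of a wiring that fills a slot: a constant or a copy of a parameter. -/
def fill {m : ℕ} (P : Fin m × Bool → Net) : Net ⊕ (Fin m × Bool) → Net := Sum.elim id P

/-- What may be put in a slot of type `d ⇒ c`. -/
def SlotTyped {m : ℕ} (Q : Fin m → Net) (d c : List VLabel) : Net ⊕ (Fin m × Bool) → Prop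
  | .inl N => N.HoleFree ∧ N.IsHypernet d c
  | .inr p => (Q p.1).IsHypernet d c

/-- The result of applying a rule to `X`, in which the parts `Q` of `X` persist, or are copied at most
twice: `X.plug σ ↦ N`, and likewise for `σ'`. -/
structure Residual (X : Net) (σ σ' : Hole → Net) (N : Net) where
  m : ℕ
  r : ℕ
  k : ℕ
  Q : Fin m → Net
  w : Fin r → List VLabel
  ins : List (Fin r)
  outs : List (Fin r)
  S : Fin k → List (Fin r) × List (Fin r)
  slot : Fin k → Net ⊕ (Fin m × Bool)
  j₀ : Fin k
  i₀ : Fin r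
  i₁ : Fin r
  linear : Linear ins outs S
  type : X.IsHypernet (ins.flatMap w) (outs.flatMap w)
  -- Jointly injective over all parameters: a hole of the context `X` thus lies in at most one
  -- parameter.
  occ : ∀ b, ∃ F : (Σ q, (Q q).Occ b) → X.Occ b, Function.Injective F
  focusFree : ∀ q, (Q q).FocusFree
  -- Each copy of a parameter, told apart by its Boolean, is used in one slot at most.
  slot_inj : ∃ ι : Fin m × Bool → Fin k, ∀ j p, slot j = .inr p → ι p = j
  slot_typed : ∀ j, SlotTyped Q ((S j).1.flatMap w) ((S j).2.flatMap w) (slot j)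
  slot_token : slot j₀ = .inl (Net.base (.token .search))
  slot_focusFree : ∀ j, j ≠ j₀ → ∀ N, slot j = .inl N → N.FocusFree
  S_token : S j₀ = ([i₀], [i₁])
  w_token : w i₁ = [.star]
  notMem_outs : i₁ ∉ outs
  -- In the second case a box has been opened. It is then recorded that the token enters at the only
  -- input, and that the content of the box hangs directly below the token.
  origin : ∀ q, (∀ x, ∃ e, (Q q).lab x = X.lab e) ∨
    ((∃ e n, X.lab e = .box n (Q q)) ∧ ins = [i₀] ∧
      (∀ j b, slot j = .inr (q, b) → (S j).1 = [i₁]) ∧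
      ∀ e t, X.lab e = .base (.token t) → X.src e = X.ins)
  left : ∃ F : Fin k → Net, N.Iso (wiring w ins outs F S).flatten ∧
    ∀ j, (fill (fun p => (Q p.1).plug σ) (slot j)).Iso (F j)
  right : ∃ (F : Fin k → Net) (L : Net), RuleShape L (wiring w ins outs F S).flatten ∧
    (X.plug σ').Iso L ∧ ∀ j, (fill (fun p => (Q p.1).plug σ') (slot j)).Iso (F j)

/-- The renaming of the holes of a copy of a parameter, avoiding the names below `K`. -/
def copyName (K : ℕ) (b : Bool) (n : ℕ) : ℕ := 2 * n + K + b.toNat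

theorem copyName_injective (K : ℕ) (b : Bool) : Function.Injective (copyName K b) := by
  intro n n' h
  simp only [copyName] at h
  omega

/-- The two copies use names of opposite parity, relative to `K`. -/
theorem copyName_inj {K : ℕ} {b b' : Bool} {n n' : ℕ} (h : copyName K b n = copyName K b' n') :
    b = b' ∧ n = n' := by
  cases b <;> cases b' <;> simp only [copyName, Bool.toNat_false, Bool.toNat_true] at h <;>
    first | omega | exact ⟨rfl, by omega⟩

theorem rename_copyName_inj {K : ℕ} {b b' : Bool} {ψ ψ' : Hole}
    (h : ψ.rename (copyName K b) = ψ'.rename (copyName K b')) : b = b' ∧ ψ = ψ' := by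
  obtain ⟨n, d, c⟩ := ψ
  obtain ⟨n', d', c'⟩ := ψ'
  simp only [Hole.rename, Hole.mk.injEq] at h
  obtain ⟨h1, rfl, rfl⟩ := h
  obtain ⟨rfl, rfl⟩ := copyName_inj h1
  exact ⟨rfl, rfl⟩

/-- The substitution for the renamed holes that corresponds to a substitution for the original ones. -/
def copySubst (K : ℕ) (σ : Hole → Net) (χ : Hole) : Net := σ ⟨(χ.name - K) / 2, χ.dom, χ.cod⟩

/-- Subtracting `K` and halving forgets the copy bit, so both copies of a hole receive the same
hypernet. -/
theorem copySubst_rename (K : ℕ) (σ : Hole → Net) (b : Bool) (ψ : Hole) :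
    copySubst K σ (ψ.rename (copyName K b)) = σ ψ := by
  obtain ⟨n, d, c⟩ := ψ
  have : (copyName K b n - K) / 2 = n := by
    cases b <;> simp only [copyName, Bool.toNat_false, Bool.toNat_true] <;> omega
  simp only [copySubst, Hole.rename, this]

theorem wellTyped_copySubst {K : ℕ} {σ : Hole → Net} (hσ : WellTyped σ) :
    WellTyped (copySubst K σ) := fun _ => hσ _

theorem Net.HoleFree.plug_iso {N : Net} (h : N.HoleFree) {d c : List VLabel}
    (hN : N.IsHypernet d c) (σ : Hole → Net) : (N.plug σ).Iso N := by
  rw [Net.plug_congr (τ := fun ψ => Net.base (.hole ψ)) fun ψ hψ => absurd hψ (h ψ)]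
  exact hN.plug_base_iso

/-! ### The residual context -/

namespace Residual

variable {X : Net} {σ σ' : Hole → Net} {N : Net} (D : Residual X σ σ' N) (K : ℕ)

/-- The components of the residual context. -/
def comp (j : Fin D.k) : Net := fill (fun p => (D.Q p.1).rename (copyName K p.2)) (D.slot j)

/-- The residual context. -/
noncomputable def context : Net := (wiring D.w D.ins D.outs (D.comp K) D.S).flatten

theorem comp_cases (j : Fin D.k) :
    (∃ N, D.slot j = .inl N ∧ D.comp K j = N ∧ N.HoleFree) ∨
      ∃ q b, D.slot j = .inr (q, b) ∧ D.comp K j = (D.Q q).rename (copyName K b) := by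
  have := D.slot_typed j
  unfold comp
  rcases h : D.slot j with N | ⟨q, b⟩
  · rw [h] at this
    exact .inl ⟨N, rfl, rfl, this.1⟩
  · exact .inr ⟨q, b, rfl, rfl⟩

theorem fill_isHypernet {P : Fin D.m × Bool → Net}
    (hP : ∀ p d c, (D.Q p.1).IsHypernet d c → (P p).IsHypernet d c) (j : Fin D.k) :
    (fill P (D.slot j)).IsHypernet ((D.S j).1.flatMap D.w) ((D.S j).2.flatMap D.w) := by
  have := D.slot_typed j
  rcases h : D.slot j with N | p
  · rw [h] at this
    exact this.2
  · rw [h] at this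
    exact hP _ _ _ this

theorem comp_isHypernet (j : Fin D.k) :
    (D.comp K j).IsHypernet ((D.S j).1.flatMap D.w) ((D.S j).2.flatMap D.w) :=
  D.fill_isHypernet (fun _ _ _ h => h.rename _) j

theorem context_wf : (wiring D.w D.ins D.outs (D.comp K) D.S).WF :=
  wiring_wf D.linear (D.comp_isHypernet K)

theorem context_isHypernet :
    (D.context K).IsHypernet (D.ins.flatMap D.w) (D.outs.flatMap D.w) :=
  wiring_isHypernet D.linear (D.comp_isHypernet K)

theorem comp_token : (D.comp K D.j₀).IsSingle (.base (.token .search)) := by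
  unfold comp
  rw [D.slot_token]
  exact Net.single_isSingle _ _ _

theorem comp_focusFree {j : Fin D.k} (hj : j ≠ D.j₀) : (D.comp K j).FocusFree := by
  rcases D.comp_cases K j with ⟨N, h1, h2, _⟩ | ⟨q, b, _, h2⟩
  · rw [h2]; exact D.slot_focusFree j hj N h1
  · rw [h2]; exact (D.focusFree q).rename (copyName_injective K b)

theorem hasHole_context {χ : Hole} (h : (D.context K).HasHole χ) :
    ∃ b ψ, χ = ψ.rename (copyName K b) ∧ X.HasHole ψ := by
  obtain ⟨o⟩ := h
  obtain ⟨j, o⟩ := Graph.occFlatten _ _ o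
  have o : (D.comp K j).Occ (.hole χ) := o
  rcases D.comp_cases K j with ⟨N, _, h2, h3⟩ | ⟨q, b, _, h2⟩
  · rw [h2] at o
    exact absurd ⟨o⟩ (h3 χ)
  · rw [h2] at o
    obtain ⟨ψ, rfl, ⟨o'⟩⟩ := Net.hasHole_rename ⟨o⟩
    obtain ⟨F, _⟩ := D.occ (.hole ψ)
    exact ⟨b, ψ, rfl, ⟨F ⟨q, o'⟩⟩⟩

/-- Two occurrences of one renamed hole have the same copy bit and the same original hole. The
latter occurs once in `X`, so they lie in the same parameter; having the same copy bit too, they lie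
in the same slot. -/
theorem subsingleton_occ (hX : ∀ χ, Subsingleton (X.Occ (.hole χ))) (χ : Hole) :
    Subsingleton ((D.context K).Occ (.hole χ)) := by
  refine (Graph.occFlatten _ _).subsingleton_congr.2 ⟨?_⟩
  rintro ⟨j, o⟩ ⟨j', o'⟩
  change (⟨j, o⟩ : Σ j, (D.comp K j).Occ (.hole χ)) = ⟨j', o'⟩
  have o : (D.comp K j).Occ (.hole χ) := o
  have key : ∀ j, Nonempty ((D.comp K j).Occ (.hole χ)) → ∃ q b ψ, D.slot j = .inr (q, b) ∧
      χ = ψ.rename (copyName K b) ∧ Nonempty ((D.comp K j).Occ (.hole χ) ≃ (D.Q q).Occ (.hole ψ)) := by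
    rintro j ⟨o⟩
    rcases D.comp_cases K j with ⟨N, _, h2, h3⟩ | ⟨q, b, h1, h2⟩
    · rw [h2] at o
      exact absurd ⟨o⟩ (h3 χ)
    · rw [h2] at o ⊢
      obtain ⟨ψ, rfl, _⟩ := Net.hasHole_rename ⟨o⟩
      exact ⟨q, b, ψ, h1, rfl, Net.occ_rename_equiv (copyName_injective K b) (.hole ψ) (D.Q q)⟩
  obtain ⟨q, b, ψ, h1, h2, ⟨f⟩⟩ := key j ⟨o⟩
  obtain ⟨q', b', ψ', h1', h2', ⟨f'⟩⟩ := key j' ⟨o'⟩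
  obtain ⟨rfl, rfl⟩ := rename_copyName_inj (h2.symm.trans h2')
  obtain ⟨F, hF⟩ := D.occ (.hole ψ)
  have h4 : (⟨q, f o⟩ : Σ q, (D.Q q).Occ (.hole ψ)) = ⟨q', f' o'⟩ := hF ((hX ψ).elim _ _)
  obtain rfl : q = q' := congrArg Sigma.fst h4
  obtain ⟨ι, hι⟩ := D.slot_inj
  obtain rfl := (hι _ _ h1).symm.trans (hι _ _ h1')
  have : Subsingleton ((D.Q q).Occ (.hole ψ)) :=
    ⟨fun a a' => eq_of_heq (Sigma.mk.inj (hF ((hX ψ).elim (F ⟨q, a⟩) (F ⟨q, a'⟩)))).2⟩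
  have := f.subsingleton
  exact congrArg _ (this.elim _ _)

theorem context_focussed : (D.context K).Focussed := by
  have hs := D.comp_token K
  have hD := D.context_wf K
  obtain ⟨x, hx⟩ := hs.edge
  have hsrc : (D.context K).src ⟨D.j₀, x⟩ =
      (bundles D.w (D.S D.j₀).1).map (wiring D.w D.ins D.outs (D.comp K) D.S).vtx := by
    refine Eq.trans ?_ (hD.map_embed_ins D.j₀)
    exact congrArg _ (hs.src x)
  have htgt : (D.context K).tgt ⟨D.j₀, x⟩ =
      (bundles D.w (D.S D.j₀).2).map (wiring D.w D.ins D.outs (D.comp K) D.S).vtx := by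
    refine Eq.trans ?_ (hD.map_embed_outs D.j₀)
    exact congrArg _ (hs.tgt x)
  refine ⟨⟨D.j₀, x⟩, .search, hs.lab x, ?_, ?_, ?_⟩
  · rintro t ⟨⟨j, y⟩, o⟩
    by_cases hj : j = D.j₀
    · subst hj
      exact congrArg (Sigma.mk D.j₀) (hx y)
    · exact ((D.comp_focusFree K hj t).false ⟨y, o⟩).elim
  · intro v h1 h2
    rw [hsrc] at h1
    rw [htgt] at h2
    obtain ⟨u, hu, rfl⟩ := List.mem_map.1 h1
    obtain ⟨u', hu', h3⟩ := List.mem_map.1 h2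
    obtain rfl := Graph.vtx_injective _ h3
    exact D.linear.noLoop _ _ (mem_bundles.1 hu) (mem_bundles.1 hu')
  · rintro ⟨_, h2⟩
    -- The token is not exposed: its target bundle is inhabited and is not an output bundle.
    have hlen : 0 < (D.w D.i₁).length := by rw [D.w_token]; exact Nat.one_pos
    have h3 := h2 ((wiring D.w D.ins D.outs (D.comp K) D.S).vtx ⟨D.i₁, ⟨0, hlen⟩⟩) (by
      rw [htgt]
      refine List.mem_map_of_mem (mem_bundles.2 ?_)
      rw [D.S_token]
      exact List.mem_singleton.2 rfl)
    obtain ⟨u, hu, h3⟩ := List.mem_map.1 h3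
    obtain rfl := Graph.vtx_injective _ h3
    exact D.notMem_outs (mem_bundles.1 hu)

/-- Plugging acts on the components one by one. Constants have no holes, and on a renamed parameter
`copySubst` undoes the renaming. -/
theorem context_plug {τ : Hole → Net} (hτ : WellTyped τ) {F : Fin D.k → Net}
    (hF : ∀ j, (fill (fun p => (D.Q p.1).plug τ) (D.slot j)).Iso (F j)) :
    ((D.context K).plug (copySubst K τ)).Iso (wiring D.w D.ins D.outs F D.S).flatten := by
  have hτ' := wellTyped_copySubst (K := K) hτ
  refine (plug_wiring D.linear (D.comp_isHypernet K) hτ').symm.trans ?_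
  refine wiring_congr D.linear (fun j => (D.comp_isHypernet K j).plug hτ') fun j => .trans ?_ (hF j)
  have ht := D.comp_isHypernet K j
  rcases D.comp_cases K j with ⟨N, h1, h2, h3⟩ | ⟨q, b, h1, h2⟩
  · rw [h1, h2]
    rw [h2] at ht
    exact h3.plug_iso ht _
  · rw [h1, h2, Net.plug_rename]
    refine .of_eq (congrArg _ ?_)
    funext ψ
    exact copySubst_rename K τ b ψ

end Residual

/-! ### Plugging the residual context into the outer context -/

theorem wellTyped_plugAt {χ : Hole} {C : Net} (hC : C.IsHypernet χ.dom χ.cod) :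
    open Classical in WellTyped fun ψ => if ψ = χ then C else Net.base (.hole ψ) := by
  intro ψ
  dsimp only
  split
  · next h => rw [h]; exact hC
  · exact Net.base_isHypernet _

theorem Net.IsHypernet.plugAt {C C' : Net} {χ : Hole} {d c : List VLabel} (hC : C.IsHypernet d c)
    (hC' : C'.IsHypernet χ.dom χ.cod) : (C.plugAt χ C').IsHypernet d c :=
  hC.plug (wellTyped_plugAt hC')

theorem Net.occ_base {b b' : BLabel} (o : (Net.base b).Occ b') : b = b' := o.2.down

theorem Net.IsContext.plugAt {C C' : Net} {χ : Hole} (hC : C.IsContext) (hC' : C'.IsContext)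
    (ht : C'.IsHypernet χ.dom χ.cod) (hd : ∀ ψ, C.HasHole ψ → ¬ C'.HasHole ψ) :
    (C.plugAt χ C').IsContext := by
  obtain ⟨⟨d, c, h⟩, hs⟩ := hC
  refine ⟨⟨d, c, h.plugAt ht⟩, fun ψ₀ => ?_⟩
  classical
  obtain ⟨F, hF⟩ := C.occ_plug (fun ψ => if ψ = χ then C' else Net.base (.hole ψ)) ψ₀
  refine ⟨fun a a' => hF ?_⟩
  generalize F a = p
  generalize F a' = p'
  obtain ⟨ψ, o, q⟩ := p
  obtain ⟨ψ', o', q'⟩ := p'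
  -- A hole of the result comes either from `C'`, through `χ`, or unchanged from `C`; by `hd` not
  -- from both.
  have key : ∀ ψ, ((if ψ = χ then C' else Net.base (.hole ψ)).Occ (.hole ψ₀)) →
      (ψ = χ ∧ C'.HasHole ψ₀) ∨ (ψ ≠ χ ∧ ψ = ψ₀) := by
    intro ψ q
    by_cases h : ψ = χ
    · rw [if_pos h] at q
      exact .inl ⟨h, ⟨q⟩⟩
    · rw [if_neg h] at q
      exact .inr ⟨h, by cases Net.occ_base q; rfl⟩
  obtain rfl : ψ = ψ' := by
    rcases key ψ q with ⟨h1, h2⟩ | ⟨h1, h2⟩ <;> rcases key ψ' q' with ⟨h3, h4⟩ | ⟨h3, h4⟩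
    · rw [h1, h3]
    · subst h4; exact absurd h2 (hd _ ⟨o'⟩)
    · subst h2; exact absurd h4 (hd _ ⟨o⟩)
    · rw [h2, h4]
  obtain rfl : o = o' := (hs ψ).elim _ _
  have : Subsingleton ((if ψ = χ then C' else Net.base (.hole ψ)).Occ (.hole ψ₀)) := by
    split
    · exact hC'.2 ψ₀
    · exact ⟨fun a a' => by
        obtain ⟨e, ⟨a⟩⟩ := a
        obtain ⟨e', ⟨a'⟩⟩ := a'
        rfl⟩
  rw [this.elim q q']

theorem LocalRule.iso {G G' N N' : Net} (h : LocalRule G N) (hG : G.Iso G') (hN : N.Iso N') :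
    LocalRule G' N' := by
  obtain ⟨G₀, N₀, h1, h2, h3⟩ := h
  exact ⟨G₀, N₀, h1, hG.symm.trans h2, hN.symm.trans h3⟩

/-- A bound `K` on the names of the holes of `C₁` makes the renamed holes fresh, so the residual
context fits into `C₁`. The two rule instances are the data `left` and `right` of the residual, read
through `context_plug`. -/
theorem Residual.preserves {R : Net → Net → Prop} {C₁ C₂ : Net} {χ : Hole} {σ σ' : Hole → Net}
    {N : Net} (D : Residual C₂ σ σ' N) (hσ : WellTyped σ) (hσ' : WellTyped σ')
    (hC₁ : C₁.IsContext) (hC₂ : C₂.IsContext) (hC₂t : C₂.IsHypernet χ.dom χ.cod)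
    (hR : RelatedOn R C₂ σ σ') (hrule : LocalRule (C₂.plug σ) N) {K : ℕ}
    (hK : ∀ ψ, C₁.HasHole ψ → ψ.name < K) :
    Preserves R C₁ χ C₂ σ σ' N (D.context K) (copySubst K σ) (copySubst K σ') := by
  obtain ⟨h1, h2⟩ := hC₂t.type_unique D.type
  have htype : (D.context K).IsHypernet χ.dom χ.cod := by
    rw [h1, h2]; exact D.context_isHypernet K
  have hctx : (D.context K).IsContext := ⟨⟨_, _, htype⟩, D.subsingleton_occ K hC₂.2⟩
  obtain ⟨F, hN, hF⟩ := D.left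
  obtain ⟨F', L, hL, hX, hF'⟩ := D.right
  have hleft := (D.context_plug K hσ hF).trans hN.symm
  refine ⟨hctx, D.context_focussed K, htype, hC₁.plugAt hctx htype fun ψ h3 h4 => ?_, fun χ' h => ?_,
    hrule.iso (.refl _) hleft.symm, hleft, ⟨L, _, hL, hX, D.context_plug K hσ' hF'⟩⟩
  · obtain ⟨b, ψ', rfl, _⟩ := D.hasHole_context K h4
    have := hK _ h3
    simp only [Hole.rename, copyName] at this
    omega
  · obtain ⟨b, ψ, rfl, h3⟩ := D.hasHole_context K h
    rw [copySubst_rename, copySubst_rename]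
    exact hR ψ h3

/-! ## Constants of the rules -/

theorem Net.holeFree_base {b : BLabel} (h : ∀ χ, b ≠ .hole χ) : (Net.base b).HoleFree :=
  fun χ ⟨o⟩ => h χ (Net.occ_base o)

theorem Net.focusFree_base {b : BLabel} (h : ∀ t, b ≠ .token t) : (Net.base b).FocusFree :=
  fun t => ⟨fun o => h t (Net.occ_base o)⟩

theorem Net.isEmpty_occ_of_base {N : Net} {b : BLabel}
    (h : ∀ x, ∃ b', N.lab x = .base b' ∧ b' ≠ b) : IsEmpty (N.Occ b) := by
  refine ⟨fun ⟨x, o⟩ => ?_⟩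
  obtain ⟨b', h1, h2⟩ := h x
  rw [h1] at o
  exact h2 o.down

theorem Net.holeFree_of_isTree {N : Net} (h : ∀ x, (N.lab x).IsTree) : N.HoleFree := by
  intro χ
  rw [Net.HasHole, not_nonempty_iff]
  refine Net.isEmpty_occ_of_base fun x => ?_
  obtain ⟨ℓ, h | h⟩ := h x
  · exact ⟨_, h, nofun⟩
  · exact ⟨_, h, nofun⟩

theorem Net.focusFree_of_isTree {N : Net} (h : ∀ x, (N.lab x).IsTree) : N.FocusFree := by
  intro t
  refine Net.isEmpty_occ_of_base fun x => ?_
  obtain ⟨ℓ, h | h⟩ := h x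
  · exact ⟨_, h, nofun⟩
  · exact ⟨_, h, nofun⟩

theorem Net.IsStable.rigid_labels {A : Net} {z : List VLabel} (hA : A.IsStable z) (x : A.E) :
    ∃ b, A.lab x = .base b ∧ ¬ (Label.base b).IsTree := by
  rcases hA.lab x with h | ⟨φ, _, h⟩ <;> refine ⟨_, h, ?_⟩ <;> rintro ⟨ℓ, h | h⟩ <;> cases h

theorem Net.IsStable.holeFree {A : Net} {z : List VLabel} (hA : A.IsStable z) : A.HoleFree := by
  intro χ
  rw [Net.HasHole, not_nonempty_iff]
  refine Net.isEmpty_occ_of_base fun x => ?_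
  rcases hA.lab x with h | ⟨φ, _, h⟩ <;> exact ⟨_, h, nofun⟩

theorem Net.IsStable.focusFree {A : Net} {z : List VLabel} (hA : A.IsStable z) :
    A.FocusFree := by
  intro t
  refine Net.isEmpty_occ_of_base fun x => ?_
  rcases hA.lab x with h | ⟨φ, _, h⟩ <;> exact ⟨_, h, nofun⟩

theorem wiring_lab {r k : ℕ} {w : Fin r → List VLabel} {ins outs : List (Fin r)} {F : Fin k → Net}
    {S : Fin k → List (Fin r) × List (Fin r)} {P : Label → Prop} (h : ∀ j x, P ((F j).lab x)) :
    ∀ x, P ((wiring w ins outs F S).flatten.lab x) := fun ⟨j, x⟩ => h j x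

theorem isTree_distributorOne (ℓ : Link) (m : ℕ) : ∀ x, ((distributorOne ℓ m).lab x).IsTree := by
  induction m with
  | zero => exact fun _ => ⟨ℓ, .inl rfl⟩
  | succ m ih =>
    rw [distributorOne, diagram_eq _ _ _ _ ![distributorOne ℓ m, Net.base (.contr ℓ)]
      ![([1], [2]), ([0, 2], [3])] fun j => by fin_cases j <;> rfl]
    refine wiring_lab fun j => ?_
    fin_cases j
    · exact ih
    · exact fun _ => ⟨ℓ, .inr rfl⟩

theorem distributorOne_isHypernet (ℓ : Link) (m : ℕ) :
    (distributorOne ℓ m).IsHypernet (List.replicate m ℓ.label) [ℓ.label] := by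
  induction m with
  | zero => exact Net.base_isHypernet _
  | succ m ih =>
    rw [distributorOne, diagram_eq _ _ _ _ ![distributorOne ℓ m, Net.base (.contr ℓ)]
      ![([1], [2]), ([0, 2], [3])] fun j => by fin_cases j <;> rfl]
    have := wiring_isHypernet (w := ![[ℓ.label], List.replicate m ℓ.label, [ℓ.label], [ℓ.label]])
      (F := ![distributorOne ℓ m, Net.base (.contr ℓ)])
      (by decide : Linear (r := 4) (k := 2) [0, 1] [3] ![([1], [2]), ([0, 2], [3])]) fun j => by
        fin_cases j
        · change Net.IsHypernet _ (List.replicate m ℓ.label ++ []) [ℓ.label]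
          rw [List.append_nil]
          exact ih
        · exact Net.base_isHypernet _
    change Net.IsHypernet _ (ℓ.label :: (List.replicate m ℓ.label ++ [])) [ℓ.label] at this
    rwa [List.append_nil] at this

theorem isTree_distributor (ℓ : Link) (k m : ℕ) : ∀ x, ((distributor ℓ k m).lab x).IsTree :=
  fun ⟨_, x⟩ => isTree_distributorOne ℓ m x

theorem distributor_isHypernet (ℓ : Link) (k m : ℕ) :
    (distributor ℓ k m).IsHypernet (List.replicate (m * k) ℓ.label) (List.replicate k ℓ.label) := by
  let D : Graph Net :=
    { V := (Fin m × Fin k) ⊕ Fin k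
      E := Fin k
      vlab := fun _ => ℓ.label
      ins := (List.finRange m).flatMap (fun i => (List.finRange k).map (fun j => Sum.inl (i, j)))
      outs := (List.finRange k).map Sum.inr
      src := fun j => (List.finRange m).map (fun i => Sum.inl (i, j))
      tgt := fun j => [Sum.inr j]
      lab := fun _ => distributorOne ℓ m }
  have hD : D.WF := by
    refine ⟨⟨inferInstanceAs (Finite ((Fin m × Fin k) ⊕ Fin k)), inferInstanceAs (Finite (Fin k)),
      fun j => ?_, fun j => List.nodup_singleton _, ?_, ?_, ?_, ?_, ?_, ?_, ?_⟩, fun e => ?_⟩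
    · exact (List.nodup_finRange m).map fun i i' h => by cases h; rfl
    · intro v e e' h h'
      obtain ⟨i, _, rfl⟩ := List.mem_map.1 h
      obtain ⟨i', _, h⟩ := List.mem_map.1 h'
      cases h
      rfl
    · intro v e e' h h'
      cases (List.mem_singleton.1 h).symm.trans (List.mem_singleton.1 h')
      rfl
    · refine List.nodup_flatMap.2 ⟨fun i _ => (List.nodup_finRange k).map fun j j' h => by
        cases h; rfl, (List.nodup_finRange m).imp fun hne v h h' => ?_⟩
      obtain ⟨j, _, rfl⟩ := List.mem_map.1 h
      obtain ⟨j', _, h⟩ := List.mem_map.1 h'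
      cases h
      exact hne rfl
    · exact (List.nodup_finRange k).map Sum.inr_injective
    · rintro (⟨i, j⟩ | j)
      · refine ⟨fun _ e h => ?_, fun _ => ?_⟩
        · cases List.mem_singleton.1 h
        · exact List.mem_flatMap.2 ⟨i, List.mem_finRange i, List.mem_map_of_mem (List.mem_finRange j)⟩
      · refine ⟨fun h => ?_, fun h => absurd (List.mem_singleton.2 rfl) (h j)⟩
        obtain ⟨i, _, h⟩ := List.mem_flatMap.1 h
        obtain ⟨j', _, h⟩ := List.mem_map.1 h
        cases h
    · rintro (⟨i, j⟩ | j)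
      · refine ⟨fun h => ?_, fun h => absurd (List.mem_map_of_mem (List.mem_finRange i)) (h j)⟩
        obtain ⟨j', _, h⟩ := List.mem_map.1 h
        cases h
      · refine ⟨fun _ e h => ?_, fun _ => List.mem_map_of_mem (List.mem_finRange j)⟩
        obtain ⟨i, _, h⟩ := List.mem_map.1 h
        cases h
    · intro v h h'
      obtain ⟨i, _, h⟩ := List.mem_flatMap.1 h
      obtain ⟨j, _, rfl⟩ := List.mem_map.1 h
      obtain ⟨j', _, h⟩ := List.mem_map.1 h'
      cases h
    · have := distributorOne_isHypernet ℓ m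
      change (distributorOne ℓ m).IsHypernet (((List.finRange m).map _).map fun _ => ℓ.label) [ℓ.label]
      simpa [Function.comp_def] using this
  have := hD.flatten_isHypernet
  have h1 : D.ins.map D.vlab = List.replicate (m * k) ℓ.label := by
    change ((List.finRange m).flatMap _).map (fun _ => ℓ.label) = _
    simp [List.length_flatMap]
  have h2 : D.outs.map D.vlab = List.replicate k ℓ.label := by
    change ((List.finRange k).map _).map (fun _ => ℓ.label) = _
    simp [Function.comp_def]
  rw [h1, h2] at this
  exact this

/-! ## Decompositions of redexes -/

/-- The assumptions about a context `X` and the substitutions `σ` and `σ'`. -/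
structure Pluggable (X : Net) (σ σ' : Hole → Net) : Prop where
  hypernet : ∃ d c, X.IsHypernet d c
  focussed : X.Focussed
  left : WellTyped σ
  right : WellTyped σ'
  left_tree : TreeHoles X σ
  right_tree : TreeHoles X σ'

/-- `X` decomposes into components `F'` along a wiring, and `σ` plugged in these yields `F`. -/
structure Decomposes (X : Net) (σ σ' : Hole → Net) {r k : ℕ} (w : Fin r → List VLabel)
    (ins outs : List (Fin r)) (F : Fin k → Net) (S : Fin k → List (Fin r) × List (Fin r))
    (F' : Fin k → Net) : Prop extends Pluggable X σ σ' where
  linear : Linear ins outs S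
  typed : ∀ j, (F' j).IsHypernet ((S j).1.flatMap w) ((S j).2.flatMap w)
  iso : X.Iso (wiring w ins outs F' S).flatten
  plug : ∀ j, ((F' j).plug σ).Iso (F j)
  labels : ∀ j x, ∃ e, (F' j).lab x = X.lab e

theorem Pluggable.decompose {X : Net} {σ σ' : Hole → Net} (hX : Pluggable X σ σ') {r k : ℕ}
    {w : Fin r → List VLabel} {ins outs : List (Fin r)} {F : Fin k → Net}
    {S : Fin k → List (Fin r) × List (Fin r)} (tr : Fin k → Bool) (h : Linear ins outs S)
    (sep : ∀ j j', tr j = true → tr j' = true → ∀ i ∈ (S j).2, i ∉ (S j').1)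
    (hF : ∀ j, (F j).IsHypernet ((S j).1.flatMap w) ((S j).2.flatMap w))
    (htr : ∀ j, tr j = false → ∀ x, ¬ ((F j).lab x).IsTree)
    (hi : (X.plug σ).Iso (wiring w ins outs F S).flatten) :
    ∃ F', Decomposes X σ σ' w ins outs F S F' := by
  obtain ⟨d, c, h0⟩ := hX.hypernet
  obtain ⟨F', h1, h2, h3, h4⟩ := exists_wiring_of_select h0 hX.left hX.left_tree tr h hF sep htr hi
  exact ⟨F', hX, h, h1, h2, h3, h4⟩

/-- Occurrences of all three kinds of token are counted together, so a second token is excluded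
whatever its state. -/
theorem Net.Focussed.subsingleton {X : Net} (h : X.Focussed) :
    Subsingleton (Σ t, X.Occ (.token t)) := by
  obtain ⟨e, t, h1, h2, _⟩ := h
  have key : ∀ p : Σ t, X.Occ (.token t), p = ⟨t, e, h1 ▸ ⟨rfl⟩⟩ := by
    rintro ⟨t', e', o⟩
    obtain rfl : e' = e := h2 t' ⟨e', o⟩
    have : ∀ (l : Label) (hl : l = .base (.token t)) (o : l.Occ (.token t')),
        t' = t ∧ HEq o (hl ▸ (⟨rfl⟩ : PLift (BLabel.token t = .token t)) : l.Occ (.token t)) := by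
      rintro l rfl ⟨o⟩
      cases o
      exact ⟨rfl, .rfl⟩
    obtain ⟨rfl, h3⟩ := this _ h1 o
    rw [eq_of_heq h3]
  exact ⟨fun p p' => (key p).trans (key p').symm⟩

theorem Net.Focussed.edge_unique {X : Net} (h : X.Focussed) {e e' : X.E} {t t' : Token}
    (he : X.lab e = .base (.token t)) (he' : X.lab e' = .base (.token t')) : e = e' := by
  obtain ⟨e₀, t₀, _, h2, _⟩ := h
  exact (h2 t ⟨e, he.symm ▸ ⟨rfl⟩⟩).trans (h2 t' ⟨e', he'.symm ▸ ⟨rfl⟩⟩).symm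

namespace Decomposes

variable {X : Net} {σ σ' : Hole → Net} {r k : ℕ} {w : Fin r → List VLabel}
  {ins outs : List (Fin r)} {F : Fin k → Net} {S : Fin k → List (Fin r) × List (Fin r)}
  {F' : Fin k → Net}

theorem tree (D : Decomposes X σ σ' w ins outs F S F') (j : Fin k) : TreeHoles (F' j) σ :=
  fun x ψ hx => by
    obtain ⟨e, he⟩ := D.labels j x
    exact D.left_tree e ψ (he ▸ hx)

theorem tree' (D : Decomposes X σ σ' w ins outs F S F') (j : Fin k) : TreeHoles (F' j) σ' :=
  fun x ψ hx => by
    obtain ⟨e, he⟩ := D.labels j x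
    exact D.right_tree e ψ (he ▸ hx)

theorem rigid (D : Decomposes X σ σ' w ins outs F S F') (j : Fin k)
    (h : ∀ x, ∃ b, (F j).lab x = .base b ∧ ¬ (Label.base b).IsTree) :
    ((F' j).plug σ').Iso (F j) :=
  (D.typed j).rigid D.left D.right (D.tree j) (D.plug j) h

theorem occ (D : Decomposes X σ σ' w ins outs F S F') (b : BLabel) :
    ∃ f : (Σ j, (F' j).Occ b) → X.Occ b, Function.Injective f := by
  obtain ⟨e⟩ := D.iso.occ_equiv b
  exact ⟨_, (e.trans (Graph.occFlatten _ b)).symm.injective⟩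

theorem occ_comp (D : Decomposes X σ σ' w ins outs F S F') {m : ℕ} {ι : Fin m → Fin k}
    (hι : Function.Injective ι) (b : BLabel) :
    ∃ f : (Σ q, (F' (ι q)).Occ b) → X.Occ b, Function.Injective f := by
  obtain ⟨f, hf⟩ := D.occ b
  refine ⟨fun p => f ⟨ι p.1, p.2⟩, ?_⟩
  rintro ⟨q, o⟩ ⟨q', o'⟩ h
  have h1 := hf h
  obtain rfl : q = q' := hι (congrArg Sigma.fst h1)
  exact congrArg _ (eq_of_heq (Sigma.mk.inj h1).2)

/-- Rigidity applied with the identity substitution: the component of `X` behind a token edge is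
that token edge already. -/
theorem token_iso (D : Decomposes X σ σ' w ins outs F S F') {j₀ : Fin k} {t : Token}
    (h₀ : F j₀ = Net.base (.token t)) : (F' j₀).Iso (Net.base (.token t)) :=
  (D.typed j₀).plug_base_iso.symm.trans ((D.typed j₀).rigid D.left wellTyped_base (D.tree j₀)
    (h₀ ▸ D.plug j₀) (Net.base_labels (by rintro ⟨ℓ, h | h⟩ <;> cases h)))

theorem token_src (D : Decomposes X σ σ' w ins outs F S F') {j₀ : Fin k} {t : Token}
    (h₀ : F j₀ = Net.base (.token t)) (hS : (S j₀).1 = ins) {e : X.E} {t' : Token}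
    (he : X.lab e = .base (.token t')) : X.src e = X.ins := by
  obtain ⟨f, g, _, h1, _, h2, _, h3⟩ := (D.token_iso h₀).symm
  obtain ⟨f', g', _, h1', _, h2', _, h3'⟩ := D.iso
  -- The edge of `X` that corresponds to the token component is the given token edge, since `X` is
  -- focussed.
  obtain ⟨e₁, he₁⟩ := g'.surjective ⟨j₀, g ()⟩
  have hl : X.lab e₁ = .base (.token t) := by
    have h4 := h3' e₁
    rw [he₁] at h4
    have h5 : (F' j₀).lab (g ()) = .base (.token t) := (h3 ()).base_left
    exact (h5 ▸ h4 : (X.lab e₁).Iso (.base (.token t))).base_right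
  obtain rfl := D.focussed.edge_unique he hl
  refine f'.injective.list_map ?_
  rw [← h2', he₁, ← h1']
  have h6 : (F' j₀).src (g ()) = (F' j₀).ins := (h2 ()).trans h1.symm
  refine (congrArg (List.map _) h6).trans (((wiring_wf D.linear D.typed).map_embed_ins j₀).trans ?_)
  exact congrArg (fun l => (bundles w l).map _) hS

/-- The token component uses up the only token of `X`, so no other component can have one. -/
theorem focusFree (D : Decomposes X σ σ' w ins outs F S F') {j₀ : Fin k} {t : Token}
    (h₀ : F j₀ = Net.base (.token t)) {j : Fin k} (hj : j ≠ j₀) : (F' j).FocusFree := by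
  intro t'
  refine ⟨fun o => hj ?_⟩
  have h1 := D.token_iso h₀
  obtain ⟨e⟩ := h1.occ_equiv (.token t)
  have := D.focussed.subsingleton
  have h2 : ∀ t, ∃ f : (Σ j, (F' j).Occ (.token t)) → X.Occ (.token t), Function.Injective f :=
    fun t => D.occ _
  choose f hf using h2
  have h3 : (⟨t', f t' ⟨j, o⟩⟩ : Σ t, X.Occ (.token t)) = ⟨t, f t ⟨j₀, e.symm ⟨(), ⟨rfl⟩⟩⟩⟩ :=
    this.elim _ _
  obtain rfl : t' = t := congrArg Sigma.fst h3
  exact congrArg Sigma.fst (hf _ (eq_of_heq (Sigma.mk.inj h3).2))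

theorem type (D : Decomposes X σ σ' w ins outs F S F') :
    X.IsHypernet (ins.flatMap w) (outs.flatMap w) :=
  (wiring_isHypernet D.linear D.typed).iso D.iso.symm

/-- This is how the other redex is recognized: the decomposition of `X` is plugged with `σ'`
componentwise, and each component is replaced with the hypernet expected by the rule. -/
theorem plug_iso (D : Decomposes X σ σ' w ins outs F S F') {E : Fin k → Net}
    (hE : ∀ j, ((F' j).plug σ').Iso (E j)) :
    (X.plug σ').Iso (wiring w ins outs E S).flatten :=
  (D.iso.plug D.right D.type).trans ((plug_wiring D.linear D.typed D.right).symm.trans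
    (wiring_congr D.linear (fun j => (D.typed j).plug D.right) hE))

end Decomposes

theorem RuleShape.of_eq {L N N' : Net} (h : RuleShape L N) (e : N = N') : RuleShape L N' := e ▸ h

/-! ## Residuals of the rules -/

theorem wiring_eq_diagram {r k : ℕ} (w : Fin r → List VLabel) (ins outs : List (Fin r))
    (es : List (Net × List (Fin r) × List (Fin r))) (F : Fin k → Net)
    (S : Fin k → List (Fin r) × List (Fin r)) (hk : es.length = k)
    (h : ∀ j, es.get j = (F (j.cast hk), S (j.cast hk))) :
    (wiring w ins outs F S).flatten = diagram w ins outs es := by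
  subst hk
  exact (diagram_eq w ins outs es F S h).symm

theorem Label.not_isTree_base {b : BLabel} (h : ∀ ℓ, b ≠ .weak ℓ ∧ b ≠ .contr ℓ) :
    ¬ (Label.base b).IsTree := by
  rintro ⟨ℓ, h' | h'⟩ <;> cases h'
  · exact (h ℓ).1 rfl
  · exact (h ℓ).2 rfl

theorem Decomposes.rigid_base {X : Net} {σ σ' : Hole → Net} {r k : ℕ} {w : Fin r → List VLabel}
    {ins outs : List (Fin r)} {F : Fin k → Net} {S : Fin k → List (Fin r) × List (Fin r)}
    {F' : Fin k → Net} (D : Decomposes X σ σ' w ins outs F S F') (j : Fin k) {b : BLabel}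
    (h : F j = Net.base b) (hb : ∀ ℓ, b ≠ .weak ℓ ∧ b ≠ .contr ℓ) :
    ((F' j).plug σ').Iso (Net.base b) := by
  rw [← h]
  refine D.rigid j ?_
  rw [h]
  exact Net.base_labels (Label.not_isTree_base hb)

theorem Net.base_not_isTree {b : BLabel} (hb : ∀ ℓ, b ≠ .weak ℓ ∧ b ≠ .contr ℓ)
    (x : (Net.base b).E) : ¬ ((Net.base b).lab x).IsTree := Label.not_isTree_base hb

theorem isHypernet_of_eq {N : Net} {d c d' c' : List VLabel} (h : N.IsHypernet d c) (hd : d = d')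
    (hc : c = c') : N.IsHypernet d' c' := hd ▸ hc ▸ h

/-- The parameters are the contraction tree and the copyable hypernet. The latter appears twice on
the right, and this is why residuals distinguish copies by a Boolean. -/
theorem residual_contraction {X N : Net} {σ σ' : Hole → Net} (hX : Pluggable X σ σ') {C H : Net}
    {k₁ k₂ p h : ℕ} (hC : C.IsContractionTree .star (k₁ + 1 + k₂)) (hH : H.IsCopyable p h)
    (hi : (X.plug σ).Iso
      (diagram ![[.star], [.star], stars k₁, stars k₂, [.star], stars p, dias h] [2, 0, 3] [5, 6]
        [(Net.base (.token .rewrite), [0], [1]), (C, [2, 1, 3], [4]), (H, [4], [5, 6])]))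
    (hN : N.Iso (diagram ![[.star], [.star], stars k₁, stars k₂, [.star], stars p, dias h, [.star],
          stars p, dias h, stars p, dias h] [2, 0, 3] [5, 6]
        [(Net.base (.token .search), [0], [1]), (H, [1], [8, 9]),
          (Net.base (.weak .star), [], [7]), (C, [2, 7, 3], [4]), (H, [4], [10, 11]),
          (distributor .star p 2, [8, 10], [5]), (distributor .dia h 2, [9, 11], [6])])) :
    Nonempty (Residual X σ σ' N) := by
  obtain ⟨F', D⟩ := hX.decompose (r := 7) (k := 3)
    (F := ![Net.base (.token .rewrite), C, H]) (S := ![([0], [1]), ([2, 1, 3], [4]), ([4], [5, 6])])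
    -- Shallow contractions and weakenings occur in `C` only; a copyable hypernet can have them only
    -- inside its boxes.
    ![false, true, false] (by decide) (by decide)
    (by
      intro j
      fin_cases j
      · exact Net.base_isHypernet _
      · refine isHypernet_of_eq hC.hypernet ?_ rfl
        change _ = stars k₁ ++ ([VLabel.star] ++ (stars k₂ ++ []))
        rw [List.replicate_add, List.replicate_add, List.append_nil, List.append_assoc]
        rfl
      · refine isHypernet_of_eq hH.hypernet rfl ?_
        change _ = stars p ++ (dias h ++ [])
        rw [List.append_nil])
    (by
      intro j hj
      fin_cases j
      · exact Net.base_not_isTree fun _ => ⟨nofun, nofun⟩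
      · cases hj
      · exact hH.not_isTree)
    (hi.trans (.of_eq (diagram_eq _ _ _ _ _ _ fun j => by fin_cases j <;> rfl)))
  have hC' := (hC.iso (D.plug 1).symm).transfer (D.typed 1) D.left D.right (D.tree 1) (D.tree' 1)
  have hH' := hH.transfer (D.typed 2) D.left D.right (D.tree 2) (D.plug 2)
  exact ⟨{
    m := 2
    r := 12
    k := 7
    Q := F' ∘ ![1, 2]
    w := ![[.star], [.star], stars k₁, stars k₂, [.star], stars p, dias h, [.star],
          stars p, dias h, stars p, dias h]
    ins := [2, 0, 3]
    outs := [5, 6]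
    S := ![([0], [1]), ([1], [8, 9]), ([], [7]), ([2, 7, 3], [4]), ([4], [10, 11]),
      ([8, 10], [5]), ([9, 11], [6])]
    slot := ![.inl (Net.base (.token .search)), .inr (1, false), .inl (Net.base (.weak .star)),
      .inr (0, false), .inr (1, true), .inl (distributor .star p 2), .inl (distributor .dia h 2)]
    j₀ := 0
    i₀ := 0
    i₁ := 1
    linear := by decide
    -- Both sides of the rule have the same interface, with the same labels on the bundles.
    type := D.type
    occ := D.occ_comp (by decide)
    focusFree := fun q => D.focusFree (j₀ := 0) rfl (by fin_cases q <;> decide)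
    -- Parameter `0` is the tree, in slot `3`; the copies `false` and `true` of parameter `1` are in
    -- slots `1` and `4`.
    slot_inj := ⟨fun p => if p.1 = 0 then 3 else if p.2 then 4 else 1,
      fun j p h => by fin_cases j <;> cases h <;> rfl⟩
    slot_typed := fun j => by
      fin_cases j
      · exact ⟨Net.holeFree_base nofun, Net.base_isHypernet _⟩
      · exact D.typed 2
      · exact ⟨Net.holeFree_base nofun, Net.base_isHypernet _⟩
      · exact D.typed 1
      · exact D.typed 2
      · refine ⟨Net.holeFree_of_isTree (isTree_distributor _ _ _),
          isHypernet_of_eq (distributor_isHypernet .star p 2) ?_ ?_⟩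
        · change _ = stars p ++ (stars p ++ [])
          rw [two_mul, List.replicate_add, List.append_nil]
          rfl
        · exact (List.append_nil _).symm
      · refine ⟨Net.holeFree_of_isTree (isTree_distributor _ _ _),
          isHypernet_of_eq (distributor_isHypernet .dia h 2) ?_ ?_⟩
        · change _ = dias h ++ (dias h ++ [])
          rw [two_mul, List.replicate_add, List.append_nil]
          rfl
        · exact (List.append_nil _).symm
    slot_token := rfl
    slot_focusFree := fun j hj N h => by
      fin_cases j <;> cases h
      · exact absurd rfl hj
      · exact Net.focusFree_base nofun
      · exact Net.focusFree_of_isTree (isTree_distributor _ _ _)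
      · exact Net.focusFree_of_isTree (isTree_distributor _ _ _)
    S_token := rfl
    w_token := rfl
    notMem_outs := by decide
    origin := fun q => .inl (D.labels _)
    left := ⟨![Net.base (.token .search), H, Net.base (.weak .star), C, H, distributor .star p 2,
        distributor .dia h 2],
      hN.trans (.of_eq (diagram_eq _ _ _ _ _ _ fun j => by fin_cases j <;> rfl)), fun j => by
        fin_cases j
        · exact .refl _
        · exact D.plug 2
        · exact .refl _
        · exact D.plug 1
        · exact D.plug 2
        · exact .refl _
        · exact .refl _⟩
    right := ⟨![Net.base (.token .search), (F' 2).plug σ', Net.base (.weak .star), (F' 1).plug σ',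
        (F' 2).plug σ', distributor .star p 2, distributor .dia h 2], _,
      (RuleShape.contraction _ _ _ _ _ _ hC' hH').of_eq
        (diagram_eq _ _ _ _ _ _ fun j => by fin_cases j <;> rfl),
      (D.plug_iso (E := ![Net.base (.token .rewrite), (F' 1).plug σ', (F' 2).plug σ']) fun j => by
        fin_cases j
        · exact D.rigid_base 0 rfl fun _ => ⟨nofun, nofun⟩
        · exact .refl _
        · exact .refl _).trans
        (.of_eq (wiring_eq_diagram _ _ _ _ _ _ rfl fun j => by fin_cases j <;> rfl)), fun j => by
      fin_cases j <;> exact .refl _⟩ }⟩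

theorem dias_one_add (k : ℕ) : dias (1 + k) = .dia :: (dias k ++ []) := by
  rw [add_comm, List.append_nil]
  rfl

theorem dias_two_add (k : ℕ) : dias (2 + k) = .dia :: .dia :: (dias k ++ []) := by
  rw [add_comm, List.append_nil]
  rfl

theorem Net.IsStable.not_isTree {A : Net} {z : List VLabel} (hA : A.IsStable z) (x : A.E) :
    ¬ (A.lab x).IsTree := by
  obtain ⟨b, h1, h2⟩ := hA.rigid_labels x
  rwa [h1]

theorem IsSharedAtom.isHypernet {A : Net} {k : ℕ} (h : IsSharedAtom A k) :
    A.IsHypernet (dias k) [.star] := by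
  rcases h with ⟨rfl, rfl⟩ | ⟨C, hC, rfl⟩
  · exact Net.base_isHypernet _
  · have := wiring_isHypernet (w := ![dias k, [.dia], [.star]]) (F := ![C, Net.base .atom])
      (by decide : Linear (r := 3) (k := 2) [0] [2] ![([0], [1]), ([1], [2])]) fun j => by
        fin_cases j
        · exact isHypernet_of_eq hC.hypernet (List.append_nil _).symm rfl
        · exact Net.base_isHypernet _
    rw [wiring_eq_diagram _ _ _ [(C, [0], [1]), (Net.base .atom, [1], [2])] _ _ rfl
      fun j => by fin_cases j <;> rfl] at this
    exact isHypernet_of_eq this (List.append_nil _) rfl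

/-- No parameter is needed: the stable argument is rigid, so it is a constant of the right-hand
side. -/
theorem residual_ref {X N : Net} {σ σ' : Hole → Net} (hX : Pluggable X σ σ') {A : Net}
    {z : List VLabel} (hA : A.IsStable z)
    (hi : (X.plug σ).Iso (diagram ![[.star], [.star], [.star], z] [0] [3]
        [(Net.base (.token .rewrite), [0], [1]), (Net.base (.op .ref), [1], [2]), (A, [2], [3])]))
    (hN : N.Iso (diagram ![[.star], [.star], [.dia], [.star], z] [0] [4]
        [(Net.base (.token .search), [0], [1]), (Net.base .inst, [1], [2]),
          (Net.base .atom, [2], [3]), (A, [3], [4])])) :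
    Nonempty (Residual X σ σ' N) := by
  obtain ⟨F', D⟩ := hX.decompose (r := 4) (k := 3)
    (F := ![Net.base (.token .rewrite), Net.base (.op .ref), A])
    (S := ![([0], [1]), ([1], [2]), ([2], [3])])
    ![false, false, false] (by decide) (by decide)
    (by
      intro j
      fin_cases j
      · exact Net.base_isHypernet _
      · exact Net.base_isHypernet _
      · exact isHypernet_of_eq hA.hypernet rfl (List.append_nil _).symm)
    (by
      intro j hj
      fin_cases j
      · exact Net.base_not_isTree (fun _ => ⟨nofun, nofun⟩)
      · exact Net.base_not_isTree (fun _ => ⟨nofun, nofun⟩)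
      · exact hA.not_isTree)
    (hi.trans (.of_eq (diagram_eq _ _ _ _ _ _ fun j => by fin_cases j <;> rfl)))
  exact ⟨{
    m := 0
    r := 5
    k := 4
    Q := F' ∘ ![]
    w := ![[.star], [.star], [.dia], [.star], z]
    ins := [0]
    outs := [4]
    S := ![([0], [1]), ([1], [2]), ([2], [3]), ([3], [4])]
    slot := ![.inl (Net.base (.token .search)), .inl (Net.base .inst), .inl (Net.base .atom), .inl A]
    j₀ := 0
    i₀ := 0
    i₁ := 1
    linear := by decide
    type := D.type
    occ := D.occ_comp (by decide)
    focusFree := fun q => q.elim0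
    slot_inj := ⟨fun p => 0, fun j p h => by fin_cases j <;> cases h⟩
    slot_typed := fun j => by
      fin_cases j
      · exact ⟨Net.holeFree_base nofun, Net.base_isHypernet _⟩
      · exact ⟨Net.holeFree_base nofun, Net.base_isHypernet _⟩
      · exact ⟨Net.holeFree_base nofun, Net.base_isHypernet _⟩
      · exact ⟨hA.holeFree, isHypernet_of_eq hA.hypernet rfl (List.append_nil _).symm⟩
    slot_token := rfl
    slot_focusFree := fun j hj N h => by
      fin_cases j <;> cases h
      · exact absurd rfl hj
      · exact Net.focusFree_base nofun
      · exact Net.focusFree_base nofun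
      · exact hA.focusFree
    S_token := rfl
    w_token := rfl
    notMem_outs := by decide
    origin := fun q => q.elim0
    left := ⟨![Net.base (.token .search), Net.base .inst, Net.base .atom, A],
      hN.trans (.of_eq (diagram_eq _ _ _ _ _ _ fun j => by fin_cases j <;> rfl)), fun j => by
        fin_cases j <;> exact .refl _⟩
    right := ⟨![Net.base (.token .search), Net.base .inst, Net.base .atom, A], _,
      (RuleShape.ref _ _ hA).of_eq (diagram_eq _ _ _ _ _ _ fun j => by fin_cases j <;> rfl),
      (D.plug_iso (E := ![Net.base (.token .rewrite), Net.base (.op .ref), A]) fun j => by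
        fin_cases j
        · exact D.rigid_base 0 rfl fun _ => ⟨nofun, nofun⟩
        · exact D.rigid_base 1 rfl fun _ => ⟨nofun, nofun⟩
        · exact D.rigid 2 hA.rigid_labels).trans
        (.of_eq (wiring_eq_diagram _ _ _ _ _ _ rfl fun j => by fin_cases j <;> rfl)), fun j => by
      fin_cases j <;> exact .refl _⟩ }⟩

/-- Only the shared atom can contain holes. It is the one parameter, and it appears once on the
right. -/
theorem residual_eqTrue {X N : Net} {σ σ' : Hole → Net} (hX : Pluggable X σ σ') {A : Net} {k : ℕ}
    (hA : IsSharedAtom A (2 + k))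
    (hi : (X.plug σ).Iso
      (diagram ![[.star], [.star], [.star], [.star], [.dia], [.dia], dias k, [.star]] [0, 6] [7]
        [(Net.base (.token .rewrite), [0], [1]), (Net.base (.op .eq), [1], [2, 3]),
          (Net.base .inst, [2], [4]), (Net.base .inst, [3], [5]), (A, [4, 5, 6], [7])]))
    (hN : N.Iso (diagram ![[.star], [.star], [.dia], [.dia], dias k, [.star]] [0, 4] [5]
        [(Net.base (.token .search), [0], [1]), (Net.base (.op .tt), [1], []),
          (Net.base (.weak .dia), [], [2]), (Net.base (.weak .dia), [], [3]),
          (A, [2, 3, 4], [5])])) :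
    Nonempty (Residual X σ σ' N) := by
  obtain ⟨F', D⟩ := hX.decompose (r := 8) (k := 5)
    (F := ![Net.base (.token .rewrite), Net.base (.op .eq), Net.base .inst, Net.base .inst, A])
    (S := ![([0], [1]), ([1], [2, 3]), ([2], [4]), ([3], [5]), ([4, 5, 6], [7])])
    ![false, false, false, false, true] (by decide) (by decide)
    (by
      intro j
      fin_cases j
      · exact Net.base_isHypernet _
      · exact Net.base_isHypernet _
      · exact Net.base_isHypernet _
      · exact Net.base_isHypernet _
      · exact isHypernet_of_eq hA.isHypernet (dias_two_add k) rfl)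
    (by
      intro j hj
      fin_cases j <;> first | (cases hj; done) | exact Net.base_not_isTree fun _ => ⟨nofun, nofun⟩)
    (hi.trans (.of_eq (diagram_eq _ _ _ _ _ _ fun j => by fin_cases j <;> rfl)))
  obtain ⟨A', hA', hi'⟩ := hA.transfer (D.typed 4) D.left D.right (D.tree 4) (D.tree' 4) (D.plug 4)
  exact ⟨{
    m := 1
    r := 6
    k := 5
    Q := F' ∘ ![4]
    w := ![[.star], [.star], [.dia], [.dia], dias k, [.star]]
    ins := [0, 4]
    outs := [5]
    S := ![([0], [1]), ([1], []), ([], [2]), ([], [3]), ([2, 3, 4], [5])]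
    slot := ![.inl (Net.base (.token .search)), .inl (Net.base (.op .tt)),
      .inl (Net.base (.weak .dia)), .inl (Net.base (.weak .dia)), .inr (0, false)]
    j₀ := 0
    i₀ := 0
    i₁ := 1
    linear := by decide
    type := D.type
    occ := D.occ_comp (by decide)
    focusFree := fun q => D.focusFree (j₀ := 0) rfl (by fin_cases q; decide)
    slot_inj := ⟨fun p => 4, fun j p h => by fin_cases j <;> cases h <;> rfl⟩
    slot_typed := fun j => by
      fin_cases j
      · exact ⟨Net.holeFree_base nofun, Net.base_isHypernet _⟩
      · exact ⟨Net.holeFree_base nofun, Net.base_isHypernet _⟩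
      · exact ⟨Net.holeFree_base nofun, Net.base_isHypernet _⟩
      · exact ⟨Net.holeFree_base nofun, Net.base_isHypernet _⟩
      · exact D.typed 4
    slot_token := rfl
    slot_focusFree := fun j hj N h => by
      fin_cases j <;> cases h
      · exact absurd rfl hj
      all_goals exact Net.focusFree_base nofun
    S_token := rfl
    w_token := rfl
    notMem_outs := by decide
    origin := fun q => .inl (D.labels _)
    left := ⟨![Net.base (.token .search), Net.base (.op .tt), Net.base (.weak .dia),
        Net.base (.weak .dia), A],
      hN.trans (.of_eq (diagram_eq _ _ _ _ _ _ fun j => by fin_cases j <;> rfl)), fun j => by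
        fin_cases j <;> first | exact D.plug 4 | exact .refl _⟩
    right := ⟨![Net.base (.token .search), Net.base (.op .tt), Net.base (.weak .dia),
        Net.base (.weak .dia), A'], _,
      (RuleShape.eqTrue _ _ hA').of_eq (diagram_eq _ _ _ _ _ _ fun j => by fin_cases j <;> rfl),
      (D.plug_iso (E := ![Net.base (.token .rewrite), Net.base (.op .eq), Net.base .inst,
        Net.base .inst, A']) fun j => by
        fin_cases j
        · exact D.rigid_base 0 rfl fun _ => ⟨nofun, nofun⟩
        · exact D.rigid_base 1 rfl fun _ => ⟨nofun, nofun⟩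
        · exact D.rigid_base 2 rfl fun _ => ⟨nofun, nofun⟩
        · exact D.rigid_base 3 rfl fun _ => ⟨nofun, nofun⟩
        · exact hi').trans
        (.of_eq (wiring_eq_diagram _ _ _ _ _ _ rfl fun j => by fin_cases j <;> rfl)), fun j => by
      fin_cases j <;> first | exact hi' | exact .refl _⟩ }⟩

/-- Two components may contain contractions, but the two shared atoms lie side by side and neither
feeds the other, so a plugged tree still cannot spread over both. -/
theorem residual_eqFalse {X N : Net} {σ σ' : Hole → Net} (hX : Pluggable X σ σ') {A B : Net}
    {k l : ℕ} (hA : IsSharedAtom A (1 + k)) (hB : IsSharedAtom B (1 + l))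
    (hi : (X.plug σ).Iso
      (diagram ![[.star], [.star], [.star], [.star], [.dia], [.dia], dias k, dias l, [.star],
          [.star]] [0, 6, 7] [8, 9]
        [(Net.base (.token .rewrite), [0], [1]), (Net.base (.op .eq), [1], [2, 3]),
          (Net.base .inst, [2], [4]), (Net.base .inst, [3], [5]), (A, [4, 6], [8]),
          (B, [5, 7], [9])]))
    (hN : N.Iso (diagram ![[.star], [.star], [.dia], [.dia], dias k, dias l, [.star], [.star]]
          [0, 4, 5] [6, 7]
        [(Net.base (.token .search), [0], [1]), (Net.base (.op .ff), [1], []),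
          (Net.base (.weak .dia), [], [2]), (Net.base (.weak .dia), [], [3]), (A, [2, 4], [6]),
          (B, [3, 5], [7])])) :
    Nonempty (Residual X σ σ' N) := by
  obtain ⟨F', D⟩ := hX.decompose (r := 10) (k := 6)
    (F := ![Net.base (.token .rewrite), Net.base (.op .eq), Net.base .inst, Net.base .inst, A, B])
    (S := ![([0], [1]), ([1], [2, 3]), ([2], [4]), ([3], [5]), ([4, 6], [8]), ([5, 7], [9])])
    ![false, false, false, false, true, true] (by decide) (by decide)
    (by
      intro j
      fin_cases j
      · exact Net.base_isHypernet _
      · exact Net.base_isHypernet _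
      · exact Net.base_isHypernet _
      · exact Net.base_isHypernet _
      · exact isHypernet_of_eq hA.isHypernet (dias_one_add k) rfl
      · exact isHypernet_of_eq hB.isHypernet (dias_one_add l) rfl)
    (by
      intro j hj
      fin_cases j <;> first | (cases hj; done) | exact Net.base_not_isTree fun _ => ⟨nofun, nofun⟩)
    (hi.trans (.of_eq (diagram_eq _ _ _ _ _ _ fun j => by fin_cases j <;> rfl)))
  obtain ⟨A', hA', hi'⟩ := hA.transfer (D.typed 4) D.left D.right (D.tree 4) (D.tree' 4) (D.plug 4)
  obtain ⟨B', hB', hj'⟩ := hB.transfer (D.typed 5) D.left D.right (D.tree 5) (D.tree' 5) (D.plug 5)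
  exact ⟨{
    m := 2
    r := 8
    k := 6
    Q := F' ∘ ![4, 5]
    w := ![[.star], [.star], [.dia], [.dia], dias k, dias l, [.star], [.star]]
    ins := [0, 4, 5]
    outs := [6, 7]
    S := ![([0], [1]), ([1], []), ([], [2]), ([], [3]), ([2, 4], [6]), ([3, 5], [7])]
    slot := ![.inl (Net.base (.token .search)), .inl (Net.base (.op .ff)),
      .inl (Net.base (.weak .dia)), .inl (Net.base (.weak .dia)), .inr (0, false), .inr (1, false)]
    j₀ := 0
    i₀ := 0
    i₁ := 1
    linear := by decide
    type := D.type
    occ := D.occ_comp (by decide)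
    focusFree := fun q => D.focusFree (j₀ := 0) rfl (by fin_cases q <;> decide)
    slot_inj := ⟨fun p => if p.1 = 0 then 4 else 5, fun j p h => by
      fin_cases j <;> cases h <;> rfl⟩
    slot_typed := fun j => by
      fin_cases j
      · exact ⟨Net.holeFree_base nofun, Net.base_isHypernet _⟩
      · exact ⟨Net.holeFree_base nofun, Net.base_isHypernet _⟩
      · exact ⟨Net.holeFree_base nofun, Net.base_isHypernet _⟩
      · exact ⟨Net.holeFree_base nofun, Net.base_isHypernet _⟩
      · exact D.typed 4
      · exact D.typed 5
    slot_token := rfl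
    slot_focusFree := fun j hj N h => by
      fin_cases j <;> cases h
      · exact absurd rfl hj
      all_goals exact Net.focusFree_base nofun
    S_token := rfl
    w_token := rfl
    notMem_outs := by decide
    origin := fun q => .inl (D.labels _)
    left := ⟨![Net.base (.token .search), Net.base (.op .ff), Net.base (.weak .dia),
        Net.base (.weak .dia), A, B],
      hN.trans (.of_eq (diagram_eq _ _ _ _ _ _ fun j => by fin_cases j <;> rfl)), fun j => by
        fin_cases j <;> first | exact D.plug 4 | exact D.plug 5 | exact .refl _⟩
    right := ⟨![Net.base (.token .search), Net.base (.op .ff), Net.base (.weak .dia),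
        Net.base (.weak .dia), A', B'], _,
      (RuleShape.eqFalse _ _ _ _ hA' hB').of_eq
        (diagram_eq _ _ _ _ _ _ fun j => by fin_cases j <;> rfl),
      (D.plug_iso (E := ![Net.base (.token .rewrite), Net.base (.op .eq), Net.base .inst,
        Net.base .inst, A', B']) fun j => by
        fin_cases j
        · exact D.rigid_base 0 rfl fun _ => ⟨nofun, nofun⟩
        · exact D.rigid_base 1 rfl fun _ => ⟨nofun, nofun⟩
        · exact D.rigid_base 2 rfl fun _ => ⟨nofun, nofun⟩
        · exact D.rigid_base 3 rfl fun _ => ⟨nofun, nofun⟩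
        · exact hi'
        · exact hj').trans
        (.of_eq (wiring_eq_diagram _ _ _ _ _ _ rfl fun j => by fin_cases j <;> rfl)), fun j => by
      fin_cases j <;> first | exact hi' | exact hj' | exact .refl _⟩ }⟩

/-- The shared atom is a parameter, with its output redirected to the stored value; the value is
stable and hence a constant. -/
theorem residual_assign {X N : Net} {σ σ' : Hole → Net} (hX : Pluggable X σ σ') {A B : Net}
    {k : ℕ} {z : List VLabel} (hA : IsSharedAtom A (1 + k)) (hB : B.IsStable z)
    (hi : (X.plug σ).Iso
      (diagram ![[.star], [.star], [.star], [.star], [.dia], dias k, [.star], z] [0, 5] [6, 7]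
        [(Net.base (.token .rewrite), [0], [1]), (Net.base (.op .assign), [1], [2, 3]),
          (Net.base .inst, [2], [4]), (A, [4, 5], [6]), (B, [3], [7])]))
    (hN : N.Iso (diagram ![[.star], [.star], [.star], [.dia], dias k, [.star], z] [0, 4] [5, 6]
        [(Net.base (.token .search), [0], [1]), (Net.base (.op .unit), [1], []),
          (Net.base (.weak .dia), [], [3]), (A, [3, 4], [2]), (B, [2], [6]),
          (Net.base (.weak .star), [], [5])])) :
    Nonempty (Residual X σ σ' N) := by
  obtain ⟨F', D⟩ := hX.decompose (r := 8) (k := 5)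
    (F := ![Net.base (.token .rewrite), Net.base (.op .assign), Net.base .inst, A, B])
    (S := ![([0], [1]), ([1], [2, 3]), ([2], [4]), ([4, 5], [6]), ([3], [7])])
    ![false, false, false, true, false] (by decide) (by decide)
    (by
      intro j
      fin_cases j
      · exact Net.base_isHypernet _
      · exact Net.base_isHypernet _
      · exact Net.base_isHypernet _
      · exact isHypernet_of_eq hA.isHypernet (dias_one_add k) rfl
      · exact isHypernet_of_eq hB.hypernet rfl (List.append_nil _).symm)
    (by
      intro j hj
      fin_cases j
      · exact Net.base_not_isTree (fun _ => ⟨nofun, nofun⟩)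
      · exact Net.base_not_isTree (fun _ => ⟨nofun, nofun⟩)
      · exact Net.base_not_isTree (fun _ => ⟨nofun, nofun⟩)
      · cases hj
      · exact hB.not_isTree)
    (hi.trans (.of_eq (diagram_eq _ _ _ _ _ _ fun j => by fin_cases j <;> rfl)))
  obtain ⟨A', hA', hi'⟩ := hA.transfer (D.typed 3) D.left D.right (D.tree 3) (D.tree' 3) (D.plug 3)
  exact ⟨{
    m := 1
    r := 7
    k := 6
    Q := F' ∘ ![3]
    w := ![[.star], [.star], [.star], [.dia], dias k, [.star], z]
    ins := [0, 4]
    outs := [5, 6]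
    S := ![([0], [1]), ([1], []), ([], [3]), ([3, 4], [2]), ([2], [6]), ([], [5])]
    slot := ![.inl (Net.base (.token .search)), .inl (Net.base (.op .unit)),
      .inl (Net.base (.weak .dia)), .inr (0, false), .inl B, .inl (Net.base (.weak .star))]
    j₀ := 0
    i₀ := 0
    i₁ := 1
    linear := by decide
    type := D.type
    occ := D.occ_comp (by decide)
    focusFree := fun q => D.focusFree (j₀ := 0) rfl (by fin_cases q; decide)
    slot_inj := ⟨fun p => 3, fun j p h => by fin_cases j <;> cases h <;> rfl⟩
    slot_typed := fun j => by
      fin_cases j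
      · exact ⟨Net.holeFree_base nofun, Net.base_isHypernet _⟩
      · exact ⟨Net.holeFree_base nofun, Net.base_isHypernet _⟩
      · exact ⟨Net.holeFree_base nofun, Net.base_isHypernet _⟩
      · exact D.typed 3
      · exact ⟨hB.holeFree, isHypernet_of_eq hB.hypernet rfl (List.append_nil _).symm⟩
      · exact ⟨Net.holeFree_base nofun, Net.base_isHypernet _⟩
    slot_token := rfl
    slot_focusFree := fun j hj N h => by
      fin_cases j <;> cases h
      · exact absurd rfl hj
      · exact Net.focusFree_base nofun
      · exact Net.focusFree_base nofun
      · exact hB.focusFree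
      · exact Net.focusFree_base nofun
    S_token := rfl
    w_token := rfl
    notMem_outs := by decide
    origin := fun q => .inl (D.labels _)
    left := ⟨![Net.base (.token .search), Net.base (.op .unit), Net.base (.weak .dia), A, B,
        Net.base (.weak .star)],
      hN.trans (.of_eq (diagram_eq _ _ _ _ _ _ fun j => by fin_cases j <;> rfl)), fun j => by
        fin_cases j <;> first | exact D.plug 3 | exact .refl _⟩
    right := ⟨![Net.base (.token .search), Net.base (.op .unit), Net.base (.weak .dia), A', B,
        Net.base (.weak .star)], _,
      (RuleShape.assign _ _ _ _ hA' hB).of_eq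
        (diagram_eq _ _ _ _ _ _ fun j => by fin_cases j <;> rfl),
      (D.plug_iso (E := ![Net.base (.token .rewrite), Net.base (.op .assign), Net.base .inst, A',
        B]) fun j => by
        fin_cases j
        · exact D.rigid_base 0 rfl fun _ => ⟨nofun, nofun⟩
        · exact D.rigid_base 1 rfl fun _ => ⟨nofun, nofun⟩
        · exact D.rigid_base 2 rfl fun _ => ⟨nofun, nofun⟩
        · exact hi'
        · exact D.rigid 4 hB.rigid_labels).trans
        (.of_eq (wiring_eq_diagram _ _ _ _ _ _ rfl fun j => by fin_cases j <;> rfl)), fun j => by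
      fin_cases j <;> first | exact hi' | exact .refl _⟩ }⟩

theorem residual_deref {X N : Net} {σ σ' : Hole → Net} (hX : Pluggable X σ σ') {A : Net} {k : ℕ}
    (hA : IsSharedAtom A (1 + k))
    (hi : (X.plug σ).Iso (diagram ![[.star], [.star], [.star], [.dia], dias k, [.star]] [0, 4] [5]
        [(Net.base (.token .rewrite), [0], [1]), (Net.base (.op .deref), [1], [2]),
          (Net.base .inst, [2], [3]), (A, [3, 4], [5])]))
    (hN : N.Iso (diagram ![[.star], [.star], [.star], [.dia], dias k, [.star]] [0, 4] [5]
        [(Net.base (.token .search), [0], [1]), (Net.base (.weak .dia), [], [3]),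
          (A, [3, 4], [2]), (Net.base (.contr .star), [1, 2], [5])])) :
    Nonempty (Residual X σ σ' N) := by
  obtain ⟨F', D⟩ := hX.decompose (r := 6) (k := 4)
    (F := ![Net.base (.token .rewrite), Net.base (.op .deref), Net.base .inst, A])
    (S := ![([0], [1]), ([1], [2]), ([2], [3]), ([3, 4], [5])])
    ![false, false, false, true] (by decide) (by decide)
    (by
      intro j
      fin_cases j
      · exact Net.base_isHypernet _
      · exact Net.base_isHypernet _
      · exact Net.base_isHypernet _
      · exact isHypernet_of_eq hA.isHypernet (dias_one_add k) rfl)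
    (by
      intro j hj
      fin_cases j <;> first | (cases hj; done) | exact Net.base_not_isTree fun _ => ⟨nofun, nofun⟩)
    (hi.trans (.of_eq (diagram_eq _ _ _ _ _ _ fun j => by fin_cases j <;> rfl)))
  obtain ⟨A', hA', hi'⟩ := hA.transfer (D.typed 3) D.left D.right (D.tree 3) (D.tree' 3) (D.plug 3)
  exact ⟨{
    m := 1
    r := 6
    k := 4
    Q := F' ∘ ![3]
    w := ![[.star], [.star], [.star], [.dia], dias k, [.star]]
    ins := [0, 4]
    outs := [5]
    S := ![([0], [1]), ([], [3]), ([3, 4], [2]), ([1, 2], [5])]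
    slot := ![.inl (Net.base (.token .search)), .inl (Net.base (.weak .dia)), .inr (0, false),
      .inl (Net.base (.contr .star))]
    j₀ := 0
    i₀ := 0
    i₁ := 1
    linear := by decide
    type := D.type
    occ := D.occ_comp (by decide)
    focusFree := fun q => D.focusFree (j₀ := 0) rfl (by fin_cases q; decide)
    slot_inj := ⟨fun p => 2, fun j p h => by fin_cases j <;> cases h <;> rfl⟩
    slot_typed := fun j => by
      fin_cases j
      · exact ⟨Net.holeFree_base nofun, Net.base_isHypernet _⟩
      · exact ⟨Net.holeFree_base nofun, Net.base_isHypernet _⟩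
      · exact D.typed 3
      · exact ⟨Net.holeFree_base nofun, Net.base_isHypernet _⟩
    slot_token := rfl
    slot_focusFree := fun j hj N h => by
      fin_cases j <;> cases h
      · exact absurd rfl hj
      all_goals exact Net.focusFree_base nofun
    S_token := rfl
    w_token := rfl
    notMem_outs := by decide
    origin := fun q => .inl (D.labels _)
    left := ⟨![Net.base (.token .search), Net.base (.weak .dia), A, Net.base (.contr .star)],
      hN.trans (.of_eq (diagram_eq _ _ _ _ _ _ fun j => by fin_cases j <;> rfl)), fun j => by
        fin_cases j <;> first | exact D.plug 3 | exact .refl _⟩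
    right := ⟨![Net.base (.token .search), Net.base (.weak .dia), A', Net.base (.contr .star)], _,
      (RuleShape.deref _ _ hA').of_eq (diagram_eq _ _ _ _ _ _ fun j => by fin_cases j <;> rfl),
      (D.plug_iso (E := ![Net.base (.token .rewrite), Net.base (.op .deref), Net.base .inst, A'])
        fun j => by
        fin_cases j
        · exact D.rigid_base 0 rfl fun _ => ⟨nofun, nofun⟩
        · exact D.rigid_base 1 rfl fun _ => ⟨nofun, nofun⟩
        · exact D.rigid_base 2 rfl fun _ => ⟨nofun, nofun⟩
        · exact hi').trans
        (.of_eq (wiring_eq_diagram _ _ _ _ _ _ rfl fun j => by fin_cases j <;> rfl)), fun j => by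
      fin_cases j <;> first | exact hi' | exact .refl _⟩ }⟩

/-- Addition and subtraction share this proof: apart from the rule instance `hr`, it needs only the
type of the operation, and everything on the right is constant. -/
theorem residual_binary {X N : Net} {σ σ' : Hole → Net} (hX : Pluggable X σ σ') {φ : Op}
    {m n p : ℕ} (hφ : φ.cod = [.star, .star])
    (hr : RuleShape (diagram ![[.star], [.star], [.star], [.star]] [0] []
        [(Net.base (.token .rewrite), [0], [1]), (Net.base (.op φ), [1], [2, 3]),
          (Net.base (.op (.num m)), [2], []), (Net.base (.op (.num n)), [3], [])])
      (diagram ![[.star], [.star]] [0] []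
        [(Net.base (.token .search), [0], [1]), (Net.base (.op (.num p)), [1], [])]))
    (hi : (X.plug σ).Iso (diagram ![[.star], [.star], [.star], [.star]] [0] []
        [(Net.base (.token .rewrite), [0], [1]), (Net.base (.op φ), [1], [2, 3]),
          (Net.base (.op (.num m)), [2], []), (Net.base (.op (.num n)), [3], [])]))
    (hN : N.Iso (diagram ![[.star], [.star]] [0] []
        [(Net.base (.token .search), [0], [1]), (Net.base (.op (.num p)), [1], [])])) :
    Nonempty (Residual X σ σ' N) := by
  obtain ⟨F', D⟩ := hX.decompose (r := 4) (k := 4)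
    (F := ![Net.base (.token .rewrite), Net.base (.op φ), Net.base (.op (.num m)),
      Net.base (.op (.num n))])
    (S := ![([0], [1]), ([1], [2, 3]), ([2], []), ([3], [])])
    ![false, false, false, false] (by decide) (by decide)
    (by
      intro j
      fin_cases j
      · exact Net.base_isHypernet _
      · exact isHypernet_of_eq (Net.base_isHypernet _) rfl hφ
      · exact Net.base_isHypernet _
      · exact Net.base_isHypernet _)
    (by
      intro j hj
      fin_cases j <;> exact Net.base_not_isTree fun _ => ⟨nofun, nofun⟩)
    (hi.trans (.of_eq (diagram_eq _ _ _ _ _ _ fun j => by fin_cases j <;> rfl)))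
  exact ⟨{
    m := 0
    r := 2
    k := 2
    Q := F' ∘ ![]
    w := ![[.star], [.star]]
    ins := [0]
    outs := []
    S := ![([0], [1]), ([1], [])]
    slot := ![.inl (Net.base (.token .search)), .inl (Net.base (.op (.num p)))]
    j₀ := 0
    i₀ := 0
    i₁ := 1
    linear := by decide
    type := D.type
    occ := D.occ_comp (by decide)
    focusFree := fun q => q.elim0
    slot_inj := ⟨fun p => 0, fun j p h => by fin_cases j <;> cases h⟩
    slot_typed := fun j => by
      fin_cases j <;> exact ⟨Net.holeFree_base nofun, Net.base_isHypernet _⟩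
    slot_token := rfl
    slot_focusFree := fun j hj N h => by
      fin_cases j <;> cases h
      · exact absurd rfl hj
      · exact Net.focusFree_base nofun
    S_token := rfl
    w_token := rfl
    notMem_outs := by decide
    origin := fun q => q.elim0
    left := ⟨![Net.base (.token .search), Net.base (.op (.num p))],
      hN.trans (.of_eq (diagram_eq _ _ _ _ _ _ fun j => by fin_cases j <;> rfl)), fun j => by
        fin_cases j <;> exact .refl _⟩
    right := ⟨![Net.base (.token .search), Net.base (.op (.num p))], _,
      hr.of_eq (diagram_eq _ _ _ _ _ _ fun j => by fin_cases j <;> rfl),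
      (D.plug_iso (E := ![Net.base (.token .rewrite), Net.base (.op φ), Net.base (.op (.num m)),
        Net.base (.op (.num n))]) fun j => by
        fin_cases j
        · exact D.rigid_base 0 rfl fun _ => ⟨nofun, nofun⟩
        · exact D.rigid_base 1 rfl fun _ => ⟨nofun, nofun⟩
        · exact D.rigid_base 2 rfl fun _ => ⟨nofun, nofun⟩
        · exact D.rigid_base 3 rfl fun _ => ⟨nofun, nofun⟩).trans
        (.of_eq (wiring_eq_diagram _ _ _ _ _ _ rfl fun j => by fin_cases j <;> rfl)), fun j => by
      fin_cases j <;> exact .refl _⟩ }⟩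

theorem residual_neg {X N : Net} {σ σ' : Hole → Net} (hX : Pluggable X σ σ') {m p : ℕ}
    (hp : (p : ℤ) = -(m : ℤ))
    (hi : (X.plug σ).Iso (diagram ![[.star], [.star], [.star]] [0] []
        [(Net.base (.token .rewrite), [0], [1]), (Net.base (.op .neg), [1], [2]),
          (Net.base (.op (.num m)), [2], [])]))
    (hN : N.Iso (diagram ![[.star], [.star]] [0] []
        [(Net.base (.token .search), [0], [1]), (Net.base (.op (.num p)), [1], [])])) :
    Nonempty (Residual X σ σ' N) := by
  obtain ⟨F', D⟩ := hX.decompose (r := 3) (k := 3)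
    (F := ![Net.base (.token .rewrite), Net.base (.op .neg), Net.base (.op (.num m))])
    (S := ![([0], [1]), ([1], [2]), ([2], [])])
    ![false, false, false] (by decide) (by decide)
    (by
      intro j
      fin_cases j <;> exact Net.base_isHypernet _)
    (by
      intro j hj
      fin_cases j <;> exact Net.base_not_isTree fun _ => ⟨nofun, nofun⟩)
    (hi.trans (.of_eq (diagram_eq _ _ _ _ _ _ fun j => by fin_cases j <;> rfl)))
  exact ⟨{
    m := 0
    r := 2
    k := 2
    Q := F' ∘ ![]
    w := ![[.star], [.star]]
    ins := [0]
    outs := []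
    S := ![([0], [1]), ([1], [])]
    slot := ![.inl (Net.base (.token .search)), .inl (Net.base (.op (.num p)))]
    j₀ := 0
    i₀ := 0
    i₁ := 1
    linear := by decide
    type := D.type
    occ := D.occ_comp (by decide)
    focusFree := fun q => q.elim0
    slot_inj := ⟨fun p => 0, fun j p h => by fin_cases j <;> cases h⟩
    slot_typed := fun j => by
      fin_cases j <;> exact ⟨Net.holeFree_base nofun, Net.base_isHypernet _⟩
    slot_token := rfl
    slot_focusFree := fun j hj N h => by
      fin_cases j <;> cases h
      · exact absurd rfl hj
      · exact Net.focusFree_base nofun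
    S_token := rfl
    w_token := rfl
    notMem_outs := by decide
    origin := fun q => q.elim0
    left := ⟨![Net.base (.token .search), Net.base (.op (.num p))],
      hN.trans (.of_eq (diagram_eq _ _ _ _ _ _ fun j => by fin_cases j <;> rfl)), fun j => by
        fin_cases j <;> exact .refl _⟩
    right := ⟨![Net.base (.token .search), Net.base (.op (.num p))], _,
      (RuleShape.neg _ _ hp).of_eq (diagram_eq _ _ _ _ _ _ fun j => by fin_cases j <;> rfl),
      (D.plug_iso (E := ![Net.base (.token .rewrite), Net.base (.op .neg), Net.base (.op (.num m))])
        fun j => by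
        fin_cases j
        · exact D.rigid_base 0 rfl fun _ => ⟨nofun, nofun⟩
        · exact D.rigid_base 1 rfl fun _ => ⟨nofun, nofun⟩
        · exact D.rigid_base 2 rfl fun _ => ⟨nofun, nofun⟩).trans
        (.of_eq (wiring_eq_diagram _ _ _ _ _ _ rfl fun j => by fin_cases j <;> rfl)), fun j => by
      fin_cases j <;> exact .refl _⟩ }⟩

theorem Label.exists_occ_of_box {l : Label} {n : ℕ} {G : Net} (h : l = .box n G) (b : BLabel) :
    ∃ f : G.Occ b → l.Occ b, Function.Injective f := by
  subst h
  rw [Label.occ_box]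
  exact ⟨id, Function.injective_id⟩

/-- The only rule that brings deep holes to the surface: its parameter is the content of the box and
not the box edge. No component on the left has shallow contractions or weakenings. -/
theorem residual_beta {X N : Net} {σ σ' : Hole → Net} (hX : Pluggable X σ σ') {G A : Net}
    {k h : ℕ} {z : List VLabel} (hG : G.IsHypernet [.star] (stars (1 + k) ++ dias h))
    (hA : A.IsStable z)
    (hi : (X.plug σ).Iso
      (diagram ![[.star], [.star], [.star], [.star], [.thunk 1], stars k ++ dias h, z] [0] [5, 6]
        [(Net.base (.token .rewrite), [0], [1]), (Net.base (.op .app), [1], [2, 3]),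
          (Net.base (.op .lam), [2], [4]),
          (Net.single (.box 1 G) [.thunk 1] (stars k ++ dias h), [4], [5]), (A, [3], [6])]))
    (hN : N.Iso (diagram ![[.star], [.star], [.star], stars k ++ dias h, z] [0] [3, 4]
        [(Net.base (.token .search), [0], [1]), (G, [1], [2, 3]), (A, [2], [4])])) :
    Nonempty (Residual X σ σ' N) := by
  have htype : stars (1 + k) ++ dias h = .star :: ((stars k ++ dias h) ++ []) := by
    rw [add_comm, List.append_nil]
    rfl
  obtain ⟨F', D⟩ := hX.decompose (r := 7) (k := 5)
    (F := ![Net.base (.token .rewrite), Net.base (.op .app), Net.base (.op .lam),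
      Net.single (.box 1 G) [.thunk 1] (stars k ++ dias h), A])
    (S := ![([0], [1]), ([1], [2, 3]), ([2], [4]), ([4], [5]), ([3], [6])])
    ![false, false, false, false, false] (by decide) (by decide)
    (by
      intro j
      fin_cases j
      · exact Net.base_isHypernet _
      · exact Net.base_isHypernet _
      · exact Net.base_isHypernet _
      · exact isHypernet_of_eq (Net.single_isHypernet
          ((Label.hasType_box _ _ _ _).2 ⟨k, h, rfl, rfl, hG⟩)) rfl (List.append_nil _).symm
      · exact isHypernet_of_eq hA.hypernet rfl (List.append_nil _).symm)
    (by
      intro j hj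
      fin_cases j
      · exact Net.base_not_isTree fun _ => ⟨nofun, nofun⟩
      · exact Net.base_not_isTree fun _ => ⟨nofun, nofun⟩
      · exact Net.base_not_isTree fun _ => ⟨nofun, nofun⟩
      · refine Net.single_not_isTree ?_
        rintro ⟨ℓ, h | h⟩ <;> cases h
      · exact hA.not_isTree)
    (hi.trans (.of_eq (diagram_eq _ _ _ _ _ _ fun j => by fin_cases j <;> rfl)))
  obtain ⟨e, G', he, hG', hs⟩ := (D.typed 3).exists_box D.left (D.tree 3) (D.plug 3)
  -- The label of the box edge gives `G'` some type; plugging preserves types and `G'[σ]` is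
  -- isomorphic to `G`, so it is the type of `G`.
  have ht : G'.IsHypernet [.star] (stars (1 + k) ++ dias h) := by
    have h1 := (D.typed 3).typed e
    rw [he, Label.hasType_box] at h1
    obtain ⟨k', h', _, _, h2⟩ := h1
    rwa [((h2.plug D.left).iso hG').type_unique hG |>.2] at h2
  have hocc : ∀ b, ∃ f : G'.Occ b → (F' 3).Occ b, Function.Injective f := fun b => by
    obtain ⟨f, hf⟩ := Label.exists_occ_of_box he b
    exact ⟨fun o => ⟨e, f o⟩, fun o o' h => hf (eq_of_heq (Sigma.mk.inj h).2)⟩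
  exact ⟨{
    m := 1
    r := 5
    k := 3
    Q := fun _ => G'
    w := ![[.star], [.star], [.star], stars k ++ dias h, z]
    ins := [0]
    outs := [3, 4]
    S := ![([0], [1]), ([1], [2, 3]), ([2], [4])]
    slot := ![.inl (Net.base (.token .search)), .inr (0, false), .inl A]
    j₀ := 0
    i₀ := 0
    i₁ := 1
    linear := by decide
    type := D.type
    occ := fun b => by
      obtain ⟨f, hf⟩ := hocc b
      obtain ⟨g, hg⟩ := D.occ b
      -- Occurrences in the content are occurrences in the box edge, which is component `3`.
      refine ⟨fun p => g ⟨3, f p.2⟩, ?_⟩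
      rintro ⟨q, o⟩ ⟨q', o'⟩ h
      obtain rfl : q = q' := Subsingleton.elim _ _
      exact congrArg _ (hf (eq_of_heq (Sigma.mk.inj (hg h)).2))
    focusFree := fun q t => ⟨fun o => by
      obtain ⟨f, _⟩ := hocc (.token t)
      exact (D.focusFree (j₀ := 0) (j := 3) rfl (by decide) t).false (f o)⟩
    slot_inj := ⟨fun p => 1, fun j p h => by fin_cases j <;> cases h <;> rfl⟩
    slot_typed := fun j => by
      fin_cases j
      · exact ⟨Net.holeFree_base nofun, Net.base_isHypernet _⟩
      · exact isHypernet_of_eq ht rfl htype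
      · exact ⟨hA.holeFree, isHypernet_of_eq hA.hypernet rfl (List.append_nil _).symm⟩
    slot_token := rfl
    slot_focusFree := fun j hj N h => by
      fin_cases j <;> cases h
      · exact absurd rfl hj
      · exact hA.focusFree
    S_token := rfl
    w_token := rfl
    notMem_outs := by decide
    origin := fun q => .inr ⟨by
      obtain ⟨e', h1⟩ := D.labels 3 e
      exact ⟨e', 1, h1.symm.trans he⟩, rfl,
        fun j b h => by fin_cases j <;> cases h <;> rfl, fun e t he => D.token_src (j₀ := 0) rfl rfl he⟩
    left := ⟨![Net.base (.token .search), G, A],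
      hN.trans (.of_eq (diagram_eq _ _ _ _ _ _ fun j => by fin_cases j <;> rfl)), fun j => by
        fin_cases j <;> first | exact hG' | exact .refl _⟩
    right := ⟨![Net.base (.token .search), G'.plug σ', A], _,
      (RuleShape.beta _ _ _ _ _ (ht.plug D.right) hA).of_eq
        (diagram_eq _ _ _ _ _ _ fun j => by fin_cases j <;> rfl),
      (D.plug_iso (E := ![Net.base (.token .rewrite), Net.base (.op .app), Net.base (.op .lam),
        Net.single (.box 1 (G'.plug σ')) [.thunk 1] (stars k ++ dias h), A]) fun j => by
        fin_cases j
        · exact D.rigid_base 0 rfl fun _ => ⟨nofun, nofun⟩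
        · exact D.rigid_base 1 rfl fun _ => ⟨nofun, nofun⟩
        · exact D.rigid_base 2 rfl fun _ => ⟨nofun, nofun⟩
        · exact hs σ' D.right
        · exact D.rigid 4 hA.rigid_labels).trans
        (.of_eq (wiring_eq_diagram _ _ _ _ _ _ rfl fun j => by fin_cases j <;> rfl)), fun j => by
      fin_cases j <;> exact .refl _⟩ }⟩

theorem LocalRule.exists_residual {X N : Net} {σ σ' : Hole → Net} (hX : Pluggable X σ σ')
    (h : LocalRule (X.plug σ) N) : Nonempty (Residual X σ σ' N) := by
  obtain ⟨L, N₀, hs, hL, hN⟩ := h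
  cases hs with
  | contraction C H k₁ k₂ p h hC hH => exact residual_contraction hX hC hH hL hN
  | beta G A k h z hG hA => exact residual_beta hX hG hA hL hN
  | ref A z hA => exact residual_ref hX hA hL hN
  | eqTrue A k hA => exact residual_eqTrue hX hA hL hN
  | eqFalse A A' k k' hA hA' => exact residual_eqFalse hX hA hA' hL hN
  | assign A G k z hA hG => exact residual_assign hX hA hG hL hN
  | deref A k hA => exact residual_deref hX hA hL hN
  | add m n p hp => exact residual_binary hX rfl (RuleShape.add m n p hp) hL hN
  | sub m n p hp => exact residual_binary hX rfl (RuleShape.sub m n p hp) hL hN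
  | neg m p hp => exact residual_neg hX hp hL hN

/-! ## Preservation -/

open Classical in
/-- The restriction of a substitution to the holes of `X`. -/
noncomputable def restrictSubst (X : Net) (σ : Hole → Net) (ψ : Hole) : Net :=
  if X.HasHole ψ then σ ψ else Net.base (.hole ψ)

theorem restrictSubst_of_hasHole {X : Net} {ψ : Hole} (h : X.HasHole ψ) (σ : Hole → Net) :
    restrictSubst X σ ψ = σ ψ := if_pos h

/-- A specimen constrains the substitutions only at holes that occur. Elsewhere each hole is sent to
itself, which makes the substitution well typed everywhere and does not affect the plugging. -/
theorem wellTyped_restrictSubst {X : Net} {σ : Hole → Net}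
    (h : ∀ ψ, X.HasHole ψ → (σ ψ).IsHypernet ψ.dom ψ.cod) : WellTyped (restrictSubst X σ) := by
  intro ψ
  unfold restrictSubst
  split
  · next h' => exact h ψ h'
  · exact Net.base_isHypernet _

theorem Net.hasHole_plugAt {C C' : Net} {χ ψ : Hole} (h : C.HasHole χ) (h' : C'.HasHole ψ) :
    (C.plugAt χ C').HasHole ψ := by
  refine Net.occ_plug_of_hole h ?_
  rw [if_pos rfl]
  exact h'

/-- The common core of the three claims. The residual is part of the conclusion because
binding-freeness has to inspect how the new context is built. -/
theorem LocalRule.exists_preserves {R : Net → Net → Prop} {C₁ C₂ N : Net} {χ : Hole}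
    {G H : Hole → Net} (hC₁ : C₁.IsContext) (hC₂ : C₂.IsContext) (hC₂f : C₂.Focussed)
    (hC₂t : C₂.IsHypernet χ.dom χ.cod) (hR : RelatedOn R C₂ G H) (hrule : LocalRule (C₂.plug G) N)
    (hG : TreeHoles C₂ G) (hH : TreeHoles C₂ H) :
    ∃ (σ σ' : Hole → Net) (D : Residual C₂ σ σ' N) (K : ℕ), ∃ G' H',
      Preserves R C₁ χ C₂ G H N (D.context K) G' H' := by
  have eG : C₂.plug (restrictSubst C₂ G) = C₂.plug G :=
    Net.plug_congr fun ψ h => restrictSubst_of_hasHole h G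
  have eH : C₂.plug (restrictSubst C₂ H) = C₂.plug H :=
    Net.plug_congr fun ψ h => restrictSubst_of_hasHole h H
  have wG : WellTyped (restrictSubst C₂ G) := wellTyped_restrictSubst fun ψ h => (hR ψ h).2.1
  have wH : WellTyped (restrictSubst C₂ H) := wellTyped_restrictSubst fun ψ h => (hR ψ h).2.2
  have tree : ∀ σ, TreeHoles C₂ σ → TreeHoles C₂ (restrictSubst C₂ σ) := fun σ h e ψ he => by
    rw [restrictSubst_of_hasHole (Net.hasHole_of_lab he)]
    exact h e ψ he
  rw [← eG] at hrule
  obtain ⟨D⟩ := hrule.exists_residual ⟨⟨_, _, hC₂t⟩, hC₂f, wG, wH, tree G hG, tree H hH⟩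
  obtain ⟨d, c, h₁⟩ := hC₁.1
  obtain ⟨K, hK⟩ := h₁.exists_name_lt
  have hR' : RelatedOn R C₂ (restrictSubst C₂ G) (restrictSubst C₂ H) := fun ψ h => by
    rw [restrictSubst_of_hasHole h, restrictSubst_of_hasHole h]
    exact hR ψ h
  obtain ⟨k1, k2, k3, k4, k5, k6, k7, k8⟩ :=
    D.preserves wG wH hC₁ hC₂ hC₂t hR' hrule hK
  rw [eG] at k6
  rw [eH] at k8
  exact ⟨_, _, D, K, _, _, k1, k2, k3, k4, k5, k6, k7, k8⟩

theorem RelatedOn.of_plugAt {R : Net → Net → Prop} {C₁ C₂ : Net} {χ : Hole} {G H : Hole → Net}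
    (h : RelatedOn R (C₁.plugAt χ C₂) G H) (hχ : C₁.HasHole χ) : RelatedOn R C₂ G H :=
  fun ψ hψ => h ψ (Net.hasHole_plugAt hχ hψ)

/-! ## Binding-freeness -/

/-- Paths join vertices, but the arguments below follow edges; uniqueness of the edge leaving a
vertex makes the first edge of the path the given one. -/
theorem Graph.transGen_incoming_of_isPath {Λ : Type 1} {N : Graph Λ}
    (hu : ∀ v e e', v ∈ N.src e → v ∈ N.src e' → e = e') {e e' : N.E} {v v' : N.V}
    (hv : v ∈ N.src e) (hv' : v' ∈ N.src e') {p : List N.E} (hp : N.IsPath p v v') :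
    TransGen N.Incoming e e' := by
  obtain ⟨a, b, h1, h2, _, h3⟩ :=
    Graph.exists_isPath_iff.1 ⟨p, hp, fun _ _ => (trivial : True)⟩
  obtain rfl := hu _ _ _ h1 hv
  exact .tail' (ReflTransGen.mono (fun _ _ h => h.1) _ _ h3) ⟨v', h2, hv'⟩

theorem Graph.exists_isPath_of_transGen {Λ : Type 1} {N : Graph Λ} {e e' : N.E} {v : N.V}
    (hv : v ∈ N.src e) (h : TransGen N.Incoming e e') : ∃ v' p, v' ∈ N.src e' ∧ N.IsPath p v v' := by
  obtain ⟨b, h1, v', h2, h3⟩ := TransGen.tail'_iff.1 h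
  obtain ⟨p, hp, _⟩ := (Graph.exists_isPath_iff (P := fun _ => True)).2
    ⟨e, b, hv, h2, trivial, ReflTransGen.mono (fun _ _ h => ⟨h, trivial⟩) _ _ h1⟩
  exact ⟨v', p, h3, hp⟩

/-- `e` is a binding edge with a source from which `e'` can be reached. -/
def Net.Binds (N : Net) (e e' : N.E) : Prop :=
  (N.lab e).IsBinding ∧ (∃ v, v ∈ N.src e) ∧ TransGen N.Incoming e e'

theorem Net.ShallowBindingFree.not_binds {N : Net} (h : N.ShallowBindingFree) {e e' : N.E} {χ : Hole}
    (he : N.lab e' = .base (.hole χ)) : ¬ N.Binds e e' := by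
  rintro ⟨h1, ⟨v, h2⟩, h3⟩
  obtain ⟨v', p, h4, h5⟩ := Graph.exists_isPath_of_transGen h2 h3
  exact h e e' χ v v' h1 h2 he h4 p h5

theorem Net.shallowBindingFree_of {N : Net}
    (hu : ∀ v e e', v ∈ N.src e → v ∈ N.src e' → e = e')
    (h : ∀ e e' χ, N.lab e' = .base (.hole χ) → ¬ N.Binds e e') : N.ShallowBindingFree :=
  fun e e' χ v _ h1 h2 h3 h4 _ hp =>
    h e e' χ h3 ⟨h1, ⟨v, h2⟩, Graph.transGen_incoming_of_isPath hu h2 h4 hp⟩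

theorem Label.bindingFree_box (n : ℕ) (G : Net) : (Label.box n G).BindingFree ↔ G.BindingFree :=
  Iff.rfl

theorem Label.bindingFree_of_isEmpty {l : Label} (h : ∀ χ, IsEmpty (l.Occ (.hole χ))) :
    l.BindingFree := by
  induction l using Label.induction with
  | base b => trivial
  | box n G ih =>
    rw [Label.bindingFree_box]
    have h' : ∀ e χ, IsEmpty ((G.lab e).Occ (.hole χ)) := fun e χ => ⟨fun o =>
      (h χ).false (by rw [Label.occ_box]; exact ⟨e, o⟩)⟩
    refine ⟨fun e e' χ v v' _ _ h3 => ?_, fun e => ih e (h' e)⟩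
    have := h' e' χ
    rw [h3] at this
    exact (this.false ⟨rfl⟩).elim

theorem Net.HoleFree.bindingFree {N : Net} (h : N.HoleFree) : N.BindingFree :=
  (Label.bindingFree_box 0 N).1 (Label.bindingFree_of_isEmpty fun χ => by
    rw [Label.occ_box]
    exact not_nonempty_iff.1 (h χ))

theorem Label.isBinding_of_rename {ρ : ℕ → ℕ} {l : Label} (h : (l.rename ρ).IsBinding) :
    l.IsBinding := by
  cases l with
  | base b => cases b <;> exact h
  | box n G => trivial

theorem Label.eq_hole_of_rename {ρ : ℕ → ℕ} {l : Label} {χ : Hole}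
    (h : l.rename ρ = .base (.hole χ)) : ∃ ψ, l = .base (.hole ψ) := by
  cases l with
  | base b =>
    cases b with
    | hole ψ => exact ⟨ψ, rfl⟩
    | _ => cases h
  | box n G => cases h

theorem Net.ShallowBindingFree.rename {N : Net} (h : N.ShallowBindingFree) (ρ : ℕ → ℕ) :
    (N.rename ρ).ShallowBindingFree := by
  intro e e' χ v v' h1 h2 h3 h4 p hp
  obtain ⟨ψ, h5⟩ := Label.eq_hole_of_rename (ρ := ρ) (l := N.lab e') h3
  exact h e e' ψ v v' (Label.isBinding_of_rename h1) h2 h5 h4 p hp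

theorem Label.BindingFree.rename {l : Label} (h : l.BindingFree) (ρ : ℕ → ℕ) :
    (l.rename ρ).BindingFree := by
  induction l using Label.induction with
  | base b => trivial
  | box n G ih =>
    rw [Label.bindingFree_box] at h
    rw [Label.rename_box, Label.bindingFree_box]
    exact ⟨h.1.rename ρ, fun e => ih e (h.2 e)⟩

/-! ## Binding-freeness of the underlying hypernet -/

theorem Net.IsHypernet.token_src {N : Net} {d c : List VLabel} (hN : N.IsHypernet d c) {e : N.E}
    {t : Token} (he : N.lab e = .base (.token t)) :
    ∃ a b, N.src e = [a] ∧ N.tgt e = [b] ∧ N.vlab a = .star ∧ N.vlab b = .star := by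
  have := hN.typed e
  rw [he] at this
  obtain ⟨a, ha, ha'⟩ := exists_eq_singleton_of_map this.1
  obtain ⟨b, hb, hb'⟩ := exists_eq_singleton_of_map this.2
  exact ⟨a, b, ha, hb, ha', hb'⟩

theorem Net.eraseEdge_incoming {N : Net} {t x y : N.E} (hx : x ≠ t) (hy : y ≠ t) {u v : N.V}
    (hu : u ∈ N.tgt x) (hv : v ∈ N.src y)
    (huv : u = v ∨ (u ∈ N.src t ∧ v ∈ N.tgt t)) : (N.eraseEdge t).Incoming ⟨x, hx⟩ ⟨y, hy⟩ := by
  refine ⟨Quot.mk _ v, ?_, List.mem_map_of_mem hv⟩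
  rcases huv with rfl | h
  · exact List.mem_map_of_mem hu
  · exact List.mem_map.2 ⟨u, hu, Quot.sound h⟩

/-- Erasing the token only shortcuts the paths through it, and the token edge is neither a binding
edge nor a hole edge. -/
theorem Net.Focussed.bindingFree_of_underlying {N : Net} {d c : List VLabel}
    (hN : N.IsHypernet d c) (hf : N.Focussed) (h : N.underlying.BindingFree) : N.BindingFree := by
  obtain ⟨e₀, t₀, h1, h2, h3, _⟩ := hf
  have hex : ∃ e t, N.lab e = .base (.token t) := ⟨e₀, t₀, h1⟩
  have hU : N.underlying = N.eraseEdge hex.choose := dif_pos hex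
  obtain ⟨t, ht⟩ := hex.choose_spec
  have h4 : hex.choose = e₀ := by
    have o : (N.lab hex.choose).Occ (.token t) := by rw [ht]; exact ⟨rfl⟩
    exact h2 t ⟨hex.choose, o⟩
  rw [h4] at hU
  rw [hU] at h
  refine ⟨Net.shallowBindingFree_of hN.interfaced.src_unique ?_, fun e => ?_⟩
  · rintro e e' χ he' ⟨hb, ⟨v, hv⟩, hp⟩
    have ne : e ≠ e₀ := by rintro rfl; rw [h1] at hb; exact hb
    have ne' : e' ≠ e₀ := by rintro rfl; rw [h1] at he'; cases he'
    -- A path that stands on the token edge has no counterpart after erasure; instead, the last edge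
    -- before the token is remembered, with the vertex through which it reached the token.
    have key : ∀ z, ReflTransGen N.Incoming e z →
        (∀ hz : z ≠ e₀, ReflTransGen (N.eraseEdge e₀).Incoming ⟨e, ne⟩ ⟨z, hz⟩) ∧
        (z = e₀ → ∃ (y : N.E) (hy : y ≠ e₀) (a : N.V), a ∈ N.src e₀ ∧ a ∈ N.tgt y ∧
          ReflTransGen (N.eraseEdge e₀).Incoming ⟨e, ne⟩ ⟨y, hy⟩) := by
      intro z hz
      induction hz with
      | refl => exact ⟨fun _ => .refl, fun h => absurd h ne⟩
      | @tail x z _ hxz ih =>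
        obtain ⟨u, hu, hu'⟩ := hxz
        by_cases hx : x = e₀
        · obtain ⟨y, hy, a, ha, ha', hr⟩ := ih.2 hx
          subst hx
          refine ⟨fun hz => hr.tail (Net.eraseEdge_incoming hy hz ha' hu' (.inr ⟨ha, hu⟩)), ?_⟩
          rintro rfl
          -- The token is self-acyclic, so a path does not pass it twice in a row.
          exact absurd hu (h3 u hu')
        · refine ⟨fun hz => (ih.1 hx).tail (Net.eraseEdge_incoming hx hz hu hu' (.inl rfl)), ?_⟩
          rintro rfl
          exact ⟨x, hx, u, hu', hu, ih.1 hx⟩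
    obtain ⟨x, hx, u, hu, hu'⟩ := TransGen.tail'_iff.1 hp
    refine h.1.not_binds (e := ⟨e, ne⟩) (e' := ⟨e', ne'⟩) (χ := χ) he'
      ⟨hb, ⟨_, List.mem_map_of_mem hv⟩, ?_⟩
    by_cases hxe : x = e₀
    · obtain ⟨y, hy, a, ha, ha', hr⟩ := (key x hx).2 hxe
      subst hxe
      exact .tail' hr (Net.eraseEdge_incoming hy ne' ha' hu' (.inr ⟨ha, hu⟩))
    · exact .tail' ((key x hx).1 hxe) (Net.eraseEdge_incoming hxe ne' hu hu' (.inl rfl))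
  · by_cases he : e = e₀
    · rw [he, h1]; trivial
    · exact h.2 ⟨e, he⟩

/-- Conversely, a step across the merged vertex expands to two steps through the token edge. -/
theorem Net.BindingFree.underlying {N : Net} {d c : List VLabel} (hN : N.IsHypernet d c)
    (h : N.BindingFree) : N.underlying.BindingFree := by
  unfold Net.underlying
  split
  · next hex =>
    obtain ⟨t', ht⟩ := hex.choose_spec
    revert ht
    generalize hex.choose = t
    intro ht
    obtain ⟨a, b, ha, hb, _, _⟩ := hN.token_src ht
    have hI := hN.interfaced
    classical
    -- Choosing the source of the token as representative shows that the quotient identifies only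
    -- the two ends `a` and `b` of the token.
    let φ : (N.eraseEdge t).V → N.V := Quot.lift (fun v => if v = b then a else v) (by
      intro u v ⟨hu, hv⟩
      rw [ha] at hu
      rw [hb] at hv
      rw [List.mem_singleton.1 hu, List.mem_singleton.1 hv, if_pos rfl]
      split <;> rfl)
    have hφ : ∀ u v, (Quot.mk _ u : (N.eraseEdge t).V) = Quot.mk _ v →
        u = v ∨ (u = a ∧ v = b) ∨ (u = b ∧ v = a) := by
      intro u v huv
      have h1 : (if u = b then a else u) = if v = b then a else v := congrArg φ huv
      split at h1 <;> split at h1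
      · next h2 h3 => exact .inl (h2.trans h3.symm)
      · next h2 h3 => exact .inr (.inr ⟨h2, h1.symm⟩)
      · next h2 h3 => exact .inr (.inl ⟨h1, h3⟩)
      · exact .inl h1
    have hat : a ∈ N.src t := by rw [ha]; exact List.mem_singleton.2 rfl
    have hbt : b ∈ N.tgt t := by rw [hb]; exact List.mem_singleton.2 rfl
    refine ⟨Net.shallowBindingFree_of ?_ ?_, fun e => h.2 e.1⟩
    · rintro q ⟨e, he⟩ ⟨e', he'⟩ hq hq'
      obtain ⟨u, hu, rfl⟩ := List.mem_map.1 hq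
      obtain ⟨v, hv, huv⟩ := List.mem_map.1 hq'
      rcases hφ _ _ huv.symm with rfl | ⟨rfl, _⟩ | ⟨_, rfl⟩
      · exact Subtype.ext (hI.src_unique _ _ _ hu hv)
      · exact absurd (hI.src_unique _ _ _ hu hat) he
      · exact absurd (hI.src_unique _ _ _ hv hat) he'
    · rintro ⟨e, he⟩ ⟨e', he'⟩ χ hl ⟨hb', ⟨q, hq⟩, hp⟩
      obtain ⟨v, hv, rfl⟩ := List.mem_map.1 hq
      refine h.1.not_binds hl ⟨hb', ⟨v, hv⟩, ?_⟩
      have step : ∀ x y : (N.eraseEdge t).E, (N.eraseEdge t).Incoming x y →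
          TransGen N.Incoming x.1 y.1 := by
        rintro ⟨x, hx⟩ ⟨y, hy⟩ ⟨q, h1, h2⟩
        obtain ⟨u, hu, rfl⟩ := List.mem_map.1 h1
        obtain ⟨v, hv, huv⟩ := List.mem_map.1 h2
        rcases hφ _ _ huv.symm with rfl | ⟨rfl, rfl⟩ | ⟨rfl, _⟩
        · exact .single ⟨u, hu, hv⟩
        · exact .tail (.single ⟨_, hu, hat⟩) ⟨_, hbt, hv⟩
        · exact absurd (hI.tgt_unique _ _ _ hu hbt) hx
      clear hl hq hv hb'
      generalize hE : (⟨e, he⟩ : (N.eraseEdge t).E) = E at hp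
      generalize hE' : (⟨e', he'⟩ : (N.eraseEdge t).E) = E' at hp
      have : TransGen N.Incoming E.1 E'.1 := by
        clear hE hE'
        induction hp with
        | single h => exact step _ _ h
        | tail _ h ih => exact ih.trans (step _ _ h)
      exact this
  · exact h

/-! ## Operation paths from the input to the token -/

/-- `l` labels an operation. -/
def Label.IsOp (l : Label) : Prop := ∃ φ, l = .base (.op φ)

theorem Label.IsOp.iso {l l' : Label} (h : l.IsOp) (h' : l.Iso l') : l'.IsOp := by
  obtain ⟨φ, rfl⟩ := h
  exact ⟨φ, h'.base_left⟩

theorem Label.IsOp.not_isBinding {l : Label} (h : l.IsOp) : ¬ l.IsBinding := by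
  obtain ⟨φ, rfl⟩ := h
  exact id

/-- `v` is an input, or the end of an operation path from an input. -/
inductive Net.OpReach (N : Net) : N.V → Prop
  | input {v : N.V} : v ∈ N.ins → OpReach N v
  | step {e : N.E} {u v : N.V} : (N.lab e).IsOp → u ∈ N.src e → v ∈ N.tgt e → OpReach N u →
      OpReach N v

/-- The source of a token is an input or the end of an operation path from an input. -/
def Net.TokenReach (N : Net) : Prop :=
  ∃ e t a, N.lab e = .base (.token t) ∧ a ∈ N.src e ∧ N.OpReach a

theorem Net.OpReach.map {N N' : Net} (f : N.V → N'.V) (g : N.E → N'.E)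
    (hi : ∀ v ∈ N.ins, f v ∈ N'.ins) (hs : ∀ e, N'.src (g e) = (N.src e).map f)
    (ht : ∀ e, N'.tgt (g e) = (N.tgt e).map f) (hl : ∀ e, (N.lab e).Iso (N'.lab (g e))) {v : N.V}
    (h : N.OpReach v) : N'.OpReach (f v) := by
  induction h with
  | input h => exact .input (hi _ h)
  | step k1 k2 k3 _ ih =>
    exact .step (k1.iso (hl _)) (by rw [hs]; exact List.mem_map_of_mem k2)
      (by rw [ht]; exact List.mem_map_of_mem k3) ih

theorem Net.TokenReach.iso {N N' : Net} (h : N.TokenReach) (hi : N.Iso N') : N'.TokenReach := by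
  obtain ⟨e, t, a, h1, h2, h3⟩ := h
  obtain ⟨f, g, _, ki, _, ks, kt, kl⟩ := hi
  refine ⟨g e, t, f a, ?_, ?_, ?_⟩
  · have := kl e
    rw [h1] at this
    exact this.base_left
  · rw [ks]; exact List.mem_map_of_mem h2
  · exact h3.map f g (fun v hv => by rw [ki]; exact List.mem_map_of_mem hv) ks kt kl

theorem Net.IsHypernet.op_src {N : Net} {d c : List VLabel} (hN : N.IsHypernet d c) {e : N.E}
    (he : (N.lab e).IsOp) : ∃ a, N.src e = [a] ∧ N.vlab a = .star := by
  obtain ⟨φ, he⟩ := he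
  have := hN.typed e
  rw [he] at this
  exact exists_eq_singleton_of_map this.1

/-- An operation has one source, so at each step upwards there is no alternative to the operation
path: whatever lies above its end belongs to it. -/
theorem Net.OpReach.isOp {N : Net} {d c : List VLabel} (hN : N.IsHypernet d c) {v : N.V}
    (h : N.OpReach v) {y g : N.E} (hy : v ∈ N.tgt y) (hg : ReflTransGen N.Incoming g y) :
    (N.lab g).IsOp := by
  induction h generalizing y with
  | input h => exact absurd hy ((hN.interfaced.mem_ins _).1 h y)
  | @step e u v h1 h2 h3 _ ih =>
    obtain rfl := hN.interfaced.tgt_unique _ _ _ h3 hy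
    rcases ReflTransGen.cases_tail hg with rfl | ⟨x, hx, w, hw, hw'⟩
    · exact h1
    · obtain ⟨a, ha, _⟩ := hN.op_src h1
      rw [ha] at h2 hw'
      rw [List.mem_singleton.1 hw', ← List.mem_singleton.1 h2] at hw
      exact ih hw hx

theorem Graph.WF.flatten_src_of_isSingle {D : Graph Net} (hD : D.WF) {e : D.E} {l : Label}
    (h : (D.lab e).IsSingle l) (x : (D.lab e).E) : D.flatten.src ⟨e, x⟩ = (D.src e).map D.vtx := by
  rw [← hD.map_embed_ins]
  exact congrArg (List.map (D.embed e)) (h.src x)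

theorem Graph.WF.flatten_tgt_of_isSingle {D : Graph Net} (hD : D.WF) {e : D.E} {l : Label}
    (h : (D.lab e).IsSingle l) (x : (D.lab e).E) : D.flatten.tgt ⟨e, x⟩ = (D.tgt e).map D.vtx := by
  rw [← hD.map_embed_outs]
  exact congrArg (List.map (D.embed e)) (h.tgt x)

theorem Graph.WF.embed_eq_of_getElem? {D : Graph Net} (hD : D.WF) {e : D.E} {s : (D.lab e).V}
    {u : D.V} {p : ℕ} (hs : (D.lab e).ins[p]? = some s) (hu : (D.src e)[p]? = some u) :
    D.embed e s = D.vtx u := by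
  have h := congrArg (·[p]?) (hD.map_embed_ins e)
  simp only [List.getElem?_map, hs, hu, Option.map_some] at h
  exact Option.some.inj h

/-- The token and the operations of `N` are fed by the `p`-th input or inside `N`, and the token is at
the `p`-th input or at a target of an operation at that input. -/
structure Net.IsGate (N : Net) (p : ℕ) : Prop where
  edge : ∀ e, ((N.lab e).IsOp ∨ ∃ t, N.lab e = .base (.token t)) → ∀ s ∈ N.src e,
    N.ins[p]? = some s ∨ (s ∉ N.ins ∧ s ∉ N.outs)
  token : ∃ e t s, N.lab e = .base (.token t) ∧ s ∈ N.src e ∧ (N.ins[p]? = some s ∨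
    ∃ e' s', (N.lab e').IsOp ∧ s ∈ N.tgt e' ∧ s' ∈ N.src e' ∧ N.ins[p]? = some s')

/-- The part of an operation path up to the gate uses only edges outside the replaced component, and
these survive. From there the new gate continues it to the token. -/
theorem Graph.WF.tokenReach_relabel {D : Graph Net} (hD : D.WF) {l' : D.E → Net}
    (hD' : (D.relabel l').WF) {e₁ : D.E} {L L' : D.E → Label}
    (hL : ∀ e, e ≠ e₁ → (D.lab e).IsSingle (L e)) (hL' : ∀ e, e ≠ e₁ → (l' e).IsSingle (L' e))
    (hop : ∀ e, (L e).IsOp → (L' e).IsOp) (htok : ∀ e t, e ≠ e₁ → L e ≠ .base (.token t)) {p : ℕ}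
    (hg : (D.lab e₁).IsGate p) (hg' : (l' e₁).IsGate p) (h : D.flatten.TokenReach) :
    (D.relabel l').flatten.TokenReach := by
  obtain ⟨u₀, hu₀⟩ : ∃ u₀, (D.src e₁)[p]? = some u₀ := by
    obtain ⟨s, hs⟩ : ∃ s, (l' e₁).ins[p]? = some s := by
      obtain ⟨_, _, s, _, _, hs | ⟨_, s, _, _, _, hs⟩⟩ := hg'.token <;> exact ⟨s, hs⟩
    obtain ⟨hp, _⟩ := List.getElem?_eq_some_iff.1 hs
    have : (l' e₁).ins.length = (D.src e₁).length := hD'.length_ins e₁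
    rw [this] at hp
    exact ⟨_, List.getElem?_eq_getElem hp⟩
  have gate : ∀ x, (((D.lab e₁).lab x).IsOp ∨ ∃ t, (D.lab e₁).lab x = .base (.token t)) →
      ∀ s ∈ (D.lab e₁).src x, D.embed e₁ s = D.vtx u₀ ∨ ∃ y, D.embed e₁ s = Sum.inr y := by
    intro x hx s hs
    rcases hg.edge x hx s hs with h1 | ⟨h1, h2⟩
    · exact .inl (hD.embed_eq_of_getElem? h1 hu₀)
    · obtain ⟨h3, h4⟩ := Graph.embed_inner h1 h2
      exact .inr ⟨_, h4⟩
  -- Following the old path, either the gate input has been reached already, or the path has stayed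
  -- outside the gate so far and can be copied.
  have claim : ∀ y, D.flatten.OpReach y → (D.relabel l').flatten.OpReach ((D.relabel l').vtx u₀) ∨
      ∃ v, y = D.vtx v ∧ (D.relabel l').flatten.OpReach ((D.relabel l').vtx v) := by
    intro y hy
    induction hy with
    | input h =>
      obtain ⟨v, hv, rfl⟩ := List.mem_map.1 h
      exact .inr ⟨v, rfl, .input (List.mem_map_of_mem hv)⟩
    | @step ex u v h1 h2 h3 _ ih =>
      obtain ⟨e, x⟩ := ex
      rcases ih with ih | ⟨u', hu', ih⟩
      · exact .inl ih
      by_cases he : e = e₁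
      · subst he
        obtain ⟨s, hs, rfl⟩ := Graph.mem_flatten_src.1 h2
        rcases gate x (.inl h1) s hs with h4 | ⟨_, h4⟩
        · rw [h4] at hu'
          obtain rfl := D.vtx_injective hu'
          exact .inl ih
        · rw [h4] at hu'
          exact (Graph.vtx_ne_inr hu'.symm).elim
      · have hs := hL e he
        have h1 : ((D.lab e).lab x).IsOp := h1
        rw [hs.lab] at h1
        rw [hD.flatten_src_of_isSingle hs] at h2
        rw [hD.flatten_tgt_of_isSingle hs] at h3
        obtain ⟨w, hw, hwu⟩ := List.mem_map.1 h2
        obtain rfl := D.vtx_injective (hwu.trans hu')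
        obtain ⟨v', hv', rfl⟩ := List.mem_map.1 h3
        have hs' : ((D.relabel l').lab e).IsSingle (L' e) := hL' e he
        obtain ⟨x', _⟩ := hs'.edge
        refine .inr ⟨v', rfl, .step (N := (D.relabel l').flatten) (e := ⟨e, x'⟩) ?_ ?_ ?_ ih⟩
        · exact (congrArg Label.IsOp (hs'.lab x')).mpr (hop e h1)
        · rw [hD'.flatten_src_of_isSingle hs']
          exact List.mem_map_of_mem hw
        · rw [hD'.flatten_tgt_of_isSingle hs']
          exact List.mem_map_of_mem hv'
  -- The token is in the gate, so its path must have come in through `u₀`.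
  have hr : (D.relabel l').flatten.OpReach ((D.relabel l').vtx u₀) := by
    obtain ⟨⟨e, x⟩, t, a, h1, h2, h3⟩ := h
    by_cases he : e = e₁
    · subst he
      obtain ⟨s, hs, rfl⟩ := Graph.mem_flatten_src.1 h2
      rcases gate x (.inr ⟨t, h1⟩) s hs with h4 | ⟨_, h4⟩ <;> rw [h4] at h3
      · rcases claim _ h3 with h | ⟨v, hv, h⟩
        · exact h
        · obtain rfl := D.vtx_injective hv
          exact h
      · rcases claim _ h3 with h | ⟨v, hv, h⟩
        · exact h
        · exact (Graph.vtx_ne_inr hv.symm).elim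
    · have h1 : (D.lab e).lab x = .base (.token t) := h1
      rw [(hL e he).lab] at h1
      exact absurd h1 (htok e t he)
  obtain ⟨x, t, s, h1, h2, h3⟩ := hg'.token
  refine ⟨⟨e₁, x⟩, t, (D.relabel l').embed e₁ s, h1,
    (Graph.mem_flatten_src (D := D.relabel l') (e := e₁) (x := x)).2 ⟨s, h2, rfl⟩, ?_⟩
  rcases h3 with h3 | ⟨x', s', h3, h4, h5, h6⟩
  · rw [hD'.embed_eq_of_getElem? h3 hu₀]
    exact hr
  · refine .step (N := (D.relabel l').flatten) (e := ⟨e₁, x'⟩) h3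
      ((Graph.mem_flatten_src (D := D.relabel l') (e := e₁) (x := x')).2 ⟨s', h5, rfl⟩)
      ((Graph.mem_flatten_tgt (D := D.relabel l') (e := e₁) (x := x')).2 ⟨s, h4, rfl⟩) ?_
    rw [hD'.embed_eq_of_getElem? h6 hu₀]
    exact hr

theorem getElem?_append_cons {α : Type*} (l l' : List α) (a : α) :
    (l ++ [a] ++ l')[l.length]? = some a := by
  simp

/-- The position of the gate is the total length of the bundles that precede `i₀` in the interface.
-/
theorem wiring_isGate {r k : ℕ} {w : Fin r → List VLabel} {ins outs : List (Fin r)}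
    {F : Fin k → Net} {S : Fin k → List (Fin r) × List (Fin r)} (h : Linear ins outs S)
    (b : Fin k → BLabel) (hb : ∀ j, F j = Net.base (b j))
    (hty : ∀ j, (b j).dom = (S j).1.flatMap w ∧ (b j).cod = (S j).2.flatMap w)
    {i₀ : Fin r} (hw : w i₀ = [.star]) {pre post : List (Fin r)} (hpre : ins = pre ++ i₀ :: post)
    (hedge : ∀ j, ((∃ φ, b j = .op φ) ∨ ∃ t, b j = .token t) → ∀ i ∈ (S j).1,
      i = i₀ ∨ (i ∉ ins ∧ i ∉ outs))
    (htok : ∃ j t, b j = .token t ∧ (i₀ ∈ (S j).1 ∨ ∃ j' φ i, b j' = .op φ ∧ i ∈ (S j).1 ∧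
      w i = [.star] ∧ i ∈ (S j').2 ∧ i₀ ∈ (S j').1)) :
    (wiring w ins outs F S).flatten.IsGate (pre.flatMap w).length := by
  have hF : ∀ j, (F j).IsHypernet ((S j).1.flatMap w) ((S j).2.flatMap w) := fun j => by
    rw [hb, ← (hty j).1, ← (hty j).2]
    exact Net.base_isHypernet _
  have hD := wiring_wf h hF
  have hs : ∀ j : (wiring w ins outs F S).E,
      ((wiring w ins outs F S).lab j).IsSingle (.base (b j)) := fun j => by
    exact Eq.mpr (congrArg (Net.IsSingle · (.base (b j))) (hb j)) (Net.single_isSingle _ _ _)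
  have hlab : ∀ (j : Fin k) (x : (F j).E), (F j).lab x = .base (b j) := fun j x => (hs j).lab x
  have hlen : ∀ i, w i = [.star] → 0 < (w i).length := fun i hi => by rw [hi]; exact Nat.one_pos
  let v₀ : (wiring w ins outs F S).V := ⟨i₀, ⟨0, hlen _ hw⟩⟩
  have hv₀ : ∀ v : (wiring w ins outs F S).V, v.1 = i₀ → v = v₀ := by
    rintro ⟨i, m, hm⟩ rfl
    have : m = 0 := by
      rw [hw] at hm
      exact Nat.lt_one_iff.1 hm
    subst this
    rfl
  have hp : (wiring w ins outs F S).flatten.ins[(pre.flatMap w).length]? =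
      some ((wiring w ins outs F S).vtx v₀) := by
    change ((bundles w ins).map (wiring w ins outs F S).vtx)[_]? = _
    have h1 : bundles w ins = bundles w pre ++ bundles w [i₀] ++ bundles w post := by
      rw [hpre]
      simp [bundles]
    have h2 : bundles w [i₀] = [v₀] := by
      obtain ⟨a, ha, _⟩ := exists_eq_singleton_of_map ((map_bundles w [i₀]).trans
        (show [i₀].flatMap w = [.star] by simp [hw]))
      rw [ha]
      congr 1
      exact hv₀ a (List.mem_singleton.1 (mem_bundles.1 (ha ▸ List.mem_singleton.2 rfl)))
    have h3 : (pre.flatMap w).length = (bundles w pre).length := by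
      rw [← map_bundles, List.length_map]
    have h4 : (bundles w ins)[(pre.flatMap w).length]? = some v₀ := by
      rw [h1, h2, h3]
      exact getElem?_append_cons _ _ _
    exact List.getElem?_map.trans (congrArg (Option.map _) h4)
  have hmem : ∀ (j : Fin k) (x : (F j).E) (i : Fin r) (hi : w i = [.star]), i ∈ (S j).1 →
      (wiring w ins outs F S).vtx ⟨i, ⟨0, hlen _ hi⟩⟩ ∈ (wiring w ins outs F S).flatten.src ⟨j, x⟩ := by
    intro j x i hi hij
    exact Eq.mpr (congrArg (_ ∈ ·) (hD.flatten_src_of_isSingle (hs j) x))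
      (List.mem_map_of_mem (mem_bundles.2 hij))
  refine ⟨?_, ?_⟩
  · rintro ⟨j, x⟩ hl s hsrc
    obtain ⟨v, hv, rfl⟩ := List.mem_map.1
      (Eq.mp (congrArg (s ∈ ·) (hD.flatten_src_of_isSingle (hs j) x)) hsrc)
    have hl' : (∃ φ, b j = .op φ) ∨ ∃ t, b j = .token t := by
      rcases hl with ⟨φ, hl⟩ | ⟨t, hl⟩
      · exact .inl ⟨φ, Label.base.inj ((hlab j x).symm.trans hl)⟩
      · exact .inr ⟨t, Label.base.inj ((hlab j x).symm.trans hl)⟩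
    rcases hedge j hl' v.1 (mem_bundles.1 hv) with h1 | ⟨h1, h2⟩
    · left
      rw [hv₀ v h1]
      exact hp
    · right
      refine ⟨fun h3 => h1 ?_, fun h3 => h2 ?_⟩
      all_goals
        obtain ⟨v', hv', h4⟩ := List.mem_map.1 h3
        obtain rfl := Graph.vtx_injective _ h4
        exact mem_bundles.1 hv'
  · obtain ⟨j, t, h1, h2⟩ := htok
    obtain ⟨x, _⟩ := (hs j).edge
    rcases h2 with h2 | ⟨j', φ, i, h2, h3, h4, h5, h6⟩
    · exact ⟨⟨j, x⟩, t, (wiring w ins outs F S).vtx v₀, (hlab j x).trans (congrArg _ h1),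
        hmem j x i₀ hw h2, .inl hp⟩
    · obtain ⟨x', _⟩ := (hs j').edge
      refine ⟨⟨j, x⟩, t, _, (hlab j x).trans (congrArg _ h1), hmem j x i h4 h3, .inr
        ⟨⟨j', x'⟩, _, ⟨φ, (hlab j' x').trans (congrArg _ h2)⟩, ?_, hmem j' x' i₀ hw h6, hp⟩⟩
      exact Eq.mpr (congrArg (_ ∈ ·) (hD.flatten_tgt_of_isSingle (hs j') x'))
        (List.mem_map_of_mem (mem_bundles.2 h5))

/-! ## Search transitions preserve operation paths to the token -/

theorem Op.cod_eq_of_lt {φ : Op} {i : ℕ} (h : i < φ.eager) :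
    φ.cod = φ.cod.take i ++ .star :: φ.cod.drop (i + 1) := by
  have h1 : i < φ.cod.length := by
    simp only [Op.cod, List.length_append, List.length_replicate]
    omega
  have h2 : φ.cod[i] = .star := by
    simp [Op.cod, h]
  rw [← h2, List.getElem_cons_drop, List.take_append_drop]

theorem tokenBefore_isGate (t : Token) (φ : Op) : (tokenBefore t φ).IsGate 0 := by
  have := wiring_isGate (r := 3) (k := 2) (w := ![[.star], [.star], φ.cod]) (ins := [0]) (outs := [2])
    (F := ![Net.base (.token t), Net.base (.op φ)]) (S := ![([0], [1]), ([1], [2])]) (by decide)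
    ![.token t, .op φ] (fun j => by fin_cases j <;> rfl)
    (fun j => by
      fin_cases j
      · exact ⟨rfl, rfl⟩
      · exact ⟨rfl, (List.append_nil _).symm⟩)
    (i₀ := 0) rfl (pre := []) (post := []) rfl
    (fun j _ i hi => by
      fin_cases j <;> obtain rfl := List.mem_singleton.1 hi
      · exact .inl rfl
      · exact .inr (by decide))
    ⟨0, t, rfl, .inl (List.mem_singleton.2 rfl)⟩
  rwa [wiring_eq_diagram _ _ _ [(Net.base (.token t), [0], [1]), (Net.base (.op φ), [1], [2])] _ _ rfl
      fun j => by fin_cases j <;> rfl] at this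

theorem tokenAfter_isGate (t : Token) {φ : Op} {i : ℕ} (h : i < φ.eager) :
    (tokenAfter t φ i).IsGate 0 := by
  have := wiring_isGate (r := 5) (k := 2)
    (w := ![[.star], φ.cod.take i, [.star], [.star], φ.cod.drop (i + 1)]) (ins := [0])
    (outs := [1, 3, 4]) (F := ![Net.base (.op φ), Net.base (.token t)])
    (S := ![([0], [1, 2, 4]), ([2], [3])]) (by decide)
    ![.op φ, .token t] (fun j => by fin_cases j <;> rfl)
    (fun j => by
      fin_cases j
      · refine ⟨rfl, (Op.cod_eq_of_lt h).trans ?_⟩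
        change _ = φ.cod.take i ++ (.star :: (φ.cod.drop (i + 1) ++ []))
        rw [List.append_nil]
      · exact ⟨rfl, rfl⟩)
    (i₀ := 0) rfl (pre := []) (post := []) rfl
    (fun j _ i hi => by
      fin_cases j <;> obtain rfl := List.mem_singleton.1 hi
      · exact .inl rfl
      · exact .inr (by decide))
    ⟨1, t, rfl, .inr ⟨0, φ, 2, rfl, List.mem_singleton.2 rfl, rfl, by decide,
      List.mem_singleton.2 rfl⟩⟩
  rwa [wiring_eq_diagram _ _ _
      [(Net.base (.op φ), [0], [1, 2, 4]), (Net.base (.token t), [2], [3])] _ _ rfl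
      fun j => by fin_cases j <;> rfl] at this

theorem contrLeft_isGate (t : Token) :
    (diagram ![[.star], [.star], [.star], [.star]] [0, 2] [3]
      [(Net.base (.token t), [0], [1]), (Net.base (.contr .star), [1, 2], [3])]).IsGate 0 := by
  have := wiring_isGate (r := 4) (k := 2) (w := ![[.star], [.star], [.star], [.star]]) (ins := [0, 2])
    (outs := [3]) (F := ![Net.base (.token t), Net.base (.contr .star)])
    (S := ![([0], [1]), ([1, 2], [3])]) (by decide)
    ![.token t, .contr .star] (fun j => by fin_cases j <;> rfl)
    (fun j => by fin_cases j <;> exact ⟨rfl, rfl⟩)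
    (i₀ := 0) rfl (pre := []) (post := [2]) rfl
    (fun j hj i hi => by
      fin_cases j
      · exact .inl (List.mem_singleton.1 hi)
      · rcases hj with ⟨_, hj⟩ | ⟨_, hj⟩ <;> cases hj)
    ⟨0, t, rfl, .inl (List.mem_singleton.2 rfl)⟩
  rwa [wiring_eq_diagram _ _ _
      [(Net.base (.token t), [0], [1]), (Net.base (.contr .star), [1, 2], [3])] _ _ rfl
      fun j => by fin_cases j <;> rfl] at this

theorem contrRight_isGate (t : Token) :
    (diagram ![[.star], [.star], [.star], [.star]] [2, 0] [3]
      [(Net.base (.token t), [0], [1]), (Net.base (.contr .star), [2, 1], [3])]).IsGate 1 := by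
  have := wiring_isGate (r := 4) (k := 2) (w := ![[.star], [.star], [.star], [.star]]) (ins := [2, 0])
    (outs := [3]) (F := ![Net.base (.token t), Net.base (.contr .star)])
    (S := ![([0], [1]), ([2, 1], [3])]) (by decide)
    ![.token t, .contr .star] (fun j => by fin_cases j <;> rfl)
    (fun j => by fin_cases j <;> exact ⟨rfl, rfl⟩)
    (i₀ := 0) rfl (pre := [2]) (post := []) rfl
    (fun j hj i hi => by
      fin_cases j
      · exact .inl (List.mem_singleton.1 hi)
      · rcases hj with ⟨_, hj⟩ | ⟨_, hj⟩ <;> cases hj)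
    ⟨0, t, rfl, .inl (List.mem_singleton.2 rfl)⟩
  rwa [wiring_eq_diagram _ _ _
      [(Net.base (.token t), [0], [1]), (Net.base (.contr .star), [2, 1], [3])] _ _ rfl
      fun j => by fin_cases j <;> rfl] at this

theorem inst_isGate (t : Token) :
    (diagram ![[.star], [.star], [.dia]] [0] [2]
      [(Net.base (.token t), [0], [1]), (Net.base .inst, [1], [2])]).IsGate 0 := by
  have := wiring_isGate (r := 3) (k := 2) (w := ![[.star], [.star], [.dia]]) (ins := [0])
    (outs := [2]) (F := ![Net.base (.token t), Net.base .inst])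
    (S := ![([0], [1]), ([1], [2])]) (by decide)
    ![.token t, .inst] (fun j => by fin_cases j <;> rfl)
    (fun j => by fin_cases j <;> exact ⟨rfl, rfl⟩)
    (i₀ := 0) rfl (pre := []) (post := []) rfl
    (fun j hj i hi => by
      fin_cases j
      · exact .inl (List.mem_singleton.1 hi)
      · rcases hj with ⟨_, hj⟩ | ⟨_, hj⟩ <;> cases hj)
    ⟨0, t, rfl, .inl (List.mem_singleton.2 rfl)⟩
  rwa [wiring_eq_diagram _ _ _
      [(Net.base (.token t), [0], [1]), (Net.base .inst, [1], [2])] _ _ rfl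
      fun j => by fin_cases j <;> rfl] at this

/-- In every interaction rule, the token is before and after the step either at the same input or
just below an operation at that input. The position is `1` when the token is on the right of a
contraction. -/
theorem InteractionRule.exists_isGate {G G' : Net} (h : InteractionRule G G') :
    ∃ p, G.IsGate p ∧ G'.IsGate p := by
  cases h with
  | contrLeft => exact ⟨0, contrLeft_isGate _, contrLeft_isGate _⟩
  | contrRight => exact ⟨1, contrRight_isGate _, contrRight_isGate _⟩
  | inst => exact ⟨0, inst_isGate _, inst_isGate _⟩
  | enter φ h => exact ⟨0, tokenBefore_isGate _ _, tokenAfter_isGate _ h⟩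
  | next φ i h => exact ⟨0, tokenAfter_isGate _ (Nat.lt_of_succ_lt h), tokenAfter_isGate _ h⟩
  | leavePassive φ i h => exact ⟨0, tokenAfter_isGate _ (by omega), tokenBefore_isGate _ _⟩
  | leaveActive φ i h => exact ⟨0, tokenAfter_isGate _ (by omega), tokenBefore_isGate _ _⟩
  | nullaryPassive φ => exact ⟨0, tokenBefore_isGate _ _, tokenBefore_isGate _ _⟩
  | nullaryActive φ => exact ⟨0, tokenBefore_isGate _ _, tokenBefore_isGate _ _⟩

/-- The transition replaces the content of one shallow hole, a gate both before and after; the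
context is focus-free, so the token is inside the gate. -/
theorem SearchTransition.tokenReach {S S' : Net} (h : SearchTransition S S') (hS : S.TokenReach) :
    S'.TokenReach := by
  obtain ⟨_, _, C, χ, G, G', hrule, hC, hCf, hCt, hG, hG', hi, hi'⟩ := h
  obtain ⟨_, e₁, he₁, hu⟩ := hC
  obtain ⟨p, hp, hp'⟩ := hrule.exists_isGate
  refine Net.TokenReach.iso ?_ hi'.symm
  have h1 := hS.iso hi
  classical
  let τ : Net → Hole → Net := fun A ψ => if ψ = χ then A else Net.base (.hole ψ)
  have hlab : ∀ A : Net, (C.plugGraph (τ A)).lab e₁ = A := fun A => by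
    change plugEdge (τ A) (C.lab e₁) _ _ _ = A
    rw [he₁]
    exact if_pos rfl
  have ne : ∀ e, e ≠ e₁ → ∀ ψ, C.lab e ≠ .base (.hole ψ) := fun e he ψ h =>
    he (hu ψ ⟨e, by rw [h]; exact ⟨rfl⟩⟩)
  exact (hCt.plugGraph_wf (wellTyped_plugAt hG)).tokenReach_relabel
    (l' := (C.plugGraph (τ G')).lab) (hCt.plugGraph_wf (wellTyped_plugAt hG')) (e₁ := e₁)
    (L := fun e => (C.lab e).plug (τ G)) (L' := fun e => (C.lab e).plug (τ G'))
    (fun e he => Net.plugGraph_isSingle (ne e he)) (fun e he => Net.plugGraph_isSingle (ne e he))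
    (fun e ⟨φ, h⟩ => ⟨φ, by rw [Label.plug_eq_base h]; rfl⟩)
    (fun e t _ h => (hCf t).false ⟨e, by rw [Label.plug_eq_base h]; exact ⟨rfl⟩⟩)
    (Eq.mpr (congrArg (Net.IsGate · p) (hlab G)) hp)
    (Eq.mpr (congrArg (Net.IsGate · p) (hlab G')) hp') h1

theorem Net.tokenReach_withToken {N : Net} (h : N.ins ≠ []) (t : Token) :
    (N.withToken t).TokenReach := by
  refine ⟨none, t, none, rfl, List.mem_singleton.2 rfl, .input ?_⟩
  cases hN : N.ins with
  | nil => exact absurd hN h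
  | cons v vs =>
    simp only [Net.withToken, hN]
    exact List.mem_cons_self

theorem Net.underlying_ins_ne_nil {N : Net} (h : N.ins ≠ []) : N.underlying.ins ≠ [] := by
  by_cases hex : ∃ e t, N.lab e = .base (.token t)
  · have hU : N.underlying = N.eraseEdge hex.choose := dif_pos hex
    rw [hU]
    exact fun h' => h (List.map_eq_nil_iff.1 h')
  · have hU : N.underlying = N := dif_neg hex
    rwa [hU]

/-- The search starts with the token at the input, where the path is empty, and each transition
keeps the property. -/
theorem Rooted.tokenReach {S : Net} (h : Rooted S) : S.TokenReach := by
  obtain ⟨hS, S', h1, h2⟩ := h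
  refine Net.TokenReach.iso ?_ h2
  have h0 : S.ins ≠ [] := fun h => by
    have := hS.1.ins_type
    rw [h] at this
    cases this
  clear h2
  induction h1 with
  | refl => exact Net.tokenReach_withToken (Net.underlying_ins_ne_nil h0) _
  | tail _ h ih => exact h.tokenReach ih

/-! ## Operation paths in contexts -/

/-- Cutting an operation path at its last entry into the label of `e`: the final segment is an
operation path from an input of that label. -/
theorem Graph.WF.exists_op_path {D : Graph Net} (hD : D.WF) {y : D.flatten.V}
    (h : D.flatten.OpReach y) : ∀ e (x : (D.lab e).E), ∀ z ∈ (D.lab e).tgt x, y = D.embed e z →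
      ∃ i ∈ (D.lab e).ins, ∃ x₀, i ∈ (D.lab e).src x₀ ∧ (D.lab e).vlab i = .star ∧
        ((D.lab e).lab x₀).IsOp ∧
        ReflTransGen (fun a b => (D.lab e).Incoming a b ∧ ((D.lab e).lab b).IsOp) x₀ x := by
  have hI := hD.flatten_interfaced
  induction h with
  | input h =>
    rintro e x z hz rfl
    exact absurd (Graph.mem_flatten_tgt.2 ⟨z, hz, rfl⟩) ((hI.mem_ins _).1 h ⟨e, x⟩)
  | @step ex u v h1 h2 h3 _ ih =>
    rintro e x z hz rfl
    obtain rfl := hI.tgt_unique _ _ _ h3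
      ((Graph.mem_flatten_tgt (D := D) (e := e) (x := x)).2 ⟨z, hz, rfl⟩)
    obtain ⟨s, hs, hs'⟩ := Graph.mem_flatten_src.1 h2
    obtain ⟨a, ha, hstar⟩ := (hD.typed e).op_src h1
    have hsa : s = a := List.mem_singleton.1 (ha ▸ hs)
    by_cases hi : s ∈ (D.lab e).ins
    · exact ⟨s, hi, x, hs, hsa ▸ hstar, h1, .refl⟩
    · rw [(hD.typed e).interfaced.mem_ins] at hi
      push Not at hi
      obtain ⟨x', hx'⟩ := hi
      obtain ⟨i, k1, x₀, k2, k3, k4, k5⟩ := ih e x' s hx' hs'.symm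
      exact ⟨i, k1, x₀, k2, k3, k4, k5.tail ⟨⟨s, hx', hs⟩, h1⟩⟩

theorem Graph.WF.not_oneWay {D : Graph Net} (hD : D.WF) {e : D.E} {v : D.V} (hv : v ∈ D.tgt e)
    (hstar : D.vlab v = .star) (h : D.flatten.OpReach (D.vtx v)) : ¬ (D.lab e).OneWay := by
  intro hw
  obtain ⟨x, hx⟩ := hD.exists_tgt hv
  obtain ⟨z, hz, hz'⟩ := Graph.mem_flatten_tgt.1 hx
  obtain ⟨i, hi, x₀, h1, h2, h3, h4⟩ := hD.exists_op_path h e x z hz hz'.symm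
  obtain ⟨p, hp, hp'⟩ := (Graph.exists_isPath_iff (P := fun x => ((D.lab e).lab x).IsOp)).2
    ⟨x₀, x, h1, hz, h3, h4⟩
  refine hw i hi z (hD.mem_tgt_of_embed (hD.tgt_notMem_ins hz) hz').1 h2 ?_ p hp hp'
  rw [← hD.vlab_embed, hz']
  exact hstar

/-- Both operation paths are traced back from the same vertex of the context in step. If that vertex
comes out of a hole, both fillings have an operation path from a `⋆` input to a `⋆` output, so
neither is one-way, against `hw`. Otherwise it is a target of an operation of the context, whose
single source is the next vertex for both paths. -/
theorem Net.IsHypernet.opReach_of_plug {X : Net} {d c : List VLabel} (hX : X.IsHypernet d c)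
    {σ σ' : Hole → Net} (hσ : WellTyped σ) (hσ' : WellTyped σ')
    (hw : ∀ ψ, X.HasHole ψ → (σ ψ).OneWay ∨ (σ' ψ).OneWay) {v : X.V}
    (h : (X.plug σ).OpReach ((X.plugGraph σ).vtx v)) (hstar : X.vlab v = .star)
    (h' : (X.plug σ').OpReach ((X.plugGraph σ').vtx v)) : X.OpReach v := by
  have hD := hX.plugGraph_wf hσ
  have hD' := hX.plugGraph_wf hσ'
  replace h : (X.plugGraph σ).flatten.OpReach ((X.plugGraph σ).vtx v) := h
  replace h' : (X.plugGraph σ').flatten.OpReach ((X.plugGraph σ').vtx v) := h'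
  obtain ⟨y, hy⟩ : ∃ y : (X.plugGraph σ).flatten.V, (X.plugGraph σ).vtx v = y := ⟨_, rfl⟩
  replace h : (X.plugGraph σ).flatten.OpReach y := hy ▸ h
  induction h generalizing v with
  | input h =>
    obtain ⟨v', h1, rfl⟩ := List.mem_map.1 h
    obtain rfl := Graph.vtx_injective _ hy
    exact .input h1
  | @step ex u y h1 h2 h3 h4 ih =>
    subst hy
    obtain ⟨e, x⟩ := ex
    have hv : v ∈ X.tgt e := hD.inl_mem_tgt h3
    by_cases he : ∃ ψ, X.lab e = .base (.hole ψ)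
    · obtain ⟨ψ, he⟩ := he
      have key : ∀ τ : Hole → Net, (X.plugGraph τ).lab e = τ ψ := fun τ => by
        change plugEdge τ (X.lab e) _ _ _ = _
        rw [he]
        rfl
      have n1 := hD.not_oneWay hv hstar (.step h1 h2 h3 h4)
      have n2 := hD'.not_oneWay hv hstar h'
      rw [key] at n1 n2
      rcases hw ψ (Net.hasHole_of_lab he) with h | h
      · exact absurd h n1
      · exact absurd h n2
    · push Not at he
      have hs := Net.plugGraph_isSingle (σ := σ) he
      have hs' := Net.plugGraph_isSingle (σ := σ') he
      obtain ⟨φ, h1⟩ : (((X.plugGraph σ).lab e).lab x).IsOp := h1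
      replace h1 := (hs.lab x).symm.trans h1
      have hop : (X.lab e).IsOp := ⟨φ, Label.plug_eq_base h1⟩
      obtain ⟨a, ha, hastar⟩ := hX.op_src hop
      have e2 : (X.plugGraph σ).flatten.src ⟨e, x⟩ = [(X.plugGraph σ).vtx a] :=
        (hD.flatten_src_of_isSingle hs x).trans (congrArg (List.map _) ha)
      rw [e2] at h2
      refine .step hop (ha ▸ List.mem_singleton.2 rfl) hv (ih hastar ?_
        (List.mem_singleton.1 h2).symm)
      obtain ⟨y', hy'⟩ : ∃ y' : (X.plugGraph σ').flatten.V, (X.plugGraph σ').vtx v = y' := ⟨_, rfl⟩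
      replace h' : (X.plugGraph σ').flatten.OpReach y' := hy' ▸ h'
      -- The second path enters the same edge of the context, by uniqueness of targets; it cannot
      -- have ended here at an input.
      cases h' with
      | input h =>
        obtain ⟨v', k1, rfl⟩ := List.mem_map.1 h
        obtain rfl := Graph.vtx_injective _ hy'
        exact absurd hv ((hX.interfaced.mem_ins _).1 k1 e)
      | @step ex' u' _ k1 k2 k3 k4 =>
        subst hy'
        obtain ⟨e', x'⟩ := ex'
        obtain rfl := hX.interfaced.tgt_unique _ _ _ hv (hD'.inl_mem_tgt k3)
        have e2' : (X.plugGraph σ').flatten.src ⟨e, x'⟩ = [(X.plugGraph σ').vtx a] :=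
          (hD'.flatten_src_of_isSingle hs' x').trans (congrArg (List.map _) ha)
        rw [e2'] at k2
        rw [← List.mem_singleton.1 k2]
        exact k4

/-- The fillings are focus-free, so the token edge is an edge of the context itself. -/
theorem Net.IsHypernet.tokenReach_plug {X : Net} {d c : List VLabel} (hX : X.IsHypernet d c)
    {σ : Hole → Net} (hσ : WellTyped σ) (hf : ∀ ψ, X.HasHole ψ → (σ ψ).FocusFree)
    (h : (X.plug σ).TokenReach) : ∃ e t a, X.lab e = .base (.token t) ∧ a ∈ X.src e ∧
      X.vlab a = .star ∧ (X.plug σ).OpReach ((X.plugGraph σ).vtx a) := by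
  obtain ⟨⟨e, x⟩, t, y, h1, h2, h3⟩ := h
  have h1 : ((X.plugGraph σ).lab e).lab x = .base (.token t) := h1
  have he : ∀ ψ, X.lab e ≠ .base (.hole ψ) := fun ψ he => by
    have key : (X.plugGraph σ).lab e = σ ψ := by
      change plugEdge σ (X.lab e) _ _ _ = _
      rw [he]
      rfl
    have hfe : ((X.plugGraph σ).lab e).FocusFree := key.symm ▸ hf ψ (Net.hasHole_of_lab he)
    exact (hfe t).false ⟨x, h1.symm ▸ ⟨rfl⟩⟩
  have hs := Net.plugGraph_isSingle (σ := σ) he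
  replace h1 := (hs.lab x).symm.trans h1
  obtain ⟨a, b, ha, hb, hastar, _⟩ := hX.token_src (Label.plug_eq_base h1)
  have e2 : (X.plug σ).src ⟨e, x⟩ = [(X.plugGraph σ).vtx a] :=
    ((hX.plugGraph_wf hσ).flatten_src_of_isSingle hs x).trans (congrArg (List.map _) ha)
  replace h2 : y ∈ [(X.plugGraph σ).vtx a] := e2 ▸ h2
  exact ⟨e, t, a, Label.plug_eq_base h1, ha ▸ List.mem_singleton.2 rfl, hastar,
    List.mem_singleton.1 h2 ▸ h3⟩

theorem Net.IsHypernet.tokenReach_of_plug {X : Net} {d c : List VLabel} (hX : X.IsHypernet d c)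
    (hXf : X.Focussed) {σ σ' : Hole → Net} (hσ : WellTyped σ) (hσ' : WellTyped σ')
    (hf : ∀ ψ, X.HasHole ψ → (σ ψ).FocusFree ∧ (σ' ψ).FocusFree)
    (hw : ∀ ψ, X.HasHole ψ → (σ ψ).OneWay ∨ (σ' ψ).OneWay)
    (h : (X.plug σ).TokenReach) (h' : (X.plug σ').TokenReach) : X.TokenReach := by
  obtain ⟨e, t, a, h1, h2, h3, h4⟩ := hX.tokenReach_plug hσ (fun ψ h => (hf ψ h).1) h
  obtain ⟨e', t', a', h1', h2', h3', h4'⟩ := hX.tokenReach_plug hσ' (fun ψ h => (hf ψ h).2) h'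
  obtain rfl := hXf.edge_unique h1 h1'
  obtain ⟨b, _, hb, _⟩ := hX.token_src h1
  rw [hb] at h2 h2'
  obtain rfl := (List.mem_singleton.1 h2).trans (List.mem_singleton.1 h2').symm
  exact ⟨e, t, a, h1, hb ▸ h2, hX.opReach_of_plug hσ hσ' hw h4 h3 h4'⟩

theorem Net.TokenReach.not_binds {X : Net} {d c : List VLabel} (hX : X.IsHypernet d c)
    (hXf : X.Focussed) (h : X.TokenReach) {e g : X.E} {t : Token}
    (he : X.lab e = .base (.token t)) : ¬ X.Binds g e := by
  rintro ⟨h1, _, h2⟩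
  obtain ⟨e', t', a, h3, h4, h5⟩ := h
  obtain rfl := hXf.edge_unique he h3
  obtain ⟨x, hx, w, hw, hw'⟩ := TransGen.tail'_iff.1 h2
  obtain ⟨b, _, hb, _⟩ := hX.token_src h3
  rw [hb] at h4 hw'
  obtain rfl := (List.mem_singleton.1 h4).trans (List.mem_singleton.1 hw').symm
  exact (h5.isOp hX hw hx).not_isBinding h1

/-! ## Outputs of the rules -/

/-- `o` is reachable from a source of a binding edge. -/
def Net.Guarded (N : Net) (o : N.V) : Prop :=
  ∃ g g', (N.lab g).IsBinding ∧ (∃ v, v ∈ N.src g) ∧ ReflTransGen N.Incoming g g' ∧ o ∈ N.tgt g'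

/-- Each output of type `⋆` is reachable from a source of a binding edge. -/
def Net.GuardedOutputs (N : Net) : Prop := ∀ o ∈ N.outs, N.vlab o = .star → N.Guarded o

theorem Label.IsBinding.iso {l l' : Label} (h : l.IsBinding) (h' : l.Iso l') : l'.IsBinding := by
  cases l with
  | base b => rwa [h'.base_left]
  | box n G =>
    obtain ⟨G', rfl, _⟩ := h'.box_left
    trivial

theorem Label.isBinding_of_plug {l : Label} {σ : Hole → Net} (h : (l.plug σ).IsBinding) :
    l.IsBinding := by
  cases l with
  | base b => exact h
  | box n G => trivial

theorem Net.Guarded.map {N N' : Net} {f : N.V → N'.V} {g : N.E → N'.E}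
    (hs : ∀ e, N'.src (g e) = (N.src e).map f) (ht : ∀ e, N'.tgt (g e) = (N.tgt e).map f)
    (hl : ∀ e, (N.lab e).IsBinding → (N'.lab (g e)).IsBinding) {o : N.V} (h : N.Guarded o) :
    N'.Guarded (f o) := by
  obtain ⟨e, e', h1, ⟨v, h2⟩, h3, h4⟩ := h
  refine ⟨g e, g e', hl e h1, ⟨f v, hs e ▸ List.mem_map_of_mem h2⟩, ?_,
    ht e' ▸ List.mem_map_of_mem h4⟩
  exact h3.lift g fun a b ⟨w, hw, hw'⟩ =>
    ⟨f w, ht a ▸ List.mem_map_of_mem hw, hs b ▸ List.mem_map_of_mem hw'⟩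

theorem Net.GuardedOutputs.iso {N N' : Net} (h : N.GuardedOutputs) (hi : N.Iso N') :
    N'.GuardedOutputs := by
  obtain ⟨f, g, kv, _, ko, ks, kt, kl⟩ := hi
  intro o ho hstar
  rw [ko] at ho
  obtain ⟨o, ho', rfl⟩ := List.mem_map.1 ho
  exact (h o ho' ((kv o).symm.trans hstar)).map ks kt fun e he => he.iso (kl e)

/-- With deep holes only, plugging does not change the shallow hypergraph, and an edge is binding
after plugging only if it was before. -/
theorem Net.GuardedOutputs.of_plug {C : Net} {d c : List VLabel} (hC : C.IsHypernet d c)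
    (hd : C.AllHolesDeep) {σ : Hole → Net} (hσ : WellTyped σ) (h : (C.plug σ).GuardedOutputs) :
    C.GuardedOutputs := by
  have h1 := h.iso (hd.plug_iso hC hσ).symm
  intro o ho hstar
  have h2 := h1 o ho hstar
  exact Net.Guarded.map (N := C.relabel fun e => (C.lab e).plug σ) (N' := C) (f := id) (g := id)
    (fun _ => (List.map_id _).symm) (fun _ => (List.map_id _).symm)
    (fun _ h => Label.isBinding_of_plug h) h2

theorem Net.single_guardedOutputs {l : Label} (h : l.IsBinding) {a : VLabel} {d c : List VLabel} :
    (Net.single l (a :: d) c).GuardedOutputs :=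
  fun _ ho _ => ⟨(), (), h, ⟨_, List.mem_map_of_mem (List.mem_finRange ⟨0, Nat.succ_pos _⟩)⟩,
    .refl, ho⟩

theorem wiring_guarded {r k : ℕ} {w : Fin r → List VLabel} {ins outs : List (Fin r)}
    {F : Fin k → Net} {S : Fin k → List (Fin r) × List (Fin r)} (h : Linear ins outs S)
    (hF : ∀ j, (F j).IsHypernet ((S j).1.flatMap w) ((S j).2.flatMap w))
    (v : (wiring w ins outs F S).V) (hv : (wiring w ins outs F S).vlab v = .star) {j : Fin k}
    (hj : v.1 ∈ (S j).2) (hg : (F j).GuardedOutputs) :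
    (wiring w ins outs F S).flatten.Guarded ((wiring w ins outs F S).vtx v) := by
  have hD := wiring_wf h hF
  obtain ⟨x, hx⟩ := hD.exists_tgt (e := j) (mem_bundles.2 hj)
  obtain ⟨z, hz, hz'⟩ := Graph.mem_flatten_tgt.1 hx
  rw [← hz']
  refine Net.Guarded.map (N := F j) (N' := (wiring w ins outs F S).flatten) (f := (wiring w ins outs F S).embed j) (g := fun x => ⟨j, x⟩)
    (fun _ => rfl) (fun _ => rfl) (fun _ h => h) (hg z ?_ ?_)
  · exact (hD.mem_tgt_of_embed (hD.tgt_notMem_ins hz) hz').1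
  · exact (hD.vlab_embed j z).symm.trans ((congrArg _ hz').trans hv)

theorem wiring_guardedOutputs {r k : ℕ} {w : Fin r → List VLabel} {ins outs : List (Fin r)}
    {F : Fin k → Net} {S : Fin k → List (Fin r) × List (Fin r)} (h : Linear ins outs S)
    (hF : ∀ j, (F j).IsHypernet ((S j).1.flatMap w) ((S j).2.flatMap w))
    (hg : ∀ i ∈ outs, .star ∈ w i → ∃ j, i ∈ (S j).2 ∧ (F j).GuardedOutputs) :
    (wiring w ins outs F S).flatten.GuardedOutputs := by
  intro o ho hstar
  obtain ⟨v, hv, rfl⟩ := List.mem_map.1 ho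
  have hstar : (w v.1).get v.2 = .star := hstar
  obtain ⟨j, hj, hg⟩ := hg v.1 (mem_bundles.1 hv) (hstar ▸ List.get_mem _ _)
  exact wiring_guarded h hF v hstar hj hg

theorem IsSharedAtom.guardedOutputs {A : Net} {k : ℕ} (h : IsSharedAtom A k) :
    A.GuardedOutputs := by
  rcases h with ⟨rfl, rfl⟩ | ⟨C, hC, rfl⟩
  · exact Net.single_guardedOutputs (l := .base .atom) trivial
  · have := wiring_guardedOutputs (w := ![dias k, [.dia], [.star]]) (F := ![C, Net.base .atom])
      (by decide : Linear (r := 3) (k := 2) [0] [2] ![([0], [1]), ([1], [2])]) (fun j => by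
        fin_cases j
        · exact isHypernet_of_eq hC.hypernet (List.append_nil _).symm rfl
        · exact Net.base_isHypernet _) (fun i hi _ => by
        obtain rfl := List.mem_singleton.1 hi
        exact ⟨1, List.mem_singleton.2 rfl, Net.single_guardedOutputs (l := .base .atom) trivial⟩)
    rwa [wiring_eq_diagram _ _ _ [(C, [0], [1]), (Net.base .atom, [1], [2])] _ _ rfl
      fun j => by fin_cases j <;> rfl] at this

/-- A weakening has no source and would bind nothing. Since the tree has an input, and this input
leads to the output, the last edge does have a source. -/
theorem Net.IsContractionTree.producer {C : Net} {ℓ : Link} {k : ℕ}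
    (hC : C.IsContractionTree ℓ (k + 1)) {o : C.V} (ho : o ∈ C.outs) {e : C.E} (he : o ∈ C.tgt e) :
    (C.lab e).IsBinding ∧ ∃ v, v ∈ C.src e := by
  have hI := hC.hypernet.interfaced
  refine ⟨by rcases hC.lab e with h | h <;> rw [h] <;> trivial, ?_⟩
  obtain ⟨i, hi⟩ : ∃ i, i ∈ C.ins := by
    have := hC.hypernet.ins_type
    cases h : C.ins with
    | nil => rw [h] at this; cases this
    | cons a l => exact ⟨a, List.mem_cons_self⟩
  obtain ⟨o', ho', h⟩ := hC.reach i
  obtain rfl : o' = o := by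
    obtain ⟨a, ha, _⟩ := exists_eq_singleton_of_map hC.hypernet.outs_type
    rw [ha] at ho ho'
    exact (List.mem_singleton.1 ho').trans (List.mem_singleton.1 ho).symm
  rcases h with rfl | ⟨p, hp⟩
  · exact absurd ho (hI.disjoint _ hi)
  · obtain ⟨a, b, h1, h2, _, h3⟩ :=
      Graph.exists_isPath_iff.1 ⟨p, hp, fun _ _ => (trivial : True)⟩
    obtain rfl := hI.tgt_unique _ _ _ he h2
    rcases ReflTransGen.cases_tail h3 with rfl | ⟨x, _, ⟨w, _, hw⟩, _⟩
    · exact ⟨_, h1⟩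
    · exact ⟨w, hw⟩

theorem contraction_guardedOutputs {C H : Net} {k₁ k₂ p h : ℕ}
    (hC : C.IsContractionTree .star (k₁ + 1 + k₂)) (hH : H.IsCopyable p h) :
    (diagram ![[.star], [.star], stars k₁, stars k₂, [.star], stars p, dias h] [2, 0, 3] [5, 6]
      [(Net.base (.token .rewrite), [0], [1]), (C, [2, 1, 3], [4]), (H, [4], [5, 6])]).GuardedOutputs := by
  let w : Fin 7 → List VLabel :=
    ![[.star], [.star], stars k₁, stars k₂, [.star], stars p, dias h]
  let F : Fin 3 → Net := ![Net.base (.token .rewrite), C, H]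
  let S : Fin 3 → List (Fin 7) × List (Fin 7) := ![([0], [1]), ([2, 1, 3], [4]), ([4], [5, 6])]
  have hl : Linear [2, 0, 3] [5, 6] S := by decide
  have hF : ∀ j, (F j).IsHypernet ((S j).1.flatMap w) ((S j).2.flatMap w) := fun j => by
    fin_cases j
    · exact Net.base_isHypernet _
    · refine isHypernet_of_eq hC.hypernet ?_ rfl
      change stars (k₁ + 1 + k₂) = stars k₁ ++ (.star :: (stars k₂ ++ []))
      rw [List.append_nil, add_assoc, stars, List.replicate_add, add_comm 1 k₂]
      rfl
    · refine isHypernet_of_eq hH.hypernet rfl ?_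
      change _ = stars p ++ (dias h ++ [])
      rw [List.append_nil]
  have hD := wiring_wf hl hF
  have key : (wiring w [2, 0, 3] [5, 6] F S).flatten.GuardedOutputs := by
    intro o ho hstar
    obtain ⟨v, hv, rfl⟩ := List.mem_map.1 ho
    have hv2 : v ∈ (wiring w [2, 0, 3] [5, 6] F S).tgt (2 : Fin 3) := hv
    obtain ⟨x, hx⟩ := hD.exists_tgt hv2
    obtain ⟨e₀, he₀, hshape⟩ := hH.shape
    -- An output made by the head of `H`, an instance or operation edge, is guarded by the last edge
    -- of the tree above it; any other output comes from a box, which guards it directly.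
    by_cases hxe : x = e₀
    · subst hxe
      have h0 : 0 < (w 4).length := Nat.one_pos
      have hu1 : (⟨4, ⟨0, h0⟩⟩ : (wiring w [2, 0, 3] [5, 6] F S).V) ∈
          (wiring w [2, 0, 3] [5, 6] F S).tgt (1 : Fin 3) :=
        mem_bundles.2 (List.mem_singleton.2 rfl)
      have hu2 : (wiring w [2, 0, 3] [5, 6] F S).vtx ⟨4, ⟨0, h0⟩⟩ ∈
          (wiring w [2, 0, 3] [5, 6] F S).flatten.src ⟨(2 : Fin 3), x⟩ := by
        have e1 : (wiring w [2, 0, 3] [5, 6] F S).flatten.src ⟨(2 : Fin 3), x⟩ =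
            ((wiring w [2, 0, 3] [5, 6] F S).src (2 : Fin 3)).map
              (wiring w [2, 0, 3] [5, 6] F S).vtx :=
          (congrArg (List.map _) he₀).trans (hD.map_embed_ins (2 : Fin 3))
        exact Eq.mpr (congrArg (_ ∈ ·) e1)
          (List.mem_map_of_mem (mem_bundles.2 (List.mem_singleton.2 rfl)))
      obtain ⟨y, hy⟩ := hD.exists_tgt hu1
      obtain ⟨z, hz, hz'⟩ := Graph.mem_flatten_tgt.1 hy
      have hC' : C.IsContractionTree .star (k₁ + k₂ + 1) := by
        rwa [show k₁ + k₂ + 1 = k₁ + 1 + k₂ by omega]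
      obtain ⟨h1, a, h2⟩ := hC'.producer (e := y)
        (hD.mem_tgt_of_embed (hD.tgt_notMem_ins hz) hz').1 hz
      exact ⟨⟨(1 : Fin 3), y⟩, ⟨(2 : Fin 3), x⟩, h1,
        ⟨_, Graph.mem_flatten_src.2 ⟨a, h2, rfl⟩⟩, .single ⟨_, hy, hu2⟩, hx⟩
    · rcases hshape with ⟨_, hall⟩ | ⟨φ, _, hall⟩
      · exact absurd (hall x) hxe
      · obtain ⟨⟨n, G, hlab⟩, a, _, ha⟩ := hall x hxe
        have hlab' : ((wiring w [2, 0, 3] [5, 6] F S).flatten.lab ⟨(2 : Fin 3), x⟩).IsBinding :=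
          Eq.mpr (congrArg Label.IsBinding hlab) trivial
        exact ⟨⟨(2 : Fin 3), x⟩, ⟨(2 : Fin 3), x⟩, hlab', ⟨_, Graph.mem_flatten_src.2 ⟨a, ha, rfl⟩⟩, .refl, hx⟩
  rwa [wiring_eq_diagram w _ _ [(Net.base (.token .rewrite), [0], [1]), (C, [2, 1, 3], [4]),
    (H, [4], [5, 6])] _ _ rfl fun j => by fin_cases j <;> rfl] at key

/-- A `⋆` output of a redex comes out of a box or a shared atom, or from below the contraction tree.
Stable hypernets have no `⋆` outputs, and the arithmetic redexes have no outputs at all. -/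
theorem RuleShape.guardedOutputs {L N : Net} (h : RuleShape L N) : L.GuardedOutputs := by
  cases h with
  | contraction C H k₁ k₂ p h hC hH => exact contraction_guardedOutputs hC hH
  | beta G A k h z hG hA =>
    have := wiring_guardedOutputs
      (w := ![[.star], [.star], [.star], [.star], [.thunk 1], stars k ++ dias h, z])
      (F := ![Net.base (.token .rewrite), Net.base (.op .app), Net.base (.op .lam),
        Net.single (.box 1 G) [.thunk 1] (stars k ++ dias h), A])
      (by decide : Linear (r := 7) (k := 5) [0] [5, 6]
        ![([0], [1]), ([1], [2, 3]), ([2], [4]), ([4], [5]), ([3], [6])]) (fun j => by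
        fin_cases j
        · exact Net.base_isHypernet _
        · exact Net.base_isHypernet _
        · exact Net.base_isHypernet _
        · exact isHypernet_of_eq (Net.single_isHypernet
            ((Label.hasType_box _ _ _ _).2 ⟨k, h, rfl, rfl, hG⟩)) rfl (List.append_nil _).symm
        · exact isHypernet_of_eq hA.hypernet rfl (List.append_nil _).symm) (fun i hi hs => by
        rcases List.mem_cons.1 hi with rfl | hi
        · exact ⟨3, List.mem_singleton.2 rfl, Net.single_guardedOutputs (l := .box 1 G) trivial⟩
        · obtain rfl := List.mem_singleton.1 hi
          exact absurd hs hA.outs_ne)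
    rwa [wiring_eq_diagram _ _ _ [(Net.base (.token .rewrite), [0], [1]),
      (Net.base (.op .app), [1], [2, 3]), (Net.base (.op .lam), [2], [4]),
      (Net.single (.box 1 G) [.thunk 1] (stars k ++ dias h), [4], [5]), (A, [3], [6])] _ _ rfl
      fun j => by fin_cases j <;> rfl] at this
  | ref A z hA =>
    have := wiring_guardedOutputs (w := ![[.star], [.star], [.star], z])
      (F := ![Net.base (.token .rewrite), Net.base (.op .ref), A])
      (by decide : Linear (r := 4) (k := 3) [0] [3] ![([0], [1]), ([1], [2]), ([2], [3])])
      (fun j => by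
        fin_cases j
        · exact Net.base_isHypernet _
        · exact Net.base_isHypernet _
        · exact isHypernet_of_eq hA.hypernet rfl (List.append_nil _).symm) (fun i hi hs => by
        obtain rfl := List.mem_singleton.1 hi
        exact absurd hs hA.outs_ne)
    rwa [wiring_eq_diagram _ _ _ [(Net.base (.token .rewrite), [0], [1]),
      (Net.base (.op .ref), [1], [2]), (A, [2], [3])] _ _ rfl
      fun j => by fin_cases j <;> rfl] at this
  | eqTrue A k hA =>
    have := wiring_guardedOutputs
      (w := ![[.star], [.star], [.star], [.star], [.dia], [.dia], dias k, [.star]])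
      (F := ![Net.base (.token .rewrite), Net.base (.op .eq), Net.base .inst, Net.base .inst, A])
      (by decide : Linear (r := 8) (k := 5) [0, 6] [7]
        ![([0], [1]), ([1], [2, 3]), ([2], [4]), ([3], [5]), ([4, 5, 6], [7])]) (fun j => by
        fin_cases j
        · exact Net.base_isHypernet _
        · exact Net.base_isHypernet _
        · exact Net.base_isHypernet _
        · exact Net.base_isHypernet _
        · exact isHypernet_of_eq hA.isHypernet (dias_two_add k) rfl) (fun i hi _ => by
        obtain rfl := List.mem_singleton.1 hi
        exact ⟨4, List.mem_singleton.2 rfl, hA.guardedOutputs⟩)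
    rwa [wiring_eq_diagram _ _ _ [(Net.base (.token .rewrite), [0], [1]),
      (Net.base (.op .eq), [1], [2, 3]), (Net.base .inst, [2], [4]), (Net.base .inst, [3], [5]),
      (A, [4, 5, 6], [7])] _ _ rfl fun j => by fin_cases j <;> rfl] at this
  | eqFalse A A' k k' hA hA' =>
    have := wiring_guardedOutputs
      (w := ![[.star], [.star], [.star], [.star], [.dia], [.dia], dias k, dias k', [.star], [.star]])
      (F := ![Net.base (.token .rewrite), Net.base (.op .eq), Net.base .inst, Net.base .inst, A, A'])
      (by decide : Linear (r := 10) (k := 6) [0, 6, 7] [8, 9]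
        ![([0], [1]), ([1], [2, 3]), ([2], [4]), ([3], [5]), ([4, 6], [8]), ([5, 7], [9])])
      (fun j => by
        fin_cases j
        · exact Net.base_isHypernet _
        · exact Net.base_isHypernet _
        · exact Net.base_isHypernet _
        · exact Net.base_isHypernet _
        · exact isHypernet_of_eq hA.isHypernet (dias_one_add k) rfl
        · exact isHypernet_of_eq hA'.isHypernet (dias_one_add k') rfl) (fun i hi _ => by
        rcases List.mem_cons.1 hi with rfl | hi
        · exact ⟨4, List.mem_singleton.2 rfl, hA.guardedOutputs⟩
        · obtain rfl := List.mem_singleton.1 hi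
          exact ⟨5, List.mem_singleton.2 rfl, hA'.guardedOutputs⟩)
    rwa [wiring_eq_diagram _ _ _ [(Net.base (.token .rewrite), [0], [1]),
      (Net.base (.op .eq), [1], [2, 3]), (Net.base .inst, [2], [4]), (Net.base .inst, [3], [5]),
      (A, [4, 6], [8]), (A', [5, 7], [9])] _ _ rfl fun j => by fin_cases j <;> rfl] at this
  | assign A G k z hA hG =>
    have := wiring_guardedOutputs
      (w := ![[.star], [.star], [.star], [.star], [.dia], dias k, [.star], z])
      (F := ![Net.base (.token .rewrite), Net.base (.op .assign), Net.base .inst, A, G])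
      (by decide : Linear (r := 8) (k := 5) [0, 5] [6, 7]
        ![([0], [1]), ([1], [2, 3]), ([2], [4]), ([4, 5], [6]), ([3], [7])]) (fun j => by
        fin_cases j
        · exact Net.base_isHypernet _
        · exact Net.base_isHypernet _
        · exact Net.base_isHypernet _
        · exact isHypernet_of_eq hA.isHypernet (dias_one_add k) rfl
        · exact isHypernet_of_eq hG.hypernet rfl (List.append_nil _).symm) (fun i hi hs => by
        rcases List.mem_cons.1 hi with rfl | hi
        · exact ⟨3, List.mem_singleton.2 rfl, hA.guardedOutputs⟩
        · obtain rfl := List.mem_singleton.1 hi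
          exact absurd hs hG.outs_ne)
    rwa [wiring_eq_diagram _ _ _ [(Net.base (.token .rewrite), [0], [1]),
      (Net.base (.op .assign), [1], [2, 3]), (Net.base .inst, [2], [4]), (A, [4, 5], [6]),
      (G, [3], [7])] _ _ rfl fun j => by fin_cases j <;> rfl] at this
  | deref A k hA =>
    have := wiring_guardedOutputs (w := ![[.star], [.star], [.star], [.dia], dias k, [.star]])
      (F := ![Net.base (.token .rewrite), Net.base (.op .deref), Net.base .inst, A])
      (by decide : Linear (r := 6) (k := 4) [0, 4] [5]
        ![([0], [1]), ([1], [2]), ([2], [3]), ([3, 4], [5])]) (fun j => by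
        fin_cases j
        · exact Net.base_isHypernet _
        · exact Net.base_isHypernet _
        · exact Net.base_isHypernet _
        · exact isHypernet_of_eq hA.isHypernet (dias_one_add k) rfl) (fun i hi _ => by
        obtain rfl := List.mem_singleton.1 hi
        exact ⟨3, List.mem_singleton.2 rfl, hA.guardedOutputs⟩)
    rwa [wiring_eq_diagram _ _ _ [(Net.base (.token .rewrite), [0], [1]),
      (Net.base (.op .deref), [1], [2]), (Net.base .inst, [2], [3]), (A, [3, 4], [5])] _ _ rfl
      fun j => by fin_cases j <;> rfl] at this
  | add | sub | neg => exact fun _ ho _ => absurd ho List.not_mem_nil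

theorem LocalRule.guardedOutputs {G N : Net} (h : LocalRule G N) : G.GuardedOutputs := by
  obtain ⟨_, _, h1, h2, _⟩ := h
  exact h1.guardedOutputs.iso h2.symm

/-! ## Binding-freeness of residuals -/

theorem Net.IsHypernet.star_of_not_isBinding {N : Net} {d c : List VLabel} (hN : N.IsHypernet d c)
    {e : N.E} (he : ¬ (N.lab e).IsBinding) {v : N.V} (hv : v ∈ N.src e) : N.vlab v = .star := by
  have h := hN.typed e
  have hv' : N.vlab v ∈ (N.src e).map N.vlab := List.mem_map_of_mem hv
  cases hl : N.lab e with
  | box n G => rw [hl] at he; exact absurd trivial he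
  | base b =>
    rw [hl] at h he
    rw [h.1] at hv'
    cases b with
    | inst | token | op => exact List.mem_singleton.1 hv'
    | _ => exact absurd trivial he

/-! ### Replacing one component of a binding-free hypergraph -/

/-- Replacing the label of the edge `e₁` of `D`; the other labels are single edges. -/
structure Graph.Replaces (D : Graph Net) (l' : D.E → Net) (e₁ : D.E) (L : D.E → Label) : Prop where
  left : D.WF
  right : (D.relabel l').WF
  single : ∀ e, e ≠ e₁ → (D.lab e).IsSingle (L e)
  single' : ∀ e, e ≠ e₁ → (l' e).IsSingle (L e)
  guarded : (D.lab e₁).GuardedOutputs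

/-- `j` has sources of type `⋆` only, and these are not reachable from sources of binding edges. -/
def Graph.Unbound (D : Graph Net) (j : D.E) : Prop :=
  (∀ u ∈ D.src j, D.vlab u = .star) ∧ ∀ y g, ¬ D.flatten.Binds g ⟨j, y⟩

theorem Graph.WF.embed_ins {D : Graph Net} (hD : D.WF) {e : D.E} {s : (D.lab e).V} (h : s ∈ (D.lab e).ins) :
    ∃ u ∈ D.src e, D.embed e s = D.vtx u := by
  rcases hD.embed_cases e s with ⟨_, h1⟩ | ⟨h1, _⟩ | ⟨h1, _⟩
  · exact h1
  · exact absurd h1 ((hD.typed e).interfaced.disjoint _ h)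
  · exact absurd h h1

namespace Graph.Replaces

variable {D : Graph Net} {l' : D.E → Net} {e₁ : D.E} {L : D.E → Label}

/-- If the replaced component produced `u`, then `u` would be a guarded output and `z` would be
bound in the old hypernet. So the producer is an unchanged edge, and whatever binds it, or it itself
if binding, would bind `z` as well. -/
theorem producer (h : D.Replaces l' e₁ L) {u : D.V} (hu : D.vlab u = .star) {z : D.flatten.E}
    (hz : D.vtx u ∈ D.flatten.src z) (hb : ∀ g, ¬ D.flatten.Binds g z)
    {a : (D.relabel l').flatten.E} (ha : (D.relabel l').vtx u ∈ (D.relabel l').flatten.tgt a) :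
    a.1 ≠ e₁ ∧ D.Unbound a.1 ∧ ¬ (((D.relabel l').flatten.lab a).IsBinding ∧
      ∃ v, v ∈ (D.relabel l').flatten.src a) := by
  obtain ⟨j, y⟩ := a
  have huj : u ∈ D.tgt j := h.right.inl_mem_tgt ha
  have hj : j ≠ e₁ := by
    rintro rfl
    obtain ⟨x, hx⟩ := h.left.exists_tgt huj
    obtain ⟨o, ho, ho'⟩ := Graph.mem_flatten_tgt.1 hx
    have hg := h.guarded o (h.left.mem_tgt_of_embed (h.left.tgt_notMem_ins ho) ho').1
      ((h.left.vlab_embed j o).symm.trans ((congrArg D.flatten.vlab ho').trans hu))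
    obtain ⟨g, g', h1, h2, h3, h4⟩ := Net.Guarded.map (N' := D.flatten) (f := D.embed j)
      (g := fun x => ⟨j, x⟩) (fun _ => rfl) (fun _ => rfl) (fun _ h => h) hg
    exact hb g ⟨h1, h2, .tail' h3 ⟨_, h4, (congrArg (· ∈ D.flatten.src z) ho').mpr hz⟩⟩
  have hs := h.single j hj
  have hs' : ((D.relabel l').lab j).IsSingle (L j) := h.single' j hj
  have hinc : ∀ y', D.flatten.Incoming ⟨j, y'⟩ z := fun y' =>
    ⟨_, (h.left.flatten_tgt_of_isSingle hs y').symm ▸ List.mem_map_of_mem huj, hz⟩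
  have hsrc : ∀ y', ∀ v ∈ D.src j, D.vtx v ∈ D.flatten.src ⟨j, y'⟩ := fun y' v hv =>
    (h.left.flatten_src_of_isSingle hs y').symm ▸ List.mem_map_of_mem hv
  obtain ⟨y', _⟩ := hs.edge
  have hlab : D.flatten.lab ⟨j, y'⟩ = L j := hs.lab y'
  have hn : ∀ v ∈ D.src j, ¬ (L j).IsBinding := fun v hv hbind =>
    hb ⟨j, y'⟩ ⟨hlab.symm ▸ hbind, ⟨_, hsrc y' v hv⟩, .single (hinc y')⟩
  refine ⟨hj, ⟨fun v hv => ?_, fun y'' g hg => hb g ⟨hg.1, hg.2.1, hg.2.2.tail (hinc y'')⟩⟩, ?_⟩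
  · exact h.left.flatten_isHypernet.star_of_not_isBinding (e := ⟨j, y'⟩)
      (hlab.symm ▸ hn v hv) (hsrc y' v hv)
  · rintro ⟨h1, v, h2⟩
    replace h1 : (L j).IsBinding := Eq.mp (congrArg Label.IsBinding (hs'.lab y)) h1
    have h3 := (h.right.flatten_src_of_isSingle hs' y) ▸ h2
    obtain ⟨v', h4, _⟩ := List.mem_map.1 h3
    exact hn v' h4 h1

theorem unbound_incoming (h : D.Replaces l' e₁ L) {a b : (D.relabel l').flatten.E} (hb : b.1 ≠ e₁)
    (hk : D.Unbound b.1) (hi : (D.relabel l').flatten.Incoming a b) :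
    a.1 ≠ e₁ ∧ D.Unbound a.1 ∧ ¬ (((D.relabel l').flatten.lab a).IsBinding ∧
      ∃ v, v ∈ (D.relabel l').flatten.src a) := by
  obtain ⟨k, x⟩ := b
  obtain ⟨p, hp, hp'⟩ := hi
  have hs' : ((D.relabel l').lab k).IsSingle (L k) := h.single' k hb
  have h3 := (h.right.flatten_src_of_isSingle hs' x) ▸ hp'
  obtain ⟨u, hu, rfl⟩ := List.mem_map.1 h3
  have hs := h.single k hb
  obtain ⟨y, _⟩ := hs.edge
  exact h.producer (hk.1 u hu) (z := ⟨k, y⟩)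
    ((h.left.flatten_src_of_isSingle hs y).symm ▸ List.mem_map_of_mem hu) (hk.2 y) hp

/-- The region above an unbound edge is closed under going upwards and never meets the replaced
component, so what the old hypernet guarantees about it stays true. -/
theorem unbound_transGen (h : D.Replaces l' e₁ L) {a b : (D.relabel l').flatten.E} (hb : b.1 ≠ e₁)
    (hk : D.Unbound b.1) (hi : TransGen (D.relabel l').flatten.Incoming a b) :
    a.1 ≠ e₁ ∧ D.Unbound a.1 ∧ ¬ (((D.relabel l').flatten.lab a).IsBinding ∧
      ∃ v, v ∈ (D.relabel l').flatten.src a) := by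
  induction hi using TransGen.head_induction_on with
  | single hi => exact h.unbound_incoming hb hk hi
  | head hi _ ih => exact h.unbound_incoming ih.1 ih.2.1 hi

/-- An edge above the new component enters through an input, which the edge `xt` consumed before the
replacement; as `xt` was unbound, `producer` applies. -/
theorem incoming_inner (h : D.Replaces l' e₁ L) {xt : (D.lab e₁).E}
    (hxt : (D.lab e₁).src xt = (D.lab e₁).ins) (hstar : ∀ u ∈ D.src e₁, D.vlab u = .star)
    (hb : ∀ g, ¬ D.flatten.Binds g ⟨e₁, xt⟩) {a : (D.relabel l').flatten.E} {x : (l' e₁).E}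
    (hi : (D.relabel l').flatten.Incoming a ⟨e₁, x⟩) :
    (∃ g : (l' e₁).E, a = ⟨e₁, g⟩ ∧ (l' e₁).Incoming g x) ∨
    (a.1 ≠ e₁ ∧ D.Unbound a.1 ∧ ¬ (((D.relabel l').flatten.lab a).IsBinding ∧
      ∃ v, v ∈ (D.relabel l').flatten.src a)) := by
  obtain ⟨p, hp, hp'⟩ := hi
  obtain ⟨s, hs, rfl⟩ := (Graph.mem_flatten_src (D := D.relabel l') (e := e₁) (x := x)).1 hp'
  by_cases hin : s ∈ (l' e₁).ins
  · right
    obtain ⟨u, hu, h1⟩ : ∃ u ∈ D.src e₁, (D.relabel l').embed e₁ s = (D.relabel l').vtx u :=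
      h.right.embed_ins hin
    rw [h1] at hp
    refine h.producer (hstar u hu) (z := ⟨e₁, xt⟩) ?_ hb hp
    have h2 : D.flatten.src ⟨e₁, xt⟩ = (D.src e₁).map D.vtx :=
      (congrArg (List.map _) hxt).trans (h.left.map_embed_ins e₁)
    exact h2.symm ▸ List.mem_map_of_mem hu
  · left
    have h1 := (h.right.typed e₁).interfaced
    have h2 : ¬ ∀ y, s ∉ (l' e₁).tgt y := fun h3 => hin ((h1.mem_ins s).2 h3)
    push Not at h2
    obtain ⟨y, hy⟩ := h2
    refine ⟨y, ?_, s, hy, hs⟩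
    exact h.right.flatten_interfaced.tgt_unique _ _ _ hp
      ((Graph.mem_flatten_tgt (D := D.relabel l') (e := e₁) (x := y)).2 ⟨s, hy, rfl⟩)

theorem shallowBindingFree (h : D.Replaces l' e₁ L) (hX : D.flatten.ShallowBindingFree)
    (hK : ∀ e, e ≠ e₁ → ∀ χ, L e = .base (.hole χ) → ∀ v ∈ D.src e, D.vlab v = .star)
    (hN : (l' e₁).ShallowBindingFree)
    (ht : (∃ x χ, (l' e₁).lab x = .base (.hole χ)) → ∃ xt, (D.lab e₁).src xt = (D.lab e₁).ins ∧
      (∀ u ∈ D.src e₁, D.vlab u = .star) ∧ ∀ g, ¬ D.flatten.Binds g ⟨e₁, xt⟩) :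
    (D.relabel l').flatten.ShallowBindingFree := by
  refine Net.shallowBindingFree_of h.right.flatten_interfaced.src_unique ?_
  rintro a ⟨k, x⟩ χ he ⟨h1, h2, h3⟩
  have he : (l' k).lab x = .base (.hole χ) := he
  by_cases hk : k = e₁
  · subst hk
    obtain ⟨xt, hxt, hstar, hb⟩ := ht ⟨x, χ, he⟩
    -- Going up from a hole of the new component, a path stays inside until it leaves through an
    -- input; from then on it is in the unbound region.
    have claim : ∀ a, TransGen (D.relabel l').flatten.Incoming a ⟨k, x⟩ →
        (∃ g : (l' k).E, a = ⟨k, g⟩ ∧ TransGen (l' k).Incoming g x) ∨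
        (a.1 ≠ k ∧ D.Unbound a.1 ∧ ¬ (((D.relabel l').flatten.lab a).IsBinding ∧
          ∃ v, v ∈ (D.relabel l').flatten.src a)) := by
      intro a ha
      induction ha using TransGen.head_induction_on with
      | single hi =>
        rcases h.incoming_inner hxt hstar hb hi with ⟨g, h4, h5⟩ | h4
        · exact .inl ⟨g, h4, .single h5⟩
        · exact .inr h4
      | head hi _ ih =>
        rcases ih with ⟨g, rfl, hg⟩ | ih
        · rcases h.incoming_inner hxt hstar hb hi with ⟨g', h4, h5⟩ | h4
          · exact .inl ⟨g', h4, hg.head h5⟩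
          · exact .inr h4
        · exact .inr (h.unbound_incoming ih.1 ih.2.1 hi)
    rcases claim a h3 with ⟨g, rfl, hg⟩ | h4
    · obtain ⟨v, hv⟩ := h2
      obtain ⟨s, hs, _⟩ := (Graph.mem_flatten_src (D := D.relabel l') (e := k) (x := g)).1 hv
      exact hN.not_binds he ⟨h1, ⟨s, hs⟩, hg⟩
    · exact h4.2.2 ⟨h1, h2⟩
  · have hL : L k = .base (.hole χ) := ((h.single' k hk).lab x).symm.trans he
    refine (h.unbound_transGen (b := ⟨k, x⟩) hk ⟨hK k hk χ hL, fun y g hg => ?_⟩ h3).2.2 ⟨h1, h2⟩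
    exact hX.not_binds (e' := ⟨k, y⟩) (((h.single k hk).lab y).trans hL) hg

end Graph.Replaces

/-! ### Binding-freeness of the residual context -/

namespace Residual

variable {X : Net} {σ σ' : Hole → Net} {N : Net} (D : Residual X σ σ' N) (K : ℕ)

theorem bindingFree_lab (hX : ∀ e, (X.lab e).BindingFree) (e : (D.context K).E) :
    ((D.context K).lab e).BindingFree := by
  obtain ⟨j, y⟩ := e
  have key : ∀ M : Net, D.comp K j = M → (∀ y, (M.lab y).BindingFree) →
      ((D.comp K j).lab y).BindingFree := by
    rintro _ rfl h
    exact h y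
  rcases D.comp_cases K j with ⟨M, _, h2, h3⟩ | ⟨q, b, _, h2⟩
  · exact key M h2 h3.bindingFree.2
  · refine key _ h2 fun y => Label.BindingFree.rename (l := (D.Q q).lab y) ?_ _
    rcases D.origin q with h | ⟨⟨e, n, h⟩, _⟩
    · obtain ⟨e, he⟩ := h y
      rw [he]
      exact hX e
    · have := hX e
      rw [h, Label.bindingFree_box] at this
      exact this.2 y

/-- The shallow holes of the residual context come from the content of a box. -/
theorem hole_cases (hd : X.AllHolesDeep) (hX : ∀ e, (X.lab e).BindingFree) {j : Fin D.k}
    {y : (D.comp K j).E} {χ : Hole} (hy : (D.comp K j).lab y = .base (.hole χ)) :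
    (D.comp K j).ShallowBindingFree ∧ D.ins = [D.i₀] ∧ (D.S j).1 = [D.i₁] ∧
      ∀ e t, X.lab e = .base (.token t) → X.src e = X.ins := by
  have key : ∀ M : Net, D.comp K j = M → ∃ y, M.lab y = .base (.hole χ) := by
    rintro _ rfl
    exact ⟨y, hy⟩
  rcases D.comp_cases K j with ⟨M, _, h2, h3⟩ | ⟨q, b, h1, h2⟩
  · obtain ⟨y, hy⟩ := key M h2
    exact absurd (Net.hasHole_of_lab hy) (h3 χ)
  · obtain ⟨y, hy⟩ := key _ h2
    obtain ⟨ψ, hψ⟩ := Label.eq_hole_of_rename (l := (D.Q q).lab y) hy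
    rcases D.origin q with h | ⟨⟨e, n, h⟩, h4, h5, h6⟩
    · obtain ⟨e, he⟩ := h y
      exact absurd (he.symm.trans hψ) (hd e ψ)
    · have h7 := hX e
      rw [h, Label.bindingFree_box] at h7
      refine ⟨?_, h4, h5 j b h1, h6⟩
      rw [h2]
      exact h7.1.rename _

/-- The only bundle above this component is the target of the token. -/
theorem incoming_comp {j : Fin D.k} (hj : (D.S j).1 = [D.i₁])
    {a : (D.context K).E} {y : (D.comp K j).E} (hi : (D.context K).Incoming a ⟨j, y⟩) :
    a.1 = D.j₀ ∨ ∃ g : (D.comp K j).E, a = ⟨j, g⟩ ∧ (D.comp K j).Incoming g y := by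
  have hD := D.context_wf K
  obtain ⟨p, hp, hp'⟩ := hi
  obtain ⟨s, hs, rfl⟩ := (Graph.mem_flatten_src
    (D := wiring D.w D.ins D.outs (D.comp K) D.S) (e := j) (x := y)).1 hp'
  by_cases hin : s ∈ (D.comp K j).ins
  · left
    obtain ⟨u, hu, h1⟩ := hD.embed_ins (e := j) hin
    have h2 : u.1 ∈ (D.S j).1 := mem_bundles.1 hu
    rw [hj] at h2
    obtain ⟨k, x⟩ := a
    have h3 : u.1 ∈ (D.S k).2 := mem_bundles.1 (hD.inl_mem_tgt (e := k) (x := x) (h1 ▸ hp))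
    by_contra hk
    refine D.linear.tgt_unique k D.j₀ hk u.1 h3 ?_
    rw [D.S_token]
    exact h2
  · right
    have h2 : ¬ ∀ y, s ∉ (D.comp K j).tgt y := fun h3 =>
      hin (((D.comp_isHypernet K j).interfaced.mem_ins s).2 h3)
    push Not at h2
    obtain ⟨g, hg⟩ := h2
    exact ⟨g, hD.flatten_interfaced.tgt_unique _ _ _ hp ((Graph.mem_flatten_tgt
      (D := wiring D.w D.ins D.outs (D.comp K) D.S) (e := j) (x := g)).2 ⟨s, hg, rfl⟩), s, hg, hs⟩

theorem not_incoming_token (hins : D.ins = [D.i₀]) {a b : (D.context K).E} (hb : b.1 = D.j₀) :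
    ¬ (D.context K).Incoming a b := by
  have hD := D.context_wf K
  obtain ⟨k, y⟩ := b
  obtain rfl : k = D.j₀ := hb
  rintro ⟨p, hp, hp'⟩
  have h1 := (hD.flatten_src_of_isSingle (e := D.j₀) (D.comp_token K) y) ▸ hp'
  obtain ⟨u, hu, rfl⟩ := List.mem_map.1 h1
  have h2 : u.1 ∈ (D.S D.j₀).1 := mem_bundles.1 hu
  rw [D.S_token] at h2
  obtain ⟨k, x⟩ := a
  have h3 : u.1 ∈ (D.S k).2 := mem_bundles.1 (hD.inl_mem_tgt (e := k) (x := x) hp)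
  exact (D.linear.mem_ins u.1).1 (hins ▸ h2) k h3

/-- Above a shallow hole there is the opened content of a box, which is binding-free, then the
token, which is not a binding edge, and then nothing, since the token is at the only input. -/
theorem context_shallowBindingFree (hd : X.AllHolesDeep) (hX : ∀ e, (X.lab e).BindingFree) :
    (D.context K).ShallowBindingFree := by
  have hD := D.context_wf K
  refine Net.shallowBindingFree_of hD.flatten_interfaced.src_unique ?_
  rintro a ⟨j, y⟩ χ he ⟨h1, ⟨v, h2⟩, h3⟩
  have he : (D.comp K j).lab y = .base (.hole χ) := he
  obtain ⟨hs, hins, hj, _⟩ := D.hole_cases K hd hX he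
  have claim : a.1 = D.j₀ ∨
      ∃ g : (D.comp K j).E, a = ⟨j, g⟩ ∧ TransGen (D.comp K j).Incoming g y := by
    clear h1 h2
    induction h3 using TransGen.head_induction_on with
    | single hi =>
      rcases D.incoming_comp K hj hi with h | ⟨g, h, h'⟩
      · exact .inl h
      · exact .inr ⟨g, h, .single h'⟩
    | head hi _ ih =>
      rcases ih with h | ⟨g, rfl, hg⟩
      · exact absurd hi (D.not_incoming_token K hins h)
      · rcases D.incoming_comp K hj hi with h | ⟨g', h, h'⟩
        · exact .inl h
        · exact .inr ⟨g', h, hg.head h'⟩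
  rcases claim with h | ⟨g, rfl, hg⟩
  · obtain ⟨k, x⟩ := a
    obtain rfl : k = D.j₀ := h
    exact Eq.mp (congrArg Label.IsBinding ((D.comp_token K).lab x)) h1
  · obtain ⟨s, hsv, _⟩ := (Graph.mem_flatten_src
      (D := wiring D.w D.ins D.outs (D.comp K) D.S) (e := j) (x := g)).1 h2
    exact hs.not_binds he ⟨h1, ⟨s, hsv⟩, hg⟩

end Residual

/-! ### Binding-freeness of the whole context -/

theorem Net.exists_shallow_hole {C₁ C₂ : Net} {χ : Hole} (hχ : C₁.HasHole χ) (hf : C₂.Focussed)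
    (hX : (C₁.plugAt χ C₂).Focussed) : ∃ e₁, C₁.lab e₁ = .base (.hole χ) := by
  classical
  obtain ⟨⟨e₁, o⟩⟩ := hχ
  refine ⟨e₁, ?_⟩
  cases hl : C₁.lab e₁ with
  | base b =>
    rw [hl] at o
    obtain ⟨rfl⟩ := o
    rfl
  | box n G =>
    -- Were `χ` inside a box of `C₁`, the token of `C₂` would be deep in the plugged context,
    -- against focus.
    exfalso
    obtain ⟨x, t, hx, _⟩ := hf
    obtain ⟨e, t', he, hu, _⟩ := hX
    let τ : Hole → Net := fun ψ => if ψ = χ then C₂ else Net.base (.hole ψ)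
    obtain ⟨⟨y, o'⟩⟩ := occ_plugEdge_of_hole (τ := τ) (b := .token t) ⟨o⟩
      (by
        change Nonempty ((if χ = χ then C₂ else _ : Net).Occ _)
        rw [if_pos rfl]
        exact ⟨x, hx.symm ▸ ⟨rfl⟩⟩) ((C₁.src e₁).map C₁.vlab) ((C₁.tgt e₁).map C₁.vlab)
    have h1 : (⟨e₁, y⟩ : (C₁.plugGraph τ).flatten.E) = e := hu t ⟨⟨e₁, y⟩, o'⟩
    have h2 : ((C₁.plugGraph τ).lab e₁).lab y = (C₁.lab e₁).plug τ :=
      (Net.plugGraph_isSingle (fun ψ h => by rw [hl] at h; cases h)).lab y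
    have h3 : ((C₁.plugGraph τ).lab e₁).lab y = .base (.token t') := by
      subst h1
      exact he
    have h4 := Label.plug_eq_base (h2.symm.trans h3)
    rw [hl] at h4
    cases h4

/-- Since `χ` is a shallow hole of `C₁`, the rewriting replaces one component of a flattening, and
every other hole of `C₁` keeps its place. -/
theorem Residual.bindingFree_plugAt {C₁ C₂ : Net} {χ : Hole} {σ σ' : Hole → Net} {N : Net}
    (D : Residual C₂ σ σ' N) (K : ℕ) (hC₁ : C₁.IsContext) (hχ : C₁.HasHole χ) (hC₂f : C₂.Focussed)
    (hC₂ : C₂.IsHypernet χ.dom χ.cod) (hd : C₂.AllHolesDeep)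
    (hC₂' : (D.context K).IsHypernet χ.dom χ.cod) (hg : C₂.GuardedOutputs)
    (hXf : (C₁.plugAt χ C₂).Focussed) (hX : (C₁.plugAt χ C₂).BindingFree)
    (ht : (C₁.plugAt χ C₂).TokenReach)
    (hs : ∀ ψ, C₁.HasHole ψ → ψ ≠ χ → ∀ ℓ ∈ ψ.dom, ℓ = VLabel.star) :
    (C₁.plugAt χ (D.context K)).BindingFree := by
  classical
  obtain ⟨e₁, he₁⟩ := Net.exists_shallow_hole hχ hC₂f hXf
  obtain ⟨⟨d, c, h₁⟩, hu⟩ := hC₁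
  let τ : Net → Hole → Net := fun A ψ => if ψ = χ then A else Net.base (.hole ψ)
  have hlab : ∀ A : Net, (C₁.plugGraph (τ A)).lab e₁ = A := fun A => by
    change plugEdge (τ A) (C₁.lab e₁) _ _ _ = A
    rw [he₁]
    exact if_pos rfl
  have ne : ∀ e, e ≠ e₁ → ¬ Nonempty ((C₁.lab e).Occ (.hole χ)) := by
    rintro e he ⟨o⟩
    have o₁ : (C₁.lab e₁).Occ (.hole χ) := by rw [he₁]; exact ⟨rfl⟩
    exact he (congrArg Sigma.fst ((hu χ).elim ⟨e, o⟩ ⟨e₁, o₁⟩))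
  have single : ∀ e, e ≠ e₁ → ((C₁.plugGraph (τ C₂)).lab e).IsSingle ((C₁.lab e).plug (τ C₂)) := by
    intro e he
    by_cases h : ∃ ψ, C₁.lab e = .base (.hole ψ)
    · obtain ⟨ψ, h⟩ := h
      have hne : ψ ≠ χ := by
        rintro rfl
        exact ne e he (h.symm ▸ ⟨⟨rfl⟩⟩)
      change (plugEdge (τ C₂) (C₁.lab e) _ _ _).IsSingle _
      rw [h]
      change (if ψ = χ then C₂ else Net.base (.hole ψ)).IsSingle _
      rw [if_neg hne]
      exact Net.single_isSingle _ _ _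
    · push Not at h
      exact Net.plugGraph_isSingle h
  have same : ∀ e, e ≠ e₁ →
      (C₁.plugGraph (τ (D.context K))).lab e = (C₁.plugGraph (τ C₂)).lab e := fun e he =>
    plugEdge_congr _ (fun ψ hψ => by
      have hne : ψ ≠ χ := by
        rintro rfl
        exact ne e he hψ
      exact (if_neg hne).trans (if_neg hne).symm) _ _
  have hR : (C₁.plugGraph (τ C₂)).Replaces (C₁.plugGraph (τ (D.context K))).lab e₁
      (fun e => (C₁.lab e).plug (τ C₂)) :=
    { left := h₁.plugGraph_wf (wellTyped_plugAt hC₂)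
      right := h₁.plugGraph_wf (wellTyped_plugAt hC₂')
      single := single
      single' := fun e he => (congrArg (Net.IsSingle · _) (same e he)).mpr (single e he)
      guarded := (congrArg Net.GuardedOutputs (hlab C₂)).mpr hg }
  have hXl : ∀ e, (C₂.lab e).BindingFree := by
    have : ∀ M : Net, M = C₂ → (∀ e, (M.lab e).BindingFree) → ∀ e, (C₂.lab e).BindingFree := by
      rintro _ rfl h
      exact h
    exact this _ (hlab C₂) fun e => hX.2 ⟨e₁, e⟩
  refine ⟨hR.shallowBindingFree hX.1 ?_ ?_ ?_, ?_⟩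
  · intro e he ψ hψ v hv
    have h2 := Label.plug_eq_base hψ
    have hne : ψ ≠ χ := by
      rintro rfl
      exact ne e he (h2.symm ▸ ⟨⟨rfl⟩⟩)
    have h3 := (h₁.typed e)
    rw [h2] at h3
    refine hs ψ (Net.hasHole_of_lab h2) hne _ (?_ : _ ∈ (BLabel.hole ψ).dom)
    rw [← h3.1]
    exact List.mem_map_of_mem hv
  · exact (congrArg Net.ShallowBindingFree (hlab (D.context K))).mpr
      (D.context_shallowBindingFree K hd hXl)
  -- A shallow hole in the new component means that a box was opened. Then the token edge of `C₂`
  -- consumes the whole input, of type `⋆`, and is unbound because an operation path leads to it.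
  · rintro ⟨x, ψ, hx⟩
    have key : ∀ M : Net, M = D.context K → (∃ x, M.lab x = .base (.hole ψ)) →
        ∃ x, (D.context K).lab x = .base (.hole ψ) := by
      rintro _ rfl h
      exact h
    obtain ⟨⟨j, y⟩, hy⟩ := key _ (hlab (D.context K)) ⟨x, hx⟩
    obtain ⟨_, _, _, h4⟩ := D.hole_cases K (j := j) (y := y) hd hXl hy
    obtain ⟨xt, t, hxt, _⟩ := hC₂f
    have h5 := h4 xt t hxt
    have key' : ∀ M : Net, M = C₂ → ∃ xt, M.lab xt = .base (.token t) ∧ M.src xt = M.ins := by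
      rintro _ rfl
      exact ⟨xt, hxt, h5⟩
    obtain ⟨xt', h6, h7⟩ := key' _ (hlab C₂)
    refine ⟨xt', h7, fun u hu => ?_, fun g => ?_⟩
    · obtain ⟨a, _, ha, _, hstar, _⟩ := hC₂.token_src hxt
      have h8 : (C₁.src e₁).map C₁.vlab = [.star] := by
        have := h₁.typed e₁
        rw [he₁] at this
        refine this.1.trans (hC₂.ins_type.symm.trans ?_)
        rw [← h5, ha, List.map_singleton, hstar]
      have h9 : C₁.vlab u ∈ (C₁.src e₁).map C₁.vlab := List.mem_map_of_mem hu
      rw [h8] at h9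
      exact List.mem_singleton.1 h9
    · exact ht.not_binds (h₁.plugAt hC₂) hXf (e := ⟨e₁, xt'⟩) (t := t) h6
  · rintro ⟨e, x⟩
    by_cases he : e = e₁
    · subst he
      have : ∀ M : Net, M = D.context K → ∀ x, (M.lab x).BindingFree := by
        rintro _ rfl
        exact D.bindingFree_lab K hXl
      exact this _ (hlab _) x
    · have : ∀ M : Net, M = (C₁.plugGraph (τ C₂)).lab e → ∀ x, (M.lab x).BindingFree := by
        rintro _ rfl x
        exact hX.2 ⟨e, x⟩
      exact this _ (same e he) x

end Spartan

theorem mainTheorem8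
    (𝒞 : Set Net) (R : Net → Net → Prop) (hR : IsPreTemplate R) (hclosed : OutputClosed R)
    (C₁ C₂ : Net) (χ : Hole) (G H : Hole → Net) (N : Net)
    (hC₁ : C₁.IsContext) (hC₁f : C₁.FocusFree) (hχ : C₁.HasHole χ)
    (hC₂ : C₂.IsContext) (hC₂f : C₂.Focussed) (hC₂t : C₂.IsHypernet χ.dom χ.cod)
    (hspec : IsSpecimen 𝒞 R (C₁.plugAt χ C₂) G H)
    (hN : N.Focussed) (hrule : LocalRule (C₂.plug G) N) :
    (C₂.AllHolesDeep →
      ∃ (C₂' : Net) (G' H' : Hole → Net), Preserves R C₁ χ C₂ G H N C₂' G' H') ∧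
    (C₂.AllHolesDeep →
      Rooted ((C₁.plugAt χ C₂).plug G) → Rooted ((C₁.plugAt χ C₂).plug H) →
      (C₁.plugAt χ C₂).underlying.BindingFree →
      (∀ ψ, C₁.HasHole ψ → ψ ≠ χ → ∀ ℓ ∈ ψ.dom, ℓ = VLabel.star) →
      ∃ (C₂' : Net) (G' H' : Hole → Net), Preserves R C₁ χ C₂ G H N C₂' G' H' ∧
        (C₁.plugAt χ C₂').underlying.BindingFree) ∧
    (OnContractionTrees R →
      ∃ (C₂' : Net) (G' H' : Hole → Net), Preserves R C₁ χ C₂ G H N C₂' G' H') := by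
  have hR₂ := hspec.related.of_plugAt hχ
  have key := fun h h' => hrule.exists_preserves (R := R) (χ := χ) (H := H) hC₁ hC₂ hC₂f hC₂t hR₂ h h'
  refine ⟨fun hd => ?_, fun hd hrG hrH hb hs => ?_, fun ht => ?_⟩
  · obtain ⟨σ, σ', D, K, G', H', h⟩ := key (hd.treeHoles G) (hd.treeHoles H)
    exact ⟨_, G', H', h⟩
  · obtain ⟨σ, σ', D, K, G', H', h⟩ := key (hd.treeHoles G) (hd.treeHoles H)
    obtain ⟨d, c, hX⟩ := hspec.context.1
    have related : ∀ ψ, (C₁.plugAt χ C₂).HasHole ψ →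
        R (restrictSubst (C₁.plugAt χ C₂) G ψ) (restrictSubst (C₁.plugAt χ C₂) H ψ) := fun ψ hψ => by
      rw [restrictSubst_of_hasHole hψ, restrictSubst_of_hasHole hψ]
      exact (hspec.related ψ hψ).1
    -- Output-closure and the rootedness of both states are used here, and only here.
    have tokenReach : (C₁.plugAt χ C₂).TokenReach := by
      refine hX.tokenReach_of_plug hspec.focussed
        (wellTyped_restrictSubst fun ψ hψ => (hspec.related ψ hψ).2.1)
        (wellTyped_restrictSubst fun ψ hψ => (hspec.related ψ hψ).2.2)
        (fun ψ hψ => ⟨(hR _ _ (related ψ hψ)).1, (hR _ _ (related ψ hψ)).2.1⟩)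
        (fun ψ hψ => hclosed _ _ (related ψ hψ)) ?_ ?_
      · rw [Net.plug_congr fun ψ hψ => restrictSubst_of_hasHole hψ G]
        exact hrG.tokenReach
      · rw [Net.plug_congr fun ψ hψ => restrictSubst_of_hasHole hψ H]
        exact hrH.tokenReach
    -- The redex is `C₂[G]`, but its shallow structure is that of `C₂`, since the holes are deep.
    have guarded : C₂.GuardedOutputs := by
      refine .of_plug hC₂t hd (wellTyped_restrictSubst fun ψ hψ => (hR₂ ψ hψ).2.1) ?_
      rw [Net.plug_congr fun ψ hψ => restrictSubst_of_hasHole hψ G]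
      exact hrule.guardedOutputs
    obtain ⟨d', c', hY⟩ := h.context_plug.1
    exact ⟨_, G', H', h, (D.bindingFree_plugAt K hC₁ hχ hC₂f hC₂t hd h.type guarded hspec.focussed
      (hspec.focussed.bindingFree_of_underlying hX hb) tokenReach hs).underlying hY⟩
  -- Here holes may be shallow, but whatever fills them is a contraction tree on either side.
  · obtain ⟨σ, σ', D, K, G', H', h⟩ := key
      (fun e ψ he => (ht _ _ (hR₂ ψ (Net.hasHole_of_lab he)).1).1)
      (fun e ψ he => (ht _ _ (hR₂ ψ (Net.hasHole_of_lab he)).1).2)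
    exact ⟨_, G', H', h⟩
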